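/- Consider on $\mathbb{R}^3$ the Boussinesq system with horizontal viscosity $$\partial_t u+u\cdot\nabla u-\Delta_h u+\nabla\Pi=\rho e_3,\qquad \partial_t\rho+u\cdot\nabla\rho=0,\qquad \operatorname{div}u=0,\qquad (u,\rho)|_{t=0}=(u_0,\rho_0),$$ where $\Delta_h=\partial_1^2+\partial_2^2$. Write $r=(x_1^2+x_2^2)^{1/2}$, $z=x_3$, $\omega=\operatorname{curl}u$, $\omega_0=\operatorname{curl}u_0$, and let $\sqrt{\mathbb L}$ be the space of functions belonging to $L^p(\mathbb{R}^3)$ for all $2\le p<\infty$ with $$\|f\|_{\sqrt{\mathbb L}}:=\sup_{2\le p<\infty}\frac{\|f\|_{L^p(\mathbb{R}^3)}}{\sqrt p}<\infty .$$ For $T\in(0,\infty]$, a smooth solution on $[0,T)$ is a pair $(\rho,u)$ which is $C^\infty$ on $[0,T)\times\mathbb{R}^3$, satisfies the system there with some $C^\infty$ pressure $\Pi$, and is such that $u\in L^\infty_{\rm loc}([0,T);H^1)$ and $\nabla u\in L^1_{\rm loc}([0,T);L^\infty)$. It is axisymmetric without swirl if $u=u_r(t,r,z)e_r+u_z(t,r,z)e_z$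 and $\rho=\rho(t,r,z)$. Let $u_0,\rho_0$ be smooth initial data such that $u_0\in H^1$, $\omega_0/r\in L^2$, $\omega_0\in\sqrt{\mathbb L}$, $\rho_0\in L^2\cap L^\infty$ depends only on $(r,z)$, $\operatorname{Supp}\rho_0$ does not intersect the axis $(Oz)=\{r=0\}$, and the projection of $\operatorname{Supp}\rho_0$ onto $(Oz)$ is compact. Then there is a constant $C>0$, depending only on the initial data $(u_0,\rho_0)$, such that for every $T\in(0,\infty]$, every smooth axisymmetric solution without swirl $(\rho,u)$ on $[0,T)$ with these data satisfies, for all $t\in[0,T)$, $\omega(t)\in\sqrt{\mathbb L}$ and $$\|\omega(t)\|_{\sqrt{\mathbb L}}\le C\,e^{\exp(Ct^{17})}\big(\|\omega_0\|_{\sqrt{\mathbb L}}+1\big).$$ -/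

import Mathlib

open scoped ContDiff
open MeasureTheory

namespace HBS

/-- Euclidean space `ℝ³`; the coordinates `x 0, x 1, x 2` are `x₁, x₂, x₃ = z`. -/
abbrev E3 : Type := EuclideanSpace ℝ (Fin 3)

/-- The `j`-th vector of the canonical basis of `ℝ³`. -/
noncomputable def basisVec (j : Fin 3) : E3 := EuclideanSpace.single j (1 : ℝ)

/-- The partial derivative `∂ⱼ f` of a (scalar or vector valued) function on `ℝ³`. -/
noncomputable def pd {F : Type*} [NormedAddCommGroup F] [NormedSpace ℝ F]
    (j : Fin 3) (f : E3 → F) (x : E3) : F :=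
  fderiv ℝ f x (basisVec j)

/-- The horizontal Laplacian `Δ_h = ∂₁² + ∂₂²`. -/
noncomputable def lapH (v : E3 → E3) (x : E3) : E3 :=
  pd 0 (pd 0 v) x + pd 1 (pd 1 v) x

/-- The divergence of a vector field. -/
noncomputable def div (v : E3 → E3) (x : E3) : ℝ :=
  ∑ j : Fin 3, (pd j v x) j

/-- The curl (vorticity) of a vector field. -/
noncomputable def curl (v : E3 → E3) (x : E3) : E3 :=
  !₂[(pd 1 v x) 2 - (pd 2 v x) 1,
     (pd 2 v x) 0 - (pd 0 v x) 2,
     (pd 0 v x) 1 - (pd 1 v x) 0]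

/-- The distance `r = (x₁² + x₂²)^{1/2}` to the axis `(Oz)`. -/
noncomputable def rad (x : E3) : ℝ := Real.sqrt (x 0 ^ 2 + x 1 ^ 2)

/-- The axis `(Oz)`. -/
def axis : Set E3 := {x | x 0 = 0 ∧ x 1 = 0}

/-- The vector `e_r = (x₁/r, x₂/r, 0)` (it is `0` on the axis, where a continuous axisymmetric
vector field has no horizontal component). -/
noncomputable def eR (x : E3) : E3 := !₂[x 0 / rad x, x 1 / rad x, 0]

/-- A scalar function which depends only on `(r, z)`. -/
def IsAxisymmetricScalar (f : E3 → ℝ) : Prop :=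
  ∃ g : ℝ → ℝ → ℝ, ∀ x, f x = g (rad x) (x 2)

/-- An axisymmetric vector field without swirl: `v = v_r(r,z) e_r + v_z(r,z) e_z`. -/
def IsAxisymmetricNoSwirl (v : E3 → E3) : Prop :=
  ∃ vr vz : ℝ → ℝ → ℝ, ∀ x, v x = vr (rad x) (x 2) • eR x + vz (rad x) (x 2) • basisVec 2

/-- `v ∈ H¹(ℝ³)`, for a smooth vector field `v` (so that the weak gradient is the classical one). -/
def InH1 (v : E3 → E3) : Prop :=
  MemLp v 2 volume ∧ MemLp (fderiv ℝ v) 2 volume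

/-- The (extended) norm `‖f‖_{√𝕃} = sup_{2 ≤ p < ∞} ‖f‖_{L^p(ℝ³)} / √p`. -/
noncomputable def sqrtLNorm (f : E3 → E3) : ENNReal :=
  ⨆ (p : ℝ) (_ : 2 ≤ p), eLpNorm f (ENNReal.ofReal p) volume / ENNReal.ofReal (Real.sqrt p)

/-- The space `√𝕃(ℝ³)`. -/
def InSqrtL (f : E3 → E3) : Prop :=
  (∀ p : ℝ, 2 ≤ p → MemLp f (ENNReal.ofReal p) volume) ∧ sqrtLNorm f < ⊤

/-- The time interval `[0, T)`, where `T ∈ [0, ∞]`. -/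
def timeInterval (T : ENNReal) : Set ℝ := {t | 0 ≤ t ∧ ENNReal.ofReal t < T}

/-- `(ρ, u)` is a smooth solution on `[0, T) × ℝ³` of the Boussinesq system with horizontal viscosity
`∂ₜu + u·∇u - Δ_h u + ∇P = ρ e₃`, `∂ₜρ + u·∇ρ = 0`, `div u = 0`, with initial data `(ρ₀, u₀)`:
the fields (and a pressure) are `C^∞` up to the initial time, and
`u ∈ L^∞_loc([0,T); H¹)`, `∇u ∈ L¹_loc([0,T); L^∞)`. -/
structure IsSmoothSolution (T : ENNReal) (u₀ : E3 → E3) (ρ₀ : E3 → ℝ)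
    (u : ℝ → E3 → E3) (ρ : ℝ → E3 → ℝ) : Prop where
  smooth_u : ContDiffOn ℝ ∞ (fun q : ℝ × E3 => u q.1 q.2) (timeInterval T ×ˢ Set.univ)
  smooth_ρ : ContDiffOn ℝ ∞ (fun q : ℝ × E3 => ρ q.1 q.2) (timeInterval T ×ˢ Set.univ)
  momentum : ∃ P : ℝ → E3 → ℝ,
    ContDiffOn ℝ ∞ (fun q : ℝ × E3 => P q.1 q.2) (timeInterval T ×ˢ Set.univ) ∧
    ∀ t ∈ timeInterval T, 0 < t → ∀ x : E3,
      deriv (fun s => u s x) t + fderiv ℝ (u t) x (u t x) - lapH (u t) x + gradient (P t) x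
        = ρ t x • basisVec 2
  transport : ∀ t ∈ timeInterval T, 0 < t → ∀ x : E3,
    deriv (fun s => ρ s x) t + fderiv ℝ (ρ t) x (u t x) = 0
  div_free : ∀ t ∈ timeInterval T, ∀ x : E3, div (u t) x = 0
  initial_u : u 0 = u₀
  initial_ρ : ρ 0 = ρ₀
  bounded_H1 : ∀ b ∈ timeInterval T, ∃ M : NNReal, ∀ t ∈ Set.Icc 0 b,
    eLpNorm (u t) 2 volume ≤ M ∧ eLpNorm (fderiv ℝ (u t)) 2 volume ≤ M
  lipschitz : ∀ b ∈ timeInterval T,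
    ∫⁻ t in Set.Icc 0 b, eLpNorm (fderiv ℝ (u t)) ⊤ volume < ⊤

end HBS

namespace HalfPlane

open Set Filter Topology

/-- The radial partial derivative of a function of `(r, z)`. -/
noncomputable def dr (g : ℝ × ℝ → ℝ) (p : ℝ × ℝ) : ℝ := deriv (fun s => g (s, p.2)) p.1

/-- The vertical partial derivative of a function of `(r, z)`. -/
noncomputable def dz (g : ℝ × ℝ → ℝ) (p : ℝ × ℝ) : ℝ := deriv (fun s => g (p.1, s)) p.2

/-- The time derivative, one-sided at the end points of `[0, b]`. -/
noncomputable def dt (b : ℝ) (F : ℝ → ℝ × ℝ → ℝ) (t : ℝ) (p : ℝ × ℝ) : ℝ :=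
  derivWithin (fun s => F s p) (Icc 0 b) t

/-- Smooth functions of `(r, z)`. -/
def Sl (g : ℝ × ℝ → ℝ) : Prop := ContDiff ℝ ∞ g

/-- Functions of `(t, r, z)` which are smooth on `[0, b] × ℝ²`. -/
def Sm (b : ℝ) (F : ℝ → ℝ × ℝ → ℝ) : Prop :=
  ContDiffOn ℝ ∞ (fun q : ℝ × (ℝ × ℝ) => F q.1 q.2) (Icc 0 b ×ˢ univ)

/-- The open half-plane `r > 0`. -/
def H : Set (ℝ × ℝ) := {p | 0 < p.1}

theorem two_le_infty : (2 : WithTop ℕ∞) ≤ ∞ := WithTop.coe_le_coe.2 (le_top : (2 : ℕ∞) ≤ ⊤)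

section Slices

variable {g h : ℝ × ℝ → ℝ}

theorem Sl.hasDerivAt_r (hg : Sl g) (r z : ℝ) :
    HasDerivAt (fun s => g (s, z)) (dr g (r, z)) r := by
  have h1 : DifferentiableAt ℝ (fun s => g (s, z)) r := by
    have : Differentiable ℝ g := hg.differentiable (by simp)
    fun_prop
  exact h1.hasDerivAt

theorem Sl.hasDerivAt_z (hg : Sl g) (r z : ℝ) :
    HasDerivAt (fun s => g (r, s)) (dz g (r, z)) z := by
  have h1 : DifferentiableAt ℝ (fun s => g (r, s)) z := by
    have : Differentiable ℝ g := hg.differentiable (by simp)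
    fun_prop
  exact h1.hasDerivAt

theorem Sl.dr_eq (hg : Sl g) : dr g = fun p => fderiv ℝ g p (1, 0) := by
  funext ⟨r, z⟩
  have h1 : HasFDerivAt g (fderiv ℝ g (r, z)) (r, z) :=
    (hg.differentiable (by simp) _).hasFDerivAt
  have h2 : HasDerivAt (fun s : ℝ => (s, z)) ((1 : ℝ), (0 : ℝ)) r :=
    (hasDerivAt_id r).prodMk (hasDerivAt_const r z)
  exact (h1.comp_hasDerivAt r h2).deriv

theorem Sl.dz_eq (hg : Sl g) : dz g = fun p => fderiv ℝ g p (0, 1) := by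
  funext ⟨r, z⟩
  have h1 : HasFDerivAt g (fderiv ℝ g (r, z)) (r, z) :=
    (hg.differentiable (by simp) _).hasFDerivAt
  have h2 : HasDerivAt (fun s : ℝ => (r, s)) ((0 : ℝ), (1 : ℝ)) z :=
    (hasDerivAt_const z r).prodMk (hasDerivAt_id z)
  exact (h1.comp_hasDerivAt z h2).deriv

theorem Sl.dr (hg : Sl g) : Sl (dr g) := by
  rw [hg.dr_eq]
  exact (hg.fderiv_right (m := ∞) (by simp)).clm_apply contDiff_const

theorem Sl.dz (hg : Sl g) : Sl (dz g) := by
  rw [hg.dz_eq]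
  exact (hg.fderiv_right (m := ∞) (by simp)).clm_apply contDiff_const

theorem Sl.dr_dz (hg : Sl g) (p : ℝ × ℝ) :
    HalfPlane.dr (HalfPlane.dz g) p = HalfPlane.dz (HalfPlane.dr g) p := by
  have hd : Differentiable ℝ (fderiv ℝ g) :=
    (hg.fderiv_right (m := ∞) (by simp)).differentiable (by simp)
  have key : ∀ e e' : ℝ × ℝ, fderiv ℝ (fun p => fderiv ℝ g p e) p e' = fderiv ℝ (fderiv ℝ g) p e' e := by
    intro e e'
    rw [fderiv_clm_apply (hd p) (by fun_prop)]
    simp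
  rw [hg.dz.dr_eq, hg.dr.dz_eq, hg.dz_eq, hg.dr_eq]
  simp only [key]
  have hs : IsSymmSndFDerivAt ℝ g p := hg.contDiffAt.isSymmSndFDerivAt (by simpa using two_le_infty)
  exact hs _ _

theorem Sl.continuous (hg : Sl g) : Continuous g := ContDiff.continuous hg

theorem Sl.add (hg : Sl g) (hh : Sl h) : Sl (fun p => g p + h p) := ContDiff.add hg hh
theorem Sl.sub (hg : Sl g) (hh : Sl h) : Sl (fun p => g p - h p) := ContDiff.sub hg hh
theorem Sl.mul (hg : Sl g) (hh : Sl h) : Sl (fun p => g p * h p) := ContDiff.mul hg hh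
theorem Sl.fst : Sl (fun p => p.1) := contDiff_fst

end Slices

section TimeDependent

variable {b : ℝ} {F G : ℝ → ℝ × ℝ → ℝ}

theorem uniqueDiffOn_strip (hb : 0 < b) :
    UniqueDiffOn ℝ (Icc 0 b ×ˢ (univ : Set (ℝ × ℝ))) :=
  (uniqueDiffOn_Icc hb).prod uniqueDiffOn_univ

theorem Sm.slice (hF : Sm b F) {t : ℝ} (ht : t ∈ Icc 0 b) : Sl (F t) := by
  have h1 : ContDiffOn ℝ ∞ (fun p : ℝ × ℝ => (t, p)) univ := by fun_prop
  have := ContDiffOn.comp (g := fun q : ℝ × (ℝ × ℝ) => F q.1 q.2) hF h1 (fun p _ => ⟨ht, mem_univ _⟩)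
  exact contDiffOn_univ.1 this

theorem Sm.continuousOn (hF : Sm b F) :
    ContinuousOn (fun q : ℝ × (ℝ × ℝ) => F q.1 q.2) (Icc 0 b ×ˢ univ) :=
  ContDiffOn.continuousOn hF

theorem Sm.hasFDerivWithinAt (hF : Sm b F) {t : ℝ} (ht : t ∈ Icc 0 b) (p : ℝ × ℝ) :
    HasFDerivWithinAt (fun q : ℝ × (ℝ × ℝ) => F q.1 q.2)
      (fderivWithin ℝ (fun q : ℝ × (ℝ × ℝ) => F q.1 q.2) (Icc 0 b ×ˢ univ) (t, p))
      (Icc 0 b ×ˢ univ) (t, p) :=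
  ((ContDiffOn.differentiableOn hF (by simp)) _ ⟨ht, mem_univ _⟩).hasFDerivWithinAt

theorem Sm.dr_eq (hF : Sm b F) {t : ℝ} (ht : t ∈ Icc 0 b) (p : ℝ × ℝ) :
    HalfPlane.dr (F t) p = fderivWithin ℝ (fun q : ℝ × (ℝ × ℝ) => F q.1 q.2) (Icc 0 b ×ˢ univ) (t, p)
      (0, (1, 0)) := by
  obtain ⟨r, z⟩ := p
  have h2 : HasDerivWithinAt (fun s : ℝ => (t, (s, z))) ((0 : ℝ), ((1 : ℝ), (0 : ℝ))) univ r :=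
    ((hasDerivAt_const r t).prodMk ((hasDerivAt_id r).prodMk (hasDerivAt_const r z))).hasDerivWithinAt
  have hm : MapsTo (fun s : ℝ => (t, (s, z))) univ (Icc 0 b ×ˢ univ) := fun s _ => ⟨ht, mem_univ _⟩
  have := (hF.hasFDerivWithinAt ht (r, z)).comp_hasDerivWithinAt r h2 hm
  exact (hasDerivWithinAt_univ.1 this).deriv

theorem Sm.dz_eq (hF : Sm b F) {t : ℝ} (ht : t ∈ Icc 0 b) (p : ℝ × ℝ) :
    HalfPlane.dz (F t) p = fderivWithin ℝ (fun q : ℝ × (ℝ × ℝ) => F q.1 q.2) (Icc 0 b ×ˢ univ) (t, p)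
      (0, (0, 1)) := by
  obtain ⟨r, z⟩ := p
  have h2 : HasDerivWithinAt (fun s : ℝ => (t, (r, s))) ((0 : ℝ), ((0 : ℝ), (1 : ℝ))) univ z :=
    ((hasDerivAt_const z t).prodMk ((hasDerivAt_const z r).prodMk (hasDerivAt_id z))).hasDerivWithinAt
  have hm : MapsTo (fun s : ℝ => (t, (r, s))) univ (Icc 0 b ×ˢ univ) := fun s _ => ⟨ht, mem_univ _⟩
  have := (hF.hasFDerivWithinAt ht (r, z)).comp_hasDerivWithinAt z h2 hm
  exact (hasDerivWithinAt_univ.1 this).deriv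

theorem Sm.hasDerivWithinAt_t (hF : Sm b F) {t : ℝ} (ht : t ∈ Icc 0 b) (p : ℝ × ℝ) :
    HasDerivWithinAt (fun s => F s p)
      (fderivWithin ℝ (fun q : ℝ × (ℝ × ℝ) => F q.1 q.2) (Icc 0 b ×ˢ univ) (t, p) (1, 0))
      (Icc 0 b) t := by
  have h2 : HasDerivWithinAt (fun s : ℝ => (s, p)) ((1 : ℝ), (0 : ℝ × ℝ)) (Icc 0 b) t :=
    ((hasDerivAt_id t).prodMk (hasDerivAt_const t p)).hasDerivWithinAt
  have hm : MapsTo (fun s : ℝ => (s, p)) (Icc 0 b) (Icc 0 b ×ˢ univ) := fun s hs => ⟨hs, mem_univ _⟩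
  exact (hF.hasFDerivWithinAt ht p).comp_hasDerivWithinAt t h2 hm

theorem Sm.dt_eq (hb : 0 < b) (hF : Sm b F) {t : ℝ} (ht : t ∈ Icc 0 b) (p : ℝ × ℝ) :
    HalfPlane.dt b F t p = fderivWithin ℝ (fun q : ℝ × (ℝ × ℝ) => F q.1 q.2) (Icc 0 b ×ˢ univ) (t, p)
      (1, 0) :=
  (hF.hasDerivWithinAt_t ht p).derivWithin (uniqueDiffOn_Icc hb t ht)

theorem Sm.hasDerivWithinAt (hb : 0 < b) (hF : Sm b F) {t : ℝ} (ht : t ∈ Icc 0 b) (p : ℝ × ℝ) :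
    HasDerivWithinAt (fun s => F s p) (HalfPlane.dt b F t p) (Icc 0 b) t := by
  rw [hF.dt_eq hb ht]; exact hF.hasDerivWithinAt_t ht p

theorem Sm.hasDerivAt (hb : 0 < b) (hF : Sm b F) {t : ℝ} (ht : t ∈ Ioo 0 b) (p : ℝ × ℝ) :
    HasDerivAt (fun s => F s p) (HalfPlane.dt b F t p) t :=
  (hF.hasDerivWithinAt hb (Ioo_subset_Icc_self ht) p).hasDerivAt (Icc_mem_nhds ht.1 ht.2)

theorem Sm.fderivWithin_apply (hb : 0 < b) (hF : Sm b F) (e : ℝ × (ℝ × ℝ)) :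
    ContDiffOn ℝ ∞ (fun q => fderivWithin ℝ (fun q : ℝ × (ℝ × ℝ) => F q.1 q.2) (Icc 0 b ×ˢ univ) q e)
      (Icc 0 b ×ˢ univ) :=
  (ContDiffOn.fderivWithin hF (uniqueDiffOn_strip hb) (m := ∞) (by simp)).clm_apply contDiffOn_const

theorem Sm.dr (hb : 0 < b) (hF : Sm b F) : Sm b (fun t => HalfPlane.dr (F t)) :=
  (hF.fderivWithin_apply hb _).congr (fun q hq => hF.dr_eq hq.1 q.2)

theorem Sm.dz (hb : 0 < b) (hF : Sm b F) : Sm b (fun t => HalfPlane.dz (F t)) :=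
  (hF.fderivWithin_apply hb _).congr (fun q hq => hF.dz_eq hq.1 q.2)

theorem Sm.dt (hb : 0 < b) (hF : Sm b F) : Sm b (HalfPlane.dt b F) :=
  (hF.fderivWithin_apply hb _).congr (fun q hq => hF.dt_eq hb hq.1 q.2)

theorem Sm.fderivWithin_swap (hb : 0 < b) (hF : Sm b F) (e e' : ℝ × (ℝ × ℝ)) {t : ℝ} (ht : t ∈ Icc 0 b)
    (p : ℝ × ℝ) :
    fderivWithin ℝ (fun q => fderivWithin ℝ (fun q : ℝ × (ℝ × ℝ) => F q.1 q.2)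
      (Icc 0 b ×ˢ univ) q e) (Icc 0 b ×ˢ univ) (t, p) e' =
    fderivWithin ℝ (fun q => fderivWithin ℝ (fun q : ℝ × (ℝ × ℝ) => F q.1 q.2)
      (Icc 0 b ×ˢ univ) q e') (Icc 0 b ×ˢ univ) (t, p) e := by
  have hmem : (t, p) ∈ Icc 0 b ×ˢ (univ : Set (ℝ × ℝ)) := ⟨ht, mem_univ _⟩
  have hu := uniqueDiffOn_strip hb (t, p) hmem
  have hd : DifferentiableWithinAt ℝ (fderivWithin ℝ (fun q : ℝ × (ℝ × ℝ) => F q.1 q.2)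
      (Icc 0 b ×ˢ univ)) (Icc 0 b ×ˢ univ) (t, p) :=
    (ContDiffOn.fderivWithin hF (uniqueDiffOn_strip hb) (m := ∞) (by simp)).differentiableOn (by simp)
      _ hmem
  have key : ∀ e e' : ℝ × (ℝ × ℝ), fderivWithin ℝ (fun q => fderivWithin ℝ
      (fun q : ℝ × (ℝ × ℝ) => F q.1 q.2) (Icc 0 b ×ˢ univ) q e) (Icc 0 b ×ˢ univ) (t, p) e' =
      fderivWithin ℝ (fderivWithin ℝ (fun q : ℝ × (ℝ × ℝ) => F q.1 q.2)
      (Icc 0 b ×ˢ univ)) (Icc 0 b ×ˢ univ) (t, p) e' e := by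
    intro e e'
    rw [fderivWithin_clm_apply hu hd (differentiableWithinAt_const _)]
    simp
  rw [key, key]
  have hs : IsSymmSndFDerivWithinAt ℝ (fun q : ℝ × (ℝ × ℝ) => F q.1 q.2) (Icc 0 b ×ˢ univ) (t, p) := by
    refine (hF _ hmem).isSymmSndFDerivWithinAt (by simpa using two_le_infty) (uniqueDiffOn_strip hb) ?_ hmem
    rw [interior_prod_eq, interior_Icc, interior_univ, closure_prod_eq, closure_Ioo hb.ne]
    exact ⟨ht, by simp⟩
  exact hs _ _

theorem Sm.dt_dr (hb : 0 < b) (hF : Sm b F) {t : ℝ} (ht : t ∈ Icc 0 b) (p : ℝ × ℝ) :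
    HalfPlane.dt b (fun t => HalfPlane.dr (F t)) t p = HalfPlane.dr (HalfPlane.dt b F t) p := by
  rw [(hF.dr hb).dt_eq hb ht, (hF.dt hb).dr_eq ht]
  have e1 : fderivWithin ℝ (fun q : ℝ × (ℝ × ℝ) => HalfPlane.dr (F q.1) q.2) (Icc 0 b ×ˢ univ) (t, p) =
      fderivWithin ℝ (fun q => fderivWithin ℝ (fun q : ℝ × (ℝ × ℝ) => F q.1 q.2)
        (Icc 0 b ×ˢ univ) q (0, (1, 0))) (Icc 0 b ×ˢ univ) (t, p) :=
    fderivWithin_congr (fun q hq => hF.dr_eq hq.1 q.2) (hF.dr_eq ht p)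
  have e2 : fderivWithin ℝ (fun q : ℝ × (ℝ × ℝ) => HalfPlane.dt b F q.1 q.2) (Icc 0 b ×ˢ univ) (t, p) =
      fderivWithin ℝ (fun q => fderivWithin ℝ (fun q : ℝ × (ℝ × ℝ) => F q.1 q.2)
        (Icc 0 b ×ˢ univ) q (1, 0)) (Icc 0 b ×ˢ univ) (t, p) :=
    fderivWithin_congr (fun q hq => hF.dt_eq hb hq.1 q.2) (hF.dt_eq hb ht p)
  rw [e1, e2]
  exact hF.fderivWithin_swap hb _ _ ht p

theorem Sm.dt_dz (hb : 0 < b) (hF : Sm b F) {t : ℝ} (ht : t ∈ Icc 0 b) (p : ℝ × ℝ) :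
    HalfPlane.dt b (fun t => HalfPlane.dz (F t)) t p = HalfPlane.dz (HalfPlane.dt b F t) p := by
  rw [(hF.dz hb).dt_eq hb ht, (hF.dt hb).dz_eq ht]
  have e1 : fderivWithin ℝ (fun q : ℝ × (ℝ × ℝ) => HalfPlane.dz (F q.1) q.2) (Icc 0 b ×ˢ univ) (t, p) =
      fderivWithin ℝ (fun q => fderivWithin ℝ (fun q : ℝ × (ℝ × ℝ) => F q.1 q.2)
        (Icc 0 b ×ˢ univ) q (0, (0, 1))) (Icc 0 b ×ˢ univ) (t, p) :=
    fderivWithin_congr (fun q hq => hF.dz_eq hq.1 q.2) (hF.dz_eq ht p)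
  have e2 : fderivWithin ℝ (fun q : ℝ × (ℝ × ℝ) => HalfPlane.dt b F q.1 q.2) (Icc 0 b ×ˢ univ) (t, p) =
      fderivWithin ℝ (fun q => fderivWithin ℝ (fun q : ℝ × (ℝ × ℝ) => F q.1 q.2)
        (Icc 0 b ×ˢ univ) q (1, 0)) (Icc 0 b ×ˢ univ) (t, p) :=
    fderivWithin_congr (fun q hq => hF.dt_eq hb hq.1 q.2) (hF.dt_eq hb ht p)
  rw [e1, e2]
  exact hF.fderivWithin_swap hb _ _ ht p

theorem Sm.add (hF : Sm b F) (hG : Sm b G) : Sm b (fun t p => F t p + G t p) := ContDiffOn.add hF hG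
theorem Sm.sub (hF : Sm b F) (hG : Sm b G) : Sm b (fun t p => F t p - G t p) := ContDiffOn.sub hF hG
theorem Sm.mul (hF : Sm b F) (hG : Sm b G) : Sm b (fun t p => F t p * G t p) := ContDiffOn.mul hF hG
theorem Sm.of_slice {g : ℝ × ℝ → ℝ} (hg : Sl g) : Sm b (fun _ p => g p) :=
  (ContDiff.comp (g := g) hg contDiff_snd).contDiffOn

end TimeDependent

section Parametric

variable {E W : Type*} [NormedAddCommGroup E] [NormedSpace ℝ E]
  [NormedAddCommGroup W] [NormedSpace ℝ W]

/-- Differentiation under the integral sign on a convex set, for a parameter in `[0, 1]`. -/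
theorem hasFDerivWithinAt_integral_of_continuousOn {S : Set E} (hS : Convex ℝ S)
    {F : ℝ → E → W} {F' : ℝ → E → E →L[ℝ] W}
    (hF : ContinuousOn (fun q : ℝ × E => F q.1 q.2) (univ ×ˢ S))
    (hd : ∀ l, ∀ x ∈ S, HasFDerivWithinAt (F l) (F' l x) S x)
    (hF' : ContinuousOn (fun q : ℝ × E => F' q.1 q.2) (univ ×ˢ S)) {x : E} (hx : x ∈ S) :
    HasFDerivWithinAt (fun x => ∫ l in (0:ℝ)..1, F l x) (∫ l in (0:ℝ)..1, F' l x) S x := by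
  have hslice : ∀ y ∈ S, Continuous (fun l => F l y) := by
    intro y hy
    have : ContinuousOn (fun l : ℝ => (l, y)) univ := by fun_prop
    exact continuousOn_univ.1 (hF.comp this (fun l _ => ⟨mem_univ _, hy⟩))
  have hslice' : ∀ y ∈ S, Continuous (fun l => F' l y) := by
    intro y hy
    have : ContinuousOn (fun l : ℝ => (l, y)) univ := by fun_prop
    exact continuousOn_univ.1 (hF'.comp this (fun l _ => ⟨mem_univ _, hy⟩))
  rw [hasFDerivWithinAt_iff_isLittleO, Asymptotics.isLittleO_iff]
  intro c hc
  have hunif : ∀ᶠ y in 𝓝[S] x, ∀ l ∈ Icc (0:ℝ) 1, ‖F' l y - F' l x‖ < c := by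
    have hloc : ∀ l ∈ Icc (0:ℝ) 1, ∀ᶠ q : E × ℝ in 𝓝[S] x ×ˢ 𝓝[Icc 0 1] l,
        ‖F' q.2 q.1 - F' q.2 x‖ < c := by
      intro l hl
      have h1 : Tendsto (fun q : E × ℝ => F' q.2 q.1) (𝓝[S] x ×ˢ 𝓝[Icc 0 1] l) (𝓝 (F' l x)) := by
        have h2 : ContinuousWithinAt (fun q : ℝ × E => F' q.1 q.2) (univ ×ˢ S) (l, x) :=
          hF' _ ⟨mem_univ _, hx⟩
        refine (h2.tendsto).comp (f := fun q : E × ℝ => (q.2, q.1)) ?_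
        rw [nhdsWithin_prod_eq, nhdsWithin_univ]
        exact (tendsto_snd.mono_right nhdsWithin_le_nhds).prodMk tendsto_fst
      have h3 : Tendsto (fun q : E × ℝ => F' q.2 x) (𝓝[S] x ×ˢ 𝓝[Icc 0 1] l) (𝓝 (F' l x)) :=
        ((hslice' x hx).tendsto l).comp (tendsto_snd.mono_right nhdsWithin_le_nhds)
      have h4 := (h1.sub h3).norm
      simp only [sub_self, norm_zero] at h4
      exact h4.eventually (gt_mem_nhds hc)
    have h5 := isCompact_Icc.induction_on (s := Icc (0:ℝ) 1)
      (p := fun s => ∀ᶠ y in 𝓝[S] x, ∀ l ∈ s, ‖F' l y - F' l x‖ < c) (by simp)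
      (fun s t hst ht => ht.mono fun y hy l hl => hy l (hst hl))
      (fun s t hs ht => (hs.and ht).mono fun y hy l hl => hl.elim (hy.1 l) (hy.2 l))
      (fun l hl => by
        obtain ⟨pa, hpa, pb, hpb, hab⟩ := eventually_prod_iff.1 (hloc l hl)
        exact ⟨{m | pb m}, hpb, hpa.mono fun y hy m hm => hab hy hm⟩)
    exact h5
  rw [eventually_nhdsWithin_iff, Metric.eventually_nhds_iff_ball] at hunif
  obtain ⟨ε, hε, hball⟩ := hunif
  have hmem : S ∩ Metric.ball x ε ∈ 𝓝[S] x :=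
    inter_mem self_mem_nhdsWithin (mem_nhdsWithin_of_mem_nhds (Metric.ball_mem_nhds x hε))
  filter_upwards [hmem] with y hy
  have hptw : ∀ l ∈ Icc (0:ℝ) 1, ‖F l y - F l x - F' l x (y - x)‖ ≤ c * ‖y - x‖ := by
    intro l hl
    refine Convex.norm_image_sub_le_of_norm_hasFDerivWithin_le' (s := S ∩ Metric.ball x ε)
      (f' := F' l) (fun w hw => (hd l w hw.1).mono inter_subset_left) (fun w hw => ?_)
      (hS.inter (convex_ball _ _)) ⟨hx, Metric.mem_ball_self hε⟩ hy
    exact (hball w hw.2 hw.1 l hl).le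
  have e1 : (∫ l in (0:ℝ)..1, F l y) - (∫ l in (0:ℝ)..1, F l x) - (∫ l in (0:ℝ)..1, F' l x) (y - x)
      = ∫ l in (0:ℝ)..1, (F l y - F l x - F' l x (y - x)) := by
    rw [intervalIntegral.integral_sub, intervalIntegral.integral_sub,
      ContinuousLinearMap.intervalIntegral_apply]
    · exact (hslice' x hx).intervalIntegrable _ _
    · exact (hslice y hy.1).intervalIntegrable _ _
    · exact (hslice x hx).intervalIntegrable _ _
    · exact ((hslice y hy.1).sub (hslice x hx)).intervalIntegrable _ _
    · exact ((hslice' x hx).clm_apply continuous_const).intervalIntegrable _ _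
  rw [e1]
  have := intervalIntegral.norm_integral_le_of_norm_le_const (a := (0:ℝ)) (b := 1)
    (f := fun l => F l y - F l x - F' l x (y - x)) (C := c * ‖y - x‖)
    (fun l hl => hptw l (by rw [uIoc_of_le zero_le_one] at hl; exact ⟨hl.1.le, hl.2⟩))
  simpa using this

end Parametric

section ParametricSmooth

theorem contDiffOn_integral_nat {E : Type} [NormedAddCommGroup E] [NormedSpace ℝ E] {S : Set E}
    (hS : Convex ℝ S) (hu : UniqueDiffOn ℝ S) (n : ℕ) :
    ∀ {W : Type} [NormedAddCommGroup W] [NormedSpace ℝ W] {F : ℝ → E → W},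
    ContDiffOn ℝ ∞ (fun q : ℝ × E => F q.1 q.2) (univ ×ˢ S) →
    ContDiffOn ℝ n (fun x => ∫ l in (0:ℝ)..1, F l x) S := by
  have main : ∀ {W : Type} [NormedAddCommGroup W] [NormedSpace ℝ W] {F : ℝ → E → W},
      ContDiffOn ℝ ∞ (fun q : ℝ × E => F q.1 q.2) (univ ×ˢ S) →
      ∃ F' : ℝ → E → E →L[ℝ] W, ContDiffOn ℝ ∞ (fun q : ℝ × E => F' q.1 q.2) (univ ×ˢ S) ∧
      ∀ x ∈ S, HasFDerivWithinAt (fun x => ∫ l in (0:ℝ)..1, F l x) (∫ l in (0:ℝ)..1, F' l x) S x := by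
    intro W _ _ F hF
    have hu' : UniqueDiffOn ℝ ((univ : Set ℝ) ×ˢ S) := uniqueDiffOn_univ.prod hu
    have hF' : ContDiffOn ℝ ∞ (fun q : ℝ × E => (fderivWithin ℝ (fun q : ℝ × E => F q.1 q.2)
        (univ ×ˢ S) q).comp (ContinuousLinearMap.inr ℝ ℝ E)) (univ ×ˢ S) :=
      (hF.fderivWithin hu' (m := ∞) (by simp)).clm_comp contDiffOn_const
    refine ⟨fun l x => (fderivWithin ℝ (fun q : ℝ × E => F q.1 q.2) (univ ×ˢ S) (l, x)).comp
      (ContinuousLinearMap.inr ℝ ℝ E), hF', fun x hx => ?_⟩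
    refine hasFDerivWithinAt_integral_of_continuousOn hS (F' := fun l x => (fderivWithin ℝ
      (fun q : ℝ × E => F q.1 q.2) (univ ×ˢ S) (l, x)).comp (ContinuousLinearMap.inr ℝ ℝ E))
      hF.continuousOn (fun l y hy => ?_) hF'.continuousOn hx
    have h1 := ((hF.differentiableOn (by simp)) (l, y) ⟨mem_univ _, hy⟩).hasFDerivWithinAt
    have hm : MapsTo (fun y : E => (l, y)) S (univ ×ˢ S) := fun y hy => ⟨mem_univ _, hy⟩
    exact h1.comp y ((hasFDerivAt_prodMk_right l y).hasFDerivWithinAt) hm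
  induction n with
  | zero =>
    intro W _ _ F hF
    obtain ⟨F', -, hd⟩ := main hF
    exact contDiffOn_zero.2 fun x hx => (hd x hx).continuousWithinAt
  | succ n ih =>
    intro W _ _ F hF
    obtain ⟨F', hF', hd⟩ := main hF
    have : ((n + 1 : ℕ) : WithTop ℕ∞) = n + 1 := by push_cast; rfl
    rw [this, contDiffOn_succ_iff_fderivWithin hu]
    refine ⟨fun x hx => (hd x hx).differentiableWithinAt, by simp, ?_⟩
    exact (ih hF').congr fun x hx => (hd x hx).fderivWithin (hu x hx)

theorem contDiffOn_integral {E : Type} [NormedAddCommGroup E] [NormedSpace ℝ E] {S : Set E}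
    (hS : Convex ℝ S) (hu : UniqueDiffOn ℝ S)
    {W : Type} [NormedAddCommGroup W] [NormedSpace ℝ W] {F : ℝ → E → W}
    (hF : ContDiffOn ℝ ∞ (fun q : ℝ × E => F q.1 q.2) (univ ×ˢ S)) :
    ContDiffOn ℝ ∞ (fun x => ∫ l in (0:ℝ)..1, F l x) S :=
  contDiffOn_infty.2 fun n => contDiffOn_integral_nat hS hu n hF

end ParametricSmooth

section Averages

theorem _root_.HasDerivAt.hasFDerivWithinAt_smul_one {f : ℝ → ℝ} {c x : ℝ} {s : Set ℝ}
    (h : HasDerivAt f c x) : HasFDerivWithinAt f (c • (1 : ℝ →L[ℝ] ℝ)) s x := by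
  have h1 := h.hasFDerivAt.hasFDerivWithinAt (s := s)
  have e : (c • (1 : ℝ →L[ℝ] ℝ)) = ContinuousLinearMap.toSpanSingleton ℝ c := by ext; simp
  rw [e]; exact h1

/-- The average `∫₀¹ λⁿ g(λ r, z) dλ`. -/
noncomputable def Av (n : ℕ) (g : ℝ × ℝ → ℝ) (p : ℝ × ℝ) : ℝ :=
  ∫ l in (0:ℝ)..1, l ^ n * g (l * p.1, p.2)

variable {b : ℝ} {F : ℝ → ℝ × ℝ → ℝ} {g : ℝ × ℝ → ℝ}

theorem Sm.Av (hb : 0 < b) (n : ℕ) (hF : Sm b F) : Sm b (fun t => Av n (F t)) := by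
  refine contDiffOn_integral (E := ℝ × (ℝ × ℝ)) (W := ℝ) ((convex_Icc _ _).prod convex_univ)
    (uniqueDiffOn_strip hb)
    (F := fun l (q : ℝ × (ℝ × ℝ)) => l ^ n * F q.1 (l * q.2.1, q.2.2)) ?_
  refine ContDiffOn.mul (by fun_prop) ?_
  have h1 : ContDiffOn ℝ ∞ (fun q : ℝ × (ℝ × (ℝ × ℝ)) => (q.2.1, (q.1 * q.2.2.1, q.2.2.2)))
    (univ ×ˢ (Icc 0 b ×ˢ univ)) := by fun_prop
  exact ContDiffOn.comp (g := fun q : ℝ × (ℝ × ℝ) => F q.1 q.2) hF h1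
    (fun q hq => ⟨hq.2.1, mem_univ _⟩)

theorem Sl.sm (hg : Sl g) : Sm 1 (fun _ => g) := Sm.of_slice hg

theorem Sl.Av (n : ℕ) (hg : Sl g) : Sl (Av n g) :=
  (hg.sm.Av one_pos n).slice (t := 0) (by simp)

theorem Sl.hasDerivAt_scale (hg : Sl g) (l r z : ℝ) :
    HasDerivAt (fun s => g (l * s, z)) (l * HalfPlane.dr g (l * r, z)) r := by
  have h := (hg.hasDerivAt_r (l * r) z).comp r ((hasDerivAt_id r).const_mul l)
  simp only [mul_one] at h
  rw [mul_comm]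
  exact h

theorem Sl.dr_Av (n : ℕ) (hg : Sl g) : HalfPlane.dr (HalfPlane.Av n g) = HalfPlane.Av (n + 1) (HalfPlane.dr g) := by
  funext ⟨r, z⟩
  have hc := hg.continuous
  have hc' := hg.dr.continuous
  have := hasFDerivWithinAt_integral_of_continuousOn (S := univ) convex_univ
    (F := fun l s => l ^ n * g (l * s, z))
    (F' := fun l s => (l ^ n * (l * HalfPlane.dr g (l * s, z))) • (1 : ℝ →L[ℝ] ℝ))
    (by fun_prop) (fun l x _ => ((hg.hasDerivAt_scale l x z).const_mul (l ^ n)).hasFDerivWithinAt_smul_one)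
    (by fun_prop) (mem_univ r)
  rw [hasFDerivWithinAt_univ] at this
  have h2 := this.hasDerivAt.deriv
  refine h2.trans ?_
  rw [ContinuousLinearMap.intervalIntegral_apply (by apply Continuous.intervalIntegrable; fun_prop)]
  refine intervalIntegral.integral_congr fun l _ => ?_
  simp [pow_succ, mul_assoc]

theorem Sl.dz_Av (n : ℕ) (hg : Sl g) : HalfPlane.dz (HalfPlane.Av n g) = HalfPlane.Av n (HalfPlane.dz g) := by
  funext ⟨r, z⟩
  have hc := hg.continuous
  have hc' := hg.dz.continuous
  have := hasFDerivWithinAt_integral_of_continuousOn (S := univ) convex_univ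
    (F := fun l s => l ^ n * g (l * r, s))
    (F' := fun l s => (l ^ n * HalfPlane.dz g (l * r, s)) • (1 : ℝ →L[ℝ] ℝ))
    (by fun_prop) (fun l x _ => ((hg.hasDerivAt_z (l * r) x).const_mul (l ^ n)).hasFDerivWithinAt_smul_one)
    (by fun_prop) (mem_univ z)
  rw [hasFDerivWithinAt_univ] at this
  have h2 := this.hasDerivAt.deriv
  refine h2.trans ?_
  rw [ContinuousLinearMap.intervalIntegral_apply (by apply Continuous.intervalIntegrable; fun_prop)]
  refine intervalIntegral.integral_congr fun l _ => ?_
  simp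

/-- Euler's identity for averages. -/
theorem Sl.euler (n : ℕ) (hg : Sl g) (p : ℝ × ℝ) :
    g p = (n + 1) * HalfPlane.Av n g p + p.1 * HalfPlane.Av (n + 1) (HalfPlane.dr g) p := by
  obtain ⟨r, z⟩ := p
  have hc := hg.continuous
  have hc' := hg.dr.continuous
  have h1 : ∀ l ∈ uIcc (0:ℝ) 1, HasDerivAt (fun l : ℝ => l ^ (n + 1) * g (l * r, z))
      ((n + 1) * (l ^ n * g (l * r, z)) + r * (l ^ (n + 1) * HalfPlane.dr g (l * r, z))) l := by
    intro l _
    have h2 : HasDerivAt (fun l => g (l * r, z)) (HalfPlane.dr g (l * r, z) * r) l := by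
      have h : HasDerivAt (fun l => g (l * r, z)) (HalfPlane.dr g (l * r, z) * (1 * r)) l :=
        HasDerivAt.comp (h₂ := fun s => g (s, z)) l (hg.hasDerivAt_r (l * r) z)
          ((hasDerivAt_id l).mul_const r)
      simpa using h
    refine ((hasDerivAt_pow (n + 1) l).mul h2).congr_deriv ?_
    push_cast
    ring
  have := intervalIntegral.integral_eq_sub_of_hasDerivAt h1
    (by apply Continuous.intervalIntegrable; fun_prop)
  simp only [one_pow, one_mul, zero_mul, ne_eq, Nat.add_eq_zero_iff, one_ne_zero, and_false,
    not_false_eq_true, zero_pow, sub_zero] at this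
  rw [← this, intervalIntegral.integral_add, intervalIntegral.integral_const_mul,
    intervalIntegral.integral_const_mul]
  · rfl
  · apply Continuous.intervalIntegrable; fun_prop
  · apply Continuous.intervalIntegrable; fun_prop

/-- Hadamard's lemma: a smooth function which vanishes on the axis is divisible by `r`. -/
theorem Sl.hadamard (hg : Sl g) (h0 : ∀ z, g (0, z) = 0) (p : ℝ × ℝ) :
    g p = p.1 * HalfPlane.Av 0 (HalfPlane.dr g) p := by
  obtain ⟨r, z⟩ := p
  have hc' := hg.dr.continuous
  have h1 : ∀ l ∈ uIcc (0:ℝ) 1, HasDerivAt (fun l : ℝ => g (l * r, z))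
      (r * (l ^ 0 * HalfPlane.dr g (l * r, z))) l := by
    intro l _
    have h : HasDerivAt (fun l => g (l * r, z)) (HalfPlane.dr g (l * r, z) * (1 * r)) l :=
      HasDerivAt.comp (h₂ := fun s => g (s, z)) l (hg.hasDerivAt_r (l * r) z)
        ((hasDerivAt_id l).mul_const r)
    refine h.congr_deriv ?_
    ring
  have := intervalIntegral.integral_eq_sub_of_hasDerivAt h1
    (by apply Continuous.intervalIntegrable; fun_prop)
  rw [intervalIntegral.integral_const_mul] at this
  simp only [one_mul, zero_mul, h0, sub_zero] at this
  exact this.symm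

end Averages


section IntegrationByParts

theorem measurableSet_H : MeasurableSet H := measurableSet_lt measurable_const measurable_fst

theorem isOpen_H : IsOpen H := isOpen_lt continuous_const continuous_fst

theorem H_eq : H = Ioi (0:ℝ) ×ˢ (univ : Set ℝ) := by ext p; simp [H]

/-- Bounded support, relative to the half-plane. -/
def BH (g : ℝ × ℝ → ℝ) : Prop := ∃ L : ℝ, ∀ p : ℝ × ℝ, 0 < p.1 → (L < p.1 ∨ L < |p.2|) → g p = 0

theorem BH.mul_right {g h : ℝ × ℝ → ℝ} (hg : BH g) : BH (fun p => g p * h p) := by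
  obtain ⟨L, hL⟩ := hg
  exact ⟨L, fun p hp h => by simp [hL p hp h]⟩

theorem BH.mul_left {g h : ℝ × ℝ → ℝ} (hg : BH g) : BH (fun p => h p * g p) := by
  obtain ⟨L, hL⟩ := hg
  exact ⟨L, fun p hp h => by simp [hL p hp h]⟩

theorem BH.add {g h : ℝ × ℝ → ℝ} (hg : BH g) (hh : BH h) : BH (fun p => g p + h p) := by
  obtain ⟨L, hL⟩ := hg
  obtain ⟨L', hL'⟩ := hh
  refine ⟨max L L', fun p hp h => ?_⟩
  have h1 : L < p.1 ∨ L < |p.2| := h.imp (lt_of_le_of_lt (le_max_left _ _)) (lt_of_le_of_lt (le_max_left _ _))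
  have h2 : L' < p.1 ∨ L' < |p.2| := h.imp (lt_of_le_of_lt (le_max_right _ _)) (lt_of_le_of_lt (le_max_right _ _))
  simp [hL p hp h1, hL' p hp h2]

theorem BH.mono {g h : ℝ × ℝ → ℝ} (hg : BH g) (hgh : ∀ p, 0 < p.1 → g p = 0 → h p = 0) : BH h := by
  obtain ⟨L, hL⟩ := hg
  exact ⟨L, fun p hp h => hgh p hp (hL p hp h)⟩

theorem BH.integrableOn {g : ℝ × ℝ → ℝ} (hg : BH g) (hc : Continuous g) : IntegrableOn g H := by
  obtain ⟨L, hL⟩ := hg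
  have hK : IntegrableOn g (Icc 0 L ×ˢ Icc (-L) L) :=
    hc.continuousOn.integrableOn_compact (isCompact_Icc.prod isCompact_Icc)
  have h2 : IntegrableOn g (H ∩ (Icc 0 L ×ˢ Icc (-L) L)) := hK.mono_set inter_subset_right
  refine h2.of_forall_sdiff_eq_zero measurableSet_H fun p hp => ?_
  refine hL p hp.1 ?_
  by_contra hcon
  push Not at hcon
  exact hp.2 ⟨hp.1, ⟨le_of_lt hp.1, hcon.1⟩, abs_le.1 hcon.2⟩

theorem BH.dz {G Gz : ℝ × ℝ → ℝ} (hG : BH G)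
    (hd : ∀ r z, 0 < r → HasDerivAt (fun s => G (r, s)) (Gz (r, z)) z) : BH Gz := by
  obtain ⟨L, hL⟩ := hG
  refine ⟨L, fun ⟨r, z⟩ hp h => ?_⟩
  have h0 : (fun s => G (r, s)) =ᶠ[𝓝 z] fun _ => 0 := by
    rcases h with h | h
    · exact Eventually.of_forall fun s => hL (r, s) hp (Or.inl h)
    · have : ∀ᶠ s in 𝓝 z, L < |s| := continuous_abs.continuousAt.eventually (lt_mem_nhds h)
      exact this.mono fun s hs => hL (r, s) hp (Or.inr hs)
  exact ((hd r z hp).congr_of_eventuallyEq h0.symm).unique (hasDerivAt_const z 0)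

theorem BH.dr {G Gr : ℝ × ℝ → ℝ} (hG : BH G)
    (hd : ∀ r z, 0 < r → HasDerivAt (fun s => G (s, z)) (Gr (r, z)) r) : BH Gr := by
  obtain ⟨L, hL⟩ := hG
  refine ⟨L, fun ⟨r, z⟩ hp h => ?_⟩
  have h0 : (fun s => G (s, z)) =ᶠ[𝓝 r] fun _ => 0 := by
    have hp' : ∀ᶠ s in 𝓝 r, 0 < s := lt_mem_nhds hp
    rcases h with h | h
    · have : ∀ᶠ s in 𝓝 r, L < s := lt_mem_nhds h
      filter_upwards [hp', this] with s h1 h2 using hL (s, z) h1 (Or.inl h2)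
    · filter_upwards [hp'] with s h1 using hL (s, z) h1 (Or.inr h)
  exact ((hd r z hp).congr_of_eventuallyEq h0.symm).unique (hasDerivAt_const r 0)

theorem integral_dz_eq_zero {G Gz : ℝ × ℝ → ℝ} (hc : Continuous Gz)
    (hd : ∀ r z, 0 < r → HasDerivAt (fun s => G (r, s)) (Gz (r, z)) z) (hG : BH G) :
    ∫ p in H, Gz p = 0 := by
  have hi := (hG.dz hd).integrableOn hc
  obtain ⟨L, hL⟩ := hG
  rw [H_eq, Measure.volume_eq_prod, setIntegral_prod _ (by rwa [← Measure.volume_eq_prod, ← H_eq])]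
  refine setIntegral_eq_zero_of_forall_eq_zero fun r hr => ?_
  rw [Measure.restrict_univ]
  have hr : 0 < r := hr
  have hsl : HasCompactSupport (fun s => G (r, s)) := by
    refine HasCompactSupport.intro (isCompact_Icc (a := -L) (b := L)) fun z hz => hL (r, z) hr (Or.inr ?_)
    by_contra hcon
    exact hz (abs_le.1 (not_lt.1 hcon))
  have hsl' : HasCompactSupport (fun s => Gz (r, s)) := by
    have : (fun s => Gz (r, s)) = deriv (fun s => G (r, s)) := by
      funext z; exact (hd r z hr).deriv.symm
    rw [this]; exact hsl.deriv
  exact integral_eq_zero_of_hasDerivAt_of_integrable (fun z => hd r z hr)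
    ((by fun_prop : Continuous fun s => Gz (r, s)).integrable_of_hasCompactSupport hsl')
    ((Differentiable.continuous fun z => (hd r z hr).differentiableAt).integrable_of_hasCompactSupport hsl)

theorem integral_dr {G Gr : ℝ × ℝ → ℝ} (hcG : Continuous G) (hc : Continuous Gr)
    (hd : ∀ r z, 0 < r → HasDerivAt (fun s => G (s, z)) (Gr (r, z)) r) (hG : BH G) :
    ∫ p in H, Gr p = - ∫ z, G (0, z) := by
  have hi := (hG.dr hd).integrableOn hc
  have hG' := hG.dr hd
  obtain ⟨L, hL⟩ := hG
  obtain ⟨L', hL'⟩ := hG'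
  have hi' : IntegrableOn Gr (Ioi (0:ℝ) ×ˢ (univ : Set ℝ)) (volume.prod volume) := by
    rwa [← Measure.volume_eq_prod, ← H_eq]
  rw [H_eq, Measure.volume_eq_prod, ← Measure.prod_restrict, integral_prod_symm _
    (by rwa [Measure.prod_restrict]), Measure.restrict_univ, ← integral_neg]
  congr 1
  funext z
  have hint : IntegrableOn (fun r => Gr (r, z)) (Ioi 0) := by
    have h1 : IntegrableOn (fun r => Gr (r, z)) (Ioi 0 ∩ Icc 0 L') :=
      ((by fun_prop : Continuous fun r => Gr (r, z)).continuousOn.integrableOn_compact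
        isCompact_Icc).mono_set inter_subset_right
    refine h1.of_forall_sdiff_eq_zero measurableSet_Ioi fun r hr => ?_
    refine hL' (r, z) hr.1 (Or.inl ?_)
    by_contra hcon
    exact hr.2 ⟨hr.1, le_of_lt hr.1, not_lt.1 hcon⟩
  have htend : Tendsto (fun r => G (r, z)) atTop (𝓝 0) := by
    refine tendsto_const_nhds.congr' ?_
    filter_upwards [eventually_gt_atTop (max L 0)] with r hr
    exact (hL (r, z) (lt_of_le_of_lt (le_max_right _ _) hr)
      (Or.inl (lt_of_le_of_lt (le_max_left _ _) hr))).symm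
  have := integral_Ioi_of_hasDerivAt_of_tendsto (a := 0) (f := fun r => G (r, z))
    (by fun_prop : Continuous fun r => G (r, z)).continuousWithinAt (fun r hr => hd r z hr) hint htend
  simpa using this

theorem integral_dr_eq_zero {G Gr : ℝ × ℝ → ℝ} (hcG : Continuous G) (hc : Continuous Gr)
    (hd : ∀ r z, 0 < r → HasDerivAt (fun s => G (s, z)) (Gr (r, z)) r) (hG : BH G)
    (h0 : ∀ z, G (0, z) = 0) : ∫ p in H, Gr p = 0 := by
  rw [integral_dr hcG hc hd hG]; simp [h0]

theorem integral_dr_nonpos {G Gr : ℝ × ℝ → ℝ} (hcG : Continuous G) (hc : Continuous Gr)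
    (hd : ∀ r z, 0 < r → HasDerivAt (fun s => G (s, z)) (Gr (r, z)) r) (hG : BH G)
    (h0 : ∀ z, 0 ≤ G (0, z)) : ∫ p in H, Gr p ≤ 0 := by
  rw [integral_dr hcG hc hd hG]
  have := integral_nonneg (μ := volume) (f := fun z => G (0, z)) h0
  linarith

/-- Passing to the limit in integrals with cutoffs. -/
theorem integrableOn_of_cutoff {Q : ℝ × ℝ → ℝ} {X : ℕ → ℝ × ℝ → ℝ} {A : ℝ} {ε : ℕ → ℝ}
    (hm : AEStronglyMeasurable Q (volume.restrict H)) (hQ : ∀ p ∈ H, 0 ≤ Q p)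
    (hX0 : ∀ n, ∀ p ∈ H, 0 ≤ X n p)
    (hX : ∀ p ∈ H, Tendsto (fun n => X n p) atTop (𝓝 1))
    (hi : ∀ᶠ n in atTop, IntegrableOn (fun p => X n p * Q p) H)
    (hb : ∀ᶠ n in atTop, ∫ p in H, X n p * Q p ≤ A + ε n) (hε : Tendsto ε atTop (𝓝 0)) :
    IntegrableOn Q H ∧ ∫ p in H, Q p ≤ A := by
  have hA : 0 ≤ A := by
    have h1 : Tendsto (fun n => A + ε n) atTop (𝓝 A) := by simpa using hε.const_add A
    refine ge_of_tendsto h1 ?_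
    filter_upwards [hb] with n hn
    refine le_trans ?_ hn
    exact setIntegral_nonneg measurableSet_H fun p hp => mul_nonneg (hX0 n p hp) (hQ p hp)
  obtain ⟨N, hN⟩ := eventually_atTop.1 (hi.and hb)
  have key : ∫⁻ p in H, ENNReal.ofReal (Q p) ≤ ENNReal.ofReal A := by
    calc ∫⁻ p in H, ENNReal.ofReal (Q p)
        = ∫⁻ p in H, liminf (fun n => ENNReal.ofReal (X (n + N) p * Q p)) atTop := by
          refine setLIntegral_congr_fun measurableSet_H fun p hp => ?_
          have h1 : Tendsto (fun n => ENNReal.ofReal (X (n + N) p * Q p)) atTop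
              (𝓝 (ENNReal.ofReal (1 * Q p))) := by
            refine (ENNReal.continuous_ofReal.tendsto _).comp ?_
            exact (((hX p hp).comp (tendsto_add_atTop_nat N))).mul_const _
          rw [h1.liminf_eq, one_mul]
      _ ≤ liminf (fun n => ∫⁻ p in H, ENNReal.ofReal (X (n + N) p * Q p)) atTop :=
          lintegral_liminf_le' fun n =>
            ((hN (n + N) (Nat.le_add_left _ _)).1.aestronglyMeasurable.aemeasurable).ennreal_ofReal
      _ ≤ liminf (fun n => ENNReal.ofReal (A + ε (n + N))) atTop := by
          refine liminf_le_liminf (Eventually.of_forall fun n => ?_)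
          rw [← ofReal_integral_eq_lintegral_ofReal (hN (n + N) (Nat.le_add_left _ _)).1]
          · exact ENNReal.ofReal_le_ofReal (hN (n + N) (Nat.le_add_left _ _)).2
          · exact (ae_restrict_iff' measurableSet_H).2 (Eventually.of_forall fun p hp =>
              mul_nonneg (hX0 _ p hp) (hQ p hp))
      _ = ENNReal.ofReal A := by
          have h1 : Tendsto (fun n => ENNReal.ofReal (A + ε (n + N))) atTop
              (𝓝 (ENNReal.ofReal (A + 0))) :=
            (ENNReal.continuous_ofReal.tendsto _).comp
              ((hε.comp (tendsto_add_atTop_nat N)).const_add A)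
          rw [h1.liminf_eq, add_zero]
  have hnn : 0 ≤ᵐ[volume.restrict H] Q :=
    (ae_restrict_iff' measurableSet_H).2 (Eventually.of_forall hQ)
  have hint : IntegrableOn Q H := by
    refine ⟨hm, ?_⟩
    rw [hasFiniteIntegral_iff_ofReal hnn]
    exact key.trans_lt ENNReal.ofReal_lt_top
  refine ⟨hint, ?_⟩
  rw [← ofReal_integral_eq_lintegral_ofReal hint hnn] at key
  exact (ENNReal.ofReal_le_ofReal_iff hA).1 key

end IntegrationByParts

section HasIntegral

/-- `f` is integrable on the half-plane, with integral `I`. -/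
structure HI (f : ℝ × ℝ → ℝ) (I : ℝ) : Prop where
  int : IntegrableOn f H
  val : ∫ p in H, f p = I

variable {f g : ℝ × ℝ → ℝ} {I J : ℝ}

theorem HI.of (h : IntegrableOn f H) : HI f (∫ p in H, f p) := ⟨h, rfl⟩
theorem HI.add (hf : HI f I) (hg : HI g J) : HI (fun p => f p + g p) (I + J) :=
  ⟨hf.int.add hg.int, by rw [← hf.val, ← hg.val]; exact integral_add hf.int hg.int⟩
theorem HI.sub (hf : HI f I) (hg : HI g J) : HI (fun p => f p - g p) (I - J) :=
  ⟨hf.int.sub hg.int, by rw [← hf.val, ← hg.val]; exact integral_sub hf.int hg.int⟩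
theorem HI.const_mul (c : ℝ) (hf : HI f I) : HI (fun p => c * f p) (c * I) :=
  ⟨hf.int.const_mul c, by rw [← hf.val]; exact integral_const_mul c _⟩
theorem HI.congr (hf : HI f I) (h : ∀ p ∈ H, f p = g p) : HI g I :=
  ⟨(integrableOn_congr_fun h measurableSet_H).1 hf.int, by
    rw [← hf.val]; exact (setIntegral_congr_fun measurableSet_H h).symm⟩
theorem HI.le (hf : HI f I) (hg : HI g J) (h : ∀ p ∈ H, f p ≤ g p) : I ≤ J := by
  rw [← hf.val, ← hg.val]; exact setIntegral_mono_on hf.int hg.int measurableSet_H h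
theorem HI.eq (hf : HI f I) (hg : HI g J) (h : ∀ p ∈ H, f p = g p) : I = J := by
  rw [← (hf.congr h).val, ← hg.val]
theorem HI.nonneg (hf : HI f I) (h : ∀ p ∈ H, 0 ≤ f p) : 0 ≤ I := by
  rw [← hf.val]; exact setIntegral_nonneg measurableSet_H h

theorem HI.dr_zero {G Gr : ℝ × ℝ → ℝ} (hcG : Continuous G) (hc : Continuous Gr)
    (hd : ∀ r z, 0 < r → HasDerivAt (fun s => G (s, z)) (Gr (r, z)) r) (hG : BH G)
    (h0 : ∀ z, G (0, z) = 0) : HI Gr 0 :=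
  ⟨(hG.dr hd).integrableOn hc, integral_dr_eq_zero hcG hc hd hG h0⟩
theorem HI.dz_zero {G Gz : ℝ × ℝ → ℝ} (hc : Continuous Gz)
    (hd : ∀ r z, 0 < r → HasDerivAt (fun s => G (r, s)) (Gz (r, z)) z) (hG : BH G) : HI Gz 0 :=
  ⟨(hG.dz hd).integrableOn hc, integral_dz_eq_zero hc hd hG⟩

end HasIntegral

section Cutoff

/-- A smooth nonincreasing function equal to `1` on `(-∞, 1]` and to `0` on `[2, ∞)`. -/
noncomputable def cut (s : ℝ) : ℝ := Real.smoothTransition (2 - s)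

theorem contDiff_cut : ContDiff ℝ ∞ cut :=
  Real.smoothTransition.contDiff.comp (by fun_prop)

theorem cut_nonneg (s : ℝ) : 0 ≤ cut s := Real.smoothTransition.nonneg _
theorem cut_le_one (s : ℝ) : cut s ≤ 1 := Real.smoothTransition.le_one _
theorem cut_eq_one {s : ℝ} (h : s ≤ 1) : cut s = 1 := Real.smoothTransition.one_of_one_le (by linarith)
theorem cut_eq_zero {s : ℝ} (h : 2 ≤ s) : cut s = 0 := Real.smoothTransition.zero_of_nonpos (by linarith)
theorem cut_antitone : Antitone cut := fun _ _ h => Real.smoothTransition.monotone (by linarith)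

theorem hasDerivAt_cut (s : ℝ) : HasDerivAt cut (deriv cut s) s :=
  (contDiff_cut.differentiable (by simp) s).hasDerivAt

theorem contDiff_deriv_cut : ContDiff ℝ ∞ (deriv cut) :=
  (contDiff_infty_iff_deriv.1 contDiff_cut).2

theorem hasDerivAt_deriv_cut (s : ℝ) : HasDerivAt (deriv cut) (deriv (deriv cut) s) s :=
  (contDiff_deriv_cut.differentiable (by simp) s).hasDerivAt

theorem continuous_deriv_cut : Continuous (deriv cut) := contDiff_deriv_cut.continuous
theorem continuous_deriv_deriv_cut : Continuous (deriv (deriv cut)) :=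
  (contDiff_infty_iff_deriv.1 contDiff_deriv_cut).2.continuous

theorem deriv_cut_nonpos (s : ℝ) : deriv cut s ≤ 0 := cut_antitone.deriv_nonpos

theorem deriv_cut_of_lt {s : ℝ} (h : s < 1) : deriv cut s = 0 := by
  have : cut =ᶠ[𝓝 s] fun _ => 1 := (gt_mem_nhds h).mono fun x hx => cut_eq_one (le_of_lt hx)
  rw [this.deriv_eq]; simp

theorem deriv_cut_of_gt {s : ℝ} (h : 2 < s) : deriv cut s = 0 := by
  have : cut =ᶠ[𝓝 s] fun _ => 0 := (lt_mem_nhds h).mono fun x hx => cut_eq_zero (le_of_lt hx)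
  rw [this.deriv_eq]; simp

theorem deriv_deriv_cut_of_lt {s : ℝ} (h : s < 1) : deriv (deriv cut) s = 0 := by
  have : deriv cut =ᶠ[𝓝 s] fun _ => 0 := (gt_mem_nhds h).mono fun x hx => deriv_cut_of_lt hx
  rw [this.deriv_eq]; simp

theorem deriv_deriv_cut_of_gt {s : ℝ} (h : 2 < s) : deriv (deriv cut) s = 0 := by
  have : deriv cut =ᶠ[𝓝 s] fun _ => 0 := (lt_mem_nhds h).mono fun x hx => deriv_cut_of_gt hx
  rw [this.deriv_eq]; simp

theorem exists_cut_bound : ∃ K : ℝ, 1 ≤ K ∧ ∀ s, |deriv cut s| ≤ K ∧ |deriv (deriv cut) s| ≤ K := by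
  obtain ⟨K1, h1⟩ := (isCompact_Icc (a := (1:ℝ)) (b := 2)).exists_bound_of_continuousOn
    continuous_deriv_cut.continuousOn
  obtain ⟨K2, h2⟩ := (isCompact_Icc (a := (1:ℝ)) (b := 2)).exists_bound_of_continuousOn
    continuous_deriv_deriv_cut.continuousOn
  refine ⟨max 1 (max K1 K2), le_max_left _ _, fun s => ?_⟩
  by_cases hs : s ∈ Icc (1:ℝ) 2
  · exact ⟨(h1 s hs).trans ((le_max_left _ _).trans (le_max_right _ _)),
      (h2 s hs).trans ((le_max_right _ _).trans (le_max_right _ _))⟩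
  · have h0 : (0:ℝ) ≤ max 1 (max K1 K2) := zero_le_one.trans (le_max_left _ _)
    rw [mem_Icc, not_and_or, not_le, not_le] at hs
    rcases hs with hs | hs
    · simp [deriv_cut_of_lt hs, deriv_deriv_cut_of_lt hs, h0]
    · simp [deriv_cut_of_gt hs, deriv_deriv_cut_of_gt hs, h0]

/-- A bound for the first two derivatives of `cut`. -/
noncomputable def cutK : ℝ := exists_cut_bound.choose
theorem one_le_cutK : 1 ≤ cutK := exists_cut_bound.choose_spec.1
theorem abs_deriv_cut_le (s : ℝ) : |deriv cut s| ≤ cutK := (exists_cut_bound.choose_spec.2 s).1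
theorem abs_deriv_deriv_cut_le (s : ℝ) : |deriv (deriv cut) s| ≤ cutK :=
  (exists_cut_bound.choose_spec.2 s).2

/-- The cutoff at scale `R` in one variable. -/
noncomputable def cutS (R s : ℝ) : ℝ := cut (s ^ 2 / R ^ 2)

theorem contDiff_cutS (R : ℝ) : ContDiff ℝ ∞ (cutS R) := contDiff_cut.comp (by fun_prop)
theorem cutS_nonneg (R s : ℝ) : 0 ≤ cutS R s := cut_nonneg _
theorem cutS_le_one (R s : ℝ) : cutS R s ≤ 1 := cut_le_one _

theorem hasDerivAt_cutS (R s : ℝ) : HasDerivAt (cutS R) (deriv (cutS R) s) s :=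
  ((contDiff_cutS R).differentiable (by simp) s).hasDerivAt

theorem hasDerivAt_deriv_cutS (R s : ℝ) : HasDerivAt (deriv (cutS R)) (deriv (deriv (cutS R)) s) s :=
  (((contDiff_infty_iff_deriv.1 (contDiff_cutS R)).2).differentiable (by simp) s).hasDerivAt

theorem continuous_cutS (R : ℝ) : Continuous (cutS R) := (contDiff_cutS R).continuous
theorem continuous_deriv_cutS (R : ℝ) : Continuous (deriv (cutS R)) :=
  (contDiff_infty_iff_deriv.1 (contDiff_cutS R)).2.continuous

theorem deriv_cutS (R s : ℝ) : deriv (cutS R) s = deriv cut (s ^ 2 / R ^ 2) * (2 * s / R ^ 2) := by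
  have h : HasDerivAt (fun s : ℝ => s ^ 2 / R ^ 2) (2 * s / R ^ 2) s := by
    simpa using (hasDerivAt_pow 2 s).div_const (R ^ 2)
  exact (HasDerivAt.comp (h₂ := cut) s (hasDerivAt_cut _) h).deriv

theorem deriv_deriv_cutS (R s : ℝ) : deriv (deriv (cutS R)) s =
    deriv (deriv cut) (s ^ 2 / R ^ 2) * (2 * s / R ^ 2) ^ 2 + deriv cut (s ^ 2 / R ^ 2) * (2 / R ^ 2) := by
  have h : HasDerivAt (fun s : ℝ => s ^ 2 / R ^ 2) (2 * s / R ^ 2) s := by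
    simpa using (hasDerivAt_pow 2 s).div_const (R ^ 2)
  have h2 : HasDerivAt (fun s : ℝ => 2 * s / R ^ 2) (2 / R ^ 2) s := by
    simpa using ((hasDerivAt_id s).const_mul 2).div_const (R ^ 2)
  have e : deriv (cutS R) = fun s => deriv cut (s ^ 2 / R ^ 2) * (2 * s / R ^ 2) := by
    funext s; exact deriv_cutS R s
  rw [e]
  have h3 := (HasDerivAt.comp (h₂ := deriv cut) s (hasDerivAt_deriv_cut _) h).mul h2
  refine h3.deriv.trans ?_
  simp only [Function.comp]
  ring

theorem cutS_eq_zero {R s : ℝ} (hR : 0 < R) (h : 2 * R ≤ |s|) : cutS R s = 0 := by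
  refine cut_eq_zero ?_
  rw [le_div_iff₀ (by positivity), ← sq_abs s]
  nlinarith

theorem cutS_eq_one {R s : ℝ} (hR : 0 < R) (h : |s| ≤ R) : cutS R s = 1 := by
  refine cut_eq_one ?_
  rw [div_le_iff₀ (by positivity), ← sq_abs s]
  nlinarith [abs_nonneg s]

theorem deriv_cutS_eq_zero {R s : ℝ} (hR : 0 < R) (h : 2 * R ≤ |s| ∨ |s| < R) :
    deriv (cutS R) s = 0 ∧ deriv (deriv (cutS R)) s = 0 := by
  rw [deriv_cutS, deriv_deriv_cutS]
  rcases h with h | h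
  · have : 2 < s ^ 2 / R ^ 2 := by
      rw [lt_div_iff₀ (by positivity), ← sq_abs s]; nlinarith
    simp [deriv_cut_of_gt this, deriv_deriv_cut_of_gt this]
  · have : s ^ 2 / R ^ 2 < 1 := by
      rw [div_lt_iff₀ (by positivity), ← sq_abs s]; nlinarith [abs_nonneg s]
    simp [deriv_cut_of_lt this, deriv_deriv_cut_of_lt this]

theorem abs_deriv_cutS_le {R : ℝ} (hR : 0 < R) (s : ℝ) :
    |deriv (cutS R) s| ≤ 4 * cutK / R ∧ |deriv (cutS R) s| ≤ 2 * cutK * |s| / R ^ 2 ∧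
    |deriv (deriv (cutS R)) s| ≤ 18 * cutK / R ^ 2 := by
  have hK := one_le_cutK
  have h2 : |deriv (cutS R) s| ≤ 2 * cutK * |s| / R ^ 2 := by
    rw [deriv_cutS, abs_mul, abs_div, abs_mul, abs_of_pos (by positivity : 0 < R ^ 2), abs_two]
    calc |deriv cut (s ^ 2 / R ^ 2)| * (2 * |s| / R ^ 2) ≤ cutK * (2 * |s| / R ^ 2) := by
          gcongr; exact abs_deriv_cut_le _
      _ = _ := by ring
  by_cases hs : 2 * R ≤ |s|
  · have := deriv_cutS_eq_zero hR (Or.inl hs)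
    refine ⟨?_, h2, ?_⟩
    · rw [this.1, abs_zero]; positivity
    · rw [this.2, abs_zero]; positivity
  · push Not at hs
    refine ⟨h2.trans ?_, h2, ?_⟩
    · rw [div_le_div_iff₀ (by positivity) hR]
      have : |s| * R ≤ 2 * R * R := by gcongr
      nlinarith
    · rw [deriv_deriv_cutS]
      have a1 : |deriv (deriv cut) (s ^ 2 / R ^ 2) * (2 * s / R ^ 2) ^ 2| ≤ cutK * (16 / R ^ 2) := by
        rw [abs_mul]
        have : |(2 * s / R ^ 2) ^ 2| ≤ 16 / R ^ 2 := by
          rw [abs_of_nonneg (sq_nonneg _), div_pow, mul_pow, ← sq_abs s, div_le_div_iff₀ (by positivity)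
            (by positivity)]
          have : |s| ^ 2 ≤ (2 * R) ^ 2 := by gcongr
          have hR2 : (0:ℝ) ≤ R ^ 2 := by positivity
          nlinarith [mul_le_mul_of_nonneg_right this hR2]
        have := abs_deriv_deriv_cut_le (s ^ 2 / R ^ 2)
        gcongr
      have a2 : |deriv cut (s ^ 2 / R ^ 2) * (2 / R ^ 2)| ≤ cutK * (2 / R ^ 2) := by
        rw [abs_mul, abs_of_pos (by positivity : 0 < 2 / R ^ 2)]
        have := abs_deriv_cut_le (s ^ 2 / R ^ 2)
        gcongr
      calc _ ≤ _ := abs_add_le _ _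
        _ ≤ cutK * (16 / R ^ 2) + cutK * (2 / R ^ 2) := add_le_add a1 a2
        _ = _ := by ring

theorem tendsto_cutS (s : ℝ) : Tendsto (fun n : ℕ => cutS (n : ℝ) s) atTop (𝓝 1) := by
  refine tendsto_const_nhds.congr' ?_
  filter_upwards [eventually_gt_atTop (Nat.ceil |s|)] with n hn
  have h1 : |s| ≤ n := (Nat.le_ceil _).trans (by exact_mod_cast hn.le)
  have h2 : (0:ℝ) < n := by exact_mod_cast lt_of_le_of_lt (Nat.zero_le _) hn
  exact (cutS_eq_one h2 h1).symm

/-- The cutoff at scale `R` in the half-plane. -/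
noncomputable def chi (R : ℝ) (p : ℝ × ℝ) : ℝ := cutS R p.1 * cutS R p.2

theorem chi_nonneg (R : ℝ) (p : ℝ × ℝ) : 0 ≤ chi R p := mul_nonneg (cutS_nonneg _ _) (cutS_nonneg _ _)
theorem chi_le_one (R : ℝ) (p : ℝ × ℝ) : chi R p ≤ 1 :=
  mul_le_one₀ (cutS_le_one _ _) (cutS_nonneg _ _) (cutS_le_one _ _)

theorem BH_chi {R : ℝ} (hR : 0 < R) : BH (chi R) := by
  refine ⟨2 * R, fun p hp h => ?_⟩
  rcases h with h | h
  · simp [chi, cutS_eq_zero hR (h.le.trans (le_abs_self p.1))]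
  · simp [chi, cutS_eq_zero hR h.le]

theorem tendsto_chi (p : ℝ × ℝ) : Tendsto (fun n : ℕ => chi n p) atTop (𝓝 1) := by
  simpa [chi] using (tendsto_cutS p.1).mul (tendsto_cutS p.2)

end Cutoff


section Elliptic

theorem elliptic_error_bound {s x K R a c G u w h : ℝ} (hs : 0 < s) (hx0 : 0 ≤ x) (hx1 : x ≤ 1)
    (hK : 1 ≤ K) (hR : 0 < R) (ha : a ^ 2 ≤ 16 * K ^ 2 / R ^ 2) (hc : c ^ 2 ≤ 16 * K ^ 2 / R ^ 2)
    (ha' : -a ≤ 2 * K * s / R ^ 2) :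
    -(2 * x * a * G * s * u) - 2 * x * a * G ^ 2 - 2 * x * c * G * s * w + 2 * x * c * G * s * h
      + x ^ 2 * w * s * h ≤ 1 / 2 * (x ^ 2 * (s * u ^ 2) + x ^ 2 * (s * w ^ 2)) + 2 * (s * h ^ 2)
      + 300 * K ^ 2 / R ^ 2 * (s * G ^ 2) := by
  have hx2 : x ^ 2 * h ^ 2 ≤ h ^ 2 := mul_le_of_le_one_left (sq_nonneg _) (by nlinarith)
  have t1 : -(2 * x * a * G * u) ≤ 1 / 2 * x ^ 2 * u ^ 2 + 2 * a ^ 2 * G ^ 2 := by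
    nlinarith [sq_nonneg (x * u + 2 * (a * G))]
  have t3 : -(2 * x * c * G * w) ≤ 1 / 4 * x ^ 2 * w ^ 2 + 4 * c ^ 2 * G ^ 2 := by
    nlinarith [sq_nonneg (x * w + 4 * (c * G))]
  have t4 : 2 * x * c * G * h ≤ h ^ 2 + c ^ 2 * G ^ 2 := by
    nlinarith [sq_nonneg (x * h - c * G)]
  have t5 : x ^ 2 * w * h ≤ 1 / 4 * x ^ 2 * w ^ 2 + h ^ 2 := by
    nlinarith [sq_nonneg (x * w - 2 * (x * h))]
  have t2 : -(2 * x * a) ≤ s * (4 * K ^ 2 / R ^ 2) := by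
    have h1 : x * (-a) ≤ 1 * (2 * K * s / R ^ 2) :=
      (mul_le_mul_of_nonneg_left ha' hx0).trans (mul_le_mul_of_nonneg_right hx1 (by positivity))
    have h2 : 2 * (2 * K * s / R ^ 2) ≤ s * (4 * K ^ 2 / R ^ 2) := by
      have : 2 * (2 * K * s / R ^ 2) = s * (4 * K / R ^ 2) := by ring
      rw [this]; gcongr; nlinarith
    linarith
  have t2' := mul_le_mul_of_nonneg_right t2 (sq_nonneg G)
  have a1 := mul_le_mul_of_nonneg_right ha (sq_nonneg G)
  have a2 := mul_le_mul_of_nonneg_right hc (sq_nonneg G)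
  set T := K ^ 2 / R ^ 2 with hT
  have hT0 : 0 ≤ T * G ^ 2 := by positivity
  have e1 : 16 * K ^ 2 / R ^ 2 = 16 * T := by simp only [hT]; ring
  have e2 : 4 * K ^ 2 / R ^ 2 = 4 * T := by simp only [hT]; ring
  have e3 : 300 * K ^ 2 / R ^ 2 = 300 * T := by simp only [hT]; ring
  rw [e1] at a1 a2
  rw [e2] at t2'
  rw [e3]
  have sum : -(2 * x * a * G * u) - 2 * x * c * G * w + 2 * x * c * G * h + x ^ 2 * w * h ≤
      1 / 2 * (x ^ 2 * u ^ 2 + x ^ 2 * w ^ 2) + 2 * h ^ 2 + 112 * (T * G ^ 2) := by linarith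
  have sum' := mul_le_mul_of_nonneg_left sum hs.le
  have hT1 : 0 ≤ s * (T * G ^ 2) := by positivity
  nlinarith

/-- The weighted energy estimate for `∂ᵣ²g + (3/r)∂ᵣg - (c/r²)g + ∂_z²g = ∂_z h` in the half-plane. -/
theorem elliptic_estimate {g h : ℝ × ℝ → ℝ} (hg : Sl g) (hh : Sl h) {c : ℝ} (hc : 0 ≤ c)
    (heq : ∀ p, 0 < p.1 → p.1 * dr (dr g) p + 3 * dr g p - c * g p / p.1 + p.1 * dz (dz g) p
      = p.1 * dz h p)
    (hg2 : IntegrableOn (fun p => p.1 * g p ^ 2) H) (hh2 : IntegrableOn (fun p => p.1 * h p ^ 2) H) :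
    IntegrableOn (fun p => p.1 * dr g p ^ 2 + p.1 * dz g p ^ 2 + c * (g p ^ 2 / p.1)) H ∧
    ∫ p in H, (p.1 * dr g p ^ 2 + p.1 * dz g p ^ 2 + c * (g p ^ 2 / p.1)) ≤
      4 * ∫ p in H, p.1 * h p ^ 2 := by
  set Q : ℝ × ℝ → ℝ := fun p => p.1 * dr g p ^ 2 + p.1 * dz g p ^ 2 + c * (g p ^ 2 / p.1) with hQ
  have cg := hg.continuous
  have cgr := hg.dr.continuous
  have cgz := hg.dz.continuous
  have cgrr := hg.dr.dr.continuous
  have cgzz := hg.dz.dz.continuous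
  have ch := hh.continuous
  have chz := hh.dz.continuous
  set B := ∫ p in H, p.1 * g p ^ 2 with hB
  set K := cutK
  have hK : 1 ≤ K := one_le_cutK
  have key : ∀ R : ℝ, 1 ≤ R → IntegrableOn (fun p => chi R p ^ 2 * Q p) H ∧
      ∫ p in H, chi R p ^ 2 * Q p ≤ 4 * (∫ p in H, p.1 * h p ^ 2) + 600 * K ^ 2 * B / R ^ 2 := by
    intro R hR
    have hR0 : 0 < R := by linarith
    have c1 := continuous_cutS R
    have c2 := continuous_deriv_cutS R
    -- the cutoff and its derivatives
    set X : ℝ × ℝ → ℝ := fun p => chi R p ^ 2 with hX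
    set xr : ℝ × ℝ → ℝ := fun p => deriv (cutS R) p.1 * cutS R p.2 with hxr
    set xz : ℝ × ℝ → ℝ := fun p => cutS R p.1 * deriv (cutS R) p.2 with hxz
    set Xr : ℝ × ℝ → ℝ := fun p => 2 * chi R p * xr p with hXr
    set Xz : ℝ × ℝ → ℝ := fun p => 2 * chi R p * xz p with hXz
    have cchi : Continuous (chi R) := by unfold chi; fun_prop
    have cX : Continuous X := by fun_prop
    have cXr : Continuous Xr := by fun_prop
    have cXz : Continuous Xz := by fun_prop
    have dX_r : ∀ r z, HasDerivAt (fun s => X (s, z)) (Xr (r, z)) r := by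
      intro r z
      refine (((hasDerivAt_cutS R r).mul_const (cutS R z)).pow 2).congr_deriv ?_
      simp [hXr, hxr, chi]
    have dX_z : ∀ r z, HasDerivAt (fun s => X (r, s)) (Xz (r, z)) z := by
      intro r z
      refine (((hasDerivAt_cutS R z).const_mul (cutS R r)).pow 2).congr_deriv ?_
      simp [hXz, hxz, chi]
    have bX : BH X := by
      refine (BH_chi hR0).mono fun p _ h0 => ?_
      simp [hX, h0]
    -- total derivatives
    set D1 : ℝ × ℝ → ℝ := fun p => Xr p * g p * p.1 * dr g p + X p * dr g p * p.1 * dr g p +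
      X p * g p * dr g p + X p * g p * p.1 * dr (dr g) p with hD1
    set D2 : ℝ × ℝ → ℝ := fun p => Xr p * g p ^ 2 + X p * (2 * g p * dr g p) with hD2
    set D3 : ℝ × ℝ → ℝ := fun p => Xz p * g p * p.1 * dz g p + X p * dz g p * p.1 * dz g p +
      X p * g p * p.1 * dz (dz g) p with hD3
    set D4 : ℝ × ℝ → ℝ := fun p => Xz p * g p * p.1 * h p + X p * dz g p * p.1 * h p +
      X p * g p * p.1 * dz h p with hD4
    have d1 : ∀ r z, HasDerivAt (fun s => X (s, z) * g (s, z) * s * dr g (s, z)) (D1 (r, z)) r := by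
      intro r z
      refine ((((dX_r r z).mul (hg.hasDerivAt_r r z)).mul (hasDerivAt_id r)).mul
        (hg.dr.hasDerivAt_r r z)).congr_deriv ?_
      simp only [hD1, id, Pi.mul_apply]; ring
    have d2 : ∀ r z, HasDerivAt (fun s => X (s, z) * g (s, z) ^ 2) (D2 (r, z)) r := by
      intro r z
      refine ((dX_r r z).mul ((hg.hasDerivAt_r r z).pow 2)).congr_deriv ?_
      simp only [hD2, Pi.pow_apply]; ring
    have d3 : ∀ r z, HasDerivAt (fun s => X (r, s) * g (r, s) * r * dz g (r, s)) (D3 (r, z)) z := by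
      intro r z
      refine ((((dX_z r z).mul (hg.hasDerivAt_z r z)).mul_const r).mul
        (hg.dz.hasDerivAt_z r z)).congr_deriv ?_
      simp only [hD3, Pi.mul_apply]; ring
    have d4 : ∀ r z, HasDerivAt (fun s => X (r, s) * g (r, s) * r * h (r, s)) (D4 (r, z)) z := by
      intro r z
      refine ((((dX_z r z).mul (hg.hasDerivAt_z r z)).mul_const r).mul
        (hh.hasDerivAt_z r z)).congr_deriv ?_
      simp only [hD4, Pi.mul_apply]; ring
    have b1 : BH (fun p => X p * g p * p.1 * dr g p) := bX.mul_right.mul_right.mul_right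
    have b2 : BH (fun p => X p * g p ^ 2) := bX.mul_right
    have b3 : BH (fun p => X p * g p * p.1 * dz g p) := bX.mul_right.mul_right.mul_right
    have b4 : BH (fun p => X p * g p * p.1 * h p) := bX.mul_right.mul_right.mul_right
    have i1 : ∫ p in H, D1 p = 0 :=
      integral_dr_eq_zero (G := fun p => X p * g p * p.1 * dr g p) (by fun_prop) (by fun_prop)
        (fun r z _ => d1 r z) b1 (by simp)
    have i2 : ∫ p in H, D2 p ≤ 0 :=
      integral_dr_nonpos (G := fun p => X p * g p ^ 2) (by fun_prop) (by fun_prop)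
        (fun r z _ => d2 r z) b2 (fun z => by positivity)
    have i3 : ∫ p in H, D3 p = 0 :=
      integral_dz_eq_zero (G := fun p => X p * g p * p.1 * dz g p) (by fun_prop)
        (fun r z _ => d3 r z) b3
    have i4 : ∫ p in H, D4 p = 0 :=
      integral_dz_eq_zero (G := fun p => X p * g p * p.1 * h p) (by fun_prop)
        (fun r z _ => d4 r z) b4
    have I1 : IntegrableOn D1 H := (b1.dr (Gr := D1) fun r z _ => d1 r z).integrableOn (by fun_prop)
    have I2 : IntegrableOn D2 H := (b2.dr (Gr := D2) fun r z _ => d2 r z).integrableOn (by fun_prop)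
    have I3 : IntegrableOn D3 H := (b3.dz (Gz := D3) fun r z _ => d3 r z).integrableOn (by fun_prop)
    have I4 : IntegrableOn D4 H := (b4.dz (Gz := D4) fun r z _ => d4 r z).integrableOn (by fun_prop)
    set E : ℝ × ℝ → ℝ := fun p => - (Xr p * g p * p.1 * dr g p) - Xr p * g p ^ 2 -
      Xz p * g p * p.1 * dz g p + Xz p * g p * p.1 * h p + X p * dz g p * p.1 * h p with hE
    have IE : IntegrableOn E H := by
      refine BH.integrableOn ?_ (by fun_prop)
      refine bX.mono fun p _ h0 => ?_
      have h1 : chi R p = 0 := by simpa [hX] using h0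
      simp [hE, hXr, hXz, h0, h1]
    have idn : ∀ p ∈ H, X p * Q p = D1 p + D2 p + D3 p - D4 p + E p := by
      intro p hp
      have hp' : p.1 ≠ 0 := ne_of_gt hp
      have e := heq p hp
      simp only [hD1, hD2, hD3, hD4, hE, hQ]
      have e2 : X p * g p * (p.1 * dr (dr g) p + 3 * dr g p - c * g p / p.1 + p.1 * dz (dz g) p)
        = X p * g p * (p.1 * dz h p) := by rw [e]
      have e3 : c * (g p ^ 2 / p.1) = g p * (c * g p / p.1) := by ring
      rw [e3]
      linear_combination -e2
    have IXQ : IntegrableOn (fun p => X p * Q p) H :=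
      (integrableOn_congr_fun idn measurableSet_H).2 ((((I1.add I2).add I3).sub I4).add IE)
    refine ⟨IXQ, ?_⟩
    have hEb : ∀ p ∈ H, E p ≤ 1 / 2 * (X p * Q p) + 2 * (p.1 * h p ^ 2) +
        300 * K ^ 2 / R ^ 2 * (p.1 * g p ^ 2) := by
      intro p hp
      have hp0 : 0 < p.1 := hp
      have hx0 := chi_nonneg R p
      have hx1 := chi_le_one R p
      have a1 : |xr p| ≤ 4 * K / R := by
        rw [hxr, abs_mul, abs_of_nonneg (cutS_nonneg R p.2)]
        exact mul_le_of_le_one_right (abs_nonneg _) (cutS_le_one _ _) |>.trans (abs_deriv_cutS_le hR0 _).1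
      have a2 : |xz p| ≤ 4 * K / R := by
        rw [hxz, abs_mul, abs_of_nonneg (cutS_nonneg R p.1)]
        exact mul_le_of_le_one_left (abs_nonneg _) (cutS_le_one _ _) |>.trans (abs_deriv_cutS_le hR0 _).1
      have a3 : |xr p| ≤ 2 * K * p.1 / R ^ 2 := by
        rw [hxr, abs_mul, abs_of_nonneg (cutS_nonneg R p.2)]
        have := (abs_deriv_cutS_le hR0 p.1).2.1
        rw [abs_of_pos hp0] at this
        exact mul_le_of_le_one_right (abs_nonneg _) (cutS_le_one _ _) |>.trans this
      have s1 : xr p ^ 2 ≤ 16 * K ^ 2 / R ^ 2 := by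
        calc xr p ^ 2 = |xr p| ^ 2 := (sq_abs _).symm
          _ ≤ (4 * K / R) ^ 2 := by gcongr
          _ = _ := by ring
      have s2 : xz p ^ 2 ≤ 16 * K ^ 2 / R ^ 2 := by
        calc xz p ^ 2 = |xz p| ^ 2 := (sq_abs _).symm
          _ ≤ (4 * K / R) ^ 2 := by gcongr
          _ = _ := by ring
      set x := chi R p
      have t0 := elliptic_error_bound (x := x) (G := g p) (u := dr g p) (w := dz g p) (h := h p) hp0 hx0 hx1 hK hR0 s1 s2
        ((neg_le_abs _).trans a3)
      have t9 : 0 ≤ x ^ 2 * (c * (g p ^ 2 / p.1)) := by positivity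
      have t8 : X p * Q p = x ^ 2 * (p.1 * dr g p ^ 2) + x ^ 2 * (p.1 * dz g p ^ 2) + x ^ 2 * (c * (g p ^ 2 / p.1)) := by
        simp only [hX, hQ, x]; ring
      rw [t8]
      have t10 : E p = -(2 * x * xr p * g p * p.1 * dr g p) - 2 * x * xr p * g p ^ 2
          - 2 * x * xz p * g p * p.1 * dz g p + 2 * x * xz p * g p * p.1 * h p + x ^ 2 * dz g p * p.1 * h p := by
        simp only [hE, hXr, hXz, hX, x]
      rw [t10]
      linarith
    have hfin := (HI.of IXQ).le (((((HI.mk I1 i1).add (HI.of I2)).add (HI.mk I3 i3)).sub (HI.mk I4 i4)).add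
      ((((HI.of IXQ).const_mul (1 / 2)).add ((HI.of hh2).const_mul 2)).add
        ((HI.of hg2).const_mul (300 * K ^ 2 / R ^ 2)))) fun p hp => by
      have := hEb p hp
      have := idn p hp
      linarith
    have e5 : 600 * K ^ 2 * B / R ^ 2 = 2 * (300 * K ^ 2 / R ^ 2 * B) := by ring
    rw [e5]
    linarith
  have hQm : AEStronglyMeasurable Q (volume.restrict H) := by
    refine ContinuousOn.aestronglyMeasurable ?_ measurableSet_H
    have : ContinuousOn (fun p : ℝ × ℝ => g p ^ 2 / p.1) H :=
      ContinuousOn.div (by fun_prop) (by fun_prop) fun p hp => ne_of_gt hp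
    simp only [hQ]
    fun_prop
  refine integrableOn_of_cutoff (X := fun n p => chi n p ^ 2) (ε := fun n => 600 * K ^ 2 * B / (n:ℝ) ^ 2)
    hQm (fun p hp => ?_) (fun n p _ => sq_nonneg _) (fun p _ => ?_) ?_ ?_ ?_
  · have hp0 : 0 < p.1 := hp
    simp only [hQ]; positivity
  · simpa using (tendsto_chi p).pow 2
  · filter_upwards [eventually_ge_atTop 1] with n hn
    exact (key n (by exact_mod_cast hn)).1
  · filter_upwards [eventually_ge_atTop 1] with n hn
    exact (key n (by exact_mod_cast hn)).2
  · refine Tendsto.div_atTop tendsto_const_nhds ?_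
    exact (tendsto_pow_atTop (by norm_num)).comp tendsto_natCast_atTop_atTop

end Elliptic

section Pointwise

/-- One dimensional Sobolev inequality. -/
theorem sq_le_integral_of_integrable {h h' w : ℝ → ℝ} (hd : ∀ x, HasDerivAt h (h' x) x)
    (hc' : Continuous h') {l : ℝ} (hl : 0 < l) (hw : Integrable w)
    (hle : ∀ x, l * h x ^ 2 + l⁻¹ * h' x ^ 2 ≤ w x) (z : ℝ) : h z ^ 2 ≤ ∫ x, w x := by
  have hc : Continuous h := Differentiable.continuous fun x => (hd x).differentiableAt
  have hw0 : ∀ x, 0 ≤ w x := fun x => le_trans (by positivity) (hle x)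
  have hbd : ∀ y, h z ^ 2 ≤ h y ^ 2 + ∫ x, w x := by
    intro y
    have h1 : ∫ x in y..z, 2 * h x * h' x = h z ^ 2 - h y ^ 2 := by
      refine intervalIntegral.integral_eq_sub_of_hasDerivAt (f := fun x => h x ^ 2) (fun x _ => ?_)
        (by apply Continuous.intervalIntegrable; fun_prop)
      refine ((hd x).pow 2).congr_deriv ?_
      simp
    have h2 : |∫ x in y..z, 2 * h x * h' x| ≤ ∫ x, w x := by
      rw [← Real.norm_eq_abs]
      refine (intervalIntegral.norm_integral_le_integral_norm_uIoc).trans ?_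
      refine le_trans ?_ (setIntegral_le_integral hw (Eventually.of_forall hw0) (s := uIoc y z))
      refine setIntegral_mono_on ?_ hw.integrableOn measurableSet_uIoc fun x _ => ?_
      · exact (intervalIntegrable_iff.1 (Continuous.intervalIntegrable (by fun_prop) _ _)).norm
      · refine le_trans ?_ (hle x)
        rw [Real.norm_eq_abs]
        have h3 : l * h x ^ 2 + l⁻¹ * h' x ^ 2 = l⁻¹ * ((l * h x) ^ 2 + h' x ^ 2) := by
          field_simp
        have h4 : 2 * h x * h' x = l⁻¹ * (2 * (l * h x) * h' x) := by field_simp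
        rw [h3, h4, abs_mul, abs_of_pos (inv_pos.2 hl)]
        gcongr
        rw [abs_le]
        constructor <;> nlinarith [sq_nonneg (l * h x + h' x), sq_nonneg (l * h x - h' x)]
    have := abs_le.1 h2
    linarith [this.2]
  by_contra hcon
  push Not at hcon
  set δ := h z ^ 2 - ∫ x, w x
  have hδ : 0 < δ := by simp only [δ]; linarith
  have h5 : Integrable (fun _ : ℝ => l * δ) := by
    refine hw.mono' (by fun_prop) (Eventually.of_forall fun x => ?_)
    rw [Real.norm_eq_abs, abs_of_pos (by positivity)]
    have h6 := hbd x
    have h7 : δ ≤ h x ^ 2 := by simp only [δ]; linarith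
    have := hle x
    have h8 : 0 ≤ l⁻¹ * h' x ^ 2 := by positivity
    nlinarith
  rw [integrable_const_iff] at h5
  rcases h5 with h5 | h5
  · exact (mul_pos hl hδ).ne' h5
  · simp [isFiniteMeasure_iff] at h5

theorem sq_intervalIntegral_le {h : ℝ → ℝ} (hc : Continuous h) {a b : ℝ} (hab : a < b) :
    (∫ x in a..b, h x) ^ 2 ≤ (b - a) * ∫ x in a..b, h x ^ 2 := by
  set I := ∫ x in a..b, h x
  set m := I / (b - a)
  have hba : 0 < b - a := by linarith
  have h1 : 0 ≤ ∫ x in a..b, (h x - m) ^ 2 :=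
    intervalIntegral.integral_nonneg hab.le fun x _ => sq_nonneg _
  have h2 : ∫ x in a..b, (h x - m) ^ 2 = (∫ x in a..b, h x ^ 2) - 2 * m * I + m ^ 2 * (b - a) := by
    have : ∀ x, (h x - m) ^ 2 = h x ^ 2 - 2 * m * h x + m ^ 2 := fun x => by ring
    simp_rw [this]
    rw [intervalIntegral.integral_add, intervalIntegral.integral_sub,
      intervalIntegral.integral_const_mul, intervalIntegral.integral_const, smul_eq_mul]
    · ring
    all_goals apply Continuous.intervalIntegrable; fun_prop
  have h3 : m * (b - a) = I := by simp only [m]; field_simp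
  rw [h2] at h1
  have h4 : 0 ≤ (b - a) * ((∫ x in a..b, h x ^ 2) - 2 * m * I + m ^ 2 * (b - a)) := by positivity
  nlinarith

/-- A pointwise bound in the half-plane in terms of weighted integrals. -/
theorem sq_le_of_weights {g w0 w1 : ℝ × ℝ → ℝ} (hg : Sl g) (l0 l1 : ℝ → ℝ)
    (hl0 : ∀ r, 0 < r → 0 < l0 r) (hl1 : ∀ r, 0 < r → 0 < l1 r)
    (hw0 : IntegrableOn w0 H) (hw1 : IntegrableOn w1 H)
    (h0 : ∀ p : ℝ × ℝ, 0 < p.1 → 0 ≤ w0 p) (h1 : ∀ p : ℝ × ℝ, 0 < p.1 → 0 ≤ w1 p)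
    (hle0 : ∀ p : ℝ × ℝ, 1 ≤ p.1 → l0 p.1 * g p ^ 2 + (l0 p.1)⁻¹ * dz g p ^ 2 ≤ w0 p)
    (hle1 : ∀ p : ℝ × ℝ, 0 < p.1 → l1 p.1 * dr g p ^ 2 + (l1 p.1)⁻¹ * dz (dr g) p ^ 2 ≤ w1 p)
    (p : ℝ × ℝ) (hp : 0 < p.1) :
    g p ^ 2 ≤ 2 * (∫ q in H, w0 q) + 4 * ∫ q in H, w1 q := by
  obtain ⟨r, z⟩ := p
  replace hp : 0 < r := hp
  have cg := hg.continuous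
  have cgr := hg.dr.continuous
  rw [H_eq, Measure.volume_eq_prod] at hw0 hw1
  rw [IntegrableOn, ← Measure.prod_restrict, Measure.restrict_univ] at hw0 hw1
  have main : ∀ {w : ℝ × ℝ → ℝ} {G : ℝ × ℝ → ℝ} {l : ℝ → ℝ} {c d : ℝ}, 0 ≤ c → c < d → Sl G →
      (∀ r, 0 < r → 0 < l r) → Integrable w ((volume.restrict (Ioi (0:ℝ))).prod volume) →
      (∀ p : ℝ × ℝ, 0 < p.1 → 0 ≤ w p) →
      (∀ p : ℝ × ℝ, 0 < p.1 → c < p.1 → l p.1 * G p ^ 2 + (l p.1)⁻¹ * dz G p ^ 2 ≤ w p) →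
      ∫ s in c..d, G (s, z) ^ 2 ≤ ∫ q in H, w q := by
    intro w G l c d hc hcd hG hl hw hw0 hle
    have cG := hG.continuous
    have hint : IntegrableOn (fun x => ∫ y, w (x, y)) (Ioi 0) := hw.integral_prod_left
    rw [H_eq, Measure.volume_eq_prod, ← Measure.prod_restrict, Measure.restrict_univ,
      integral_prod _ hw, intervalIntegral.integral_of_le hcd.le]
    have hsub : Ioc c d ⊆ Ioi 0 := fun x hx => lt_of_le_of_lt hc hx.1
    refine le_trans ?_ (setIntegral_mono_set (s := Ioc c d) hint ?_ hsub.eventuallyLE)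
    · refine setIntegral_mono_ae_restrict ?_ (hint.mono_set hsub) ?_
      · exact (Continuous.integrableOn_Ioc (by fun_prop))
      · have := hw.prod_right_ae
        rw [ae_restrict_iff' measurableSet_Ioi] at this
        rw [EventuallyLE, ae_restrict_iff' measurableSet_Ioc]
        filter_upwards [this] with s hs hsI
        have hs0 : 0 < s := hsub hsI
        exact sq_le_integral_of_integrable (fun y => hG.hasDerivAt_z s y)
          (by have := hG.dz.continuous; fun_prop) (hl s hs0) (hs hs0)
          (fun x => hle (s, x) hs0 hsI.1) z
    · rw [EventuallyLE, ae_restrict_iff' measurableSet_Ioi]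
      exact Eventually.of_forall fun s hs => integral_nonneg fun y => hw0 (s, y) hs
  have m0 := main (w := w0) (G := g) (l := l0) (c := r + 1) (d := r + 2) (by linarith) (by linarith) hg hl0 hw0 h0
    (fun p _ hp => hle0 p (by linarith))
  have m1 := main (w := w1) (G := dr g) (l := l1) (c := r) (d := r + 2) hp.le (by linarith) hg.dr hl1 hw1 h1
    (fun p hp _ => hle1 p hp)
  have pt : ∀ s ∈ Icc (r + 1) (r + 2), g (r, z) ^ 2 ≤ 2 * g (s, z) ^ 2 + 4 * ∫ x in r..(r+2), dr g (x, z) ^ 2 := by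
    intro s hs
    have hrs : r < s := by linarith [hs.1]
    have e1 : ∫ x in r..s, dr g (x, z) = g (s, z) - g (r, z) :=
      intervalIntegral.integral_eq_sub_of_hasDerivAt (f := fun x => g (x, z))
        (fun x _ => hg.hasDerivAt_r x z) (by apply Continuous.intervalIntegrable; fun_prop)
    have e2 := sq_intervalIntegral_le (h := fun x => dr g (x, z)) (by fun_prop) hrs
    have e3 : ∫ x in r..s, dr g (x, z) ^ 2 ≤ ∫ x in r..(r+2), dr g (x, z) ^ 2 := by
      refine intervalIntegral.integral_mono_interval le_rfl hrs.le hs.2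
        (Eventually.of_forall fun x => sq_nonneg _) (by apply Continuous.intervalIntegrable; fun_prop)
    have e4 : 0 ≤ ∫ x in r..s, dr g (x, z) ^ 2 :=
      intervalIntegral.integral_nonneg hrs.le fun x _ => sq_nonneg _
    rw [e1] at e2
    have e5 : (s - r) * ∫ x in r..s, dr g (x, z) ^ 2 ≤ 2 * ∫ x in r..(r+2), dr g (x, z) ^ 2 := by
      have : s - r ≤ 2 := by linarith [hs.2]
      nlinarith
    nlinarith [sq_nonneg (g (r, z) - 2 * g (s, z))]
  have avg : ∫ s in (r+1)..(r+2), g (r, z) ^ 2 ≤ ∫ s in (r+1)..(r+2), (2 * g (s, z) ^ 2 +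
      4 * ∫ x in r..(r+2), dr g (x, z) ^ 2) :=
    intervalIntegral.integral_mono_on (by linarith) (by simp)
      (by apply Continuous.intervalIntegrable; fun_prop) pt
  rw [intervalIntegral.integral_const, intervalIntegral.integral_add
    (by apply Continuous.intervalIntegrable; fun_prop) (by simp), intervalIntegral.integral_const_mul,
    intervalIntegral.integral_const] at avg
  have e6 : r + 2 - (r + 1) = 1 := by ring
  rw [e6, one_smul, one_smul] at avg
  linarith

end Pointwise


section Profiles

theorem dr_congr_H {g h : ℝ × ℝ → ℝ} (hgh : ∀ p : ℝ × ℝ, 0 < p.1 → g p = h p) (p : ℝ × ℝ) (hp : 0 < p.1) :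
    dr g p = dr h p := by
  refine Filter.EventuallyEq.deriv_eq ?_
  filter_upwards [lt_mem_nhds hp] with s hs using hgh (s, p.2) hs

theorem dz_congr_H {g h : ℝ × ℝ → ℝ} (hgh : ∀ p : ℝ × ℝ, 0 < p.1 → g p = h p) (p : ℝ × ℝ) (hp : 0 < p.1) :
    dz g p = dz h p := by
  have : (fun s => g (p.1, s)) = fun s => h (p.1, s) := funext fun s => hgh (p.1, s) hp
  simp only [dz, this]

/-- An axisymmetric divergence free velocity profile `(v, f)`, with `v = u_r` and `f = u_z`. -/
structure Prof (v f : ℝ × ℝ → ℝ) : Prop where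
  sv : Sl v
  sf : Sl f
  v0 : ∀ z, v (0, z) = 0
  f0 : ∀ z, dr f (0, z) = 0
  div : ∀ p : ℝ × ℝ, 0 < p.1 → dr v p + v p / p.1 + dz f p = 0

/-- The quotient `u_r / r`. -/
noncomputable def quot (v : ℝ × ℝ → ℝ) : ℝ × ℝ → ℝ := Av 0 (dr v)

/-- The angular vorticity `ω_θ = ∂_z u_r - ∂_r u_z`. -/
noncomputable def vort (v f : ℝ × ℝ → ℝ) (p : ℝ × ℝ) : ℝ := dz v p - dr f p

/-- The quotient `Γ = ω_θ / r`. -/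
noncomputable def gam (v f : ℝ × ℝ → ℝ) : ℝ × ℝ → ℝ := Av 0 (dr (vort v f))

variable {v f : ℝ × ℝ → ℝ}

theorem Prof.s_quot (h : Prof v f) : Sl (quot v) := h.sv.dr.Av 0
theorem Prof.s_vort (h : Prof v f) : Sl (vort v f) := h.sv.dz.sub h.sf.dr
theorem Prof.s_gam (h : Prof v f) : Sl (gam v f) := h.s_vort.dr.Av 0

theorem Prof.v_eq (h : Prof v f) (p : ℝ × ℝ) : v p = p.1 * quot v p := h.sv.hadamard h.v0 p

theorem Prof.vort_zero (h : Prof v f) (z : ℝ) : vort v f (0, z) = 0 := by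
  have h1 : dz v (0, z) = 0 := by
    have : (fun s => v ((0:ℝ), s)) = fun _ => 0 := funext h.v0
    simp [dz, this]
  simp [vort, h1, h.f0]

theorem Prof.vort_eq (h : Prof v f) (p : ℝ × ℝ) : vort v f p = p.1 * gam v f p :=
  h.s_vort.hadamard h.vort_zero p

theorem Prof.quot_eq (h : Prof v f) {p : ℝ × ℝ} (hp : 0 < p.1) : quot v p = v p / p.1 := by
  rw [h.v_eq p]; field_simp

theorem Prof.dr_v (h : Prof v f) (p : ℝ × ℝ) : dr v p = quot v p + p.1 * dr (quot v) p := by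
  obtain ⟨r, z⟩ := p
  have e : (fun s => v (s, z)) = fun s => s * quot v (s, z) := funext fun s => h.v_eq (s, z)
  have := ((hasDerivAt_id r).mul (h.s_quot.hasDerivAt_r r z)).deriv
  rw [dr, e]
  refine Eq.trans this ?_
  simp

theorem Prof.dz_v (h : Prof v f) (p : ℝ × ℝ) : dz v p = p.1 * dz (quot v) p := by
  obtain ⟨r, z⟩ := p
  have e : (fun s => v (r, s)) = fun s => r * quot v (r, s) := funext fun s => h.v_eq (r, s)
  rw [dz, e]
  exact ((h.s_quot.hasDerivAt_z r z).const_mul r).deriv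

theorem Prof.dz_f (h : Prof v f) (p : ℝ × ℝ) (hp : 0 < p.1) :
    dz f p = -(2 * quot v p + p.1 * dr (quot v) p) := by
  have := h.div p hp
  rw [← h.quot_eq hp, h.dr_v] at this
  linarith

theorem Prof.dr_f (h : Prof v f) (p : ℝ × ℝ) : dr f p = p.1 * dz (quot v) p - p.1 * gam v f p := by
  have := h.vort_eq p
  rw [vort, h.dz_v] at this
  linarith

theorem Prof.dr_dz_f (h : Prof v f) (p : ℝ × ℝ) (hp : 0 < p.1) :
    dr (dz f) p = -(3 * dr (quot v) p + p.1 * dr (dr (quot v)) p) := by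
  rw [dr_congr_H h.dz_f p hp]
  obtain ⟨r, z⟩ := p
  refine (((h.s_quot.hasDerivAt_r r z).const_mul 2).add
    ((hasDerivAt_id r).mul (h.s_quot.dr.hasDerivAt_r r z))).neg.deriv.trans ?_
  simp only [id]
  ring

theorem Prof.quot_equation (h : Prof v f) (p : ℝ × ℝ) (hp : 0 < p.1) :
    p.1 * dr (dr (quot v)) p + 3 * dr (quot v) p - 0 * quot v p / p.1 + p.1 * dz (dz (quot v)) p
      = p.1 * dz (gam v f) p := by
  have h1 := h.dr_dz_f p hp
  rw [h.sf.dr_dz, dz_congr_H (fun p _ => h.dr_f p) p hp] at h1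
  obtain ⟨r, z⟩ := p
  have h2 : dz (fun p => p.1 * dz (quot v) p - p.1 * gam v f p) (r, z) =
      r * dz (dz (quot v)) (r, z) - r * dz (gam v f) (r, z) :=
    (((h.s_quot.dz.hasDerivAt_z r z).const_mul r).sub ((h.s_gam.hasDerivAt_z r z).const_mul r)).deriv
  rw [h2] at h1
  simp only [zero_mul, zero_div] at h1 ⊢
  linear_combination h1

theorem Prof.dr_quot_equation (h : Prof v f) (p : ℝ × ℝ) (hp : 0 < p.1) :
    p.1 * dr (dr (dr (quot v))) p + 3 * dr (dr (quot v)) p - 3 * dr (quot v) p / p.1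
      + p.1 * dz (dz (dr (quot v))) p = p.1 * dz (dr (gam v f)) p := by
  have e0 := h.quot_equation p hp
  have h1 := dr_congr_H h.quot_equation p hp
  have c1 : dz (dz (dr (quot v))) p = dr (dz (dz (quot v))) p := by
    rw [h.s_quot.dz.dr_dz, dz_congr_H (fun q _ => (h.s_quot.dr_dz q).symm) p hp]
  have c2 : dz (dr (gam v f)) p = dr (dz (gam v f)) p := (h.s_gam.dr_dz p).symm
  rw [c1, c2]
  obtain ⟨r, z⟩ := p
  have d1 : dr (fun p => p.1 * dr (dr (quot v)) p + 3 * dr (quot v) p - 0 * quot v p / p.1 +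
      p.1 * dz (dz (quot v)) p) (r, z) = (dr (dr (quot v)) (r, z) + r * dr (dr (dr (quot v))) (r, z)) +
      3 * dr (dr (quot v)) (r, z) + (dz (dz (quot v)) (r, z) + r * dr (dz (dz (quot v))) (r, z)) := by
    have e : (fun s => s * dr (dr (quot v)) (s, z) + 3 * dr (quot v) (s, z) - 0 * quot v (s, z) / s +
      s * dz (dz (quot v)) (s, z)) = fun s => s * dr (dr (quot v)) (s, z) + 3 * dr (quot v) (s, z) +
      s * dz (dz (quot v)) (s, z) := by funext s; simp
    rw [dr, e]
    refine ((((hasDerivAt_id r).mul (h.s_quot.dr.dr.hasDerivAt_r r z)).add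
      ((h.s_quot.dr.hasDerivAt_r r z).const_mul 3)).add
      ((hasDerivAt_id r).mul (h.s_quot.dz.dz.hasDerivAt_r r z))).deriv.trans ?_
    simp
  have d2 : dr (fun p => p.1 * dz (gam v f) p) (r, z) = dz (gam v f) (r, z) + r * dr (dz (gam v f)) (r, z) := by
    refine ((hasDerivAt_id r).mul (h.s_gam.dz.hasDerivAt_r r z)).deriv.trans ?_
    simp
  rw [d1, d2] at h1
  simp only [zero_mul, zero_div] at e0 ⊢
  have hr : r ≠ 0 := ne_of_gt hp
  have e1 : dz (dz (quot v)) (r, z) - dz (gam v f) (r, z) = -(dr (dr (quot v)) (r, z) + 3 * dr (quot v) (r, z) / r) := by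
    field_simp
    linarith
  linarith

variable {e E' G2 D2 : ℝ}

theorem Prof.pointwise (h : Prof v f)
    (h1 : IntegrableOn (fun p => p.1 * quot v p ^ 2) H)
    (he : HI (fun p => p.1 * (v p ^ 2 + f p ^ 2)) e) (hE : HI (fun p => p.1 * dr f p ^ 2) E')
    (hG : HI (fun p => p.1 * gam v f p ^ 2) G2) (hD : HI (fun p => p.1 * dr (gam v f) p ^ 2) D2)
    (p : ℝ × ℝ) (hp : 0 < p.1) :
    quot v p ^ 2 ≤ 100 * (e + E' + G2 + D2) ∧ f p ^ 2 ≤ 100 * (e + E' + G2 + D2) := by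
  obtain ⟨i1, b1⟩ := elliptic_estimate h.s_quot h.s_gam le_rfl h.quot_equation h1 hG.int
  rw [hG.val] at b1
  have h2 : IntegrableOn (fun p => p.1 * dr (quot v) p ^ 2) H := by
    refine Integrable.mono' i1 ?_ ?_
    · have := h.s_quot.dr.continuous
      exact (by fun_prop : Continuous fun p : ℝ × ℝ => p.1 * dr (quot v) p ^ 2).aestronglyMeasurable
    · refine (ae_restrict_iff' measurableSet_H).2 (Eventually.of_forall fun p hp => ?_)
      have hp : 0 < p.1 := hp
      rw [Real.norm_eq_abs, abs_of_nonneg (by positivity)]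
      have : 0 ≤ p.1 * dz (quot v) p ^ 2 := by positivity
      linarith
  obtain ⟨i2, b2⟩ := elliptic_estimate h.s_quot.dr h.s_gam.dr (by norm_num : (0:ℝ) ≤ 3)
    h.dr_quot_equation h2 hD.int
  rw [hD.val] at b2
  have I1 := HI.of i1
  have I2 := HI.of i2
  set J1 := ∫ p in H, (p.1 * dr (quot v) p ^ 2 + p.1 * dz (quot v) p ^ 2 + 0 * (quot v p ^ 2 / p.1))
  set J2 := ∫ p in H, (p.1 * dr (dr (quot v)) p ^ 2 + p.1 * dz (dr (quot v)) p ^ 2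
    + 3 * (dr (quot v) p ^ 2 / p.1))
  have e0 : 0 ≤ e := he.nonneg fun p hp => by have : 0 < p.1 := hp; positivity
  have E0 : 0 ≤ E' := hE.nonneg fun p hp => by have : 0 < p.1 := hp; positivity
  have G0 : 0 ≤ G2 := hG.nonneg fun p hp => by have : 0 < p.1 := hp; positivity
  have D0 : 0 ≤ D2 := hD.nonneg fun p hp => by have : 0 < p.1 := hp; positivity
  have qv : ∀ p : ℝ × ℝ, 1 ≤ p.1 → quot v p ^ 2 ≤ p.1 * v p ^ 2 := by
    intro p hp
    rw [h.v_eq p]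
    have : 1 ≤ p.1 ^ 3 := one_le_pow₀ hp
    nlinarith [sq_nonneg (quot v p)]
  have qv' : ∀ p : ℝ × ℝ, 1 ≤ p.1 → p.1⁻¹ * quot v p ^ 2 ≤ p.1 * v p ^ 2 := by
    intro p hp
    have : p.1⁻¹ ≤ 1 := inv_le_one_of_one_le₀ hp
    calc p.1⁻¹ * quot v p ^ 2 ≤ 1 * quot v p ^ 2 := by gcongr
      _ ≤ _ := by rw [one_mul]; exact qv p hp
  constructor
  · have I0 := he.add I1
    have := sq_le_of_weights h.s_quot (fun _ => 1) (fun r => r⁻¹) (fun _ _ => one_pos)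
      (fun r hr => inv_pos.2 hr) I0.int I2.int (fun p hp => by positivity) (fun p hp => by positivity)
      (fun p hp => by
        have h1 := qv p hp
        have : 0 < p.1 := by linarith
        have h2 : 0 ≤ p.1 * f p ^ 2 := by positivity
        have h3 : 0 ≤ p.1 * dr (quot v) p ^ 2 := by positivity
        have h4 : dz (quot v) p ^ 2 ≤ p.1 * dz (quot v) p ^ 2 :=
          le_mul_of_one_le_left (sq_nonneg _) hp
        rw [inv_one]
        linarith)
      (fun p hp => by
        have h3 : 0 ≤ p.1 * dr (dr (quot v)) p ^ 2 := by positivity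
        have h4 : 0 ≤ dr (quot v) p ^ 2 / p.1 := by positivity
        have h5 : p.1⁻¹ * dr (quot v) p ^ 2 = dr (quot v) p ^ 2 / p.1 := by ring
        rw [h5, inv_inv]
        linarith) p hp
    rw [I0.val, I2.val] at this
    linarith
  · have I0 := (he.const_mul 9).add (I1.const_mul 2)
    have I3 := hE.add (I2.const_mul 6)
    have := sq_le_of_weights h.sf (fun r => r) (fun r => r) (fun r hr => hr)
      (fun r hr => hr) I0.int I3.int (fun p hp => by positivity) (fun p hp => by positivity)
      (fun p hp => by
        have h1 := qv' p hp
        have hp0 : 0 < p.1 := by linarith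
        have h3 : 0 ≤ p.1 * dz (quot v) p ^ 2 := by positivity
        have h4 : 0 ≤ p.1 * f p ^ 2 := by positivity
        have h5 : p.1⁻¹ * dz f p ^ 2 ≤ 8 * (p.1⁻¹ * quot v p ^ 2) + 2 * (p.1 * dr (quot v) p ^ 2) := by
          rw [h.dz_f p hp0]
          have : 8 * (p.1⁻¹ * quot v p ^ 2) + 2 * (p.1 * dr (quot v) p ^ 2) =
            p.1⁻¹ * (8 * quot v p ^ 2 + 2 * (p.1 * dr (quot v) p) ^ 2) := by field_simp
          rw [this]
          gcongr
          nlinarith [sq_nonneg (2 * quot v p - p.1 * dr (quot v) p)]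
        have h6 : 0 ≤ p.1 * v p ^ 2 := by positivity
        simp only [zero_mul, add_zero]
        linarith)
      (fun p hp => by
        have h3 : 0 ≤ p.1 * dz (dr (quot v)) p ^ 2 := by positivity
        have h4 : 0 ≤ p.1 * dr (dr (quot v)) p ^ 2 := by positivity
        have h5 : p.1⁻¹ * dz (dr f) p ^ 2 ≤ 18 * (dr (quot v) p ^ 2 / p.1) +
            2 * (p.1 * dr (dr (quot v)) p ^ 2) := by
          rw [← h.sf.dr_dz, h.dr_dz_f p hp]
          have : 18 * (dr (quot v) p ^ 2 / p.1) + 2 * (p.1 * dr (dr (quot v)) p ^ 2) =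
            p.1⁻¹ * (18 * dr (quot v) p ^ 2 + 2 * (p.1 * dr (dr (quot v)) p) ^ 2) := by field_simp
          rw [this]
          gcongr
          nlinarith [sq_nonneg (3 * dr (quot v) p - p.1 * dr (dr (quot v)) p)]
        linarith) p hp
    rw [I0.val, I3.val] at this
    linarith

end Profiles

section Solutions

/-- A smooth axisymmetric solution without swirl on `[0, b]`, in the variables `(r, z)`. -/
structure HSol (b M : ℝ) (v f ρ : ℝ → ℝ × ℝ → ℝ) : Prop where
  hb : 0 < b
  sv : Sm b v
  sf : Sm b f
  sρ : Sm b ρ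
  prof : ∀ t ∈ Icc 0 b, Prof (v t) (f t)
  mom : ∃ P : ℝ → ℝ × ℝ → ℝ, Sm b P ∧ ∀ t ∈ Ioo 0 b, ∀ p : ℝ × ℝ, 0 < p.1 →
    (dt b v t p + v t p * dr (v t) p + f t p * dz (v t) p
      - (dr (dr (v t)) p + dr (v t) p / p.1 - v t p / p.1 ^ 2) + dr (P t) p = 0) ∧
    (dt b f t p + v t p * dr (f t) p + f t p * dz (f t) p
      - (dr (dr (f t)) p + dr (f t) p / p.1) + dz (P t) p = ρ t p)
  trans : ∀ t ∈ Ioo 0 b, ∀ p : ℝ × ℝ, 0 < p.1 →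
    dt b ρ t p + v t p * dr (ρ t) p + f t p * dz (ρ t) p = 0
  L2 : ∀ t ∈ Icc 0 b, IntegrableOn (fun p => p.1 * (v t p ^ 2 + f t p ^ 2)) H ∧
    ∫ p in H, p.1 * (v t p ^ 2 + f t p ^ 2) ≤ M
  H1 : ∀ t ∈ Icc 0 b, IntegrableOn (fun p => p.1 * (dr (v t) p ^ 2 + dz (v t) p ^ 2
      + dr (f t) p ^ 2 + dz (f t) p ^ 2)) H ∧
    ∫ p in H, p.1 * (dr (v t) p ^ 2 + dz (v t) p ^ 2 + dr (f t) p ^ 2 + dz (f t) p ^ 2) ≤ M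
  lip : ∃ g : ℝ → ENNReal, Measurable g ∧ ∫⁻ t in Icc 0 b, g t < ⊤ ∧ ∀ t ∈ Icc 0 b,
    ∀ p : ℝ × ℝ, 0 < p.1 → ENNReal.ofReal |dr (v t) p| ≤ g t ∧ ENNReal.ofReal |dz (v t) p| ≤ g t ∧
      ENNReal.ofReal |dr (f t) p| ≤ g t ∧ ENNReal.ofReal |dz (f t) p| ≤ g t

variable {b M : ℝ} {v f ρ : ℝ → ℝ × ℝ → ℝ}

theorem HSol.s_quot (h : HSol b M v f ρ) : Sm b (fun t => quot (v t)) := (h.sv.dr h.hb).Av h.hb 0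
theorem HSol.s_vort (h : HSol b M v f ρ) : Sm b (fun t => vort (v t) (f t)) :=
  (h.sv.dz h.hb).sub (h.sf.dr h.hb)
theorem HSol.s_gam (h : HSol b M v f ρ) : Sm b (fun t => gam (v t) (f t)) := (h.s_vort.dr h.hb).Av h.hb 0

/-- The equation for the angular vorticity. -/
theorem HSol.vort_equation (h : HSol b M v f ρ) {t : ℝ} (ht : t ∈ Ioo 0 b) (p : ℝ × ℝ) (hp : 0 < p.1) :
    dt b (fun t => vort (v t) (f t)) t p + v t p * dr (vort (v t) (f t)) p + f t p * dz (vort (v t) (f t)) p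
      - (dr (dr (vort (v t) (f t))) p + dr (vort (v t) (f t)) p / p.1 - vort (v t) (f t) p / p.1 ^ 2)
      = quot (v t) p * vort (v t) (f t) p - dr (ρ t) p := by
  obtain ⟨P, sP, hP⟩ := h.mom
  have hb := h.hb
  have ht' := Ioo_subset_Icc_self ht
  have pr := h.prof t ht'
  have sv := h.sv.slice ht'
  have sf := h.sf.slice ht'
  have sP' := sP.slice ht'
  have svt := (h.sv.dt hb).slice ht'
  have sft := (h.sf.dt hb).slice ht'
  have q1 := dz_congr_H (h := fun _ => (0:ℝ)) (fun p hp => (hP t ht p hp).1) p hp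
  have q2 := dr_congr_H (h := ρ t) (fun p hp => (hP t ht p hp).2) p hp
  have w1 : ∀ q, dr (vort (v t) (f t)) q = dr (dz (v t)) q - dr (dr (f t)) q := fun ⟨r, z⟩ =>
    ((sv.dz.hasDerivAt_r r z).sub (sf.dr.hasDerivAt_r r z)).deriv
  have w2 : ∀ q, dz (vort (v t) (f t)) q = dz (dz (v t)) q - dz (dr (f t)) q := fun ⟨r, z⟩ =>
    ((sv.dz.hasDerivAt_z r z).sub (sf.dr.hasDerivAt_z r z)).deriv
  have w3 : dr (dr (vort (v t) (f t))) p = dr (dr (dz (v t))) p - dr (dr (dr (f t))) p := by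
    have : dr (vort (v t) (f t)) = fun q => dr (dz (v t)) q - dr (dr (f t)) q := funext w1
    rw [this]
    exact ((sv.dz.dr.hasDerivAt_r p.1 p.2).sub (sf.dr.dr.hasDerivAt_r p.1 p.2)).deriv
  have w4 : dt b (fun t => vort (v t) (f t)) t p = dz (dt b v t) p - dr (dt b f t) p := by
    rw [← h.sv.dt_dz hb ht', ← h.sf.dt_dr hb ht']
    have := ((h.sv.dz hb).hasDerivAt hb ht p).sub ((h.sf.dr hb).hasDerivAt hb ht p)
    exact ((h.s_vort.hasDerivAt hb ht p).unique this)
  have c1 : dz (dr (v t)) p = dr (dz (v t)) p := (sv.dr_dz p).symm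
  have c2 : dz (dr (dr (v t))) p = dr (dr (dz (v t))) p := by
    rw [← sv.dr.dr_dz]
    exact dr_congr_H (fun q _ => (sv.dr_dz q).symm) p hp
  have c3 : dr (dz (P t)) p = dz (dr (P t)) p := sP'.dr_dz p
  have c4 : dz (dr (f t)) p = dr (dz (f t)) p := (sf.dr_dz p).symm
  have dv := pr.div p hp
  have qe := pr.quot_eq hp
  rw [w4, w1, w2, w3, qe]
  obtain ⟨r, z⟩ := p
  have hr : r ≠ 0 := ne_of_gt hp
  have d1 := ((((svt.hasDerivAt_z r z).add ((sv.hasDerivAt_z r z).mul (sv.dr.hasDerivAt_z r z))).add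
    ((sf.hasDerivAt_z r z).mul (sv.dz.hasDerivAt_z r z))).sub
    (((sv.dr.dr.hasDerivAt_z r z).add ((sv.dr.hasDerivAt_z r z).div_const r)).sub
      ((sv.hasDerivAt_z r z).div_const (r ^ 2)))).add (sP'.dr.hasDerivAt_z r z)
  have q1' := d1.deriv.symm.trans (q1.trans (by simp [dz] : dz (fun _ => (0:ℝ)) (r, z) = 0))
  have d2 := ((((sft.hasDerivAt_r r z).add ((sv.hasDerivAt_r r z).mul (sf.dr.hasDerivAt_r r z))).add
    ((sf.hasDerivAt_r r z).mul (sf.dz.hasDerivAt_r r z))).sub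
    ((sf.dr.dr.hasDerivAt_r r z).add ((sf.dr.hasDerivAt_r r z).div (hasDerivAt_id r) hr))).add
      (sP'.dz.hasDerivAt_r r z)
  have q2' := d2.deriv.symm.trans q2
  simp only [id] at q1' q2' dv c1 c2 c3 c4 hp ⊢
  rw [c1, c2] at q1'
  rw [c3] at q2'
  simp only [vort]
  rw [c4]
  have e1 : (dr (dr (f t)) (r, z) * r - dr (f t) (r, z) * 1) / r ^ 2 =
      dr (dr (f t)) (r, z) / r - dr (f t) (r, z) / r ^ 2 := by field_simp
  rw [e1] at q2'
  have e2 : dr (v t) (r, z) + dz (f t) (r, z) = - (v t (r, z) / r) := by linarith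
  have e3 : (dz (v t) (r, z) - dr (f t) (r, z)) * (dr (v t) (r, z) + dz (f t) (r, z)) =
     - (v t (r, z) / r) * (dz (v t) (r, z) - dr (f t) (r, z)) := by rw [e2]; ring
  linear_combination q1' - q2' - e3

/-- The equation for `Γ`. -/
theorem HSol.gam_equation (h : HSol b M v f ρ) {t : ℝ} (ht : t ∈ Ioo 0 b) (p : ℝ × ℝ) (hp : 0 < p.1) :
    p.1 * (dt b (fun t => gam (v t) (f t)) t p + v t p * dr (gam (v t) (f t)) p
      + f t p * dz (gam (v t) (f t)) p)
      = p.1 * dr (dr (gam (v t) (f t))) p + 3 * dr (gam (v t) (f t)) p - dr (ρ t) p := by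
  have hb := h.hb
  have ht' := Ioo_subset_Icc_self ht
  have pr := h.prof t ht'
  have sg := pr.s_gam
  have e := h.vort_equation ht p hp
  have w0 := pr.vort_eq
  have w1 : ∀ q, dr (vort (v t) (f t)) q = gam (v t) (f t) q + q.1 * dr (gam (v t) (f t)) q := by
    rintro ⟨r, z⟩
    have e : (fun s => vort (v t) (f t) (s, z)) = fun s => s * gam (v t) (f t) (s, z) := funext fun s => w0 (s, z)
    rw [dr, e]
    refine ((hasDerivAt_id r).mul (sg.hasDerivAt_r r z)).deriv.trans ?_
    simp
  have w2 : dz (vort (v t) (f t)) p = p.1 * dz (gam (v t) (f t)) p := by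
    have e : (fun s => vort (v t) (f t) (p.1, s)) = fun s => p.1 * gam (v t) (f t) (p.1, s) :=
      funext fun s => w0 (p.1, s)
    rw [dz, e]
    exact ((sg.hasDerivAt_z p.1 p.2).const_mul p.1).deriv
  have w3 : dr (dr (vort (v t) (f t))) p = 2 * dr (gam (v t) (f t)) p + p.1 * dr (dr (gam (v t) (f t))) p := by
    have : dr (vort (v t) (f t)) = fun q => gam (v t) (f t) q + q.1 * dr (gam (v t) (f t)) q := funext w1
    rw [this]
    refine ((sg.hasDerivAt_r p.1 p.2).add
      ((hasDerivAt_id p.1).mul (sg.dr.hasDerivAt_r p.1 p.2))).deriv.trans ?_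
    simp only [id]; ring
  have w4 : dt b (fun t => vort (v t) (f t)) t p = p.1 * dt b (fun t => gam (v t) (f t)) t p := by
    have h1 := (h.s_gam.hasDerivAt hb ht p).const_mul p.1
    refine ((h.s_vort.hasDerivAt hb ht p).congr_of_eventuallyEq ?_).unique h1
    filter_upwards [Icc_mem_nhds ht.1 ht.2] with s hs
    exact ((h.prof s hs).vort_eq p).symm
  have hr : p.1 ≠ 0 := ne_of_gt hp
  have qe := pr.v_eq p
  rw [w4, w1, w2, w3, w0] at e
  have e1 : (gam (v t) (f t) p + p.1 * dr (gam (v t) (f t)) p) / p.1 =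
    gam (v t) (f t) p / p.1 + dr (gam (v t) (f t)) p := by field_simp
  have e2 : p.1 * gam (v t) (f t) p / p.1 ^ 2 = gam (v t) (f t) p / p.1 := by field_simp
  rw [e1, e2] at e
  have e3 : v t p * gam (v t) (f t) p = quot (v t) p * (p.1 * gam (v t) (f t) p) := by rw [qe]; ring
  linear_combination e - e3

end Solutions


section Evolution

variable {b : ℝ} {F G : ℝ → ℝ × ℝ → ℝ}

/-- Bounded support on the half-plane, uniformly in time. -/
def BHt (b : ℝ) (G : ℝ → ℝ × ℝ → ℝ) : Prop :=
  ∃ L : ℝ, ∀ t ∈ Icc 0 b, ∀ p : ℝ × ℝ, 0 < p.1 → (L < p.1 ∨ L < |p.2|) → G t p = 0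

theorem BHt.slice (hG : BHt b G) {t : ℝ} (ht : t ∈ Icc 0 b) : BH (G t) := by
  obtain ⟨L, hL⟩ := hG
  exact ⟨L, hL t ht⟩

theorem BHt.mul_left (hG : BHt b G) : BHt b (fun t p => F t p * G t p) := by
  obtain ⟨L, hL⟩ := hG
  exact ⟨L, fun t ht p hp h => by simp [hL t ht p hp h]⟩

theorem BHt.dt (hG : BHt b G) : BHt b (dt b G) := by
  obtain ⟨L, hL⟩ := hG
  refine ⟨L, fun t ht p hp h => ?_⟩
  have : derivWithin (fun s => G s p) (Icc 0 b) t = derivWithin (fun _ => (0:ℝ)) (Icc 0 b) t :=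
    derivWithin_congr (fun s hs => hL s hs p hp h) (hL t ht p hp h)
  simpa [HalfPlane.dt] using this

theorem BHt.exists_bound (hG : BHt b G) (hc : ContinuousOn (fun q : ℝ × (ℝ × ℝ) => G q.1 q.2) (Icc 0 b ×ˢ univ)) :
    ∃ B : ℝ × ℝ → ℝ, IntegrableOn B H ∧ ∀ t ∈ Icc 0 b, ∀ p ∈ H, |G t p| ≤ B p := by
  obtain ⟨L, hL⟩ := hG
  obtain ⟨C, hC⟩ := ((isCompact_Icc (a := (0:ℝ)) (b := b)).prod
    ((isCompact_Icc (a := (0:ℝ)) (b := L)).prod (isCompact_Icc (a := -L) (b := L)))).exists_bound_of_continuousOn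
    (hc.mono (prod_mono_right (subset_univ _)))
  refine ⟨(Icc 0 L ×ˢ Icc (-L) L).indicator fun _ => C, ?_, fun t ht p hp => ?_⟩
  · refine Integrable.integrableOn ?_
    rw [integrable_indicator_iff (measurableSet_Icc.prod measurableSet_Icc)]
    exact integrableOn_const (by exact (isCompact_Icc.prod isCompact_Icc).measure_lt_top.ne)
  · by_cases hpL : p ∈ Icc 0 L ×ˢ Icc (-L) L
    · rw [indicator_of_mem hpL]
      exact hC (t, p) ⟨ht, hpL⟩
    · rw [indicator_of_notMem hpL, hL t ht p hp, abs_zero]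
      by_contra hcon
      push Not at hcon
      exact hpL ⟨⟨le_of_lt hp, hcon.1⟩, abs_le.1 hcon.2⟩

theorem BHt.continuousOn_integral (hG : BHt b G)
    (hc : ContinuousOn (fun q : ℝ × (ℝ × ℝ) => G q.1 q.2) (Icc 0 b ×ˢ univ)) :
    ContinuousOn (fun t => ∫ p in H, G t p) (Icc 0 b) := by
  obtain ⟨B, hB, hGB⟩ := hG.exists_bound hc
  refine continuousOn_of_dominated (bound := B) (fun t ht => ?_) (fun t ht => ?_) hB ?_
  · have hm : MapsTo (fun p : ℝ × ℝ => (t, p)) univ (Icc 0 b ×ˢ univ) := fun p _ => ⟨ht, mem_univ _⟩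
    have : ContinuousOn (fun p : ℝ × ℝ => G t p) univ :=
      hc.comp (continuous_const.prodMk continuous_id).continuousOn hm
    exact (continuousOn_univ.1 this).aestronglyMeasurable
  · exact (ae_restrict_iff' measurableSet_H).2 (Eventually.of_forall fun p hp => hGB t ht p hp)
  · refine Eventually.of_forall fun p => ?_
    have hm : MapsTo (fun t : ℝ => (t, p)) (Icc 0 b) (Icc 0 b ×ˢ univ) := fun t ht => ⟨ht, mem_univ _⟩
    exact hc.comp (continuous_id.prodMk continuous_const).continuousOn hm

/-- Differentiation under the integral sign. -/
theorem hasDerivAt_integral_of_Sm (hb : 0 < b) (hF : Sm b F) (hB : BHt b F) {t : ℝ} (ht : t ∈ Ioo 0 b) :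
    HasDerivAt (fun t => ∫ p in H, F t p) (∫ p in H, dt b F t p) t := by
  obtain ⟨B, hBi, hFB⟩ := hB.dt.exists_bound (hF.dt hb).continuousOn
  have hIcc : Icc 0 b ∈ 𝓝 t := Icc_mem_nhds ht.1 ht.2
  have ht' := Ioo_subset_Icc_self ht
  refine (hasDerivAt_integral_of_dominated_loc_of_deriv_le (bound := B) (F := F)
    (F' := fun t p => dt b F t p) (s := Ioo 0 b) (Ioo_mem_nhds ht.1 ht.2) ?_ ?_ ?_ ?_ hBi ?_).2
  · filter_upwards [hIcc] with s hs
    exact (hF.slice hs).continuous.aestronglyMeasurable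
  · exact (hB.slice ht').integrableOn (hF.slice ht').continuous
  · exact ((hF.dt hb).slice ht').continuous.aestronglyMeasurable
  · exact (ae_restrict_iff' measurableSet_H).2 (Eventually.of_forall fun p hp s hs =>
      hFB s (Ioo_subset_Icc_self hs) p hp)
  · exact Eventually.of_forall fun p s hs => hF.hasDerivAt hb hs p

/-- The material derivative. -/
noncomputable def mat (b : ℝ) (v f G : ℝ → ℝ × ℝ → ℝ) (t : ℝ) (p : ℝ × ℝ) : ℝ :=
  dt b G t p + v t p * dr (G t) p + f t p * dz (G t) p

variable {v f : ℝ → ℝ × ℝ → ℝ}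

theorem mat_mul (hb : 0 < b) (hF : Sm b F) (hG : Sm b G) {t : ℝ} (ht : t ∈ Ioo 0 b) (p : ℝ × ℝ) :
    mat b v f (fun t p => F t p * G t p) t p = mat b v f F t p * G t p + F t p * mat b v f G t p := by
  have ht' := Ioo_subset_Icc_self ht
  have sF := hF.slice ht'
  have sG := hG.slice ht'
  have h1 : dt b (fun t p => F t p * G t p) t p = dt b F t p * G t p + F t p * dt b G t p :=
    ((hF.mul hG).hasDerivAt hb ht p).unique ((hF.hasDerivAt hb ht p).mul (hG.hasDerivAt hb ht p))
  have h2 : dr (fun p => F t p * G t p) p = dr (F t) p * G t p + F t p * dr (G t) p :=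
    ((sF.hasDerivAt_r p.1 p.2).mul (sG.hasDerivAt_r p.1 p.2)).deriv
  have h3 : dz (fun p => F t p * G t p) p = dz (F t) p * G t p + F t p * dz (G t) p :=
    ((sF.hasDerivAt_z p.1 p.2).mul (sG.hasDerivAt_z p.1 p.2)).deriv
  simp only [mat, h1, h2, h3]
  ring

theorem Sm.comp_left (hF : Sm b F) {β : ℝ → ℝ} (hβ : ContDiff ℝ ∞ β) : Sm b (fun t p => β (F t p)) :=
  hβ.comp_contDiffOn hF

theorem mat_comp (hb : 0 < b) (hF : Sm b F) {β : ℝ → ℝ} (hβ : ContDiff ℝ ∞ β) {t : ℝ}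
    (ht : t ∈ Ioo 0 b) (p : ℝ × ℝ) :
    mat b v f (fun t p => β (F t p)) t p = deriv β (F t p) * mat b v f F t p := by
  have ht' := Ioo_subset_Icc_self ht
  have sF := hF.slice ht'
  have hd : HasDerivAt β (deriv β (F t p)) (F t p) := (hβ.differentiable (by simp) _).hasDerivAt
  have h1 : dt b (fun t p => β (F t p)) t p = deriv β (F t p) * dt b F t p :=
    ((hF.comp_left hβ).hasDerivAt hb ht p).unique (HasDerivAt.comp (h₂ := β) t hd (hF.hasDerivAt hb ht p))
  have h2 : dr (fun p => β (F t p)) p = deriv β (F t p) * dr (F t) p :=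
    (HasDerivAt.comp (h₂ := β) (h := fun s => F t (s, p.2)) p.1 hd (sF.hasDerivAt_r p.1 p.2)).deriv
  have h3 : dz (fun p => β (F t p)) p = deriv β (F t p) * dz (F t) p :=
    (HasDerivAt.comp (h₂ := β) (h := fun s => F t (p.1, s)) p.2 hd (sF.hasDerivAt_z p.1 p.2)).deriv
  simp only [mat, h1, h2, h3]
  ring

/-- Functions of time only. -/
theorem Sm.of_time {V : ℝ → ℝ} (hV : ContDiff ℝ ∞ V) : Sm b (fun t _ => V t) :=
  (hV.comp contDiff_fst).contDiffOn

theorem Sm.fst : Sm b (fun _ p => p.1) := Sm.of_slice Sl.fst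

theorem mat_of_time (hb : 0 < b) {V : ℝ → ℝ} (hV : ContDiff ℝ ∞ V) {t : ℝ} (ht : t ∈ Ioo 0 b)
    (p : ℝ × ℝ) : mat b v f (fun t _ => V t) t p = deriv V t := by
  have h1 : dt b (fun t _ => V t) t p = deriv V t :=
    ((Sm.of_time hV).hasDerivAt hb ht p).unique (hV.differentiable (by simp) t).hasDerivAt
  simp [mat, h1, dr, dz]

theorem mat_of_slice (hb : 0 < b) {g : ℝ × ℝ → ℝ} (hg : Sl g) {t : ℝ} (ht : t ∈ Ioo 0 b)
    (p : ℝ × ℝ) : mat b v f (fun _ p => g p) t p = v t p * dr g p + f t p * dz g p := by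
  have h1 : dt b (fun _ p => g p) t p = 0 :=
    ((Sm.of_slice hg).hasDerivAt hb ht p).unique (hasDerivAt_const t (g p))
  simp [mat, h1]

theorem mat_add (hb : 0 < b) (hF : Sm b F) (hG : Sm b G) {t : ℝ} (ht : t ∈ Ioo 0 b) (p : ℝ × ℝ) :
    mat b v f (fun t p => F t p + G t p) t p = mat b v f F t p + mat b v f G t p := by
  have ht' := Ioo_subset_Icc_self ht
  have sF := hF.slice ht'
  have sG := hG.slice ht'
  have h1 : dt b (fun t p => F t p + G t p) t p = dt b F t p + dt b G t p :=
    ((hF.add hG).hasDerivAt hb ht p).unique ((hF.hasDerivAt hb ht p).add (hG.hasDerivAt hb ht p))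
  have h2 : dr (fun p => F t p + G t p) p = dr (F t) p + dr (G t) p :=
    ((sF.hasDerivAt_r p.1 p.2).add (sG.hasDerivAt_r p.1 p.2)).deriv
  have h3 : dz (fun p => F t p + G t p) p = dz (F t) p + dz (G t) p :=
    ((sF.hasDerivAt_z p.1 p.2).add (sG.hasDerivAt_z p.1 p.2)).deriv
  simp only [mat, h1, h2, h3]
  ring

theorem Sm.mat (hb : 0 < b) (hv : Sm b v) (hf : Sm b f) (hG : Sm b G) : Sm b (HalfPlane.mat b v f G) :=
  ((hG.dt hb).add (hv.mul (hG.dr hb))).add (hf.mul (hG.dz hb))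

/-- A divergence free field does not change the integral. -/
theorem Prof.integral_transport {v f g : ℝ × ℝ → ℝ} (h : Prof v f) (hg : Sl g) (hB : BH g) :
    HI (fun p => p.1 * (v p * dr g p + f p * dz g p)) 0 := by
  have h1 : HI (fun p => v p * g p + p.1 * dr v p * g p + p.1 * v p * dr g p) 0 := by
    refine HI.dr_zero (G := fun p => p.1 * v p * g p) ?_ ?_ ?_ hB.mul_left (fun z => by simp)
    · exact ((Sl.fst.mul h.sv).mul hg).continuous
    · exact ((h.sv.mul hg).add ((Sl.fst.mul h.sv.dr).mul hg)).add ((Sl.fst.mul h.sv).mul hg.dr) |>.continuous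
    · intro r z _
      refine (((hasDerivAt_id r).mul (h.sv.hasDerivAt_r r z)).mul (hg.hasDerivAt_r r z)).congr_deriv ?_
      simp only [id, Pi.mul_apply]; ring
  have h2 : HI (fun p => p.1 * dz f p * g p + p.1 * f p * dz g p) 0 := by
    refine HI.dz_zero (G := fun p => p.1 * f p * g p) ?_ ?_ hB.mul_left
    · exact (((Sl.fst.mul h.sf.dz).mul hg).add ((Sl.fst.mul h.sf).mul hg.dz)).continuous
    · intro r z _
      refine (((h.sf.hasDerivAt_z r z).const_mul r).mul (hg.hasDerivAt_z r z)).congr_deriv ?_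
      ring
  refine ⟨((h1.add h2).congr fun p hp => ?_).int, ?_⟩
  · have hp : 0 < p.1 := hp
    have hd := h.div p hp
    have : v p + p.1 * dr v p + p.1 * dz f p = 0 := by
      have : p.1 * (dr v p + v p / p.1 + dz f p) = 0 := by rw [hd, mul_zero]
      rw [← this]; field_simp; ring
    linear_combination g p * this
  · refine ((h1.add h2).congr fun p hp => ?_).val.trans (by ring)
    have hp : 0 < p.1 := hp
    have hd := h.div p hp
    have : v p + p.1 * dr v p + p.1 * dz f p = 0 := by
      have : p.1 * (dr v p + v p / p.1 + dz f p) = 0 := by rw [hd, mul_zero]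
      rw [← this]; field_simp; ring
    linear_combination g p * this

end Evolution


section Transport

variable {b M : ℝ} {v f ρ G : ℝ → ℝ × ℝ → ℝ}

theorem HSol.hasDerivAt_integral (h : HSol b M v f ρ) (hG : Sm b G) (hB : BHt b G) {t : ℝ}
    (ht : t ∈ Ioo 0 b) :
    HasDerivAt (fun t => ∫ p in H, p.1 * G t p) (∫ p in H, p.1 * mat b v f G t p) t := by
  have hb := h.hb
  have ht' := Ioo_subset_Icc_self ht
  have s1 : Sm b (fun t p => p.1 * G t p) := Sm.fst.mul hG
  have hd := hasDerivAt_integral_of_Sm hb s1 (hB.mul_left (F := fun _ p => p.1)) ht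
  have e1 : ∀ p : ℝ × ℝ, dt b (fun t p => p.1 * G t p) t p = p.1 * dt b G t p := fun p =>
    (s1.hasDerivAt hb ht p).unique ((hG.hasDerivAt hb ht p).const_mul p.1)
  have h1 : HI (fun p => p.1 * dt b G t p) (∫ p in H, dt b (fun t p => p.1 * G t p) t p) := by
    have : HI (fun p => dt b (fun t p => p.1 * G t p) t p) _ :=
      HI.of (((hB.mul_left (F := fun _ p => p.1)).dt.slice ht').integrableOn ((s1.dt hb).slice ht').continuous)
    exact this.congr fun p _ => e1 p
  have h2 := (h.prof t ht').integral_transport (hG.slice ht') (hB.slice ht')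
  have h3 : HI (fun p => p.1 * mat b v f G t p) _ := (h1.add h2).congr fun p _ => by
    simp only [mat]; ring
  rw [h3.val, add_zero]
  exact hd

theorem HSol.integral_le (h : HSol b M v f ρ) (hG : Sm b G) (hB : BHt b G) {k : ℝ → ℝ} {t : ℝ}
    (ht : t ∈ Icc 0 b) (hk : IntegrableOn k (Icc 0 t))
    (hle : ∀ s ∈ Ioo 0 t, ∫ p in H, p.1 * mat b v f G s p ≤ k s) :
    ∫ p in H, p.1 * G t p ≤ (∫ p in H, p.1 * G 0 p) + ∫ s in (0:ℝ)..t, k s := by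
  have hc : ContinuousOn (fun t => ∫ p in H, p.1 * G t p) (Icc 0 t) :=
    ((hB.mul_left (F := fun _ p => p.1)).continuousOn_integral (Sm.fst.mul hG).continuousOn).mono
      (Icc_subset_Icc_right ht.2)
  have := intervalIntegral.sub_le_integral_of_hasDeriv_right_of_le ht.1 hc
    (fun s hs => (h.hasDerivAt_integral hG hB ⟨hs.1, hs.2.trans_le ht.2⟩).hasDerivWithinAt) hk hle
  linarith

theorem mem_closure_H {p : ℝ × ℝ} (hp : 0 ≤ p.1) : p ∈ closure H := by
  rw [H_eq, closure_prod_eq, closure_univ, closure_Ioi]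
  exact ⟨hp, mem_univ _⟩

theorem le_of_forall_H {g : ℝ × ℝ → ℝ} (hg : Continuous g) {c : ENNReal}
    (h : ∀ p : ℝ × ℝ, 0 < p.1 → ENNReal.ofReal |g p| ≤ c) {p : ℝ × ℝ} (hp : 0 ≤ p.1) :
    ENNReal.ofReal |g p| ≤ c :=
  closure_minimal (s := H) (t := {p | ENNReal.ofReal |g p| ≤ c}) (fun p hp => h p hp)
    (isClosed_le (ENNReal.continuous_ofReal.comp hg.abs) continuous_const) (mem_closure_H hp)

/-- A smooth majorant in time of the supremum over a compact set. -/
theorem exists_smooth_majorant (hb : 0 < b) {F : ℝ → ℝ × ℝ → ℝ}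
    (hF : ContinuousOn (fun q : ℝ × (ℝ × ℝ) => F q.1 q.2) (Icc 0 b ×ˢ univ)) {K : Set (ℝ × ℝ)}
    (hK : IsCompact K) (hne : K.Nonempty) :
    ∃ V : ℝ → ℝ, ContDiff ℝ ∞ V ∧ V 0 = 0 ∧ (∀ t ∈ Icc 0 b, ∀ p ∈ K, |F t p| ≤ deriv V t) ∧
      ∀ g : ℝ → ENNReal, (∀ t ∈ Icc 0 b, ∀ p ∈ K, ENNReal.ofReal |F t p| ≤ g t) →
        ∀ t ∈ Icc 0 b, ENNReal.ofReal (V t) ≤ (∫⁻ s in Icc 0 t, g s) + 1 := by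
  set F' : ℝ → ℝ × ℝ → ℝ := fun t p => |F (projIcc 0 b hb.le t) p| with hF'
  have hF'c : Continuous fun q : ℝ × (ℝ × ℝ) => F' q.1 q.2 := by
    refine Continuous.abs ?_
    have hm : ∀ q : ℝ × (ℝ × ℝ), ((projIcc 0 b hb.le q.1 : ℝ), q.2) ∈ Icc 0 b ×ˢ (univ : Set (ℝ × ℝ)) :=
      fun q => ⟨(projIcc 0 b hb.le q.1).2, mem_univ _⟩
    exact hF.comp_continuous (f := fun q : ℝ × (ℝ × ℝ) => ((projIcc 0 b hb.le q.1 : ℝ), q.2))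
      ((continuous_subtype_val.comp (continuous_projIcc.comp continuous_fst)).prodMk continuous_snd) hm
  set m : ℝ → ℝ := fun t => sSup (F' t '' K) with hm
  have hmc : Continuous m := hK.continuous_sSup hF'c
  have hslice : ∀ t, Continuous (F' t) := fun t =>
    hF'c.comp (continuous_const.prodMk continuous_id : Continuous fun p : ℝ × ℝ => (t, p))
  have heq : ∀ t ∈ Icc 0 b, ∀ p, F' t p = |F t p| := fun t ht p => by
    simp only [hF', projIcc_of_mem hb.le ht]
  have hle : ∀ t ∈ Icc 0 b, ∀ p ∈ K, |F t p| ≤ m t := fun t ht p hp => by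
    rw [← heq t ht]
    exact le_csSup (hK.bddAbove_image (hslice t).continuousOn) (mem_image_of_mem _ hp)
  set δ : ℝ := 1 / (2 * b + 2) with hδ
  have hδ0 : 0 < δ := by positivity
  obtain ⟨q, hq⟩ := exists_polynomial_near_of_continuousOn 0 b (fun t => m t + δ)
    (hmc.add continuous_const).continuousOn δ hδ0
  have hq1 : ∀ t ∈ Icc 0 b, m t ≤ q.eval t := fun t ht => by
    have := (abs_lt.1 (hq t ht)).1; linarith
  have hq2 : ∀ t ∈ Icc 0 b, q.eval t ≤ m t + 2 * δ := fun t ht => by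
    have := (abs_lt.1 (hq t ht)).2; linarith
  have hqc : Continuous fun t => q.eval t := q.continuous
  have hV : ∀ t, HasDerivAt (fun t => ∫ s in (0:ℝ)..t, q.eval s) (q.eval t) t := fun t =>
    intervalIntegral.integral_hasDerivAt_right (hqc.intervalIntegrable _ _)
      (hqc.stronglyMeasurableAtFilter _ _) hqc.continuousAt
  have hVd : deriv (fun t => ∫ s in (0:ℝ)..t, q.eval s) = fun t => q.eval t := funext fun t => (hV t).deriv
  refine ⟨fun t => ∫ s in (0:ℝ)..t, q.eval s, ?_, by simp, ?_, ?_⟩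
  · rw [contDiff_infty_iff_deriv]
    refine ⟨fun t => (hV t).differentiableAt, ?_⟩
    rw [hVd]
    exact q.contDiff_aeval ∞
  · intro t ht p hp
    rw [hVd]
    exact (hle t ht p hp).trans (hq1 t ht)
  · intro g hg t ht
    have hq0 : ∀ s ∈ Icc 0 b, 0 ≤ q.eval s := fun s hs => by
      obtain ⟨p, hp⟩ := hne
      exact (abs_nonneg _).trans ((hle s hs p hp).trans (hq1 s hs))
    show ENNReal.ofReal (∫ s in (0:ℝ)..t, q.eval s) ≤ _
    rw [intervalIntegral.integral_of_le ht.1, ← integral_Icc_eq_integral_Ioc,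
      ofReal_integral_eq_lintegral_ofReal (hqc.continuousOn.integrableOn_Icc)
      ((ae_restrict_iff' measurableSet_Icc).2 (Eventually.of_forall fun s hs =>
        hq0 s ⟨hs.1, hs.2.trans ht.2⟩))]
    calc ∫⁻ s in Icc 0 t, ENNReal.ofReal (q.eval s)
        ≤ ∫⁻ s in Icc 0 t, (g s + ENNReal.ofReal (2 * δ)) := by
          refine setLIntegral_mono' measurableSet_Icc fun s hs => ?_
          have hs' : s ∈ Icc 0 b := ⟨hs.1, hs.2.trans ht.2⟩
          obtain ⟨p, hp, hmp⟩ := hK.exists_sSup_image_eq hne (hslice s).continuousOn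
          have h1 : q.eval s ≤ |F s p| + 2 * δ := by
            rw [← heq s hs', ← hmp]; exact hq2 s hs'
          calc ENNReal.ofReal (q.eval s) ≤ ENNReal.ofReal (|F s p| + 2 * δ) := ENNReal.ofReal_le_ofReal h1
            _ = ENNReal.ofReal |F s p| + ENNReal.ofReal (2 * δ) :=
              ENNReal.ofReal_add (abs_nonneg _) (by positivity)
            _ ≤ _ := by gcongr; exact hg s hs' p hp
      _ = (∫⁻ s in Icc 0 t, g s) + ENNReal.ofReal (2 * δ) * ENNReal.ofReal t := by
          rw [lintegral_add_right _ measurable_const]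
          simp
      _ ≤ _ := by
          gcongr
          rw [← ENNReal.ofReal_mul (by positivity), ← ENNReal.ofReal_one]
          refine ENNReal.ofReal_le_ofReal ?_
          have : 2 * δ * t ≤ 2 * δ * b := by gcongr; exact ht.2
          refine this.trans ?_
          have hb2 : (2 * b + 2 : ℝ) ≠ 0 := by positivity
          rw [hδ]
          rw [mul_one_div, div_mul_eq_mul_div, div_le_one (by positivity)]
          linarith

/-- The Japanese bracket. -/
noncomputable def jap (s : ℝ) : ℝ := Real.sqrt (1 + s ^ 2)

theorem one_le_jap (s : ℝ) : 1 ≤ jap s := by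
  rw [jap, Real.le_sqrt' one_pos]; nlinarith [sq_nonneg s]
theorem jap_pos (s : ℝ) : 0 < jap s := one_pos.trans_le (one_le_jap s)
theorem jap_sq (s : ℝ) : jap s ^ 2 = 1 + s ^ 2 := Real.sq_sqrt (by positivity)
theorem abs_le_jap (s : ℝ) : |s| ≤ jap s := Real.le_sqrt_of_sq_le (by rw [sq_abs]; linarith)
theorem jap_le (s : ℝ) : jap s ≤ 1 + |s| := by
  rw [jap, Real.sqrt_le_left (by positivity)]
  nlinarith [abs_nonneg s, sq_abs s]

theorem contDiff_jap : ContDiff ℝ ∞ jap :=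
  ContDiff.sqrt (by fun_prop) fun s => by positivity

theorem hasDerivAt_jap (s : ℝ) : HasDerivAt jap (s / jap s) s := by
  have h : HasDerivAt (fun s : ℝ => 1 + s ^ 2) (2 * s) s := by
    simpa using (hasDerivAt_pow 2 s).const_add 1
  refine (h.sqrt (by positivity)).congr_deriv ?_
  have := jap_pos s
  rw [← jap]; field_simp

theorem abs_div_jap_le (s : ℝ) : |s / jap s| ≤ 1 := by
  rw [abs_div, abs_of_pos (jap_pos s), div_le_one (jap_pos s)]
  exact abs_le_jap s

theorem hasDerivAt_div_jap (s : ℝ) : HasDerivAt (fun s => s / jap s) (1 / jap s ^ 3) s := by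
  refine ((hasDerivAt_id s).div (hasDerivAt_jap s) (jap_pos s).ne').congr_deriv ?_
  have := jap_pos s
  have h2 := jap_sq s
  simp only [id]
  field_simp
  linarith

/-- Cutoffs which decrease along the flow. -/
structure MW (b X : ℝ) (v f : ℝ → ℝ × ℝ → ℝ) (R : ℝ) (Φ : ℝ → ℝ × ℝ → ℝ) : Prop where
  sm : Sm b Φ
  nonneg : ∀ t p, 0 ≤ Φ t p
  le_one : ∀ t p, Φ t p ≤ 1
  supp : ∀ t ∈ Icc 0 b, ∀ p : ℝ × ℝ, Φ t p ≠ 0 → |p.1| ≤ 2 * R ∧ |p.2| ≤ 2 * R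
  mat : ∀ t ∈ Ioo 0 b, ∀ p : ℝ × ℝ, 0 < p.1 → mat b v f Φ t p ≤ 0
  d1 : ∀ t ∈ Icc 0 b, ∀ p : ℝ × ℝ, |dr (Φ t) p| ≤ cutK / R
  d1' : ∀ t ∈ Icc 0 b, ∀ p : ℝ × ℝ, |dr (Φ t) p| ≤ cutK * |p.1| / R
  d2 : ∀ t ∈ Icc 0 b, ∀ p : ℝ × ℝ, |dr (dr (Φ t)) p| ≤ 2 * cutK / R
  flat : ∀ t ∈ Icc 0 b, ∀ p : ℝ × ℝ, |p.1| + 1 + X < R → dr (Φ t) p = 0 ∧ dr (dr (Φ t)) p = 0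
  one : ∀ t ∈ Icc 0 b, ∀ p : ℝ × ℝ, |p.1| + 1 + X ≤ R → |p.2| + 1 + X ≤ R → Φ t p = 1

theorem MW.bht {X R : ℝ} {Φ : ℝ → ℝ × ℝ → ℝ} (h : MW b X v f R Φ) : BHt b Φ := by
  refine ⟨2 * R, fun t ht p hp hc => ?_⟩
  by_contra hne
  have := h.supp t ht p hne
  rcases hc with hc | hc
  · exact absurd this.1 (not_le.2 (hc.trans_le (le_abs_self _)))
  · exact absurd this.2 (not_le.2 hc)

theorem monotone_of_deriv_nonneg_Icc {V : ℝ → ℝ} (hV : ContDiff ℝ ∞ V) (h : ∀ t ∈ Icc 0 b, 0 ≤ deriv V t) :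
    MonotoneOn V (Icc 0 b) :=
  monotoneOn_of_deriv_nonneg (convex_Icc 0 b) hV.continuous.continuousOn
    (hV.differentiable (by simp)).differentiableOn (fun t ht => h t (interior_subset ht))

theorem exists_MW (hb : 0 < b) {X R : ℝ} (hR : 1 ≤ R) {V : ℝ → ℝ} (hV : ContDiff ℝ ∞ V) (hV0 : V 0 = 0)
    (hVX : ∀ t ∈ Icc 0 b, V t ≤ X) (hV' : ∀ t ∈ Icc 0 b, 0 ≤ deriv V t)
    (hvf : ∀ t ∈ Icc 0 b, ∀ p : ℝ × ℝ, 0 < p.1 → |p.1| ≤ 2 * R → |p.2| ≤ 2 * R →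
      |v t p| ≤ deriv V t ∧ |f t p| ≤ deriv V t) :
    ∃ Φ, MW b X v f R Φ := by
  have hR0 : 0 < R := by linarith
  have hVnn : ∀ t ∈ Icc 0 b, 0 ≤ V t := fun t ht => by
    rw [← hV0]; exact monotone_of_deriv_nonneg_Icc hV hV' ⟨le_rfl, hb.le⟩ ht ht.1
  have hcK := one_le_cutK
  set A : ℝ → ℝ × ℝ → ℝ := fun t p => (jap p.1 + V t) * R⁻¹ with hA
  set B : ℝ → ℝ × ℝ → ℝ := fun t p => (jap p.2 + V t) * R⁻¹ with hB
  have hA' : ∀ t p, A t p = (jap p.1 + V t) / R := fun _ _ => rfl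
  have hB' : ∀ t p, B t p = (jap p.2 + V t) / R := fun _ _ => rfl
  have j1 : Sl fun p => jap p.1 := contDiff_jap.comp contDiff_fst
  have j2 : Sl fun p => jap p.2 := contDiff_jap.comp contDiff_snd
  have sA : Sm b A := ((Sm.of_slice j1).add (Sm.of_time hV)).mul (Sm.of_time contDiff_const)
  have sB : Sm b B := ((Sm.of_slice j2).add (Sm.of_time hV)).mul (Sm.of_time contDiff_const)
  have sCA : Sm b (fun t p => cut (A t p)) := sA.comp_left contDiff_cut
  have sCB : Sm b (fun t p => cut (B t p)) := sB.comp_left contDiff_cut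
  have boxA : ∀ t ∈ Icc 0 b, ∀ p, A t p ≤ 2 → |p.1| ≤ 2 * R := fun t ht p h => by
    rw [hA', div_le_iff₀ hR0] at h
    have := abs_le_jap p.1; have := hVnn t ht; linarith
  have boxB : ∀ t ∈ Icc 0 b, ∀ p, B t p ≤ 2 → |p.2| ≤ 2 * R := fun t ht p h => by
    rw [hB', div_le_iff₀ hR0] at h
    have := abs_le_jap p.2; have := hVnn t ht; linarith
  have mA : ∀ t ∈ Ioo 0 b, ∀ p, mat b v f A t p = (v t p * (p.1 / jap p.1) + deriv V t) * R⁻¹ := by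
    intro t ht p
    rw [hA, mat_mul hb ((Sm.of_slice j1).add (Sm.of_time hV)) (Sm.of_time contDiff_const) ht,
      mat_add hb (Sm.of_slice j1) (Sm.of_time hV) ht, mat_of_slice hb j1 ht, mat_of_time hb hV ht,
      mat_of_time hb contDiff_const ht]
    have e1 : dr (fun p => jap p.1) p = p.1 / jap p.1 := (hasDerivAt_jap p.1).deriv
    have e2 : dz (fun p => jap p.1) p = 0 := by simp [dz]
    rw [e1, e2]; simp
  have mB : ∀ t ∈ Ioo 0 b, ∀ p, mat b v f B t p = (f t p * (p.2 / jap p.2) + deriv V t) * R⁻¹ := by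
    intro t ht p
    rw [hB, mat_mul hb ((Sm.of_slice j2).add (Sm.of_time hV)) (Sm.of_time contDiff_const) ht,
      mat_add hb (Sm.of_slice j2) (Sm.of_time hV) ht, mat_of_slice hb j2 ht, mat_of_time hb hV ht,
      mat_of_time hb contDiff_const ht]
    have e1 : dr (fun p => jap p.2) p = 0 := by simp [dr]
    have e2 : dz (fun p => jap p.2) p = p.2 / jap p.2 := (hasDerivAt_jap p.2).deriv
    rw [e1, e2]; simp
  have key : ∀ x y c : ℝ, |x| ≤ c → |y| ≤ 1 → 0 ≤ (x * y + c) * R⁻¹ := fun x y c h1 h2 => by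
    have : |x * y| ≤ c := by
      rw [abs_mul]; exact (mul_le_of_le_one_right (abs_nonneg _) h2).trans h1
    have := (abs_le.1 this).1
    exact mul_nonneg (by linarith) (by positivity)
  have d1 : ∀ t, ∀ p : ℝ × ℝ, dr (fun p => cut (A t p) * cut (B t p)) p =
      deriv cut (A t p) * (p.1 / jap p.1 * R⁻¹) * cut (B t p) := fun t p => by
    have h1 : HasDerivAt (fun s => A t (s, p.2)) (p.1 / jap p.1 * R⁻¹) p.1 :=
      ((hasDerivAt_jap p.1).add_const (V t)).mul_const R⁻¹
    exact ((HasDerivAt.comp (h₂ := cut) (h := fun s => A t (s, p.2)) p.1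
      (hasDerivAt_cut _) h1).mul_const (cut (B t p))).deriv
  have d2 : ∀ t, ∀ p : ℝ × ℝ, dr (dr (fun p => cut (A t p) * cut (B t p))) p =
      (deriv (deriv cut) (A t p) * (p.1 / jap p.1 * R⁻¹) * (p.1 / jap p.1 * R⁻¹) +
        deriv cut (A t p) * (1 / jap p.1 ^ 3 * R⁻¹)) * cut (B t p) := fun t p => by
    rw [funext (d1 t)]
    have h1 : HasDerivAt (fun s => A t (s, p.2)) (p.1 / jap p.1 * R⁻¹) p.1 :=
      ((hasDerivAt_jap p.1).add_const (V t)).mul_const R⁻¹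
    exact (((HasDerivAt.comp (h₂ := deriv cut) (h := fun s => A t (s, p.2)) p.1
      (hasDerivAt_deriv_cut _) h1).mul ((hasDerivAt_div_jap p.1).mul_const R⁻¹)).mul_const (cut (B t p))).deriv
  have habsB : ∀ t p, |cut (B t p)| ≤ 1 := fun t p => by
    rw [abs_of_nonneg (cut_nonneg _)]; exact cut_le_one _
  refine ⟨fun t p => cut (A t p) * cut (B t p), sCA.mul sCB, fun t p => mul_nonneg (cut_nonneg _) (cut_nonneg _),
    fun t p => mul_le_one₀ (cut_le_one _) (cut_nonneg _) (cut_le_one _), ?_, ?_, ?_, ?_, ?_, ?_, ?_⟩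
  · intro t ht p hne
    refine ⟨boxA t ht p ?_, boxB t ht p ?_⟩
    · by_contra hc; exact hne (by simp [cut_eq_zero (not_le.1 hc).le])
    · by_contra hc; exact hne (by simp [cut_eq_zero (not_le.1 hc).le])
  · intro t ht p hp
    have ht' := Ioo_subset_Icc_self ht
    rw [mat_mul hb sCA sCB ht, mat_comp hb sA contDiff_cut ht, mat_comp hb sB contDiff_cut ht, mA t ht, mB t ht]
    by_cases h1 : A t p ≤ 2
    · by_cases h2 : B t p ≤ 2
      · have := hvf t ht' p hp (boxA t ht' p h1) (boxB t ht' p h2)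
        have k1 := key _ _ _ this.1 (abs_div_jap_le p.1)
        have k2 := key _ _ _ this.2 (abs_div_jap_le p.2)
        have n1 := mul_nonneg (mul_nonneg (neg_nonneg.2 (deriv_cut_nonpos (A t p))) k1) (cut_nonneg (B t p))
        have n2 := mul_nonneg (mul_nonneg (neg_nonneg.2 (deriv_cut_nonpos (B t p))) k2) (cut_nonneg (A t p))
        linarith
      · rw [cut_eq_zero (not_le.1 h2).le, deriv_cut_of_gt (not_le.1 h2)]; simp
    · rw [cut_eq_zero (not_le.1 h1).le, deriv_cut_of_gt (not_le.1 h1)]; simp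
  · intro t ht p
    rw [d1, abs_mul, abs_mul, abs_mul, abs_of_pos (inv_pos.2 hR0)]
    calc |deriv cut (A t p)| * (|p.1 / jap p.1| * R⁻¹) * |cut (B t p)| ≤ cutK * (1 * R⁻¹) * 1 := by
          gcongr
          · exact abs_deriv_cut_le _
          · exact abs_div_jap_le _
          · exact habsB t p
      _ = cutK / R := by ring
  · intro t ht p
    rw [d1, abs_mul, abs_mul, abs_mul, abs_of_pos (inv_pos.2 hR0)]
    calc |deriv cut (A t p)| * (|p.1 / jap p.1| * R⁻¹) * |cut (B t p)| ≤ cutK * (|p.1| * R⁻¹) * 1 := by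
          have hj : |p.1 / jap p.1| ≤ |p.1| := by
            rw [abs_div, abs_of_pos (jap_pos _)]
            exact div_le_self (abs_nonneg _) (one_le_jap _)
          refine mul_le_mul (mul_le_mul (abs_deriv_cut_le _) (mul_le_mul_of_nonneg_right hj (by positivity))
            (by positivity) (by positivity)) (habsB t p) (abs_nonneg _) (by positivity)
      _ = cutK * |p.1| / R := by ring
  · intro t ht p
    have hRi : R⁻¹ ≤ 1 := inv_le_one_of_one_le₀ hR
    have hRi0 : 0 < R⁻¹ := inv_pos.2 hR0
    rw [d2, abs_mul]
    have e1 : |deriv (deriv cut) (A t p) * (p.1 / jap p.1 * R⁻¹) * (p.1 / jap p.1 * R⁻¹)| ≤ cutK * R⁻¹ := by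
      rw [abs_mul, abs_mul, abs_mul, abs_of_pos hRi0]
      calc |deriv (deriv cut) (A t p)| * (|p.1 / jap p.1| * R⁻¹) * (|p.1 / jap p.1| * R⁻¹)
          ≤ cutK * (1 * 1) * (1 * R⁻¹) := by
            gcongr
            · exact abs_deriv_deriv_cut_le _
            · exact abs_div_jap_le _
            · exact abs_div_jap_le _
        _ = _ := by ring
    have e2 : |deriv cut (A t p) * (1 / jap p.1 ^ 3 * R⁻¹)| ≤ cutK * R⁻¹ := by
      have hj : 1 / jap p.1 ^ 3 ≤ 1 := by
        rw [div_le_one (by have := jap_pos p.1; positivity)]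
        exact one_le_pow₀ (one_le_jap _)
      have hj0 : 0 < 1 / jap p.1 ^ 3 := by have := jap_pos p.1; positivity
      rw [abs_mul, abs_mul, abs_of_pos hRi0, abs_of_pos hj0]
      calc |deriv cut (A t p)| * (1 / jap p.1 ^ 3 * R⁻¹) ≤ cutK * (1 * R⁻¹) := by
            gcongr
            exact abs_deriv_cut_le _
        _ = _ := by ring
    calc _ ≤ (cutK * R⁻¹ + cutK * R⁻¹) * 1 := by
          gcongr
          · exact (abs_add_le _ _).trans (add_le_add e1 e2)
          · exact habsB t p
      _ = _ := by ring
  · intro t ht p h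
    have : A t p < 1 := by
      rw [hA', div_lt_one hR0]
      have := jap_le p.1; have := hVX t ht; linarith
    rw [d1, d2, deriv_cut_of_lt this, deriv_deriv_cut_of_lt this]
    simp
  · intro t ht p h1 h2
    have hA1 : A t p ≤ 1 := by
      rw [hA', div_le_one hR0]
      have := jap_le p.1; have := hVX t ht; linarith
    have hB1 : B t p ≤ 1 := by
      rw [hB', div_le_one hR0]
      have := jap_le p.2; have := hVX t ht; linarith
    simp [cut_eq_one hA1, cut_eq_one hB1]

end Transport


section Density

variable {b M : ℝ} {v f ρ G : ℝ → ℝ × ℝ → ℝ}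

theorem abs_sub_le_of_partials {F : ℝ × ℝ → ℝ} (hF : Sl F) {l : ℝ}
    (h1 : ∀ p : ℝ × ℝ, 0 < p.1 → |dr F p| ≤ l) (h2 : ∀ p : ℝ × ℝ, 0 < p.1 → |dz F p| ≤ l)
    {p q : ℝ × ℝ} (hp : 0 < p.1) (hq : 0 < q.1) : |F p - F q| ≤ l * |p.1 - q.1| + l * |p.2 - q.2| := by
  have e1 : |F (p.1, p.2) - F (q.1, p.2)| ≤ l * |p.1 - q.1| :=
    Convex.norm_image_sub_le_of_norm_hasDerivWithin_le (s := Ioi (0:ℝ)) (f := fun s => F (s, p.2))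
      (fun s _ => (hF.hasDerivAt_r s p.2).hasDerivWithinAt) (fun s hs => h1 (s, p.2) hs) (convex_Ioi 0) hq hp
  have e2 : |F (q.1, p.2) - F (q.1, q.2)| ≤ l * |p.2 - q.2| :=
    Convex.norm_image_sub_le_of_norm_hasDerivWithin_le (s := univ) (f := fun s => F (q.1, s))
      (fun s _ => (hF.hasDerivAt_z q.1 s).hasDerivWithinAt) (fun s _ => h2 (q.1, s) hq) convex_univ
      (mem_univ _) (mem_univ _)
  have := abs_sub_le (F (p.1, p.2)) (F (q.1, p.2)) (F (q.1, q.2))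
  exact this.trans (add_le_add e1 e2)

/-- A Lipschitz function with finite energy is bounded. -/
theorem abs_le_of_lipschitz {F : ℝ × ℝ → ℝ} (hF : Sl F) {l M : ℝ}
    (h1 : ∀ p : ℝ × ℝ, 0 < p.1 → |dr F p| ≤ l) (h2 : ∀ p : ℝ × ℝ, 0 < p.1 → |dz F p| ≤ l)
    (hi : IntegrableOn (fun p => p.1 * F p ^ 2) H) (hM : ∫ p in H, p.1 * F p ^ 2 ≤ M)
    {p : ℝ × ℝ} (hp : 0 < p.1) : |F p| ≤ 3 * l + (M + 1) := by
  have hl : 0 ≤ l := (abs_nonneg _).trans (h1 p hp)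
  have hM0 : 0 ≤ M := le_trans (setIntegral_nonneg measurableSet_H fun q hq =>
    mul_nonneg (le_of_lt hq) (sq_nonneg _)) hM
  by_contra hcon
  push Not at hcon
  set S : Set (ℝ × ℝ) := Icc (p.1 + 1) (p.1 + 2) ×ˢ Icc p.2 (p.2 + 1) with hS
  have hSm : MeasurableSet S := measurableSet_Icc.prod measurableSet_Icc
  have hSH : S ⊆ H := fun q hq => by
    have : p.1 + 1 ≤ q.1 := hq.1.1
    show 0 < q.1
    linarith
  have hvol : (volume : Measure (ℝ × ℝ)).real S = 1 := by
    rw [measureReal_def, hS, Measure.volume_eq_prod, Measure.prod_prod, Real.volume_Icc, Real.volume_Icc]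
    norm_num
  have hlow : ∀ q ∈ S, (M + 1) ^ 2 ≤ q.1 * F q ^ 2 := fun q hq => by
    have hq1 : p.1 + 1 ≤ q.1 := hq.1.1
    have hq2 : q.1 ≤ p.1 + 2 := hq.1.2
    have hq3 : p.2 ≤ q.2 := hq.2.1
    have hq4 : q.2 ≤ p.2 + 1 := hq.2.2
    have hd := abs_sub_le_of_partials hF h1 h2 hp (hSH hq)
    have a1 : |p.1 - q.1| ≤ 2 := by rw [abs_le]; constructor <;> linarith
    have a2 : |p.2 - q.2| ≤ 1 := by rw [abs_le]; constructor <;> linarith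
    have hd2 : |F p - F q| ≤ 3 * l := by
      have := mul_le_mul_of_nonneg_left a1 hl
      have := mul_le_mul_of_nonneg_left a2 hl
      linarith
    have hd3 : |F p| - |F q| ≤ |F p - F q| := abs_sub_abs_le_abs_sub _ _
    have hF1 : M + 1 ≤ |F q| := by linarith
    have : (M + 1) ^ 2 ≤ F q ^ 2 := by rw [← sq_abs (F q)]; gcongr
    nlinarith [sq_nonneg (F q)]
  have e1 : (M + 1) ^ 2 * (volume : Measure (ℝ × ℝ)).real S ≤ ∫ q in S, q.1 * F q ^ 2 := by
    refine setIntegral_ge_of_const_le_real hSm ?_ hlow (hi.mono_set hSH)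
    exact (isCompact_Icc.prod isCompact_Icc).measure_lt_top.ne
  have e2 : ∫ q in S, q.1 * F q ^ 2 ≤ ∫ q in H, q.1 * F q ^ 2 :=
    setIntegral_mono_set hi ((ae_restrict_iff' measurableSet_H).2 (Eventually.of_forall fun q hq =>
      mul_nonneg (le_of_lt hq) (sq_nonneg _))) hSH.eventuallyLE
  rw [hvol] at e1
  nlinarith

theorem ofReal_abs_le_of_lipschitz {F : ℝ × ℝ → ℝ} (hF : Sl F) {l : ENNReal} {M : ℝ}
    (h1 : ∀ p : ℝ × ℝ, 0 < p.1 → ENNReal.ofReal |dr F p| ≤ l)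
    (h2 : ∀ p : ℝ × ℝ, 0 < p.1 → ENNReal.ofReal |dz F p| ≤ l)
    (hi : IntegrableOn (fun p => p.1 * F p ^ 2) H) (hM : ∫ p in H, p.1 * F p ^ 2 ≤ M)
    {p : ℝ × ℝ} (hp : 0 < p.1) : ENNReal.ofReal |F p| ≤ 3 * l + ENNReal.ofReal (M + 1) := by
  by_cases hl : l = ⊤
  · simp [hl]
  lift l to NNReal using hl
  have h1' : ∀ p : ℝ × ℝ, 0 < p.1 → |dr F p| ≤ l := fun p hp => by
    have := h1 p hp
    rw [← ENNReal.ofReal_coe_nnreal] at this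
    exact (ENNReal.ofReal_le_ofReal_iff l.coe_nonneg).1 this
  have h2' : ∀ p : ℝ × ℝ, 0 < p.1 → |dz F p| ≤ l := fun p hp => by
    have := h2 p hp
    rw [← ENNReal.ofReal_coe_nnreal] at this
    exact (ENNReal.ofReal_le_ofReal_iff l.coe_nonneg).1 this
  have := abs_le_of_lipschitz hF h1' h2' hi hM hp
  have hM0 : 0 ≤ M := le_trans (setIntegral_nonneg measurableSet_H fun q hq =>
    mul_nonneg (le_of_lt hq) (sq_nonneg _)) hM
  calc ENNReal.ofReal |F p| ≤ ENNReal.ofReal (3 * l + (M + 1)) := ENNReal.ofReal_le_ofReal this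
    _ = ENNReal.ofReal (3 * l) + ENNReal.ofReal (M + 1) := ENNReal.ofReal_add (by positivity) (by positivity)
    _ = _ := by rw [ENNReal.ofReal_mul (by norm_num), ENNReal.ofReal_coe_nnreal]; norm_num

theorem Prof.abs_quot_le {v f : ℝ × ℝ → ℝ} (_h : Prof v f) {l : ENNReal}
    (h1 : ∀ p : ℝ × ℝ, 0 < p.1 → ENNReal.ofReal |HalfPlane.dr v p| ≤ l) {p : ℝ × ℝ} (hp : 0 < p.1) :
    ENNReal.ofReal |quot v p| ≤ l := by
  by_cases hl : l = ⊤
  · simp [hl]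
  lift l to NNReal using hl
  rw [← ENNReal.ofReal_coe_nnreal]
  refine ENNReal.ofReal_le_ofReal ?_
  have : ‖∫ s in (0:ℝ)..1, s ^ 0 * HalfPlane.dr v (s * p.1, p.2)‖ ≤ (l : ℝ) * |1 - 0| := by
    refine intervalIntegral.norm_integral_le_of_norm_le_const fun s hs => ?_
    rw [uIoc_of_le zero_le_one] at hs
    have := h1 (s * p.1, p.2) (mul_pos hs.1 hp)
    rw [← ENNReal.ofReal_coe_nnreal] at this
    simpa using (ENNReal.ofReal_le_ofReal_iff l.coe_nonneg).1 this
  simpa [quot, Av] using this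

/-- Qualitative bounds of the velocity. -/
theorem HSol.exists_velocity_bound (h : HSol b M v f ρ) : ∃ g : ℝ → ENNReal, Measurable g ∧ ∫⁻ t in Icc 0 b, g t < ⊤ ∧
    ∀ t ∈ Icc 0 b, ∀ p : ℝ × ℝ, 0 < p.1 → ENNReal.ofReal |v t p| ≤ g t ∧ ENNReal.ofReal |f t p| ≤ g t ∧
      ENNReal.ofReal |quot (v t) p| ≤ g t := by
  obtain ⟨g, hgm, hgi, hg⟩ := h.lip
  refine ⟨fun t => 3 * g t + ENNReal.ofReal (M + 1), (hgm.const_mul 3).add_const _, ?_, fun t ht p hp => ?_⟩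
  · rw [lintegral_add_right _ measurable_const, lintegral_const_mul' _ _ (by norm_num)]
    refine ENNReal.add_lt_top.2 ⟨ENNReal.mul_lt_top (by norm_num) hgi, ?_⟩
    simp [ENNReal.mul_lt_top]
  · have pr := h.prof t ht
    have hI := h.L2 t ht
    have i1 : IntegrableOn (fun p => p.1 * v t p ^ 2) H ∧ ∫ p in H, p.1 * v t p ^ 2 ≤ M := by
      have hi : IntegrableOn (fun p => p.1 * v t p ^ 2) H :=
        Integrable.mono' hI.1 (Sl.fst.mul (pr.sv.pow 2)).continuous.aestronglyMeasurable
          ((ae_restrict_iff' measurableSet_H).2 (Eventually.of_forall fun q hq => by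
            have hq : 0 < q.1 := hq
            rw [Real.norm_of_nonneg (by positivity)]
            nlinarith [sq_nonneg (f t q)]))
      exact ⟨hi, ((HI.of hi).le (HI.of hI.1) fun q hq => by
        have hq : 0 < q.1 := hq
        nlinarith [sq_nonneg (f t q)]).trans hI.2⟩
    have i2 : IntegrableOn (fun p => p.1 * f t p ^ 2) H ∧ ∫ p in H, p.1 * f t p ^ 2 ≤ M := by
      have hi : IntegrableOn (fun p => p.1 * f t p ^ 2) H :=
        Integrable.mono' hI.1 (Sl.fst.mul (pr.sf.pow 2)).continuous.aestronglyMeasurable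
          ((ae_restrict_iff' measurableSet_H).2 (Eventually.of_forall fun q hq => by
            have hq : 0 < q.1 := hq
            rw [Real.norm_of_nonneg (by positivity)]
            nlinarith [sq_nonneg (v t q)]))
      exact ⟨hi, ((HI.of hi).le (HI.of hI.1) fun q hq => by
        have hq : 0 < q.1 := hq
        nlinarith [sq_nonneg (v t q)]).trans hI.2⟩
    refine ⟨ofReal_abs_le_of_lipschitz pr.sv (fun q hq => (hg t ht q hq).1)
      (fun q hq => (hg t ht q hq).2.1) i1.1 i1.2 hp,
      ofReal_abs_le_of_lipschitz pr.sf (fun q hq => (hg t ht q hq).2.2.1)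
      (fun q hq => (hg t ht q hq).2.2.2) i2.1 i2.2 hp,
      (pr.abs_quot_le (fun q hq => (hg t ht q hq).1) hp).trans ?_⟩
    calc g t = 1 * g t := (one_mul _).symm
      _ ≤ 3 * g t := by gcongr; norm_num
      _ ≤ _ := le_self_add

/-- The compact sets supporting the cutoffs. -/
def box (R : ℝ) : Set (ℝ × ℝ) := Icc 0 (2 * R) ×ˢ Icc (-(2 * R)) (2 * R)

theorem isCompact_box (R : ℝ) : IsCompact (box R) := isCompact_Icc.prod isCompact_Icc
theorem box_nonempty {R : ℝ} (hR : 1 ≤ R) : (box R).Nonempty :=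
  ⟨(0, 0), ⟨le_rfl, by linarith⟩, by simp; linarith, by simp; linarith⟩
theorem mem_box {R : ℝ} {p : ℝ × ℝ} (hp : 0 < p.1) (h1 : |p.1| ≤ 2 * R) (h2 : |p.2| ≤ 2 * R) : p ∈ box R :=
  ⟨⟨hp.le, (le_abs_self _).trans h1⟩, abs_le.1 h2⟩

theorem HSol.exists_weight (h : HSol b M v f ρ) : ∃ X : ℝ, 0 ≤ X ∧ ∀ R : ℝ, 1 ≤ R → ∃ Φ, MW b X v f R Φ := by
  have hb := h.hb
  obtain ⟨g, _, hgi, hg⟩ := h.exists_velocity_bound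
  refine ⟨((∫⁻ t in Icc 0 b, (g t + g t)) + 1).toReal, ENNReal.toReal_nonneg, fun R hR => ?_⟩
  have hfin : (∫⁻ t in Icc 0 b, (g t + g t)) + 1 < ⊤ := by
    have : ∀ t, g t + g t = 2 * g t := fun t => (two_mul _).symm
    simp only [this]
    rw [lintegral_const_mul' _ _ (by norm_num)]
    exact ENNReal.add_lt_top.2 ⟨ENNReal.mul_lt_top (by norm_num) hgi, by norm_num⟩
  obtain ⟨V, hV, hV0, hVd, hVb⟩ := exists_smooth_majorant hb (F := fun t p => |v t p| + |f t p|)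
    (h.sv.continuousOn.abs.add h.sf.continuousOn.abs) (isCompact_box R) (box_nonempty hR)
  have hnn : ∀ t p, |(|v t p| + |f t p|)| = |v t p| + |f t p| := fun t p => abs_of_nonneg (by positivity)
  simp only [hnn] at hVd hVb
  refine exists_MW hb hR hV hV0 (fun t ht => ?_) (fun t ht => ?_) (fun t ht p hp h1 h2 => ?_)
  · have := hVb (fun t => g t + g t) (fun t ht p hp => ?_) t ht
    · refine (ENNReal.ofReal_le_iff_le_toReal hfin.ne).1 (this.trans ?_)
      gcongr
      exact ht.2
    · rw [ENNReal.ofReal_add (abs_nonneg _) (abs_nonneg _)]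
      exact add_le_add
        (le_of_forall_H (h.sv.slice ht).continuous (fun q hq => (hg t ht q hq).1) hp.1.1)
        (le_of_forall_H (h.sf.slice ht).continuous (fun q hq => (hg t ht q hq).2.1) hp.1.1)
  · obtain ⟨p, hp⟩ := box_nonempty hR
    exact le_trans (by positivity) (hVd t ht p hp)
  · have := hVd t ht p (mem_box hp h1 h2)
    constructor <;> linarith [abs_nonneg (v t p), abs_nonneg (f t p)]

theorem HSol.integral_mul_weight_le (h : HSol b M v f ρ) {X R : ℝ} {Φ : ℝ → ℝ × ℝ → ℝ} (hΦ : MW b X v f R Φ)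
    (hG : Sm b G) (hnn : ∀ t ∈ Icc 0 b, ∀ p : ℝ × ℝ, 0 < p.1 → 0 ≤ G t p)
    (hm : ∀ t ∈ Ioo 0 b, ∀ p ∈ box R, 0 < p.1 → mat b v f G t p ≤ 0) {t : ℝ} (ht : t ∈ Icc 0 b) :
    ∫ p in H, p.1 * (G t p * Φ t p) ≤ ∫ p in H, p.1 * (G 0 p * Φ 0 p) := by
  have := h.integral_le (hG.mul hΦ.sm) hΦ.bht.mul_left ht (k := fun _ => 0) (by simp) (fun s hs => ?_)
  · simpa using this
  · have hs : s ∈ Ioo 0 b := ⟨hs.1, hs.2.trans_le ht.2⟩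
    refine setIntegral_nonpos measurableSet_H fun p hp => ?_
    have hp : 0 < p.1 := hp
    have hs' := Ioo_subset_Icc_self hs
    rw [mat_mul h.hb hG hΦ.sm hs]
    have h1 : G s p * mat b v f Φ s p ≤ 0 := mul_nonpos_of_nonneg_of_nonpos (hnn s hs' p hp) (hΦ.mat s hs p hp)
    have h2 : mat b v f G s p * Φ s p ≤ 0 := by
      by_cases h0 : Φ s p = 0
      · simp [h0]
      · have := hΦ.supp s hs' p h0
        exact mul_nonpos_of_nonpos_of_nonneg (hm s hs p (mem_box hp this.1 this.2) hp) (hΦ.nonneg s p)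
    exact mul_nonpos_of_nonneg_of_nonpos hp.le (by linarith)

theorem HSol.mul_weight_eq_zero (h : HSol b M v f ρ) {X R : ℝ} {Φ : ℝ → ℝ × ℝ → ℝ} (hΦ : MW b X v f R Φ)
    (hG : Sm b G) (h0 : ∀ p : ℝ × ℝ, 0 < p.1 → G 0 p = 0)
    (hnn : ∀ t ∈ Icc 0 b, ∀ p : ℝ × ℝ, 0 < p.1 → 0 ≤ G t p)
    (hm : ∀ t ∈ Ioo 0 b, ∀ p ∈ box R, 0 < p.1 → mat b v f G t p ≤ 0) {t : ℝ} (ht : t ∈ Icc 0 b)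
    {p : ℝ × ℝ} (hp : 0 < p.1) : G t p * Φ t p = 0 := by
  have hle := h.integral_mul_weight_le hΦ hG hnn hm ht
  have e0 : ∫ p in H, p.1 * (G 0 p * Φ 0 p) = 0 :=
    setIntegral_eq_zero_of_forall_eq_zero fun p hp => by simp [h0 p hp]
  rw [e0] at hle
  have hc : Continuous fun p => p.1 * (G t p * Φ t p) :=
    (Sl.fst.mul ((hG.slice ht).mul (hΦ.sm.slice ht))).continuous
  have hB : BH fun p => p.1 * (G t p * Φ t p) := (hΦ.bht.slice ht).mul_left.mul_left
  have hpos : ∀ p ∈ H, 0 ≤ p.1 * (G t p * Φ t p) := fun p hp =>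
    mul_nonneg (le_of_lt hp) (mul_nonneg (hnn t ht p hp) (hΦ.nonneg t p))
  have heq := le_antisymm hle (setIntegral_nonneg measurableSet_H hpos)
  have hae := (setIntegral_eq_zero_iff_of_nonneg_ae ((ae_restrict_iff' measurableSet_H).2
    (Eventually.of_forall hpos)) (hB.integrableOn hc)).1 heq
  have := Measure.eqOn_open_of_ae_eq hae isOpen_H hc.continuousOn continuousOn_const hp
  have h1 : p.1 * (G t p * Φ t p) = 0 := this
  exact (mul_eq_zero.1 h1).resolve_left hp.ne'


end Density


section Density

variable {b M : ℝ} {v f ρ G : ℝ → ℝ × ℝ → ℝ}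

theorem HSol.mat_rho (h : HSol b M v f ρ) {β : ℝ → ℝ} (hβ : ContDiff ℝ ∞ β) {t : ℝ} (ht : t ∈ Ioo 0 b)
    {p : ℝ × ℝ} (hp : 0 < p.1) : mat b v f (fun t p => β (ρ t p)) t p = 0 := by
  rw [mat_comp h.hb h.sρ hβ ht]
  have := h.trans t ht p hp
  simp only [mat, this, mul_zero]

theorem contDiff_smoothTransition_comp {g : ℝ → ℝ} (hg : ContDiff ℝ ∞ g) :
    ContDiff ℝ ∞ fun s => Real.smoothTransition (g s) := Real.smoothTransition.contDiff.comp hg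

theorem smoothTransition_eq_zero_iff {s : ℝ} : Real.smoothTransition s = 0 ↔ s ≤ 0 :=
  ⟨fun h => by
    by_contra hc
    exact (Real.smoothTransition.pos_of_pos (not_le.1 hc)).ne' h, Real.smoothTransition.zero_of_nonpos⟩

theorem deriv_smoothTransition_nonneg (s : ℝ) : 0 ≤ deriv Real.smoothTransition s :=
  Real.smoothTransition.monotone.deriv_nonneg

theorem HSol.abs_rho_le (h : HSol b M v f ρ) {L : ℝ} (hL : 0 ≤ L)
    (h0 : ∀ p : ℝ × ℝ, 0 < p.1 → |ρ 0 p| ≤ L) {t : ℝ} (ht : t ∈ Icc 0 b) {p : ℝ × ℝ} (hp : 0 < p.1) :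
    |ρ t p| ≤ L := by
  obtain ⟨X, hX0, hX⟩ := h.exists_weight
  obtain ⟨Φ, hΦ⟩ := hX (max 1 (max |p.1| |p.2| + 1 + X)) (le_max_left _ _)
  have hβ : ContDiff ℝ ∞ fun s : ℝ => Real.smoothTransition (s ^ 2 - L ^ 2) :=
    contDiff_smoothTransition_comp (by fun_prop)
  have key := h.mul_weight_eq_zero hΦ (G := fun t p => Real.smoothTransition (ρ t p ^ 2 - L ^ 2))
    (h.sρ.comp_left hβ)
    (fun p hp => Real.smoothTransition.zero_of_nonpos (by
      have := pow_le_pow_left₀ (abs_nonneg _) (h0 p hp) 2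
      rw [sq_abs] at this; linarith))
    (fun t _ p _ => Real.smoothTransition.nonneg _)
    (fun t ht p _ hp => (h.mat_rho hβ ht hp).le) ht hp
  have h1 : |p.1| + 1 + X ≤ max 1 (max |p.1| |p.2| + 1 + X) :=
    le_trans (by linarith [le_max_left |p.1| |p.2|]) (le_max_right _ _)
  have h2 : |p.2| + 1 + X ≤ max 1 (max |p.1| |p.2| + 1 + X) :=
    le_trans (by linarith [le_max_right |p.1| |p.2|]) (le_max_right _ _)
  rw [hΦ.one t ht p h1 h2, mul_one, smoothTransition_eq_zero_iff] at key
  exact abs_le_of_sq_le_sq (by linarith) hL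

theorem HSol.integral_rho_pow_le (h : HSol b M v f ρ) (n : ℕ)
    (hi : IntegrableOn (fun p => p.1 * ρ 0 p ^ (2 * n)) H) {t : ℝ} (ht : t ∈ Icc 0 b) :
    IntegrableOn (fun p => p.1 * ρ t p ^ (2 * n)) H ∧
      ∫ p in H, p.1 * ρ t p ^ (2 * n) ≤ ∫ p in H, p.1 * ρ 0 p ^ (2 * n) := by
  obtain ⟨X, hX0, hX⟩ := h.exists_weight
  choose Φ hΦ using fun n : ℕ => hX (n + 1) (by linarith [Nat.cast_nonneg (α := ℝ) n])
  have hβ : ContDiff ℝ ∞ fun s : ℝ => s ^ (2 * n) := by fun_prop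
  have sG : Sm b fun t p => ρ t p ^ (2 * n) := h.sρ.comp_left hβ
  have hnn : ∀ t p, 0 ≤ ρ t p ^ (2 * n) := fun t p => by rw [pow_mul]; positivity
  refine integrableOn_of_cutoff (X := fun k => Φ k t) (ε := fun _ => 0)
    (Sl.fst.mul (sG.slice ht)).continuous.aestronglyMeasurable (fun p hp => mul_nonneg (le_of_lt hp) (hnn t p))
    (fun k p _ => (hΦ k).nonneg t p) (fun p _ => ?_) (Eventually.of_forall fun k => ?_)
    (Eventually.of_forall fun k => ?_) tendsto_const_nhds
  · refine tendsto_const_nhds.congr' ?_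
    filter_upwards [eventually_ge_atTop (Nat.ceil (max |p.1| |p.2| + 1 + X))] with k hk
    have h3 : max |p.1| |p.2| + 1 + X ≤ k + 1 := (Nat.le_ceil _).trans (by
      have : ((Nat.ceil (max |p.1| |p.2| + 1 + X) : ℕ) : ℝ) ≤ k := by exact_mod_cast hk
      linarith)
    exact ((hΦ k).one t ht p (by linarith [le_max_left |p.1| |p.2|])
      (by linarith [le_max_right |p.1| |p.2|])).symm
  · exact ((hΦ k).bht.slice ht).mul_right.integrableOn
      ((hΦ k).sm.slice ht |>.mul (Sl.fst.mul (sG.slice ht))).continuous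
  · have key := h.integral_mul_weight_le (hΦ k) sG (fun t _ p _ => hnn t p)
      (fun t ht p _ hp => (h.mat_rho hβ ht hp).le) ht
    have h0 : (0:ℝ) ∈ Icc 0 b := ⟨le_rfl, h.hb.le⟩
    have e1 : ∫ p in H, p.1 * (ρ 0 p ^ (2 * n) * Φ k 0 p) ≤ ∫ p in H, p.1 * ρ 0 p ^ (2 * n) := by
      refine (HI.of ?_).le (HI.of hi) fun p hp => ?_
      · exact (((hΦ k).bht.slice h0).mul_left.mul_left).integrableOn
          (Sl.fst.mul ((sG.slice h0).mul ((hΦ k).sm.slice h0))).continuous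
      · exact mul_le_mul_of_nonneg_left (mul_le_of_le_one_right (hnn 0 p) ((hΦ k).le_one 0 p)) (le_of_lt hp)
    have e2 : ∫ p in H, Φ k t p * (p.1 * ρ t p ^ (2 * n)) = ∫ p in H, p.1 * (ρ t p ^ (2 * n) * Φ k t p) := by
      congr 1; funext p; ring
    rw [e2, add_zero]
    exact key.trans e1

theorem mat_rho_mul (h : HSol b M v f ρ) (hG : Sm b G) {t : ℝ} (ht : t ∈ Ioo 0 b) {p : ℝ × ℝ} (hp : 0 < p.1) :
    mat b v f (fun t p => ρ t p ^ 2 * G t p) t p = ρ t p ^ 2 * mat b v f G t p := by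
  have hβ : ContDiff ℝ ∞ fun s : ℝ => s ^ 2 := by fun_prop
  rw [mat_mul h.hb (h.sρ.comp_left hβ) hG ht, h.mat_rho hβ ht hp]
  ring

theorem HSol.rho_eq_zero_of_barrier (h : HSol b M v f ρ) {X R : ℝ} {Φ : ℝ → ℝ × ℝ → ℝ} (hΦ : MW b X v f R Φ)
    {t : ℝ} (ht : t ∈ Icc 0 b) {p : ℝ × ℝ} (hp : 0 < p.1) (hR : max |p.1| |p.2| + 1 + X ≤ R) (hG : Sm b G)
    (hnn : ∀ t p, 0 ≤ G t p) (h0 : ∀ p : ℝ × ℝ, 0 < p.1 → ρ 0 p ≠ 0 → G 0 p = 0)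
    (hm : ∀ t ∈ Ioo 0 b, ∀ p ∈ box R, 0 < p.1 → mat b v f G t p ≤ 0) (hpos : G t p ≠ 0) : ρ t p = 0 := by
  have hβ : ContDiff ℝ ∞ fun s : ℝ => s ^ 2 := by fun_prop
  have key := h.mul_weight_eq_zero hΦ (G := fun t p => ρ t p ^ 2 * G t p) ((h.sρ.comp_left hβ).mul hG)
    (fun p hp => by
      by_cases hr : ρ 0 p = 0
      · simp [hr]
      · simp [h0 p hp hr])
    (fun t _ p _ => mul_nonneg (sq_nonneg _) (hnn t p))
    (fun t ht p hpb hp => by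
      rw [mat_rho_mul h hG ht hp]
      exact mul_nonpos_of_nonneg_of_nonpos (sq_nonneg _) (hm t ht p hpb hp)) ht hp
  have h1 : |p.1| + 1 + X ≤ R := le_trans (by linarith [le_max_left |p.1| |p.2|]) hR
  have h2 : |p.2| + 1 + X ≤ R := le_trans (by linarith [le_max_right |p.1| |p.2|]) hR
  rw [hΦ.one t ht p h1 h2, mul_one, mul_eq_zero, or_iff_left hpos] at key
  exact pow_eq_zero_iff (two_ne_zero) |>.1 key

theorem ofReal_le_add_one {x y : ℝ} (hy : 0 ≤ y) {c : ENNReal} (h1 : ENNReal.ofReal x ≤ c + 1)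
    (h2 : c ≤ ENNReal.ofReal y) : x ≤ y + 1 := by
  have : ENNReal.ofReal x ≤ ENNReal.ofReal (y + 1) := by
    rw [ENNReal.ofReal_add hy zero_le_one, ENNReal.ofReal_one]
    exact h1.trans (by gcongr)
  exact (ENNReal.ofReal_le_ofReal_iff (by linarith)).1 this

/-- The density stays away from the axis. -/
theorem HSol.rho_eq_zero_near (h : HSol b M v f ρ) {d Y : ℝ} (hY : 0 ≤ Y)
    (h0 : ∀ p : ℝ × ℝ, 0 < p.1 → p.1 < d → ρ 0 p = 0) {g : ℝ → ENNReal}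
    (hg : ∀ t ∈ Icc 0 b, ∀ p : ℝ × ℝ, 0 < p.1 → ENNReal.ofReal |quot (v t) p| ≤ g t)
    {t : ℝ} (ht : t ∈ Icc 0 b) (hgY : ∫⁻ s in Icc 0 t, g s ≤ ENNReal.ofReal Y)
    {p : ℝ × ℝ} (hp : 0 < p.1) (hpd : p.1 * Real.exp (Y + 1) < d) : ρ t p = 0 := by
  have hb := h.hb
  obtain ⟨X, hX0, hX⟩ := h.exists_weight
  set R := max 1 (max |p.1| |p.2| + 1 + X)
  have hR : 1 ≤ R := le_max_left _ _
  obtain ⟨Φ, hΦ⟩ := hX R hR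
  obtain ⟨W, hW, hW0, hWd, hWb⟩ := exists_smooth_majorant hb (F := fun t => quot (v t))
    h.s_quot.continuousOn (isCompact_box R) (box_nonempty hR)
  have hWt : W t ≤ Y + 1 := ofReal_le_add_one hY (hWb g (fun s hs p hp =>
    le_of_forall_H (h.s_quot.slice hs).continuous (hg s hs) hp.1.1) t ht) hgY
  have sE : ContDiff ℝ ∞ fun t => Real.exp (W t) := hW.exp
  have sA : Sm b fun t p => p.1 * Real.exp (W t) := Sm.fst.mul (Sm.of_time sE)
  have hβ : ContDiff ℝ ∞ fun s : ℝ => Real.smoothTransition (d - s) :=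
    contDiff_smoothTransition_comp (by fun_prop)
  refine h.rho_eq_zero_of_barrier hΦ ht hp (le_max_right _ _)
    (G := fun t p => Real.smoothTransition (d - p.1 * Real.exp (W t))) (sA.comp_left hβ)
    (fun t p => Real.smoothTransition.nonneg _) (fun p hp hr => ?_) (fun s hs q hq hq0 => ?_) ?_
  · refine Real.smoothTransition.zero_of_nonpos ?_
    rw [hW0, Real.exp_zero, mul_one, sub_nonpos]
    by_contra hc
    exact hr (h0 p hp (not_le.1 hc))
  · rw [mat_comp hb sA hβ hs, mat_mul hb Sm.fst (Sm.of_time sE) hs, mat_of_slice hb Sl.fst hs,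
      mat_of_time hb sE hs]
    have hs' := Ioo_subset_Icc_self hs
    have e1 : dr (fun p => p.1) q = 1 := by simp [dr]
    have e2 : dz (fun p => p.1) q = 0 := by simp [dz]
    have e3 : deriv (fun t => Real.exp (W t)) s = Real.exp (W s) * deriv W s :=
      ((hW.differentiable (by simp) s).hasDerivAt.exp).deriv
    have e4 : deriv (fun s : ℝ => Real.smoothTransition (d - s)) (q.1 * Real.exp (W s)) =
        - deriv Real.smoothTransition (d - q.1 * Real.exp (W s)) := by
      rw [deriv_comp_const_sub]
    rw [e1, e2, e3, e4, (h.prof s hs').v_eq q]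
    have := (abs_le.1 (hWd s hs' q hq)).1
    have k := mul_nonneg (mul_nonneg (deriv_smoothTransition_nonneg (d - q.1 * Real.exp (W s)))
      (mul_nonneg hq0.le (Real.exp_pos (W s)).le)) (by linarith : 0 ≤ quot (v s) q + deriv W s)
    linarith
  · rw [Ne, smoothTransition_eq_zero_iff, not_le, sub_pos]
    refine lt_of_le_of_lt ?_ hpd
    gcongr

/-- The density has finite speed of propagation in the vertical direction. -/
theorem HSol.rho_eq_zero_far (h : HSol b M v f ρ) {l X' : ℝ} (hX' : 0 ≤ X')
    (h0 : ∀ p : ℝ × ℝ, 0 < p.1 → l < |p.2| → ρ 0 p = 0) {g : ℝ → ENNReal}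
    (hg : ∀ t ∈ Icc 0 b, ∀ p : ℝ × ℝ, 0 < p.1 → ENNReal.ofReal |f t p| ≤ g t)
    {t : ℝ} (ht : t ∈ Icc 0 b) (hgX : ∫⁻ s in Icc 0 t, g s ≤ ENNReal.ofReal X')
    {p : ℝ × ℝ} (hp : 0 < p.1) (hpl : l + X' + 2 < |p.2|) : ρ t p = 0 := by
  have hb := h.hb
  obtain ⟨X, hX0, hX⟩ := h.exists_weight
  set R := max 1 (max |p.1| |p.2| + 1 + X)
  have hR : 1 ≤ R := le_max_left _ _
  obtain ⟨Φ, hΦ⟩ := hX R hR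
  obtain ⟨W, hW, hW0, hWd, hWb⟩ := exists_smooth_majorant hb (F := f)
    h.sf.continuousOn (isCompact_box R) (box_nonempty hR)
  have hWt : W t ≤ X' + 1 := ofReal_le_add_one hX' (hWb g (fun s hs p hp =>
    le_of_forall_H (h.sf.slice hs).continuous (hg s hs) hp.1.1) t ht) hgX
  have j2 : Sl fun p => jap p.2 := contDiff_jap.comp contDiff_snd
  have hW' : ContDiff ℝ ∞ fun t => - W t := hW.neg
  have sA : Sm b fun t p => jap p.2 + - W t := (Sm.of_slice j2).add (Sm.of_time hW')
  have hβ : ContDiff ℝ ∞ fun s : ℝ => Real.smoothTransition (s - (1 + l)) :=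
    contDiff_smoothTransition_comp (by fun_prop)
  refine h.rho_eq_zero_of_barrier hΦ ht hp (le_max_right _ _)
    (G := fun t p => Real.smoothTransition (jap p.2 + - W t - (1 + l))) (sA.comp_left hβ)
    (fun t p => Real.smoothTransition.nonneg _) (fun p hp hr => ?_) (fun s hs q hq hq0 => ?_) ?_
  · refine Real.smoothTransition.zero_of_nonpos ?_
    have : |p.2| ≤ l := by
      by_contra hc
      exact hr (h0 p hp (not_le.1 hc))
    have := jap_le p.2
    rw [hW0]; linarith
  · rw [mat_comp hb sA hβ hs, mat_add hb (Sm.of_slice j2) (Sm.of_time hW') hs, mat_of_slice hb j2 hs,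
      mat_of_time hb hW' hs]
    have hs' := Ioo_subset_Icc_self hs
    have e1 : dr (fun p => jap p.2) q = 0 := by simp [dr]
    have e2 : dz (fun p => jap p.2) q = q.2 / jap q.2 := (hasDerivAt_jap q.2).deriv
    have e3 : deriv (fun t => - W t) s = - deriv W s := deriv.fun_neg
    have e4 : deriv (fun s : ℝ => Real.smoothTransition (s - (1 + l))) (jap q.2 + - W s) =
        deriv Real.smoothTransition (jap q.2 + - W s - (1 + l)) := by
      rw [deriv_comp_sub_const]
    rw [e1, e2, e3, e4]
    have hfb : f s q * (q.2 / jap q.2) ≤ deriv W s := by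
      refine (le_abs_self _).trans ?_
      rw [abs_mul]
      exact (mul_le_of_le_one_right (abs_nonneg _) (abs_div_jap_le _)).trans (hWd s hs' q hq)
    exact mul_nonpos_of_nonneg_of_nonpos (deriv_smoothTransition_nonneg _) (by linarith)
  · rw [Ne, smoothTransition_eq_zero_iff, not_le]
    have := abs_le_jap p.2
    linarith

/-- The density in `L²` with the singular weight `1/r`. -/
theorem integral_rho_sq_div_le {σ : ℝ × ℝ → ℝ} (hσ : Sl σ) {d L Z A : ℝ} (hd : 0 < d) (hZ : 0 ≤ Z)
    (hi : IntegrableOn (fun p => p.1 * σ p ^ 2) H) (hA : ∫ p in H, p.1 * σ p ^ 2 ≤ A)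
    (hL : ∀ p : ℝ × ℝ, 0 < p.1 → |σ p| ≤ L) (h1 : ∀ p : ℝ × ℝ, 0 < p.1 → p.1 < d → σ p = 0)
    (h2 : ∀ p : ℝ × ℝ, 0 < p.1 → Z < |p.2| → σ p = 0) (hd1 : d ≤ 1) :
    IntegrableOn (fun p => σ p ^ 2 / p.1) H ∧
      ∫ p in H, σ p ^ 2 / p.1 ≤ A + 2 * L ^ 2 * Z * Real.log d⁻¹ := by
  set S : Set (ℝ × ℝ) := Icc d 1 ×ˢ Icc (-Z) Z with hS
  have hSm : MeasurableSet S := measurableSet_Icc.prod measurableSet_Icc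
  have hSH : S ⊆ H := fun q hq => lt_of_lt_of_le hd hq.1.1
  have hL0 : 0 ≤ L := (abs_nonneg _).trans (hL (1, 0) one_pos)
  have iS : IntegrableOn (fun p : ℝ × ℝ => p.1⁻¹) S := by
    refine ContinuousOn.integrableOn_compact (isCompact_Icc.prod isCompact_Icc) ?_
    exact continuousOn_fst.inv₀ fun q hq => (hSH hq).ne'
  have vS : ∫ p in S, p.1⁻¹ = Real.log d⁻¹ * (2 * Z) := by
    have e1 := setIntegral_prod_mul (μ := volume) (ν := volume) (fun r : ℝ => r⁻¹) (fun _ : ℝ => (1:ℝ))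
      (Icc d 1) (Icc (-Z) Z)
    simp only [mul_one] at e1
    rw [hS, Measure.volume_eq_prod, e1]
    congr 1
    · rw [integral_Icc_eq_integral_Ioc, ← intervalIntegral.integral_of_le hd1, integral_inv_of_pos hd one_pos]
      simp
    · rw [integral_Icc_eq_integral_Ioc, ← intervalIntegral.integral_of_le (by linarith), intervalIntegral.integral_const]
      simp; ring
  have I1 : HI (S.indicator fun p => p.1⁻¹) (Real.log d⁻¹ * (2 * Z)) := by
    refine ⟨(iS.integrable_indicator hSm).integrableOn, ?_⟩
    rw [setIntegral_indicator hSm, inter_eq_self_of_subset_right hSH, vS]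
  have I2 := (HI.of hi).add (I1.const_mul (L ^ 2))
  have hpt : ∀ p ∈ H, σ p ^ 2 / p.1 ≤ p.1 * σ p ^ 2 + L ^ 2 * S.indicator (fun p => p.1⁻¹) p := fun p hp => by
    have hp : 0 < p.1 := hp
    by_cases hpS : p ∈ S
    · rw [indicator_of_mem hpS, div_eq_mul_inv]
      have e : σ p ^ 2 ≤ L ^ 2 := by rw [← sq_abs]; exact pow_le_pow_left₀ (abs_nonneg _) (hL p hp) 2
      have : σ p ^ 2 * p.1⁻¹ ≤ L ^ 2 * p.1⁻¹ := by gcongr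
      nlinarith [mul_nonneg hp.le (sq_nonneg (σ p))]
    · rw [indicator_of_notMem hpS, mul_zero, add_zero]
      by_cases hr : p.1 ≤ 1
      · have : σ p = 0 := by
          by_contra hne
          refine hpS ⟨⟨?_, hr⟩, abs_le.1 ?_⟩
          · by_contra hc; exact hne (h1 p hp (not_le.1 hc))
          · by_contra hc; exact hne (h2 p hp (not_le.1 hc))
        simp [this]
      · have : 1 ≤ p.1 := (not_le.1 hr).le
        rw [div_le_iff₀ hp]
        have : 1 ≤ p.1 * p.1 := by nlinarith
        nlinarith [sq_nonneg (σ p)]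
  have hi3 : IntegrableOn (fun p => σ p ^ 2 / p.1) H := by
    refine Integrable.mono' I2.int ?_ ((ae_restrict_iff' measurableSet_H).2 (Eventually.of_forall fun p hp => ?_))
    · exact ((hσ.continuous.pow 2).measurable.div measurable_fst).aestronglyMeasurable
    · have hp0 : 0 < p.1 := hp
      rw [Real.norm_of_nonneg (by positivity)]
      exact hpt p hp
  exact ⟨hi3, by have := (HI.of hi3).le I2 hpt; linarith⟩

end Density


section GammaEstimate

variable {b M : ℝ} {v f ρ G : ℝ → ℝ × ℝ → ℝ}

theorem Sl.BH_dr {g : ℝ × ℝ → ℝ} (hg : Sl g) (hB : BH g) : BH (HalfPlane.dr g) :=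
  hB.dr fun r z _ => hg.hasDerivAt_r r z
theorem Sl.BH_dz {g : ℝ × ℝ → ℝ} (hg : Sl g) (hB : BH g) : BH (HalfPlane.dz g) :=
  hB.dz fun r z _ => hg.hasDerivAt_z r z

theorem HSol.integrableOn_mat (h : HSol b M v f ρ) (hG : Sm b G) (hB : BHt b G) {t : ℝ}
    (ht : t ∈ Icc 0 b) : IntegrableOn (fun p => p.1 * mat b v f G t p) H := by
  have sG := hG.slice ht
  have B : BH (mat b v f G t) := ((hB.dt.slice ht).add ((sG.BH_dr (hB.slice ht)).mul_left)).add
    ((sG.BH_dz (hB.slice ht)).mul_left)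
  exact B.mul_left.integrableOn (Sl.fst.mul ((h.sv.mat h.hb h.sf hG).slice ht)).continuous

/-- The vorticity is square integrable. -/
theorem HSol.integral_vort_sq_le (h : HSol b M v f ρ) {t : ℝ} (ht : t ∈ Icc 0 b) :
    IntegrableOn (fun p => p.1 * vort (v t) (f t) p ^ 2) H ∧
      ∫ p in H, p.1 * vort (v t) (f t) p ^ 2 ≤ 2 * M := by
  obtain ⟨i1, i2⟩ := h.H1 t ht
  have key : ∀ p ∈ H, p.1 * vort (v t) (f t) p ^ 2 ≤ 2 * (p.1 * (dr (v t) p ^ 2 + dz (v t) p ^ 2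
      + dr (f t) p ^ 2 + dz (f t) p ^ 2)) := fun p hp => by
    have hp : 0 < p.1 := hp
    have : vort (v t) (f t) p ^ 2 ≤ 2 * (dr (v t) p ^ 2 + dz (v t) p ^ 2
      + dr (f t) p ^ 2 + dz (f t) p ^ 2) := by
      simp only [vort]
      nlinarith [sq_nonneg (dz (v t) p + dr (f t) p), sq_nonneg (dr (v t) p), sq_nonneg (dz (f t) p)]
    nlinarith [mul_le_mul_of_nonneg_left this hp.le]
  have hi : IntegrableOn (fun p => p.1 * vort (v t) (f t) p ^ 2) H :=
    Integrable.mono' (i1.const_mul 2)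
      (Sl.fst.mul ((h.s_vort.slice ht).pow 2)).continuous.aestronglyMeasurable
      ((ae_restrict_iff' measurableSet_H).2 (Eventually.of_forall fun p hp => by
        have hp' : 0 < p.1 := hp
        rw [Real.norm_of_nonneg (by positivity)]
        exact key p hp))
  exact ⟨hi, by have := (HI.of hi).le ((HI.of i1).const_mul 2) key; linarith⟩

theorem gam_pointwise {r g gr grr φ φr φrr s sr m mφ w K : ℝ} (hr : 0 < r) (hφ : 0 ≤ φ) (hφ1 : φ ≤ 1)
    (hmφ : mφ ≤ 0) (hm : r * m = r * grr + 3 * gr - sr) (hw : w = r * g) (hK : 0 ≤ K)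
    (h1 : |φr| ≤ K) (h2 : |φrr| ≤ 2 * K) (hflat : r < 1 → φr = 0 ∧ φrr = 0) :
    r * (2 * g * m * φ + g ^ 2 * mφ) ≤
      (2 * g * gr * φ + 2 * r * gr ^ 2 * φ + 2 * r * g * grr * φ + 2 * r * g * gr * φr + 4 * g * gr * φ
        + 2 * g ^ 2 * φr - g ^ 2 * φr - 2 * r * g * gr * φr - r * g ^ 2 * φrr
        - (2 * gr * φ * s + 2 * g * φr * s + 2 * g * φ * sr))
      - φ * (r * gr ^ 2) + s ^ 2 / r + 4 * K * (r * w ^ 2 + r * s ^ 2) := by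
  have e1 : r * g ^ 2 * mφ ≤ 0 := mul_nonpos_of_nonneg_of_nonpos (by positivity) hmφ
  have e2 : 2 * s * gr * φ ≤ φ * (r * gr ^ 2) + s ^ 2 / r := by
    have h3 : 2 * s * gr ≤ r * gr ^ 2 + s ^ 2 / r := by
      have : r * gr ^ 2 + s ^ 2 / r - 2 * s * gr = (r * gr - s) ^ 2 / r := by field_simp; ring
      have : 0 ≤ (r * gr - s) ^ 2 / r := by positivity
      linarith
    have h4 : φ * (s ^ 2 / r) ≤ s ^ 2 / r := mul_le_of_le_one_left (by positivity) hφ1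
    nlinarith [mul_le_mul_of_nonneg_left h3 hφ]
  have e3 : g ^ 2 * (r * φrr - φr) + 2 * s * g * φr ≤ 4 * K * (r * w ^ 2 + r * s ^ 2) := by
    by_cases hr1 : r < 1
    · obtain ⟨z1, z2⟩ := hflat hr1
      rw [z1, z2]
      have : 0 ≤ 4 * K * (r * w ^ 2 + r * s ^ 2) := by positivity
      linarith
    · have hr1 : 1 ≤ r := not_lt.1 hr1
      have a1 : g ^ 2 * r ≤ r * w ^ 2 := by
        rw [hw]
        have : g ^ 2 ≤ (r * g) ^ 2 := by
          rw [mul_pow]; exact le_mul_of_one_le_left (sq_nonneg _) (one_le_pow₀ hr1)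
        nlinarith
      have a2 : g ^ 2 ≤ g ^ 2 * r := le_mul_of_one_le_right (sq_nonneg _) hr1
      have a3 : s ^ 2 ≤ r * s ^ 2 := le_mul_of_one_le_left (sq_nonneg _) hr1
      have b1 : g ^ 2 * (r * φrr) ≤ r * w ^ 2 * (2 * K) := by
        calc g ^ 2 * (r * φrr) = (g ^ 2 * r) * φrr := by ring
          _ ≤ (g ^ 2 * r) * (2 * K) := by gcongr; exact (le_abs_self _).trans h2
          _ ≤ _ := by gcongr
      have b2 : g ^ 2 * (-φr) ≤ r * w ^ 2 * K := by
        calc g ^ 2 * (-φr) ≤ g ^ 2 * K := by gcongr; exact (neg_le_abs _).trans h1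
          _ ≤ _ := by gcongr; exact a2.trans a1
      have b3 : 2 * s * g * φr ≤ (r * s ^ 2 + r * w ^ 2) * K := by
        calc 2 * s * g * φr ≤ |2 * s * g * φr| := le_abs_self _
          _ = |2 * s * g| * |φr| := abs_mul _ _
          _ ≤ (s ^ 2 + g ^ 2) * K := by
            refine mul_le_mul ?_ h1 (abs_nonneg _) (by positivity)
            rw [abs_le]
            constructor <;> nlinarith [sq_nonneg (s + g), sq_nonneg (s - g)]
          _ ≤ _ := by gcongr; exact a2.trans a1
      have : 0 ≤ r * s ^ 2 * K := by positivity
      linarith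
  have e4 : r * (2 * g * m * φ + g ^ 2 * mφ) = 2 * g * φ * (r * m) + r * g ^ 2 * mφ := by ring
  rw [e4, hm]
  nlinarith

theorem HSol.gam_integral_mat_le (h : HSol b M v f ρ) {X R A n : ℝ} {Φ : ℝ → ℝ × ℝ → ℝ} (hΦ : MW b X v f R Φ)
    (hR : X + 2 ≤ R) (hR0 : 0 < R) {t : ℝ} (ht : t ∈ Ioo 0 b)
    (hρ : IntegrableOn (fun p => p.1 * ρ t p ^ 2) H) (hA : ∫ p in H, p.1 * ρ t p ^ 2 ≤ A)
    (hρ' : IntegrableOn (fun p => ρ t p ^ 2 / p.1) H) (hn : ∫ p in H, ρ t p ^ 2 / p.1 ≤ n)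
    (haxis : ∀ z, ρ t (0, z) = 0) :
    ∫ p in H, p.1 * mat b v f (fun t p => gam (v t) (f t) p ^ 2 * Φ t p) t p ≤
      n + 4 * (cutK / R) * (2 * M + A) - ∫ p in H, Φ t p * (p.1 * dr (gam (v t) (f t)) p ^ 2) := by
  have hb := h.hb
  have ht' := Ioo_subset_Icc_self ht
  have pr := h.prof t ht'
  have sg := pr.s_gam
  have sφ := hΦ.sm.slice ht'
  have sρ := h.sρ.slice ht'
  have hK : 0 ≤ cutK / R := div_nonneg (zero_le_one.trans one_le_cutK) hR0.le
  have Bφ := hΦ.bht.slice ht'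
  have hβ : ContDiff ℝ ∞ fun s : ℝ => s ^ 2 := by fun_prop
  have sG2 : Sm b fun t p => gam (v t) (f t) p ^ 2 := h.s_gam.comp_left hβ
  set g := gam (v t) (f t) with hg
  set φ := Φ t with hφ
  set s := ρ t with hs
  have I1 := HI.of (h.integrableOn_mat (sG2.mul hΦ.sm) hΦ.bht.mul_left ht')
  have I2 : HI (fun p => φ p * (p.1 * dr g p ^ 2)) _ := HI.of
    (Bφ.mul_right.integrableOn (sφ.mul (Sl.fst.mul (sg.dr.pow 2))).continuous)
  obtain ⟨iw, vw⟩ := h.integral_vort_sq_le ht'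
  have I3 := ((HI.of iw).add (HI.of hρ)).const_mul (4 * (cutK / R))
  let J : ℝ × ℝ → ℝ := fun p => (2 * p.1 * g p * dr g p * φ p + 2 * g p ^ 2 * φ p
    - p.1 * g p ^ 2 * dr φ p) - 2 * g p * φ p * s p
  let Jr : ℝ × ℝ → ℝ := fun p => 2 * g p * dr g p * φ p + 2 * p.1 * dr g p ^ 2 * φ p
    + 2 * p.1 * g p * dr (dr g) p * φ p + 2 * p.1 * g p * dr g p * dr φ p + 4 * g p * dr g p * φ p
    + 2 * g p ^ 2 * dr φ p - g p ^ 2 * dr φ p - 2 * p.1 * g p * dr g p * dr φ p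
    - p.1 * g p ^ 2 * dr (dr φ) p
    - (2 * dr g p * φ p * s p + 2 * g p * dr φ p * s p + 2 * g p * φ p * dr s p)
  have c0 := sg.continuous
  have c1 := sg.dr.continuous
  have c2 := sg.dr.dr.continuous
  have c3 := sφ.continuous
  have c4 := sφ.dr.continuous
  have c5 := sφ.dr.dr.continuous
  have c6 := sρ.continuous
  have c7 := sρ.dr.continuous
  have cJ : Continuous J := by simp only [J]; fun_prop
  have cJr : Continuous Jr := by simp only [Jr]; fun_prop
  have dJ : ∀ r z, 0 < r → HasDerivAt (fun x => J (x, z)) (Jr (r, z)) r := fun r z _ => by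
    have h0 := hasDerivAt_id r
    have h1 := sg.hasDerivAt_r r z
    have h2 := sg.dr.hasDerivAt_r r z
    have h3 := sφ.hasDerivAt_r r z
    have h4 := sφ.dr.hasDerivAt_r r z
    have h5 := sρ.hasDerivAt_r r z
    refine ((((((h0.const_mul 2).mul h1).mul h2).mul h3).add (((h1.pow 2).const_mul 2).mul h3)).sub
      ((h0.mul (h1.pow 2)).mul h4)).sub (((h1.const_mul 2).mul h3).mul h5) |>.congr_deriv ?_
    simp only [id, Pi.mul_apply, Pi.pow_apply, Jr]
    push_cast
    ring
  have BJ : BH J := by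
    obtain ⟨L, hL⟩ := Bφ
    obtain ⟨L', hL'⟩ := sφ.BH_dr (hΦ.bht.slice ht')
    refine ⟨max L L', fun p hp hh => ?_⟩
    have e1 := hL p hp (hh.imp (lt_of_le_of_lt (le_max_left _ _)) (lt_of_le_of_lt (le_max_left _ _)))
    have e2 := hL' p hp (hh.imp (lt_of_le_of_lt (le_max_right _ _)) (lt_of_le_of_lt (le_max_right _ _)))
    simp only [J, e1, e2]; ring
  have IJ : HI Jr _ := HI.of ((BJ.dr dJ).integrableOn cJr)
  have hJ0 : ∫ p in H, Jr p ≤ 0 := integral_dr_nonpos cJ cJr dJ BJ fun z => by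
    have := haxis z
    have h0 := hΦ.nonneg t (0, z)
    simp only [J, this]
    have : 0 ≤ 2 * g (0, z) ^ 2 * φ (0, z) := by positivity
    linarith
  have key := I1.le (((IJ.sub I2).add (HI.of hρ')).add I3) fun p hp => by
    have hp : 0 < p.1 := hp
    rw [mat_mul hb sG2 hΦ.sm ht, mat_comp hb h.s_gam hβ ht]
    have e1 : deriv (fun s : ℝ => s ^ 2) (gam (v t) (f t) p) = 2 * gam (v t) (f t) p := by simp
    rw [e1]
    have := gam_pointwise (K := cutK / R) (s := s p) hp (hΦ.nonneg t p) (hΦ.le_one t p) (hΦ.mat t ht p hp)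
      (h.gam_equation ht p hp) (pr.vort_eq p) hK (hΦ.d1 t ht' p)
      (by have := hΦ.d2 t ht' p; rwa [mul_div_assoc] at this)
      (fun hr => hΦ.flat t ht' p (by rw [abs_of_pos hp]; linarith))
    exact this
  have : 4 * (cutK / R) * ((∫ p in H, p.1 * vort (v t) (f t) p ^ 2) + ∫ p in H, p.1 * s p ^ 2) ≤
      4 * (cutK / R) * (2 * M + A) := by gcongr
  linarith

theorem liminf_add_liminf_le (u w : ℕ → ENNReal) : liminf u atTop + liminf w atTop ≤ liminf (fun n => u n + w n) atTop := by
  simp only [liminf_eq_iSup_iInf_of_nat]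
  rw [ENNReal.iSup_add_iSup_of_monotone]
  · refine iSup_mono fun n => le_iInf₂ fun i hi => ?_
    exact add_le_add (iInf₂_le i hi) (iInf₂_le i hi)
  · exact fun n m hnm => le_iInf₂ fun i hi => iInf₂_le i (hnm.trans hi)
  · exact fun n m hnm => le_iInf₂ fun i hi => iInf₂_le i (hnm.trans hi)

/-- Fatou's lemma for cutoffs. -/
theorem lintegral_le_liminf_of_tendsto {Q : ℝ × ℝ → ℝ} {Φ : ℕ → ℝ × ℝ → ℝ} (hQ : Continuous Q)
    (hΦ : ∀ k, Continuous (Φ k)) (hlim : ∀ p, Tendsto (fun k => Φ k p) atTop (𝓝 1)) :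
    ∫⁻ p in H, ENNReal.ofReal (Q p) ≤ liminf (fun k => ∫⁻ p in H, ENNReal.ofReal (Φ k p * Q p)) atTop := by
  refine le_trans (le_of_eq ?_) (lintegral_liminf_le fun k =>
    (ENNReal.continuous_ofReal.comp ((hΦ k).mul hQ)).measurable)
  refine lintegral_congr fun p => ?_
  have : Tendsto (fun k => ENNReal.ofReal (Φ k p * Q p)) atTop (𝓝 (ENNReal.ofReal (Q p))) := by
    have := ENNReal.tendsto_ofReal ((hlim p).mul_const (Q p))
    simpa using this
  exact this.liminf_eq.symm

theorem ofReal_integral_H {Q : ℝ × ℝ → ℝ} (hi : IntegrableOn Q H) (hQ : ∀ p ∈ H, 0 ≤ Q p) :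
    ∫⁻ p in H, ENNReal.ofReal (Q p) = ENNReal.ofReal (∫ p in H, Q p) :=
  (ofReal_integral_eq_lintegral_ofReal hi ((ae_restrict_iff' measurableSet_H).2 (Eventually.of_forall hQ))).symm

theorem MW.tendsto_one {X : ℝ} {Φ : ℕ → ℝ → ℝ × ℝ → ℝ} {c : ℝ} (hΦ : ∀ n : ℕ, MW b X v f (n + c) (Φ n))
    {t : ℝ} (ht : t ∈ Icc 0 b) (p : ℝ × ℝ) : Tendsto (fun n => Φ n t p) atTop (𝓝 1) := by
  refine tendsto_const_nhds.congr' ?_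
  filter_upwards [eventually_ge_atTop (Nat.ceil (max |p.1| |p.2| + 1 + X - c))] with k hk
  have h3 : max |p.1| |p.2| + 1 + X - c ≤ k := (Nat.le_ceil _).trans (by exact_mod_cast hk)
  exact ((hΦ k).one t ht p (by linarith [le_max_left |p.1| |p.2|])
    (by linarith [le_max_right |p.1| |p.2|])).symm

/-- The estimate of `Γ`. -/
theorem HSol.gam_estimate (h : HSol b M v f ρ) {A C₀ : ℝ} {N : ℝ → ℝ}
    (hρ : ∀ t ∈ Icc 0 b, IntegrableOn (fun p => p.1 * ρ t p ^ 2) H ∧ ∫ p in H, p.1 * ρ t p ^ 2 ≤ A)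
    (hN : ∀ t ∈ Icc 0 b, IntegrableOn (fun p => ρ t p ^ 2 / p.1) H ∧ ∫ p in H, ρ t p ^ 2 / p.1 ≤ N t)
    (hNc : IntegrableOn N (Icc 0 b)) (haxis : ∀ t ∈ Icc 0 b, ∀ z, ρ t (0, z) = 0)
    (hi : IntegrableOn (fun p => p.1 * gam (v 0) (f 0) p ^ 2) H)
    (hC : ∫ p in H, p.1 * gam (v 0) (f 0) p ^ 2 ≤ C₀) {t : ℝ} (ht : t ∈ Icc 0 b) :
    (∫⁻ p in H, ENNReal.ofReal (p.1 * gam (v t) (f t) p ^ 2)) +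
      ∫⁻ s in Icc 0 t, ∫⁻ p in H, ENNReal.ofReal (p.1 * dr (gam (v s) (f s)) p ^ 2) ≤
      ENNReal.ofReal (C₀ + ∫ s in (0:ℝ)..t, N s) := by
  have hb := h.hb
  obtain ⟨X, hX0, hX⟩ := h.exists_weight
  choose Φ hΦ using fun n : ℕ => hX (n + (X + 2)) (by linarith [Nat.cast_nonneg (α := ℝ) n])
  have hβ : ContDiff ℝ ∞ fun s : ℝ => s ^ 2 := by fun_prop
  have sG2 : Sm b fun t p => gam (v t) (f t) p ^ 2 := h.s_gam.comp_left hβ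
  have hsub : Icc 0 t ⊆ Icc 0 b := Icc_subset_Icc_right ht.2
  have h00 : (0:ℝ) ∈ Icc 0 b := ⟨le_rfl, hb.le⟩
  have sD : Sm b fun t p => p.1 * dr (gam (v t) (f t)) p ^ 2 :=
    Sm.fst.mul ((h.s_gam.dr hb).comp_left hβ)
  set c : ℕ → ℝ := fun k => 4 * (cutK / (k + (X + 2))) * (2 * M + A) with hc
  have hD : ∀ k, ContinuousOn (fun s => ∫ p in H, Φ k s p * (p.1 * dr (gam (v s) (f s)) p ^ 2)) (Icc 0 b) := fun k => by
    have B : BHt b fun s p => Φ k s p * (p.1 * dr (gam (v s) (f s)) p ^ 2) := by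
      obtain ⟨L, hL⟩ := (hΦ k).bht
      exact ⟨L, fun t ht p hp h => by simp [hL t ht p hp h]⟩
    exact B.continuousOn_integral ((hΦ k).sm.mul sD).continuousOn
  have main : ∀ k, (∫ p in H, Φ k t p * (p.1 * gam (v t) (f t) p ^ 2)) +
      (∫ s in (0:ℝ)..t, ∫ p in H, Φ k s p * (p.1 * dr (gam (v s) (f s)) p ^ 2)) ≤
      C₀ + (∫ s in (0:ℝ)..t, N s) + t * c k := fun k => by
    have iN : IntervalIntegrable N volume 0 t := by
      rw [intervalIntegrable_iff_integrableOn_Icc_of_le ht.1]; exact hNc.mono_set hsub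
    have iD : IntervalIntegrable (fun s => ∫ p in H, Φ k s p * (p.1 * dr (gam (v s) (f s)) p ^ 2)) volume 0 t :=
      ((hD k).mono hsub).intervalIntegrable_of_Icc ht.1
    have ic : IntervalIntegrable (fun _ : ℝ => c k) volume 0 t := intervalIntegrable_const
    have key := h.integral_le (sG2.mul (hΦ k).sm) (hΦ k).bht.mul_left ht
      (k := fun s => N s + c k - ∫ p in H, Φ k s p * (p.1 * dr (gam (v s) (f s)) p ^ 2))
      (by rw [← intervalIntegrable_iff_integrableOn_Icc_of_le ht.1]; exact (iN.add ic).sub iD)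
      (fun s hs => by
        have hs : s ∈ Ioo 0 b := ⟨hs.1, hs.2.trans_le ht.2⟩
        have hs' := Ioo_subset_Icc_self hs
        exact h.gam_integral_mat_le (hΦ k) (by linarith [Nat.cast_nonneg (α := ℝ) k])
          (by linarith [Nat.cast_nonneg (α := ℝ) k]) hs (hρ s hs').1 (hρ s hs').2 (hN s hs').1 (hN s hs').2
          (haxis s hs'))
    rw [intervalIntegral.integral_sub (iN.add ic) iD, intervalIntegral.integral_add iN ic,
      intervalIntegral.integral_const] at key
    have e1 : ∫ p in H, p.1 * (gam (v 0) (f 0) p ^ 2 * Φ k 0 p) ≤ C₀ := by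
      refine ((HI.of ?_).le (HI.of hi) fun p hp => ?_).trans hC
      · exact (((hΦ k).bht.slice h00).mul_left.mul_left).integrableOn
          (Sl.fst.mul ((sG2.slice h00).mul ((hΦ k).sm.slice h00))).continuous
      · exact mul_le_mul_of_nonneg_left (mul_le_of_le_one_right (sq_nonneg _) ((hΦ k).le_one 0 p)) (le_of_lt hp)
    have e2 : ∫ p in H, Φ k t p * (p.1 * gam (v t) (f t) p ^ 2) = ∫ p in H, p.1 * (gam (v t) (f t) p ^ 2 * Φ k t p) := by
      congr 1; funext p; ring
    rw [e2]
    simp only [sub_zero, smul_eq_mul] at key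
    linarith
  have hnn1 : ∀ k, ∀ s, ∀ p ∈ H, 0 ≤ Φ k s p * (p.1 * dr (gam (v s) (f s)) p ^ 2) := fun k s p hp =>
    mul_nonneg ((hΦ k).nonneg s p) (mul_nonneg (le_of_lt hp) (sq_nonneg _))
  have hnn2 : ∀ k, ∀ s, ∀ p ∈ H, 0 ≤ Φ k s p * (p.1 * gam (v s) (f s) p ^ 2) := fun k s p hp =>
    mul_nonneg ((hΦ k).nonneg s p) (mul_nonneg (le_of_lt hp) (sq_nonneg _))
  have inner : ∀ k, ∀ s ∈ Icc 0 b, ∫⁻ p in H, ENNReal.ofReal (Φ k s p * (p.1 * dr (gam (v s) (f s)) p ^ 2)) =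
      ENNReal.ofReal (∫ p in H, Φ k s p * (p.1 * dr (gam (v s) (f s)) p ^ 2)) := fun k s hs =>
    ofReal_integral_H (((hΦ k).bht.slice hs).mul_right.integrableOn
      (((hΦ k).sm.slice hs).mul (sD.slice hs)).continuous) (hnn1 k s)
  have main2 : ∀ k, (∫⁻ p in H, ENNReal.ofReal (Φ k t p * (p.1 * gam (v t) (f t) p ^ 2))) +
      (∫⁻ s in Icc 0 t, ENNReal.ofReal (∫ p in H, Φ k s p * (p.1 * dr (gam (v s) (f s)) p ^ 2))) ≤
      ENNReal.ofReal (C₀ + (∫ s in (0:ℝ)..t, N s) + t * c k) := fun k => by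
    rw [ofReal_integral_H (((hΦ k).bht.slice ht).mul_right.integrableOn
      (((hΦ k).sm.slice ht).mul (Sl.fst.mul (sG2.slice ht))).continuous) (hnn2 k t),
      ← ofReal_integral_eq_lintegral_ofReal (((hD k).mono hsub).integrableOn_Icc)
        (Eventually.of_forall fun s => setIntegral_nonneg measurableSet_H (hnn1 k s)),
      ← ENNReal.ofReal_add (setIntegral_nonneg measurableSet_H (hnn2 k t))
        (integral_nonneg fun s => setIntegral_nonneg measurableSet_H (hnn1 k s)),
      integral_Icc_eq_integral_Ioc, ← intervalIntegral.integral_of_le ht.1]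
    exact ENNReal.ofReal_le_ofReal (main k)
  have lim : Tendsto (fun k => ENNReal.ofReal (C₀ + (∫ s in (0:ℝ)..t, N s) + t * c k)) atTop
      (𝓝 (ENNReal.ofReal (C₀ + ∫ s in (0:ℝ)..t, N s))) := by
    refine ENNReal.tendsto_ofReal ?_
    have h1 : Tendsto (fun k : ℕ => (k : ℝ) + (X + 2)) atTop atTop :=
      tendsto_atTop_add_const_right _ _ tendsto_natCast_atTop_atTop
    have h2 : Tendsto c atTop (𝓝 0) := by
      have := ((h1.const_div_atTop cutK).const_mul 4).mul_const (2 * M + A)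
      simpa [hc] using this
    simpa using (h2.const_mul t).const_add (C₀ + ∫ s in (0:ℝ)..t, N s)
  rw [← lim.liminf_eq]
  refine le_trans (add_le_add ?_ ?_) ((liminf_add_liminf_le _ _).trans (liminf_le_liminf (Eventually.of_forall main2)))
  · exact lintegral_le_liminf_of_tendsto (Sl.fst.mul (sG2.slice ht)).continuous
      (fun k => ((hΦ k).sm.slice ht).continuous) (fun p => MW.tendsto_one hΦ ht p)
  · refine le_trans ?_ (lintegral_liminf_le' fun k => ?_)
    · refine setLIntegral_mono' measurableSet_Icc fun s hs => ?_
      simp only [← inner _ s (hsub hs)]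
      exact lintegral_le_liminf_of_tendsto (sD.slice (hsub hs)).continuous
        (fun k => ((hΦ k).sm.slice (hsub hs)).continuous) (fun p => MW.tendsto_one hΦ (hsub hs) p)
    · exact (ENNReal.continuous_ofReal.measurable.comp_aemeasurable
        (((hD k).mono hsub).aestronglyMeasurable measurableSet_Icc).aemeasurable)

end GammaEstimate


section Truncation

/-- A truncation of `w²` at height `1/ε`. -/
noncomputable def trunc (ε w : ℝ) : ℝ := w ^ 2 / (1 + ε * w ^ 2)

/-- A function of quadratic growth approximating `w ^ (2 (m + 1))` from below, and its derivatives. -/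
noncomputable def bet (ε : ℝ) (m : ℕ) (w : ℝ) : ℝ := w ^ 2 * trunc ε w ^ m
/-- The first derivative of `bet`, divided by `2 w`. -/
noncomputable def betq (ε : ℝ) (m : ℕ) (w : ℝ) : ℝ := trunc ε w ^ m * (1 + m * (1 + ε * w ^ 2)⁻¹)
/-- The second derivative of `bet`. -/
noncomputable def betd (ε : ℝ) (m : ℕ) (w : ℝ) : ℝ :=
  2 * trunc ε w ^ m * (1 + m * (1 + ε * w ^ 2)⁻¹ + 2 * m * (m + 1) * ((1 + ε * w ^ 2)⁻¹) ^ 2)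

variable {ε : ℝ} (hε : 0 < ε) (m : ℕ) (w : ℝ)

include hε in
theorem contDiff_bet : ContDiff ℝ ∞ (bet ε m) := by
  have : ContDiff ℝ ∞ (trunc ε) := ContDiff.div (by fun_prop) (by fun_prop) fun w => by positivity
  exact ContDiff.mul (by fun_prop) (this.pow m)

include hε in
theorem hasDerivAt_trunc : HasDerivAt (trunc ε) (2 * w * ((1 + ε * w ^ 2)⁻¹) ^ 2) w := by
  have h1 : HasDerivAt (fun w : ℝ => w ^ 2) (2 * w) w := by simpa using hasDerivAt_pow 2 w
  have h0 : 1 + ε * w ^ 2 ≠ 0 := by positivity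
  refine (h1.div ((h1.const_mul ε).const_add 1) h0).congr_deriv ?_
  field_simp
  ring

include hε in
theorem hasDerivAt_inv_trunc :
    HasDerivAt (fun w => (1 + ε * w ^ 2)⁻¹) (-(2 * ε * w * ((1 + ε * w ^ 2)⁻¹) ^ 2)) w := by
  have h1 : HasDerivAt (fun w : ℝ => w ^ 2) (2 * w) w := by simpa using hasDerivAt_pow 2 w
  have h0 : 1 + ε * w ^ 2 ≠ 0 := by positivity
  refine (((h1.const_mul ε).const_add 1).inv h0).congr_deriv ?_
  field_simp

include hε in
theorem hasDerivAt_bet : HasDerivAt (bet ε m) (2 * w * betq ε m w) w := by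
  have h1 : HasDerivAt (fun w : ℝ => w ^ 2) (2 * w) w := by simpa using hasDerivAt_pow 2 w
  refine (h1.mul ((hasDerivAt_trunc hε w).pow m)).congr_deriv ?_
  have hx : w ^ 2 * (1 + ε * w ^ 2)⁻¹ = trunc ε w := by rw [trunc, div_eq_mul_inv]
  simp only [Pi.pow_apply, betq]
  rcases m with _ | k
  · simp
  · simp only [Nat.add_sub_cancel]
    push_cast
    linear_combination (2 * w * (k + 1) * trunc ε w ^ k * (1 + ε * w ^ 2)⁻¹) * hx

include hε in
theorem hasDerivAt_betq : HasDerivAt (fun w => 2 * w * betq ε m w) (betd ε m w) w := by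
  have h2 := (hasDerivAt_trunc hε w).pow m
  have h3 := ((hasDerivAt_inv_trunc hε w).const_mul (m : ℝ)).const_add 1
  refine (((hasDerivAt_id w).const_mul 2).mul (h2.mul h3)).congr_deriv ?_
  have hx : w ^ 2 * (1 + ε * w ^ 2)⁻¹ = trunc ε w := by rw [trunc, div_eq_mul_inv]
  have h0 : 1 + ε * w ^ 2 ≠ 0 := by positivity
  have hk : ε * w ^ 2 * (1 + ε * w ^ 2)⁻¹ = 1 - (1 + ε * w ^ 2)⁻¹ := by field_simp; ring
  simp only [Pi.pow_apply, Pi.mul_apply, id, betd]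
  set c := (1 + ε * w ^ 2)⁻¹
  set x := trunc ε w
  rcases m with _ | k
  · simp
  · simp only [Nat.add_sub_cancel]
    push_cast
    linear_combination (4 * (k + 1) * x ^ k * c * (1 + (k + 1) * c)) * hx
      - (4 * (k + 1) * x ^ (k + 1) * c) * hk

include hε in
theorem trunc_bounds : 0 ≤ trunc ε w ∧ trunc ε w ≤ w ^ 2 ∧ trunc ε w ≤ ε⁻¹ := by
  refine ⟨by rw [trunc]; positivity, div_le_self (sq_nonneg _) ?_, ?_⟩
  · have : 0 ≤ ε * w ^ 2 := by positivity
    linarith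
  · rw [trunc, div_le_iff₀ (by positivity)]
    have : ε⁻¹ * (1 + ε * w ^ 2) = ε⁻¹ + w ^ 2 := by field_simp
    rw [this]
    have : 0 < ε⁻¹ := inv_pos.2 hε
    linarith

include hε in
theorem bet_bounds : 0 ≤ bet ε m w ∧ bet ε m w ≤ w ^ (2 * (m + 1)) ∧ bet ε m w ≤ w ^ 2 * ε⁻¹ ^ m ∧
    trunc ε w ^ (m + 1) ≤ bet ε m w ∧ 0 ≤ betq ε m w ∧ betq ε m w ≤ (m + 1) * trunc ε w ^ m ∧
    0 ≤ betd ε m w ∧ betd ε m w ≤ 4 * ((m + 1) ^ 2 * trunc ε w ^ m) := by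
  obtain ⟨h0, h1, h2⟩ := trunc_bounds hε w
  have hc0 : 0 ≤ (1 + ε * w ^ 2)⁻¹ := by positivity
  have hc1 : (1 + ε * w ^ 2)⁻¹ ≤ 1 := inv_le_one_of_one_le₀ (by
    have : 0 ≤ ε * w ^ 2 := by positivity
    linarith)
  have hm : (0:ℝ) ≤ m := Nat.cast_nonneg m
  have hx : 0 ≤ trunc ε w ^ m := by positivity
  refine ⟨by rw [bet]; positivity, ?_, ?_, ?_, by rw [betq]; positivity, ?_, by rw [betd]; positivity, ?_⟩
  · calc bet ε m w ≤ w ^ 2 * (w ^ 2) ^ m := by rw [bet]; gcongr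
      _ = _ := by rw [← pow_succ', ← pow_mul]
  · rw [bet]; gcongr
  · rw [bet, pow_succ']; gcongr
  · have e1 : (m : ℝ) * (1 + ε * w ^ 2)⁻¹ ≤ m := mul_le_of_le_one_right hm hc1
    calc betq ε m w ≤ trunc ε w ^ m * (1 + m) := by rw [betq]; gcongr
      _ = _ := by ring
  · rw [betd]
    have e1 : (m : ℝ) * (1 + ε * w ^ 2)⁻¹ ≤ m := mul_le_of_le_one_right hm hc1
    have e2 : 2 * (m : ℝ) * (m + 1) * ((1 + ε * w ^ 2)⁻¹) ^ 2 ≤ 2 * m * (m + 1) :=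
      mul_le_of_le_one_right (by positivity) (pow_le_one₀ hc0 hc1)
    have : 1 + m * (1 + ε * w ^ 2)⁻¹ + 2 * m * (m + 1) * ((1 + ε * w ^ 2)⁻¹) ^ 2 ≤ 2 * (m + 1 : ℝ) ^ 2 := by
      nlinarith
    nlinarith [mul_le_mul_of_nonneg_left this hx]

theorem young_pow {x y : ℝ} (hx : 0 ≤ x) (hy : 0 ≤ y) : (m + 1) * x ^ m * y ≤ m * x ^ (m + 1) + y ^ (m + 1) := by
  induction m with
  | zero => simp
  | succ m ih =>
    have h1 := mul_le_mul_of_nonneg_right ih hy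
    have h2 : 0 ≤ (m + 1) * x ^ m * (y - x) ^ 2 := by positivity
    push_cast
    have e1 : (m * x ^ (m + 1) + y ^ (m + 1)) * y = m * x ^ (m + 1) * y + y ^ (m + 1 + 1) := by ring
    have e2 : x ^ (m + 1) = x ^ m * x := pow_succ _ _
    have e3 : x ^ (m + 1 + 1) = x ^ m * x * x := by rw [pow_succ, pow_succ]
    rw [e1, e2] at h1
    rw [e3, e2]
    linarith

include hε in
theorem bet_young (s : ℝ) : (m + 1) ^ 2 * trunc ε w ^ m * s ^ 2 ≤
    (m + 1) * bet ε m w + (m + 1) ^ (m + 1) * s ^ (2 * (m + 1)) := by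
  obtain ⟨h0, h1, h2⟩ := trunc_bounds hε w
  obtain ⟨b0, _, _, b3, _⟩ := bet_bounds hε m w
  have hm : (0:ℝ) ≤ m := Nat.cast_nonneg m
  have key := young_pow m h0 (by positivity : 0 ≤ (m + 1) * s ^ 2)
  have e1 : ((m + 1) * s ^ 2 : ℝ) ^ (m + 1) = (m + 1) ^ (m + 1) * s ^ (2 * (m + 1)) := by
    rw [mul_pow, ← pow_mul]
  rw [e1] at key
  have e2 : m * trunc ε w ^ (m + 1) ≤ (m + 1) * bet ε m w :=
    mul_le_mul (by linarith) b3 (by positivity) (by positivity)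
  linarith

theorem half_square_le {r B w s : ℝ} (hr : 0 < r) (hB : 0 ≤ B) :
    2 * w * B * s - 2 * w * B * w / r ≤ r * (B * s ^ 2) := by
  have : r * (B * s ^ 2) - (2 * w * B * s - 2 * w * B * w / r) = B * ((w - r * s) ^ 2 + w ^ 2) / r := by
    field_simp; ring
  have : 0 ≤ B * ((w - r * s) ^ 2 + w ^ 2) / r := by positivity
  linarith

theorem vort_pointwise_aux {n b B d D P Y r w wr wrr a s sr φ φr φrr mφ mw W K : ℝ} (hr : 0 < r) (hφ : 0 ≤ φ)
    (hφ1 : φ ≤ 1) (hmφ : mφ ≤ 0) (hm : mw - (wrr + wr / r - w / r ^ 2) = a * w - sr) (hK : 0 ≤ K)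
    (h1 : |φr| ≤ K) (h1' : |φr| ≤ K * r) (h2 : |φrr| ≤ 2 * K) (ha : φ ≠ 0 → |a| ≤ W)
    (hn : 1 ≤ n) (b0 : 0 ≤ b) (b2 : b ≤ w ^ 2 * D) (q0 : 0 ≤ B) (q1 : B ≤ n * D) (hD : 0 ≤ D)
    (d0 : 0 ≤ d) (hBY : B * s ^ 2 ≤ Y) (hdY : d * (s ^ 2 / 4) ≤ Y) (hYP : Y ≤ n * b + P) (hP : 0 ≤ P)
    (hwB : w ^ 2 * B ≤ n * b) :
    r * ((2 * w * B) * mw * φ + b * mφ) - (2 * n + 2 * n * W) * (r * (b * φ)) ≤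
      (φr * (2 * w * B) * r * wr + φ * (d * wr) * r * wr + φ * (2 * w * B) * wr
        + φ * (2 * w * B) * r * wrr - φr * b - r * φrr * b
        - r * φr * (2 * w * B * wr) - (φr * (2 * w * B) * r * s + φ * (d * wr) * r * s
        + φ * (2 * w * B) * s + φ * (2 * w * B) * r * sr))
      + 2 * (r * P) + 4 * n * K * D * (r * w ^ 2 + r * s ^ 2) := by
  have t1 : φ * (d * wr) * r * s - r * φ * d * wr ^ 2 ≤ r * φ * Y := by
    have e1 : wr * s - wr ^ 2 ≤ s ^ 2 / 4 := by nlinarith [sq_nonneg (wr - s / 2)]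
    have e2 : d * (wr * s - wr ^ 2) ≤ Y := (mul_le_mul_of_nonneg_left e1 d0).trans hdY
    have := mul_le_mul_of_nonneg_left e2 (mul_nonneg hr.le hφ)
    linarith
  have t2 : φ * (2 * w * B) * s - φ * (2 * w * B) * w / r ≤ r * φ * Y := by
    have e1 := half_square_le (w := w) (s := s) hr q0
    have e3 : r * (B * s ^ 2) ≤ r * Y := by gcongr
    have e4 := mul_le_mul_of_nonneg_left (e1.trans e3) hφ
    calc φ * (2 * w * B) * s - φ * (2 * w * B) * w / r = φ * (2 * w * B * s - 2 * w * B * w / r) := by ring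
      _ ≤ φ * (r * Y) := e4
      _ = _ := by ring
  have t12 : r * φ * Y ≤ n * (r * (b * φ)) + r * P := by
    have e1 : r * φ * Y ≤ r * φ * (n * b + P) := by gcongr
    have e2 : r * φ * P ≤ r * P := by
      rw [mul_assoc]
      exact mul_le_mul_of_nonneg_left (mul_le_of_le_one_left hP hφ1) hr.le
    linarith
  have t3 : φr * (2 * w * B) * r * s ≤ n * K * D * (r * w ^ 2 + r * s ^ 2) := by
    have e1 : |2 * w * s| ≤ w ^ 2 + s ^ 2 := by
      rw [abs_le]; constructor <;> nlinarith [sq_nonneg (w + s), sq_nonneg (w - s)]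
    calc φr * (2 * w * B) * r * s ≤ |φr * (2 * w * B) * r * s| := le_abs_self _
      _ = |φr| * |2 * w * s| * (B * r) := by
        rw [show φr * (2 * w * B) * r * s = φr * (2 * w * s) * (B * r) by ring, abs_mul, abs_mul,
          abs_of_nonneg (by positivity : 0 ≤ B * r)]
      _ ≤ K * (w ^ 2 + s ^ 2) * (n * D * r) := by gcongr
      _ = _ := by ring
  have t4 : b * (φr + r * φrr) ≤ 3 * n * K * D * (r * w ^ 2 + r * s ^ 2) := by
    have e1 : φr + r * φrr ≤ 3 * (K * r) := by
      have := (le_abs_self φr).trans h1'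
      have := mul_le_mul_of_nonneg_left ((le_abs_self φrr).trans h2) hr.le
      linarith
    calc b * (φr + r * φrr) ≤ b * (3 * (K * r)) := by gcongr
      _ ≤ (w ^ 2 * D) * (3 * (K * r)) := by gcongr
      _ = 3 * 1 * K * D * (r * w ^ 2 + 0) := by ring
      _ ≤ _ := by gcongr; positivity
  have t5 : φ * (2 * w * B) * (a * w) * r ≤ 2 * n * W * (r * (b * φ)) := by
    by_cases hz : φ = 0
    · simp [hz]
    · have hW := ha hz
      have hW0 : 0 ≤ W := (abs_nonneg _).trans hW
      calc φ * (2 * w * B) * (a * w) * r = a * (2 * φ * r * (w ^ 2 * B)) := by ring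
        _ ≤ W * (2 * φ * r * (n * b)) :=
          mul_le_mul ((le_abs_self a).trans hW) (by gcongr) (by positivity) hW0
        _ = _ := by ring
  have t6 : r * (b * mφ) ≤ 0 := mul_nonpos_of_nonneg_of_nonpos hr.le (mul_nonpos_of_nonneg_of_nonpos b0 hmφ)
  have hmw : r * ((2 * w * B) * mw * φ) = φ * (2 * w * B) * r * wrr + φ * (2 * w * B) * wr
      - φ * (2 * w * B) * w / r + φ * (2 * w * B) * (a * w) * r - φ * (2 * w * B) * r * sr := by
    have : mw = (wrr + wr / r - w / r ^ 2) + a * w - sr := by linarith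
    rw [this]; field_simp
  rw [mul_add r, hmw]
  linarith

include hε in
theorem vort_pointwise {r wr wrr a s sr φ φr φrr mφ mw W K : ℝ} (hr : 0 < r) (hφ : 0 ≤ φ) (hφ1 : φ ≤ 1)
    (hmφ : mφ ≤ 0) (hm : mw - (wrr + wr / r - w / r ^ 2) = a * w - sr) (hK : 0 ≤ K)
    (h1 : |φr| ≤ K) (h1' : |φr| ≤ K * r) (h2 : |φrr| ≤ 2 * K) (ha : φ ≠ 0 → |a| ≤ W) :
    r * ((2 * w * betq ε m w) * mw * φ + bet ε m w * mφ) - (2 * (m + 1) + 2 * (m + 1) * W) * (r * (bet ε m w * φ)) ≤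
      (φr * (2 * w * betq ε m w) * r * wr + φ * (betd ε m w * wr) * r * wr + φ * (2 * w * betq ε m w) * wr
        + φ * (2 * w * betq ε m w) * r * wrr - φr * bet ε m w - r * φrr * bet ε m w
        - r * φr * (2 * w * betq ε m w * wr) - (φr * (2 * w * betq ε m w) * r * s + φ * (betd ε m w * wr) * r * s
        + φ * (2 * w * betq ε m w) * s + φ * (2 * w * betq ε m w) * r * sr))
      + 2 * (r * ((m + 1) ^ (m + 1) * s ^ (2 * (m + 1))))
      + 4 * (m + 1) * K * ε⁻¹ ^ m * (r * w ^ 2 + r * s ^ 2) := by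
  obtain ⟨h0, _, h3⟩ := trunc_bounds hε w
  obtain ⟨b0, _, b2, _, q0, q1, d0, d1⟩ := bet_bounds hε m w
  have hmm : (0:ℝ) ≤ m := Nat.cast_nonneg m
  have hD : trunc ε w ^ m ≤ ε⁻¹ ^ m := by gcongr
  have hx : 0 ≤ trunc ε w ^ m := by positivity
  refine vort_pointwise_aux (Y := (m + 1) ^ 2 * trunc ε w ^ m * s ^ 2) hr hφ hφ1 hmφ hm hK h1 h1' h2 ha
    (by linarith) b0 b2 q0 (q1.trans (by gcongr)) (by positivity) d0 ?_ ?_ (bet_young hε m w s) ?_ ?_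
  · have : (m + 1) * trunc ε w ^ m ≤ (m + 1 : ℝ) ^ 2 * trunc ε w ^ m := by
      gcongr; nlinarith
    exact mul_le_mul_of_nonneg_right (q1.trans this) (sq_nonneg s)
  · calc betd ε m w * (s ^ 2 / 4) ≤ 4 * ((m + 1) ^ 2 * trunc ε w ^ m) * (s ^ 2 / 4) := by gcongr
      _ = _ := by ring
  · have : 0 ≤ s ^ (2 * (m + 1)) := by rw [pow_mul]; positivity
    positivity
  · calc w ^ 2 * betq ε m w ≤ w ^ 2 * ((m + 1) * trunc ε w ^ m) := by gcongr
      _ = _ := by rw [bet]; ring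

end Truncation


section VorticityEstimate

variable {b M : ℝ} {v f ρ G : ℝ → ℝ × ℝ → ℝ}

theorem HSol.vort_integral_mat_le (h : HSol b M v f ρ) {X R A n ε : ℝ} {m : ℕ} {Φ : ℝ → ℝ × ℝ → ℝ}
    (hε : 0 < ε) (hΦ : MW b X v f R Φ) (hR0 : 0 < R) {W : ℝ → ℝ} (hW : ContDiff ℝ ∞ W)
    (hWd : ∀ t ∈ Icc 0 b, ∀ p ∈ box R, |quot (v t) p| ≤ deriv W t)
    {t : ℝ} (ht : t ∈ Ioo 0 b) (hWt : 0 ≤ W t)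
    (hρ : IntegrableOn (fun p => p.1 * ρ t p ^ 2) H) (hA : ∫ p in H, p.1 * ρ t p ^ 2 ≤ A)
    (hρ' : IntegrableOn (fun p => p.1 * ρ t p ^ (2 * (m + 1))) H)
    (hn : ∫ p in H, p.1 * ρ t p ^ (2 * (m + 1)) ≤ n) :
    ∫ p in H, p.1 * mat b v f (fun t p => bet ε m (vort (v t) (f t) p) * Φ t p *
        Real.exp (-(2 * (m + 1) * t + 2 * (m + 1) * W t))) t p ≤
      2 * ((m + 1) ^ (m + 1) * n) + 4 * (m + 1) * (cutK / R) * ε⁻¹ ^ m * (2 * M + A) := by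
  have hb := h.hb
  have ht' := Ioo_subset_Icc_self ht
  have pr := h.prof t ht'
  have sw := pr.s_vort
  have sφ := hΦ.sm.slice ht'
  have sρ := h.sρ.slice ht'
  have hK : 0 ≤ cutK / R := div_nonneg (zero_le_one.trans one_le_cutK) hR0.le
  have Bφ := hΦ.bht.slice ht'
  have sG2 : Sm b fun t p => bet ε m (vort (v t) (f t) p) := h.s_vort.comp_left (contDiff_bet hε m)
  have sE : ContDiff ℝ ∞ fun t => Real.exp (-(2 * (m + 1) * t + 2 * (m + 1) * W t)) := by
    have : ContDiff ℝ ∞ fun t => 2 * (m + 1 : ℝ) * W t := contDiff_const.mul hW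
    exact (((by fun_prop : ContDiff ℝ ∞ fun t => 2 * (m + 1 : ℝ) * t).add this).neg).exp
  set w := vort (v t) (f t) with hw
  set φ := Φ t with hφ
  set s := ρ t with hs
  have I1 := HI.of (h.integrableOn_mat ((sG2.mul hΦ.sm).mul (Sm.of_time sE)) (by
    obtain ⟨L, hL⟩ := hΦ.bht
    exact ⟨L, fun t ht p hp h => by simp [hL t ht p hp h]⟩) ht')
  obtain ⟨iw, vw⟩ := h.integral_vort_sq_le ht'
  have I3 := ((HI.of iw).add (HI.of hρ)).const_mul (4 * (m + 1) * (cutK / R) * ε⁻¹ ^ m)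
  have I4 := ((HI.of hρ').const_mul ((m + 1) ^ (m + 1))).const_mul 2
  let β1 : ℝ → ℝ := fun w => 2 * w * betq ε m w
  have cb : Continuous (bet ε m) := (contDiff_bet hε m).continuous
  have eβ1 : deriv (bet ε m) = β1 := funext fun w => (hasDerivAt_bet hε m w).deriv
  have sβ1 : ContDiff ℝ ∞ β1 := eβ1 ▸ (contDiff_infty_iff_deriv.1 (contDiff_bet hε m)).2
  have cb1 : Continuous β1 := sβ1.continuous
  have eβ2 : deriv β1 = betd ε m := funext fun w => (hasDerivAt_betq hε m w).deriv
  have cb2 : Continuous (betd ε m) := eβ2 ▸ (contDiff_infty_iff_deriv.1 sβ1).2.continuous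
  let J : ℝ × ℝ → ℝ := fun p => φ p * β1 (w p) * p.1 * dr w p - p.1 * dr φ p * bet ε m (w p)
    - φ p * β1 (w p) * p.1 * s p
  let Jr : ℝ × ℝ → ℝ := fun p => dr φ p * β1 (w p) * p.1 * dr w p
    + φ p * (betd ε m (w p) * dr w p) * p.1 * dr w p + φ p * β1 (w p) * dr w p
    + φ p * β1 (w p) * p.1 * dr (dr w) p - dr φ p * bet ε m (w p) - p.1 * dr (dr φ) p * bet ε m (w p)
    - p.1 * dr φ p * (β1 (w p) * dr w p) - (dr φ p * β1 (w p) * p.1 * s p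
    + φ p * (betd ε m (w p) * dr w p) * p.1 * s p + φ p * β1 (w p) * s p + φ p * β1 (w p) * p.1 * dr s p)
  have c0 := sw.continuous
  have c1 := sw.dr.continuous
  have c2 := sw.dr.dr.continuous
  have c3 := sφ.continuous
  have c4 := sφ.dr.continuous
  have c5 := sφ.dr.dr.continuous
  have c6 := sρ.continuous
  have c7 := sρ.dr.continuous
  have k0 : Continuous fun p => bet ε m (w p) := cb.comp c0
  have k1 : Continuous fun p => β1 (w p) := cb1.comp c0
  have k2 : Continuous fun p => betd ε m (w p) := cb2.comp c0
  have cJ : Continuous J := by simp only [J]; fun_prop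
  have cJr : Continuous Jr := by simp only [Jr]; fun_prop
  have dJ : ∀ r z, 0 < r → HasDerivAt (fun x => J (x, z)) (Jr (r, z)) r := fun r z _ => by
    have h0 := hasDerivAt_id r
    have h1 := sw.hasDerivAt_r r z
    have h2 := sw.dr.hasDerivAt_r r z
    have h3 := sφ.hasDerivAt_r r z
    have h4 := sφ.dr.hasDerivAt_r r z
    have h5 := sρ.hasDerivAt_r r z
    have h6 : HasDerivAt (fun x => bet ε m (w (x, z))) (β1 (w (r, z)) * dr w (r, z)) r :=
      HasDerivAt.comp (h₂ := bet ε m) (h := fun x => w (x, z)) r (hasDerivAt_bet hε m _) h1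
    have h7 : HasDerivAt (fun x => β1 (w (x, z))) (betd ε m (w (r, z)) * dr w (r, z)) r :=
      HasDerivAt.comp (h₂ := β1) (h := fun x => w (x, z)) r (hasDerivAt_betq hε m _) h1
    refine (((((h3.mul h7).mul h0).mul h2).sub ((h0.mul h4).mul h6)).sub
      (((h3.mul h7).mul h0).mul h5)).congr_deriv ?_
    simp only [id, Pi.mul_apply, Jr]
    ring
  have BJ : BH J := by
    obtain ⟨L, hL⟩ := Bφ
    obtain ⟨L', hL'⟩ := sφ.BH_dr (hΦ.bht.slice ht')
    refine ⟨max L L', fun p hp hh => ?_⟩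
    have e1 := hL p hp (hh.imp (lt_of_le_of_lt (le_max_left _ _)) (lt_of_le_of_lt (le_max_left _ _)))
    have e2 := hL' p hp (hh.imp (lt_of_le_of_lt (le_max_right _ _)) (lt_of_le_of_lt (le_max_right _ _)))
    simp only [J, e1, e2]; ring
  have IJ : HI Jr 0 := HI.dr_zero cJ cJr dJ BJ fun z => by simp [J]
  set e := Real.exp (-(2 * (m + 1) * t + 2 * (m + 1) * W t)) with he
  have he0 : 0 < e := Real.exp_pos _
  have he1 : e ≤ 1 := by
    rw [he, Real.exp_le_one_iff]
    have : 0 ≤ 2 * (m + 1 : ℝ) * t + 2 * (m + 1) * W t := by have := ht'.1; positivity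
    linarith
  have key := I1.le (((IJ.add I4).add I3).const_mul e) fun p hp => by
    have hp : 0 < p.1 := hp
    rw [mat_mul hb (sG2.mul hΦ.sm) (Sm.of_time sE) ht, mat_mul hb sG2 hΦ.sm ht,
      mat_comp hb h.s_vort (contDiff_bet hε m) ht, eβ1, mat_of_time hb sE ht]
    have e1 : deriv (fun t => Real.exp (-(2 * (m + 1) * t + 2 * (m + 1) * W t))) t =
        e * (-(2 * (m + 1) * 1 + 2 * (m + 1) * deriv W t)) :=
      ((((hasDerivAt_id t).const_mul (2 * (m + 1 : ℝ))).add
        ((hW.differentiable (by simp) t).hasDerivAt.const_mul (2 * (m + 1 : ℝ)))).neg.exp).deriv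
    rw [e1]
    have := vort_pointwise hε m (w p) (K := cutK / R) (s := s p) (W := deriv W t) hp (hΦ.nonneg t p)
      (hΦ.le_one t p) (hΦ.mat t ht p hp) (h.vort_equation ht p hp) hK (hΦ.d1 t ht' p)
      (by have := hΦ.d1' t ht' p; rwa [abs_of_pos hp, mul_div_right_comm] at this)
      (by have := hΦ.d2 t ht' p; rwa [mul_div_assoc] at this)
      (fun hne => by
        have := hΦ.supp t ht' p hne
        exact hWd t ht' p (mem_box hp this.1 this.2))
    have := mul_le_mul_of_nonneg_left this he0.le
    refine le_trans (le_of_eq ?_) (this.trans (le_of_eq ?_))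
    · simp only [β1, mat]; ring
    · simp only [Jr, β1]; ring
  refine key.trans ?_
  have hM0 : 0 ≤ (∫ p in H, p.1 * w p ^ 2) + ∫ p in H, p.1 * s p ^ 2 := add_nonneg
    (setIntegral_nonneg measurableSet_H fun q hq => mul_nonneg (le_of_lt hq) (sq_nonneg _))
    (setIntegral_nonneg measurableSet_H fun q hq => mul_nonneg (le_of_lt hq) (sq_nonneg _))
  have hn0 : 0 ≤ ∫ p in H, p.1 * s p ^ (2 * (m + 1)) :=
    setIntegral_nonneg measurableSet_H fun q hq => mul_nonneg (le_of_lt hq) (by rw [pow_mul]; positivity)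
  have hi : (0:ℝ) ≤ ε⁻¹ ^ m := by positivity
  refine (mul_le_of_le_one_left (by positivity) he1).trans ?_
  rw [zero_add]
  gcongr

/-- Growth of the Lebesgue norms of the vorticity. -/
theorem HSol.vort_estimate (h : HSol b M v f ρ) (m : ℕ) {A B V₀ Y : ℝ}
    (hρ : ∀ t ∈ Icc 0 b, IntegrableOn (fun p => p.1 * ρ t p ^ 2) H ∧ ∫ p in H, p.1 * ρ t p ^ 2 ≤ A)
    (hρ' : ∀ t ∈ Icc 0 b, IntegrableOn (fun p => p.1 * ρ t p ^ (2 * (m + 1))) H ∧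
      ∫ p in H, p.1 * ρ t p ^ (2 * (m + 1)) ≤ B)
    (hi : IntegrableOn (fun p => p.1 * vort (v 0) (f 0) p ^ (2 * (m + 1))) H)
    (hV : ∫ p in H, p.1 * vort (v 0) (f 0) p ^ (2 * (m + 1)) ≤ V₀) {g : ℝ → ENNReal} (hY : 0 ≤ Y)
    (hg : ∀ t ∈ Icc 0 b, ∀ p : ℝ × ℝ, 0 < p.1 → ENNReal.ofReal |quot (v t) p| ≤ g t)
    {t : ℝ} (ht : t ∈ Icc 0 b) (hgY : ∫⁻ s in Icc 0 t, g s ≤ ENNReal.ofReal Y) :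
    ∫⁻ p in H, ENNReal.ofReal (p.1 * vort (v t) (f t) p ^ (2 * (m + 1))) ≤
      ENNReal.ofReal (Real.exp (2 * (m + 1) * (t + (Y + 1))) * (V₀ + 2 * ((m + 1) ^ (m + 1) * B) * t)) := by
  have hb := h.hb
  have h00 : (0:ℝ) ∈ Icc 0 b := ⟨le_rfl, hb.le⟩
  obtain ⟨X, hX0, hX⟩ := h.exists_weight
  choose Φ hΦ using fun n : ℕ => hX (n + 1) (by linarith [Nat.cast_nonneg (α := ℝ) n])
  have hR : ∀ k : ℕ, (1:ℝ) ≤ k + 1 := fun k => by linarith [Nat.cast_nonneg (α := ℝ) k]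
  choose W hW hW0 hWd hWb using fun k : ℕ => exists_smooth_majorant hb (F := fun t => quot (v t))
    h.s_quot.continuousOn (isCompact_box (k + 1)) (box_nonempty (hR k))
  have hWt : ∀ k, W k t ≤ Y + 1 := fun k => ofReal_le_add_one hY (hWb k g (fun s hs p hp =>
    le_of_forall_H (h.s_quot.slice hs).continuous (hg s hs) hp.1.1) t ht) hgY
  have hWd0 : ∀ k, ∀ s ∈ Icc 0 b, 0 ≤ deriv (W k) s := fun k s hs => by
    obtain ⟨p, hp⟩ := box_nonempty (hR k)
    exact (abs_nonneg _).trans (hWd k s hs p hp)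
  have hWnn : ∀ k, ∀ s ∈ Icc 0 b, 0 ≤ W k s := fun k s hs => by
    rw [← hW0 k]; exact monotone_of_deriv_nonneg_Icc (hW k) (hWd0 k) h00 hs hs.1
  set c : ℝ := V₀ + 2 * ((m + 1) ^ (m + 1) * B) * t with hc
  set E : ℝ := Real.exp (2 * (m + 1) * (t + (Y + 1))) with hE
  have step1 : ∀ ε : ℝ, 0 < ε → ∀ k : ℕ, ∫ p in H, Φ k t p * (p.1 * bet ε m (vort (v t) (f t) p)) ≤
      E * (c + (4 * (m + 1) * (cutK / (k + 1)) * ε⁻¹ ^ m * (2 * M + A)) * t) := fun ε hε k => by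
    have sG2 : Sm b fun t p => bet ε m (vort (v t) (f t) p) := h.s_vort.comp_left (contDiff_bet hε m)
    have sE : ContDiff ℝ ∞ fun t => Real.exp (-(2 * (m + 1) * t + 2 * (m + 1) * W k t)) := by
      have : ContDiff ℝ ∞ fun t => 2 * (m + 1 : ℝ) * W k t := contDiff_const.mul (hW k)
      exact (((by fun_prop : ContDiff ℝ ∞ fun t => 2 * (m + 1 : ℝ) * t).add this).neg).exp
    have key := h.integral_le ((sG2.mul (hΦ k).sm).mul (Sm.of_time sE)) (by
      obtain ⟨L, hL⟩ := (hΦ k).bht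
      exact ⟨L, fun t ht p hp h => by simp [hL t ht p hp h]⟩) ht (k := fun _ =>
        2 * ((m + 1) ^ (m + 1) * B) + 4 * (m + 1) * (cutK / (k + 1)) * ε⁻¹ ^ m * (2 * M + A))
      continuous_const.continuousOn.integrableOn_Icc (fun s hs => by
        have hs : s ∈ Ioo 0 b := ⟨hs.1, hs.2.trans_le ht.2⟩
        have hs' := Ioo_subset_Icc_self hs
        exact h.vort_integral_mat_le hε (hΦ k) (by linarith [hR k]) (hW k) (hWd k) hs (hWnn k s hs')
          (hρ s hs').1 (hρ s hs').2 (hρ' s hs').1 (hρ' s hs').2)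
    rw [intervalIntegral.integral_const, sub_zero, smul_eq_mul] at key
    have e1 : ∫ p in H, p.1 * (bet ε m (vort (v 0) (f 0) p) * Φ k 0 p *
        Real.exp (-(2 * (m + 1) * 0 + 2 * (m + 1) * W k 0))) ≤ V₀ := by
      refine ((HI.of ?_).le (HI.of hi) fun p hp => ?_).trans hV
      · exact ((((hΦ k).bht.slice h00).mul_left.mul_right).mul_left).integrableOn
          (Sl.fst.mul (((sG2.slice h00).mul ((hΦ k).sm.slice h00)).mul contDiff_const)).continuous
      · rw [hW0]
        simp only [mul_zero, add_zero, neg_zero, Real.exp_zero, mul_one]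
        obtain ⟨b0, b1, _⟩ := bet_bounds hε m (vort (v 0) (f 0) p)
        exact mul_le_mul_of_nonneg_left ((mul_le_of_le_one_right b0 ((hΦ k).le_one 0 p)).trans b1) (le_of_lt hp)
    have e2 : ∫ p in H, p.1 * (bet ε m (vort (v t) (f t) p) * Φ k t p *
        Real.exp (-(2 * (m + 1) * t + 2 * (m + 1) * W k t))) =
        Real.exp (-(2 * (m + 1) * t + 2 * (m + 1) * W k t)) *
          ∫ p in H, Φ k t p * (p.1 * bet ε m (vort (v t) (f t) p)) := by
      rw [← integral_const_mul]; congr 1; funext p; ring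
    rw [e2] at key
    have hI0 : 0 ≤ ∫ p in H, Φ k t p * (p.1 * bet ε m (vort (v t) (f t) p)) :=
      setIntegral_nonneg measurableSet_H fun p hp => mul_nonneg ((hΦ k).nonneg t p)
        (mul_nonneg (le_of_lt hp) (bet_bounds hε m _).1)
    have e3 : 1 ≤ E * Real.exp (-(2 * (m + 1) * t + 2 * (m + 1) * W k t)) := by
      rw [hE, ← Real.exp_add, Real.one_le_exp_iff]
      have : 0 ≤ 2 * (m + 1 : ℝ) * ((Y + 1) - W k t) := mul_nonneg (by positivity) (by linarith [hWt k])
      linarith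
    calc _ ≤ (E * Real.exp (-(2 * (m + 1) * t + 2 * (m + 1) * W k t))) *
          ∫ p in H, Φ k t p * (p.1 * bet ε m (vort (v t) (f t) p)) := le_mul_of_one_le_left hI0 e3
      _ = E * (Real.exp (-(2 * (m + 1) * t + 2 * (m + 1) * W k t)) *
          ∫ p in H, Φ k t p * (p.1 * bet ε m (vort (v t) (f t) p))) := by ring
      _ ≤ _ := by
        refine mul_le_mul_of_nonneg_left ?_ (Real.exp_pos _).le
        rw [hc]; linarith
  have step2 : ∀ ε : ℝ, 0 < ε → ∫⁻ p in H, ENNReal.ofReal (p.1 * bet ε m (vort (v t) (f t) p)) ≤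
      ENNReal.ofReal (E * c) := fun ε hε => by
    have sG2 : Sm b fun t p => bet ε m (vort (v t) (f t) p) := h.s_vort.comp_left (contDiff_bet hε m)
    have lim : Tendsto (fun k : ℕ => ENNReal.ofReal
        (E * (c + (4 * (m + 1) * (cutK / (k + 1)) * ε⁻¹ ^ m * (2 * M + A)) * t))) atTop
        (𝓝 (ENNReal.ofReal (E * c))) := by
      refine ENNReal.tendsto_ofReal ?_
      have h1 : Tendsto (fun k : ℕ => (k : ℝ) + 1) atTop atTop :=
        tendsto_atTop_add_const_right _ _ tendsto_natCast_atTop_atTop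
      have := (((((((h1.const_div_atTop cutK).const_mul (4 * (m + 1 : ℝ))).mul_const (ε⁻¹ ^ m)).mul_const
        (2 * M + A)).mul_const t).const_add c).const_mul E)
      simpa using this
    rw [← lim.liminf_eq]
    refine le_trans (lintegral_le_liminf_of_tendsto (Sl.fst.mul (sG2.slice ht)).continuous
      (fun k => ((hΦ k).sm.slice ht).continuous) (fun p => MW.tendsto_one hΦ ht p))
      (liminf_le_liminf (Eventually.of_forall fun k => ?_))
    refine (ofReal_integral_H (((hΦ k).bht.slice ht).mul_right.integrableOn
      (((hΦ k).sm.slice ht).mul (Sl.fst.mul (sG2.slice ht))).continuous) fun p hp =>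
        mul_nonneg ((hΦ k).nonneg t p) (mul_nonneg (le_of_lt hp) (bet_bounds hε m _).1)).trans_le ?_
    exact ENNReal.ofReal_le_ofReal (step1 ε hε k)
  have hε : ∀ k : ℕ, (0:ℝ) < 1 / ((k : ℝ) + 1) := fun k => Nat.one_div_pos_of_nat
  have pt : ∀ p : ℝ × ℝ, Tendsto (fun k : ℕ => ENNReal.ofReal (p.1 * bet (1 / ((k : ℝ) + 1)) m (vort (v t) (f t) p)))
      atTop (𝓝 (ENNReal.ofReal (p.1 * vort (v t) (f t) p ^ (2 * (m + 1))))) := fun p => by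
    refine ENNReal.tendsto_ofReal (Tendsto.const_mul _ ?_)
    have h0 := tendsto_one_div_add_atTop_nhds_zero_nat (𝕜 := ℝ)
    set w := vort (v t) (f t) p
    have h1 : Tendsto (fun k : ℕ => trunc (1 / ((k : ℝ) + 1)) w) atTop (𝓝 (w ^ 2 / (1 + 0 * w ^ 2))) :=
      (tendsto_const_nhds).div ((h0.mul_const _).const_add 1) (by simp)
    have h2 := (h1.pow m).const_mul (w ^ 2)
    have e : w ^ 2 * (w ^ 2 / (1 + 0 * w ^ 2)) ^ m = w ^ (2 * (m + 1)) := by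
      simp only [zero_mul, add_zero, div_one]
      rw [← pow_succ', ← pow_mul]
    rw [← e]
    exact h2
  have fat : ∫⁻ p in H, ENNReal.ofReal (p.1 * vort (v t) (f t) p ^ (2 * (m + 1))) ≤
      liminf (fun k : ℕ => ∫⁻ p in H, ENNReal.ofReal (p.1 * bet (1 / ((k : ℝ) + 1)) m (vort (v t) (f t) p))) atTop := by
    refine le_trans (le_of_eq (lintegral_congr fun p => (pt p).liminf_eq.symm)) (lintegral_liminf_le fun k => ?_)
    exact (ENNReal.continuous_ofReal.comp (Sl.fst.mul
      ((h.s_vort.comp_left (contDiff_bet (hε k) m)).slice ht)).continuous).measurable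
  refine fat.trans ?_
  calc _ ≤ liminf (fun _ : ℕ => ENNReal.ofReal (E * c)) atTop :=
        liminf_le_liminf (Eventually.of_forall fun k => step2 _ (hε k))
    _ = _ := tendsto_const_nhds.liminf_eq

end VorticityEstimate


section Diagonal

/-- Restriction of a symmetric function of two times to the diagonal. -/
theorem diagonal_sub_eq_integral {b : ℝ} (hb : 0 < b) {φ l : ℝ → ℝ → ℝ} {k : ℝ → ℝ}
    (hsymm : ∀ s t, φ s t = φ t s)
    (hi : ∀ s ∈ Icc 0 b, IntervalIntegrable (fun τ => l τ s) volume 0 b)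
    (hφ : ∀ s ∈ Icc 0 b, ∀ t₁ ∈ Icc 0 b, ∀ t₂ ∈ Icc 0 b, t₁ ≤ t₂ → φ s t₂ - φ s t₁ = ∫ τ in t₁..t₂, l τ s)
    (hk : IntervalIntegrable k volume 0 b)
    (hae : ∀ᵐ τ, τ ∈ Icc 0 b → (∀ s ∈ Icc 0 b, |l τ s| ≤ k τ) ∧ ContinuousOn (l τ) (Icc 0 b)) :
    IntervalIntegrable (fun τ => l τ τ) volume 0 b ∧ φ b b - φ 0 0 = 2 * ∫ τ in (0:ℝ)..b, l τ τ := by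
  have hδ : ∀ n : ℕ, 0 < b / (n + 1) := fun n => by positivity
  let fl : ℕ → ℝ → ℕ := fun n τ => ⌊τ / (b / (n + 1))⌋₊
  let d : ℕ → ℝ → ℝ := fun n τ => (b / (n + 1)) * fl n τ
  let c : ℕ → ℝ → ℝ := fun n τ => (b / (n + 1)) * (fl n τ + 1)
  have hd1 : ∀ n, ∀ τ ∈ Ioo 0 b, d n τ ≤ τ ∧ τ < c n τ := fun n τ hτ => by
    have h1 := Nat.floor_le (div_nonneg hτ.1.le (hδ n).le)
    have h2 := Nat.lt_floor_add_one (τ / (b / (n + 1)))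
    rw [le_div_iff₀ (hδ n)] at h1
    rw [div_lt_iff₀ (hδ n)] at h2
    exact ⟨by rw [mul_comm] at h1; exact h1, by rw [mul_comm] at h2; exact h2⟩
  have hcd : ∀ n τ, c n τ = d n τ + b / (n + 1) := fun n τ => by simp only [c, d]; ring
  have hmem : ∀ n, ∀ τ ∈ Ioo 0 b, d n τ ∈ Icc 0 b ∧ c n τ ∈ Icc 0 b := fun n τ hτ => by
    obtain ⟨h1, h2⟩ := hd1 n τ hτ
    have hd0 : 0 ≤ d n τ := by have := hδ n; positivity
    refine ⟨⟨hd0, h1.trans hτ.2.le⟩, hτ.1.le.trans h2.le, ?_⟩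
    have h3 : fl n τ < n + 1 := by
      have h4 : (b / (n + 1)) * fl n τ < b := h1.trans_lt hτ.2
      rw [div_mul_eq_mul_div, div_lt_iff₀ (by positivity)] at h4
      have := lt_of_mul_lt_mul_left h4 hb.le
      exact_mod_cast this
    have h4 : (fl n τ : ℝ) + 1 ≤ n + 1 := by exact_mod_cast h3
    calc c n τ ≤ (b / (n + 1)) * (n + 1) := mul_le_mul_of_nonneg_left h4 (hδ n).le
      _ = b := by field_simp
  let L : ℕ → ℝ → ℝ := fun n τ => l τ (c n τ) + l τ (d n τ)
  let p : ℕ → ℕ → ℝ := fun n i => (b / (n + 1)) * i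
  have hp : ∀ n i, i ≤ n + 1 → p n i ∈ Icc 0 b := fun n i hi => by
    have h4 : (i : ℝ) ≤ n + 1 := by exact_mod_cast hi
    refine ⟨by have := hδ n; positivity, ?_⟩
    calc p n i ≤ (b / (n + 1)) * (n + 1) := mul_le_mul_of_nonneg_left h4 (hδ n).le
      _ = b := by field_simp
  have hp1 : ∀ n i, p n i ≤ p n (i + 1) := fun n i => by
    simp only [p]; push_cast
    have := hδ n
    nlinarith
  have hfl : ∀ n i, ∀ τ ∈ Ioo (p n i) (p n (i + 1)), d n τ = p n i ∧ c n τ = p n (i + 1) := fun n i τ hτ => by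
    have h0 : 0 ≤ p n i := by have := hδ n; simp only [p]; positivity
    have h1 : fl n τ = i := by
      refine (Nat.floor_eq_iff (div_nonneg (h0.trans hτ.1.le) (hδ n).le)).2 ⟨?_, ?_⟩
      · rw [le_div_iff₀ (hδ n), mul_comm]; exact hτ.1.le
      · rw [div_lt_iff₀ (hδ n), mul_comm]
        have := hτ.2
        simp only [p] at this
        push_cast at this
        exact this
    exact ⟨by simp only [d, p, h1], by simp only [c, p, h1]; push_cast; rfl⟩
  have piece : ∀ n i, i < n + 1 → IntervalIntegrable (L n) volume (p n i) (p n (i + 1)) ∧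
      ∫ τ in p n i..p n (i + 1), L n τ = φ (p n (i + 1)) (p n (i + 1)) - φ (p n i) (p n i) := fun n i hin => by
    have m1 := hp n i hin.le
    have m2 := hp n (i + 1) hin
    have hsub : uIcc (p n i) (p n (i + 1)) ⊆ uIcc 0 b := by
      rw [uIcc_of_le (hp1 n i), uIcc_of_le hb.le]; exact Icc_subset_Icc m1.1 m2.2
    have i1 := (hi _ m2).mono_set hsub
    have i2 := (hi _ m1).mono_set hsub
    have heq : ∀ᵐ τ, τ ∈ uIoc (p n i) (p n (i + 1)) → l τ (p n (i + 1)) + l τ (p n i) = L n τ := by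
      have : ∀ᵐ τ : ℝ, τ ≠ p n (i + 1) := by simp [ae_iff]
      filter_upwards [this] with τ hne hτ
      rw [uIoc_of_le (hp1 n i)] at hτ
      have := hfl n i τ ⟨hτ.1, lt_of_le_of_ne hτ.2 hne⟩
      simp only [L, this.1, this.2]
    refine ⟨IntervalIntegrable.congr_uIoo (f := fun τ => l τ (p n (i + 1)) + l τ (p n i)) (i1.add i2) fun τ hτ => ?_, ?_⟩
    · rw [uIoo_of_le (hp1 n i)] at hτ
      have := hfl n i τ hτ
      simp only [L, this.1, this.2]
    rw [← intervalIntegral.integral_congr_ae heq, intervalIntegral.integral_add i1 i2,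
      ← hφ _ m2 _ m1 _ m2 (hp1 n i), ← hφ _ m1 _ m1 _ m2 (hp1 n i), hsymm (p n i) (p n (i + 1))]
    ring
  have hp0 : ∀ n, p n 0 = 0 := fun n => by simp [p]
  have hpn : ∀ n, p n (n + 1) = b := fun n => by simp only [p]; push_cast; field_simp
  have tot : ∀ n, IntervalIntegrable (L n) volume 0 b ∧ ∫ τ in (0:ℝ)..b, L n τ = φ b b - φ 0 0 := fun n => by
    have h1 := IntervalIntegrable.trans_iterate (a := p n) (n := n + 1) (μ := volume) (f := L n)
      (fun i hi => (piece n i hi).1)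
    have h2 := intervalIntegral.sum_integral_adjacent_intervals (a := p n) (n := n + 1) (μ := volume) (f := L n)
      (fun i hi => (piece n i hi).1)
    rw [hp0, hpn] at h1 h2
    refine ⟨h1, ?_⟩
    rw [← h2, Finset.sum_congr rfl fun i hi => (piece n i (Finset.mem_range.1 hi)).2,
      Finset.sum_range_sub (fun i => φ (p n i) (p n i)), hp0, hpn]
  have hae' : ∀ᵐ τ, τ ∈ uIoc 0 b → τ ∈ Ioo 0 b ∧ (∀ s ∈ Icc 0 b, |l τ s| ≤ k τ) ∧ ContinuousOn (l τ) (Icc 0 b) := by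
    have : ∀ᵐ τ : ℝ, τ ≠ b := by simp [ae_iff]
    filter_upwards [hae, this] with τ h1 hne hτ
    rw [uIoc_of_le hb.le] at hτ
    have h2 : τ ∈ Ioo 0 b := ⟨hτ.1, lt_of_le_of_ne hτ.2 hne⟩
    exact ⟨h2, h1 (Ioo_subset_Icc_self h2)⟩
  have hlim : ∀ᵐ τ, τ ∈ uIoc 0 b → Tendsto (fun n => L n τ) atTop (𝓝 (2 * l τ τ)) := by
    filter_upwards [hae'] with τ h hτ
    obtain ⟨h1, _, h3⟩ := h hτ
    have hz : Tendsto (fun n : ℕ => b / ((n : ℝ) + 1)) atTop (𝓝 0) :=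
      (tendsto_atTop_add_const_right _ _ tendsto_natCast_atTop_atTop).const_div_atTop b
    have td : Tendsto (fun n => d n τ) atTop (𝓝 τ) := by
      refine tendsto_of_tendsto_of_tendsto_of_le_of_le (g := fun n : ℕ => τ - b / ((n : ℝ) + 1)) (h := fun _ => τ)
        (by simpa using hz.const_sub τ) tendsto_const_nhds (fun n => ?_) (fun n => (hd1 n τ h1).1)
      have := (hd1 n τ h1).2
      rw [hcd] at this
      show τ - b / ((n : ℝ) + 1) ≤ d n τ
      linarith
    have tc : Tendsto (fun n => c n τ) atTop (𝓝 τ) := by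
      simp only [hcd]
      simpa using td.add hz
    have hc := h3 τ (Ioo_subset_Icc_self h1)
    have t1 := hc.tendsto.comp (tendsto_nhdsWithin_iff.2 ⟨tc, Eventually.of_forall fun n => (hmem n τ h1).2⟩)
    have t2 := hc.tendsto.comp (tendsto_nhdsWithin_iff.2 ⟨td, Eventually.of_forall fun n => (hmem n τ h1).1⟩)
    rw [two_mul]
    exact t1.add t2
  have hbd : ∀ n, ∀ᵐ τ, τ ∈ uIoc 0 b → ‖L n τ‖ ≤ 2 * k τ := fun n => by
    filter_upwards [hae'] with τ h hτ
    obtain ⟨h1, h2, _⟩ := h hτ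
    have := h2 _ (hmem n τ h1).1
    have := h2 _ (hmem n τ h1).2
    refine (norm_add_le _ _).trans ?_
    simp only [Real.norm_eq_abs]
    linarith
  have hm : ∀ n, AEStronglyMeasurable (L n) (volume.restrict (uIoc 0 b)) := fun n =>
    (tot n).1.aestronglyMeasurable_restrict_uIoc
  have hlim' := intervalIntegral.tendsto_integral_filter_of_dominated_convergence (l := atTop) (F := L)
    (fun τ => 2 * k τ) (Eventually.of_forall hm) (Eventually.of_forall hbd) (hk.const_mul 2) hlim
  have hint : IntervalIntegrable (fun τ => 2 * l τ τ) volume 0 b := by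
    refine (hk.const_mul 2).mono_fun' ?_ ?_
    · exact aestronglyMeasurable_of_tendsto_ae atTop hm ((ae_restrict_iff' measurableSet_uIoc).2 hlim)
    · refine (ae_restrict_iff' measurableSet_uIoc).2 ?_
      filter_upwards [hae'] with τ h hτ
      obtain ⟨h1, h2, _⟩ := h hτ
      have := h2 τ (Ioo_subset_Icc_self h1)
      rw [norm_mul, Real.norm_two, Real.norm_eq_abs]
      linarith
  refine ⟨by simpa using hint.const_mul 2⁻¹, ?_⟩
  simp only [(tot _).2] at hlim'
  rw [← intervalIntegral.integral_const_mul]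
  exact tendsto_nhds_unique tendsto_const_nhds hlim'

end Diagonal

section Pairing

/-- The weighted inner product on the half-plane. -/
noncomputable def ip (a w : ℝ × ℝ → ℝ) : ℝ := ∫ p in H, p.1 * (a p * w p)

/-- Square integrability on the half-plane, with a bound. -/
structure L2 (a : ℝ × ℝ → ℝ) (C : ℝ) : Prop where
  meas : AEStronglyMeasurable a (volume.restrict H)
  int : IntegrableOn (fun p => p.1 * a p ^ 2) H
  le : ∫ p in H, p.1 * a p ^ 2 ≤ C

variable {a w : ℝ × ℝ → ℝ} {C D : ℝ}

theorem L2.nonneg (h : L2 a C) : 0 ≤ C :=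
  le_trans (setIntegral_nonneg measurableSet_H fun _ hp => mul_nonneg (le_of_lt hp) (sq_nonneg _)) h.le

theorem ae_H {P : ℝ × ℝ → Prop} (h : ∀ p ∈ H, P p) : ∀ᵐ p ∂(volume.restrict H), P p :=
  (ae_restrict_iff' measurableSet_H).2 (Eventually.of_forall h)

theorem L2.integrable_mul (h : L2 a C) (h' : L2 w D) : IntegrableOn (fun p => p.1 * (a p * w p)) H := by
  refine Integrable.mono' (h.int.add h'.int) ?_ (ae_H fun p hp => ?_)
  · exact measurable_fst.aestronglyMeasurable.mul (h.meas.mul h'.meas)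
  · have hp : 0 < p.1 := hp
    rw [norm_mul, Real.norm_of_nonneg hp.le, Real.norm_eq_abs]
    have : |a p * w p| ≤ a p ^ 2 + w p ^ 2 := by
      rw [abs_le]; constructor <;> nlinarith [sq_nonneg (a p + w p), sq_nonneg (a p - w p)]
    show p.1 * |a p * w p| ≤ p.1 * a p ^ 2 + p.1 * w p ^ 2
    nlinarith [mul_le_mul_of_nonneg_left this hp.le]

theorem L2.of_le {Q : ℝ × ℝ → ℝ} (ha : AEStronglyMeasurable a (volume.restrict H)) (hQ : IntegrableOn Q H)
    (hC : ∫ p in H, Q p ≤ C) (hle : ∀ p ∈ H, p.1 * a p ^ 2 ≤ Q p) : L2 a C := by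
  have hi : IntegrableOn (fun p => p.1 * a p ^ 2) H := by
    refine Integrable.mono' hQ (measurable_fst.aestronglyMeasurable.mul (ha.pow 2)) (ae_H fun p hp => ?_)
    rw [Real.norm_of_nonneg (mul_nonneg (le_of_lt hp) (sq_nonneg _))]
    exact hle p hp
  exact ⟨ha, hi, ((HI.of hi).le (HI.of hQ) hle).trans hC⟩

theorem L2.abs_ip_le (h : L2 a C) (h' : L2 w D) {l : ℝ} (hl : 0 < l) : |ip a w| ≤ l * C + D / l := by
  have I1 := ((HI.of h.int).const_mul l).add ((HI.of h'.int).const_mul l⁻¹)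
  have hi := h.integrable_mul h'
  have pt : ∀ p ∈ H, |p.1 * (a p * w p)| ≤ l * (p.1 * a p ^ 2) + l⁻¹ * (p.1 * w p ^ 2) := fun p hp => by
    have hp : 0 < p.1 := hp
    rw [abs_mul, abs_of_pos hp]
    have : |a p * w p| ≤ l * a p ^ 2 + l⁻¹ * w p ^ 2 := by
      have e1 : l * a p ^ 2 + l⁻¹ * w p ^ 2 - a p * w p = l⁻¹ * ((l * a p - w p / 2) ^ 2 + 3 / 4 * w p ^ 2) := by
        field_simp; ring
      have e2 : l * a p ^ 2 + l⁻¹ * w p ^ 2 + a p * w p = l⁻¹ * ((l * a p + w p / 2) ^ 2 + 3 / 4 * w p ^ 2) := by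
        field_simp; ring
      have p1 : 0 ≤ l⁻¹ * ((l * a p - w p / 2) ^ 2 + 3 / 4 * w p ^ 2) := by positivity
      have p2 : 0 ≤ l⁻¹ * ((l * a p + w p / 2) ^ 2 + 3 / 4 * w p ^ 2) := by positivity
      rw [abs_le]; constructor <;> linarith
    nlinarith [mul_le_mul_of_nonneg_left this hp.le]
  have I2 : HI (fun p => |p.1 * (a p * w p)|) _ := HI.of hi.abs
  calc |ip a w| ≤ ∫ p in H, |p.1 * (a p * w p)| := abs_integral_le_integral_abs
    _ ≤ l * (∫ p in H, p.1 * a p ^ 2) + l⁻¹ * ∫ p in H, p.1 * w p ^ 2 := I2.le I1 pt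
    _ ≤ l * C + l⁻¹ * D := by gcongr; exacts [h.le, h'.le]
    _ = _ := by rw [inv_mul_eq_div]

/-- Weak continuity in time. -/
theorem continuousOn_ip {b : ℝ} {F : ℝ → ℝ × ℝ → ℝ} (h : L2 a C) (hF : Sm b F) (ha : Continuous a)
    (hFD : ∀ s ∈ Icc 0 b, L2 (F s) D) : ContinuousOn (fun s => ip a (F s)) (Icc 0 b) := by
  have hn0 : ∀ n : ℕ, (0:ℝ) < ((n + 1 : ℕ) : ℝ) := fun n => by positivity
  have sχ : ∀ n : ℕ, Sl (chi ((n + 1 : ℕ) : ℝ)) := fun n =>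
    ((contDiff_cutS _).comp contDiff_fst).mul ((contDiff_cutS _).comp contDiff_snd)
  let tl : ℕ → ℝ := fun n => ∫ p in H, p.1 * ((1 - chi ((n + 1 : ℕ) : ℝ) p) * a p) ^ 2
  have hb : ∀ n : ℕ, ∀ p ∈ H, ‖p.1 * ((1 - chi ((n + 1 : ℕ) : ℝ) p) * a p) ^ 2‖ ≤ p.1 * a p ^ 2 := fun n p hp => by
    have hp : 0 < p.1 := hp
    have h0 := chi_nonneg ((n + 1 : ℕ) : ℝ) p
    have h1 := chi_le_one ((n + 1 : ℕ) : ℝ) p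
    rw [Real.norm_of_nonneg (by positivity), mul_pow]
    refine mul_le_mul_of_nonneg_left (mul_le_of_le_one_left (sq_nonneg _) ?_) hp.le
    exact pow_le_one₀ (by linarith) (by linarith)
  have hm : ∀ n : ℕ, AEStronglyMeasurable (fun p => p.1 * ((1 - chi ((n + 1 : ℕ) : ℝ) p) * a p) ^ 2) (volume.restrict H) :=
    fun n => by
      have := (sχ n).continuous
      exact (by fun_prop : Continuous fun p : ℝ × ℝ => p.1 * ((1 - chi ((n + 1 : ℕ) : ℝ) p) * a p) ^ 2).aestronglyMeasurable
  have htl : Tendsto tl atTop (𝓝 0) := by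
    have := tendsto_integral_of_dominated_convergence (μ := volume.restrict H) (f := fun _ => (0:ℝ))
      (F := fun (n : ℕ) p => p.1 * ((1 - chi ((n + 1 : ℕ) : ℝ) p) * a p) ^ 2)
      (fun p => p.1 * a p ^ 2) hm h.int (fun n => ae_H (hb n)) (Eventually.of_forall fun p => by
        have h1 : Tendsto (fun n : ℕ => chi ((n + 1 : ℕ) : ℝ) p) atTop (𝓝 1) :=
          (tendsto_chi p).comp (tendsto_add_atTop_nat 1)
        simpa only [sub_self, zero_mul, ne_eq, OfNat.ofNat_ne_zero, not_false_eq_true, zero_pow, mul_zero] using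
          (((h1.const_sub 1).mul_const (a p)).pow 2).const_mul p.1)
    simpa only [integral_zero] using this
  have hu : TendstoUniformlyOn (fun (n : ℕ) s => ip (fun p => chi ((n + 1 : ℕ) : ℝ) p * a p) (F s))
      (fun s => ip a (F s)) atTop (Icc 0 b) := by
    rw [Metric.tendstoUniformlyOn_iff]
    intro e he
    by_cases hne : (Icc 0 b).Nonempty
    swap
    · exact Eventually.of_forall fun n s hs => absurd ⟨s, hs⟩ hne
    obtain ⟨s0, hs0⟩ := hne
    have hD := (hFD s0 hs0).nonneg
    set l : ℝ := 2 * (D + 1) / e with hl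
    have hl0 : 0 < l := by positivity
    have hev : ∀ᶠ n in atTop, tl n < e / (4 * l) := htl.eventually (gt_mem_nhds (by positivity))
    filter_upwards [hev] with n hn s hs
    have hχ : L2 (fun p => chi ((n + 1 : ℕ) : ℝ) p * a p) C :=
      L2.of_le ((sχ n).continuous.mul ha).aestronglyMeasurable h.int h.le fun p hp => by
        have h0 := chi_nonneg ((n + 1 : ℕ) : ℝ) p
        have h1 := chi_le_one ((n + 1 : ℕ) : ℝ) p
        rw [mul_pow]
        exact mul_le_mul_of_nonneg_left (mul_le_of_le_one_left (sq_nonneg _) (pow_le_one₀ h0 h1)) (le_of_lt hp)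
    have ht : L2 (fun p => (1 - chi ((n + 1 : ℕ) : ℝ) p) * a p) (e / (4 * l)) :=
      ⟨((continuous_const.sub (sχ n).continuous).mul ha).aestronglyMeasurable,
        Integrable.mono' h.int (hm n) (ae_H (hb n)), hn.le⟩
    have e1 : ip a (F s) - ip (fun p => chi ((n + 1 : ℕ) : ℝ) p * a p) (F s) =
        ip (fun p => (1 - chi ((n + 1 : ℕ) : ℝ) p) * a p) (F s) := by
      have J := ((HI.of (h.integrable_mul (hFD s hs))).sub (HI.of (hχ.integrable_mul (hFD s hs))))
      exact (J.congr fun p _ => by ring).val.symm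
    rw [Real.dist_eq, e1]
    refine (ht.abs_ip_le (hFD s hs) hl0).trans_lt ?_
    have e2 : l * (e / (4 * l)) = e / 4 := by field_simp
    have e3 : D / l < e / 2 := by
      rw [hl, div_div_eq_mul_div, div_lt_div_iff₀ (by positivity) two_pos]
      nlinarith
    linarith
  refine hu.continuousOn (Frequently.of_forall fun n => ?_)
  have sG : ContinuousOn (fun q : ℝ × (ℝ × ℝ) => q.2.1 * (chi ((n + 1 : ℕ) : ℝ) q.2 * a q.2 * F q.1 q.2)) (Icc 0 b ×ˢ univ) := by
    refine ContinuousOn.mul (by fun_prop) (ContinuousOn.mul ?_ hF.continuousOn)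
    exact (((sχ n).continuous.comp continuous_snd).mul (ha.comp continuous_snd)).continuousOn
  refine BHt.continuousOn_integral (G := fun s p => p.1 * (chi ((n + 1 : ℕ) : ℝ) p * a p * F s p)) ?_ sG
  obtain ⟨L, hL⟩ := BH_chi (hn0 n)
  exact ⟨L, fun t _ p hp hh => by simp only [hL p hp hh, zero_mul, mul_zero]⟩

/-- Dominated convergence for the pairing. -/
theorem tendsto_ip {z : ℕ → ℝ × ℝ → ℝ} {y Z : ℝ × ℝ → ℝ} {c : ℝ} (h : L2 a C) (hZ : L2 Z D)
    (hz : ∀ n, Continuous (z n)) (hb : ∀ n, ∀ p ∈ H, |z n p| ≤ c * Z p)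
    (hlim : ∀ p ∈ H, Tendsto (fun n => z n p) atTop (𝓝 (y p))) :
    Tendsto (fun n => ip a (z n)) atTop (𝓝 (ip a y)) := by
  have hi := ((h.integrable_mul hZ).const_mul c).abs
  refine tendsto_integral_of_dominated_convergence (fun p => |c * (p.1 * (a p * Z p))|) (fun n => ?_) hi
    (fun n => ae_H fun p hp => ?_) (ae_H fun p hp => ?_)
  · exact measurable_fst.aestronglyMeasurable.mul (h.meas.mul (hz n).aestronglyMeasurable)
  · have hp' : 0 < p.1 := hp
    rw [Real.norm_eq_abs, abs_mul, abs_mul, abs_mul, abs_mul, abs_mul]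
    have h1 : |z n p| ≤ |c| * |Z p| := by
      rw [← abs_mul]; exact (hb n p hp).trans (le_abs_self _)
    calc |p.1| * (|a p| * |z n p|) ≤ |p.1| * (|a p| * (|c| * |Z p|)) := by gcongr
      _ = _ := by ring
  · exact ((hlim p hp).const_mul (a p)).const_mul p.1

end Pairing


section Stream

variable {v f : ℝ × ℝ → ℝ}

/-- The function `q` with `∂_r (r² q) = r u_z`, `∂_z q = - u_r / r`. -/
noncomputable def strm (f : ℝ × ℝ → ℝ) : ℝ × ℝ → ℝ := Av 1 f

theorem Prof.s_strm (h : Prof v f) : Sl (strm f) := h.sf.Av 1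

theorem Prof.f_eq (h : Prof v f) (p : ℝ × ℝ) : f p = 2 * strm f p + p.1 * dr (strm f) p := by
  have := h.sf.euler 1 p
  rw [strm, h.sf.dr_Av]
  rw [this]; norm_num

theorem Prof.dz_strm (h : Prof v f) (p : ℝ × ℝ) (hp : 0 < p.1) : dz (strm f) p = -quot v p := by
  obtain ⟨r, z⟩ := p
  have hp : 0 < r := hp
  rw [strm, h.sf.dz_Av]
  let D : ℝ × ℝ → ℝ := fun p => Av 1 (dz f) p + quot v p
  have sD : Sl D := (h.sf.dz.Av 1).add h.s_quot
  have e : ∀ s, 0 < s → 2 * D (s, z) + s * dr D (s, z) = 0 := fun s hs => by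
    have e1 := h.sf.dz.euler 1 (s, z)
    have e2 := h.dz_f (s, z) hs
    have e3 : dr D (s, z) = dr (Av 1 (dz f)) (s, z) + dr (quot v) (s, z) :=
      (((h.sf.dz.Av 1).hasDerivAt_r s z).add (h.s_quot.hasDerivAt_r s z)).deriv
    rw [h.sf.dz.dr_Av] at e3
    rw [e3]
    simp only [D]
    norm_num at e1 e2 ⊢
    linarith
  have hd : ∀ s, HasDerivAt (fun s => s ^ 2 * D (s, z)) (s * (2 * D (s, z) + s * dr D (s, z))) s := fun s =>
    ((hasDerivAt_pow 2 s).mul (sD.hasDerivAt_r s z)).congr_deriv (by push_cast; ring)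
  have hc := constant_of_has_deriv_right_zero (f := fun s => s ^ 2 * D (s, z)) (a := 0) (b := r)
    (fun s _ => (hd s).continuousAt.continuousWithinAt) (fun s hs => by
      rcases hs.1.eq_or_lt with h0 | h0
      · have := (hd s).hasDerivWithinAt (s := Ici s)
        rw [← h0] at this ⊢
        simpa using this
      · have := (hd s).hasDerivWithinAt (s := Ici s)
        rwa [e s h0, mul_zero] at this) r ⟨hp.le, le_rfl⟩
  have : r ^ 2 * D (r, z) = 0 := by simpa using hc
  have : D (r, z) = 0 := by
    rcases mul_eq_zero.1 this with h0 | h0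
    · exact absurd h0 (by positivity)
    · exact h0
  simp only [D] at this
  linarith

theorem contDiff_chi (R : ℝ) : Sl (chi R) :=
  ((contDiff_cutS _).comp contDiff_fst).mul ((contDiff_cutS _).comp contDiff_snd)

theorem dr_chi (R : ℝ) (p : ℝ × ℝ) : dr (chi R) p = deriv (cutS R) p.1 * cutS R p.2 :=
  ((hasDerivAt_cutS R p.1).mul_const (cutS R p.2)).deriv

theorem dz_chi (R : ℝ) (p : ℝ × ℝ) : dz (chi R) p = cutS R p.1 * deriv (cutS R) p.2 :=
  ((hasDerivAt_cutS R p.2).const_mul (cutS R p.1)).deriv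

theorem deriv_cutS_nonpos (R : ℝ) {s : ℝ} (hs : 0 ≤ s) : deriv (cutS R) s ≤ 0 := by
  rw [deriv_cutS]
  exact mul_nonpos_of_nonpos_of_nonneg (deriv_cut_nonpos _) (by positivity)

/-- Hardy's inequality. -/
theorem Prof.integral_strm_sq_le (h : Prof v f) (hi : IntegrableOn (fun p => p.1 * f p ^ 2) H) :
    IntegrableOn (fun p => p.1 * strm f p ^ 2) H ∧ ∫ p in H, p.1 * strm f p ^ 2 ≤ ∫ p in H, p.1 * f p ^ 2 := by
  have sq := h.s_strm
  have cq := sq.continuous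
  have cf := h.sf.continuous
  have cqr := sq.dr.continuous
  have hn0 : ∀ n : ℕ, (0:ℝ) < ((n + 1 : ℕ) : ℝ) := fun n => by positivity
  have key : ∀ n : ℕ, IntegrableOn (fun p => chi ((n + 1 : ℕ) : ℝ) p * (p.1 * strm f p ^ 2)) H ∧
      ∫ p in H, chi ((n + 1 : ℕ) : ℝ) p * (p.1 * strm f p ^ 2) ≤ (∫ p in H, p.1 * f p ^ 2) + 0 := fun n => by
    set R : ℝ := ((n + 1 : ℕ) : ℝ)
    have sX := contDiff_chi R
    have cX := sX.continuous
    have cXr := sX.dr.continuous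
    have bX := BH_chi (hn0 n)
    have i1 : HI (fun p => chi R p * (p.1 * strm f p ^ 2)) _ :=
      HI.of (bX.mul_right.integrableOn (by fun_prop : Continuous fun p : ℝ × ℝ => chi R p * (p.1 * strm f p ^ 2)))
    have i2 : HI (fun p => chi R p * (p.1 * f p ^ 2)) _ :=
      HI.of (bX.mul_right.integrableOn (by fun_prop : Continuous fun p : ℝ × ℝ => chi R p * (p.1 * f p ^ 2)))
    have i3 : HI (fun p => dr (chi R) p * (p.1 ^ 2 * strm f p ^ 2) +
        chi R p * (2 * p.1 * strm f p ^ 2 + 2 * p.1 ^ 2 * strm f p * dr (strm f) p)) 0 := by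
      refine HI.dr_zero (G := fun p => chi R p * (p.1 ^ 2 * strm f p ^ 2)) (by fun_prop) (by fun_prop) ?_ bX.mul_right
        (fun z => by simp)
      intro r z _
      refine ((sX.hasDerivAt_r r z).mul (((hasDerivAt_id r).pow 2).mul ((sq.hasDerivAt_r r z).pow 2))).congr_deriv ?_
      simp only [id, Pi.mul_apply, Pi.pow_apply]
      push_cast; ring
    refine ⟨i1.int, ?_⟩
    have h1 := i1.le ((i2.sub i3)) fun p hp => by
      have hp : 0 < p.1 := hp
      have x0 := chi_nonneg R p
      have xr : dr (chi R) p ≤ 0 := by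
        rw [dr_chi]; exact mul_nonpos_of_nonpos_of_nonneg (deriv_cutS_nonpos R hp.le) (cutS_nonneg _ _)
      have e := h.f_eq p
      have t1 : 0 ≤ chi R p * (p.1 * (f p - strm f p) ^ 2) := by positivity
      have t2 : 0 ≤ -dr (chi R) p * (p.1 ^ 2 * strm f p ^ 2) := mul_nonneg (by linarith) (by positivity)
      have e2 : p.1 * dr (strm f) p = f p - 2 * strm f p := by linarith
      have e3 : 2 * p.1 * strm f p ^ 2 + 2 * p.1 ^ 2 * strm f p * dr (strm f) p =
        2 * p.1 * strm f p ^ 2 + 2 * p.1 * strm f p * (f p - 2 * strm f p) := by rw [← e2]; ring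
      rw [e3]
      linarith
    have h2 := i2.le (HI.of hi) fun p hp => by
      have hp : 0 < p.1 := hp
      exact mul_le_of_le_one_left (by positivity) (chi_le_one R p)
    linarith
  exact integrableOn_of_cutoff (X := fun n => chi ((n + 1 : ℕ) : ℝ)) (ε := fun _ => 0)
    (by fun_prop : Continuous fun p : ℝ × ℝ => p.1 * strm f p ^ 2).aestronglyMeasurable
    (fun p hp => mul_nonneg (le_of_lt hp) (sq_nonneg _)) (fun n p _ => chi_nonneg _ _)
    (fun p _ => (tendsto_chi p).comp (tendsto_add_atTop_nat 1))
    (Eventually.of_forall fun n => (key n).1) (Eventually.of_forall fun n => (key n).2) tendsto_const_nhds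

end Stream

section Test

/-- The divergence free field with stream function `κ`, together with its horizontal gradient. -/
noncomputable def tst (κ : ℝ × ℝ → ℝ) : Fin 5 → ℝ × ℝ → ℝ :=
  ![fun p => -(p.1 * dz κ p), fun p => 2 * κ p + p.1 * dr κ p, dr fun p => -(p.1 * dz κ p),
    dr fun p => 2 * κ p + p.1 * dr κ p, fun p => -dz κ p]

/-- The velocity together with its horizontal gradient. -/
noncomputable def prf (v f : ℝ × ℝ → ℝ) : Fin 5 → ℝ × ℝ → ℝ := ![v, f, dr v, dr f, quot v]

/-- The forces in the weak formulation of the momentum equation. -/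
noncomputable def frc (v f ρ : ℝ × ℝ → ℝ) : Fin 5 → ℝ × ℝ → ℝ :=
  ![fun p => -(v p * dr v p + f p * dz v p), fun p => ρ p - (v p * dr f p + f p * dz f p),
    fun p => -dr v p, fun p => -dr f p, fun p => -quot v p]

/-- The pairing of tuples. -/
noncomputable def pair (A W : Fin 5 → ℝ × ℝ → ℝ) : ℝ := ∑ i, ip (A i) (W i)

theorem s_tst {κ : ℝ × ℝ → ℝ} (hκ : Sl κ) (i : Fin 5) : Sl (tst κ i) := by
  have s1 : Sl fun p => -(p.1 * dz κ p) := (Sl.fst.mul hκ.dz).neg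
  have s2 : Sl fun p => 2 * κ p + p.1 * dr κ p := (contDiff_const.mul hκ).add (Sl.fst.mul hκ.dr)
  fin_cases i
  exacts [s1, s2, s1.dr, s2.dr, hκ.dz.neg]

/-- A dominating function for the truncated test fields. -/
noncomputable def dom (v f : ℝ × ℝ → ℝ) (p : ℝ × ℝ) : ℝ :=
  |v p| + |f p| + |strm f p| + |dr v p| + |dr f p| + |quot v p|

theorem cut_coefficients {R r : ℝ} (hR : 1 ≤ R) (hr : 0 < r) (z : ℝ) :
    |cutS R r * cutS R z| ≤ 36 * cutK ^ 2 ∧ |cutS R r * deriv (cutS R) z| ≤ 36 * cutK ^ 2 ∧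
    |deriv (cutS R) r * cutS R z| ≤ 36 * cutK ^ 2 ∧ |r * cutS R r * deriv (cutS R) z| ≤ 36 * cutK ^ 2 ∧
    |r * deriv (cutS R) r * cutS R z| ≤ 36 * cutK ^ 2 ∧
    |r * deriv (cutS R) r * deriv (cutS R) z| ≤ 36 * cutK ^ 2 ∧
    |r * deriv (deriv (cutS R)) r * cutS R z| ≤ 36 * cutK ^ 2 := by
  have hK := one_le_cutK
  have hR0 : 0 < R := by linarith
  have ab : ∀ s, |cutS R s| ≤ 1 := fun s => by rw [abs_of_nonneg (cutS_nonneg _ _)]; exact cutS_le_one _ _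
  have d1 : ∀ s, |deriv (cutS R) s| ≤ 4 * cutK / R := fun s => (abs_deriv_cutS_le hR0 s).1
  have d2 : ∀ s, |deriv (deriv (cutS R)) s| ≤ 18 * cutK / R ^ 2 := fun s => (abs_deriv_cutS_le hR0 s).2.2
  have d1' : 4 * cutK / R ≤ 4 * cutK := div_le_self (by linarith) hR
  have K2 : cutK ≤ cutK ^ 2 := by nlinarith
  have c0 : r * |cutS R r| ≤ 2 * R := by
    rcases le_total (2 * R) r with h | h
    · rw [cutS_eq_zero hR0 (h.trans (le_abs_self r))]; simp; linarith
    · calc r * |cutS R r| ≤ r * 1 := by gcongr; exact ab r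
        _ ≤ _ := by linarith
  have c1 : r * |deriv (cutS R) r| ≤ 8 * cutK := by
    rcases le_total (2 * R) r with h | h
    · rw [(deriv_cutS_eq_zero hR0 (Or.inl (h.trans (le_abs_self r)))).1]; simp; linarith
    · calc r * |deriv (cutS R) r| ≤ (2 * R) * (4 * cutK / R) := by gcongr; exact d1 r
        _ = _ := by field_simp; ring
  have c2 : r * |deriv (deriv (cutS R)) r| ≤ 36 * cutK := by
    rcases le_total (2 * R) r with h | h
    · rw [(deriv_cutS_eq_zero hR0 (Or.inl (h.trans (le_abs_self r)))).2]; simp; linarith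
    · calc r * |deriv (deriv (cutS R)) r| ≤ (2 * R) * (18 * cutK / R ^ 2) := by gcongr; exact d2 r
        _ = 36 * cutK / R := by field_simp; ring
        _ ≤ _ := div_le_self (by linarith) hR
  simp only [abs_mul, abs_of_pos hr]
  refine ⟨?_, ?_, ?_, ?_, ?_, ?_, ?_⟩
  · calc |cutS R r| * |cutS R z| ≤ 1 * 1 := by gcongr; exacts [ab r, ab z]
      _ ≤ _ := by nlinarith
  · calc |cutS R r| * |deriv (cutS R) z| ≤ 1 * (4 * cutK / R) := by gcongr; exacts [ab r, d1 z]
      _ ≤ _ := by linarith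
  · calc |deriv (cutS R) r| * |cutS R z| ≤ (4 * cutK / R) * 1 := by gcongr; exacts [d1 r, ab z]
      _ ≤ _ := by linarith
  · calc r * |cutS R r| * |deriv (cutS R) z| ≤ (2 * R) * (4 * cutK / R) := by gcongr; exact d1 z
      _ = 8 * cutK := by field_simp; ring
      _ ≤ _ := by linarith
  · calc r * |deriv (cutS R) r| * |cutS R z| ≤ (8 * cutK) * 1 := by gcongr; exact ab z
      _ ≤ _ := by linarith
  · calc r * |deriv (cutS R) r| * |deriv (cutS R) z| ≤ (8 * cutK) * (4 * cutK / R) := by gcongr; exact d1 z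
      _ ≤ (8 * cutK) * (4 * cutK) := by gcongr
      _ ≤ _ := by nlinarith
  · calc r * |deriv (deriv (cutS R)) r| * |cutS R z| ≤ (36 * cutK) * 1 := by gcongr; exact ab z
      _ ≤ _ := by linarith

variable {v f : ℝ × ℝ → ℝ}

/-- The truncated test field in terms of the velocity. -/
theorem Prof.tst_eq (h : Prof v f) (R : ℝ) (p : ℝ × ℝ) (hp : 0 < p.1) :
    tst (fun p => chi R p * strm f p) 0 p = cutS R p.1 * cutS R p.2 * v p
      - p.1 * cutS R p.1 * deriv (cutS R) p.2 * strm f p ∧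
    tst (fun p => chi R p * strm f p) 1 p = cutS R p.1 * cutS R p.2 * f p
      + p.1 * deriv (cutS R) p.1 * cutS R p.2 * strm f p ∧
    tst (fun p => chi R p * strm f p) 2 p = deriv (cutS R) p.1 * cutS R p.2 * v p
      + cutS R p.1 * cutS R p.2 * dr v p
      - (cutS R p.1 * deriv (cutS R) p.2 * (f p - strm f p)
        + p.1 * deriv (cutS R) p.1 * deriv (cutS R) p.2 * strm f p) ∧
    tst (fun p => chi R p * strm f p) 3 p = deriv (cutS R) p.1 * cutS R p.2 * f p
      + cutS R p.1 * cutS R p.2 * dr f p + deriv (cutS R) p.1 * cutS R p.2 * (f p - strm f p)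
      + p.1 * deriv (deriv (cutS R)) p.1 * cutS R p.2 * strm f p ∧
    tst (fun p => chi R p * strm f p) 4 p = cutS R p.1 * cutS R p.2 * quot v p
      - cutS R p.1 * deriv (cutS R) p.2 * strm f p := by
  have sq := h.s_strm
  have kz : ∀ p : ℝ × ℝ, 0 < p.1 → dz (fun p => chi R p * strm f p) p =
      cutS R p.1 * deriv (cutS R) p.2 * strm f p - cutS R p.1 * cutS R p.2 * quot v p := fun ⟨r, z⟩ hp => by
    have := (((contDiff_chi R).hasDerivAt_z r z).mul (sq.hasDerivAt_z r z)).deriv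
    refine this.trans ?_
    rw [dz_chi, h.dz_strm _ hp]
    simp only [chi]; ring
  have kr : ∀ p : ℝ × ℝ, dr (fun p => chi R p * strm f p) p =
      deriv (cutS R) p.1 * cutS R p.2 * strm f p + cutS R p.1 * cutS R p.2 * dr (strm f) p := fun ⟨r, z⟩ => by
    have := (((contDiff_chi R).hasDerivAt_r r z).mul (sq.hasDerivAt_r r z)).deriv
    refine this.trans ?_
    rw [dr_chi]
    simp only [chi]
  have e0 : ∀ p : ℝ × ℝ, 0 < p.1 → tst (fun p => chi R p * strm f p) 0 p = cutS R p.1 * cutS R p.2 * v p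
      - p.1 * cutS R p.1 * deriv (cutS R) p.2 * strm f p := fun p hp => by
    have e : tst (fun p => chi R p * strm f p) 0 p = -(p.1 * dz (fun p => chi R p * strm f p) p) := rfl
    rw [e, kz p hp, h.v_eq p]; ring
  have e1 : ∀ p : ℝ × ℝ, 0 < p.1 → tst (fun p => chi R p * strm f p) 1 p = cutS R p.1 * cutS R p.2 * f p
      + p.1 * deriv (cutS R) p.1 * cutS R p.2 * strm f p := fun p hp => by
    have e : tst (fun p => chi R p * strm f p) 1 p =
      2 * (chi R p * strm f p) + p.1 * dr (fun p => chi R p * strm f p) p := rfl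
    rw [e, kr p, h.f_eq p]; simp only [chi]; ring
  have er : p.1 * dr (strm f) p = f p - 2 * strm f p := by rw [h.f_eq p]; ring
  refine ⟨e0 p hp, e1 p hp, ?_, ?_, ?_⟩
  · have e : tst (fun p => chi R p * strm f p) 2 = dr (tst (fun p => chi R p * strm f p) 0) := rfl
    rw [e, dr_congr_H e0 p hp]
    obtain ⟨r, z⟩ := p
    refine ((((hasDerivAt_cutS R r).mul_const (cutS R z)).mul (h.sv.hasDerivAt_r r z)).sub
      ((((hasDerivAt_id r).mul (hasDerivAt_cutS R r)).mul_const (deriv (cutS R) z)).mul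
        (sq.hasDerivAt_r r z))).deriv.trans ?_
    simp only [id, Pi.mul_apply] at er ⊢
    linear_combination (-cutS R r * deriv (cutS R) z) * er
  · have e : tst (fun p => chi R p * strm f p) 3 = dr (tst (fun p => chi R p * strm f p) 1) := rfl
    rw [e, dr_congr_H e1 p hp]
    obtain ⟨r, z⟩ := p
    refine ((((hasDerivAt_cutS R r).mul_const (cutS R z)).mul (h.sf.hasDerivAt_r r z)).add
      ((((hasDerivAt_id r).mul (hasDerivAt_deriv_cutS R r)).mul_const (cutS R z)).mul
        (sq.hasDerivAt_r r z))).deriv.trans ?_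
    simp only [id, Pi.mul_apply] at er ⊢
    linear_combination (deriv (cutS R) r * cutS R z) * er
  · have e : tst (fun p => chi R p * strm f p) 4 p = -dz (fun p => chi R p * strm f p) p := rfl
    rw [e, kz p hp]; ring

theorem Prof.abs_tst_le (h : Prof v f) {R : ℝ} (hR : 1 ≤ R) (i : Fin 5) (p : ℝ × ℝ) (hp : 0 < p.1) :
    |tst (fun p => chi R p * strm f p) i p| ≤ 144 * cutK ^ 2 * dom v f p := by
  obtain ⟨e0, e1, e2, e3, e4⟩ := h.tst_eq R p hp
  obtain ⟨c1, c2, c3, c4, c5, c6, c7⟩ := cut_coefficients hR hp p.2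
  set B := 36 * cutK ^ 2
  have hB : 0 ≤ B := (abs_nonneg _).trans c1
  have m : ∀ {c x : ℝ}, |c| ≤ B → |c * x| ≤ B * |x| := fun {c x} hc => by
    rw [abs_mul]; exact mul_le_mul_of_nonneg_right hc (abs_nonneg _)
  have hfq : |f p - strm f p| ≤ |f p| + |strm f p| := abs_sub _ _
  have n1 := mul_nonneg hB (abs_nonneg (v p))
  have n2 := mul_nonneg hB (abs_nonneg (f p))
  have n3 := mul_nonneg hB (abs_nonneg (strm f p))
  have n4 := mul_nonneg hB (abs_nonneg (dr v p))
  have n5 := mul_nonneg hB (abs_nonneg (dr f p))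
  have n6 := mul_nonneg hB (abs_nonneg (quot v p))
  have nf := mul_le_mul_of_nonneg_left hfq hB
  have ed : 144 * cutK ^ 2 * dom v f p = 4 * (B * |v p| + B * |f p| + B * |strm f p| + B * |dr v p| + B * |dr f p|
    + B * |quot v p|) := by simp only [dom, B]; ring
  rw [ed]
  fin_cases i
  · show |tst (fun p => chi R p * strm f p) 0 p| ≤ _
    rw [e0]
    have := abs_sub (cutS R p.1 * cutS R p.2 * v p) (p.1 * cutS R p.1 * deriv (cutS R) p.2 * strm f p)
    linarith [m (x := v p) c1, m (x := strm f p) c4]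
  · show |tst (fun p => chi R p * strm f p) 1 p| ≤ _
    rw [e1]
    have := abs_add_le (cutS R p.1 * cutS R p.2 * f p) (p.1 * deriv (cutS R) p.1 * cutS R p.2 * strm f p)
    linarith [m (x := f p) c1, m (x := strm f p) c5]
  · show |tst (fun p => chi R p * strm f p) 2 p| ≤ _
    rw [e2]
    have t1 := m (x := v p) c3
    have t2 := m (x := dr v p) c1
    have t3 := m (x := f p - strm f p) c2
    have t4 := m (x := strm f p) c6
    rw [abs_le] at t1 t2 t3 t4 ⊢
    constructor <;> linarith
  · show |tst (fun p => chi R p * strm f p) 3 p| ≤ _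
    rw [e3]
    have t1 := m (x := f p) c3
    have t2 := m (x := dr f p) c1
    have t3 := m (x := f p - strm f p) c3
    have t4 := m (x := strm f p) c7
    rw [abs_le] at t1 t2 t3 t4 ⊢
    constructor <;> linarith
  · show |tst (fun p => chi R p * strm f p) 4 p| ≤ _
    rw [e4]
    have := abs_sub (cutS R p.1 * cutS R p.2 * quot v p) (cutS R p.1 * deriv (cutS R) p.2 * strm f p)
    linarith [m (x := quot v p) c1, m (x := strm f p) c2]

theorem Prof.tendsto_tst (h : Prof v f) (i : Fin 5) (p : ℝ × ℝ) (hp : 0 < p.1) :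
    Tendsto (fun n : ℕ => tst (fun p => chi ((n + 1 : ℕ) : ℝ) p * strm f p) i p) atTop (𝓝 (prf v f i p)) := by
  refine tendsto_const_nhds.congr' ?_
  filter_upwards [eventually_gt_atTop (Nat.ceil |p.1|), eventually_gt_atTop (Nat.ceil |p.2|)] with n h1 h2
  have hR : (0:ℝ) < ((n + 1 : ℕ) : ℝ) := by positivity
  have l1 : |p.1| < ((n + 1 : ℕ) : ℝ) := by
    refine (Nat.le_ceil _).trans_lt ?_
    exact_mod_cast h1.trans (Nat.lt_succ_self n)
  have l2 : |p.2| < ((n + 1 : ℕ) : ℝ) := by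
    refine (Nat.le_ceil _).trans_lt ?_
    exact_mod_cast h2.trans (Nat.lt_succ_self n)
  obtain ⟨e0, e1, e2, e3, e4⟩ := h.tst_eq ((n + 1 : ℕ) : ℝ) p hp
  rw [cutS_eq_one hR l1.le, cutS_eq_one hR l2.le] at e0 e1 e2 e3 e4
  have a1 := deriv_cutS_eq_zero hR (Or.inr l1)
  have a2 := deriv_cutS_eq_zero hR (Or.inr l2)
  rw [a1.1] at e1 e2 e3
  rw [a2.1] at e0 e2 e4
  rw [a1.2] at e3
  simp only [mul_one, one_mul, mul_zero, zero_mul, sub_zero, add_zero, zero_add] at e0 e1 e2 e3 e4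
  fin_cases i
  exacts [e0.symm, e1.symm, e2.symm, e3.symm, e4.symm]

end Test


section Weak

variable {b M : ℝ} {v f ρ : ℝ → ℝ × ℝ → ℝ} {κ : ℝ × ℝ → ℝ}

theorem BH_tst (sκ : Sl κ) (bκ : BH κ) (i : Fin 5) : BH (tst κ i) := by
  have b1 : BH fun p : ℝ × ℝ => -(p.1 * dz κ p) := (sκ.BH_dz bκ).mono fun p _ h => by simp [h]
  have b2 : BH fun p : ℝ × ℝ => 2 * κ p + p.1 * dr κ p :=
    (bκ.mul_left (h := fun _ => 2)).add ((sκ.BH_dr bκ).mul_left (h := fun p => p.1))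
  fin_cases i
  exacts [b1, b2, (s_tst sκ 0).BH_dr b1, (s_tst sκ 1).BH_dr b2, (sκ.BH_dz bκ).mono fun p _ h => neg_eq_zero.2 h]

theorem HSol.s_frc (h : HSol b M v f ρ) (i : Fin 5) : Sm b (fun t => frc (v t) (f t) (ρ t) i) := by
  have hb := h.hb
  fin_cases i
  exacts [((h.sv.mul (h.sv.dr hb)).add (h.sf.mul (h.sv.dz hb))).neg,
    h.sρ.sub ((h.sv.mul (h.sf.dr hb)).add (h.sf.mul (h.sf.dz hb))),
    (h.sv.dr hb).neg, (h.sf.dr hb).neg, h.s_quot.neg]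

theorem HSol.s_prf (h : HSol b M v f ρ) (i : Fin 5) : Sm b (fun t => prf (v t) (f t) i) := by
  have hb := h.hb
  fin_cases i
  exacts [h.sv, h.sf, h.sv.dr hb, h.sf.dr hb, h.s_quot]

theorem HI_ip {a w : ℝ × ℝ → ℝ} (ha : Sl a) (hw : Sl w) (hB : BH w) : HI (fun p => p.1 * (a p * w p)) (ip a w) :=
  HI.of (hB.mul_left.mul_left.integrableOn (Sl.fst.mul (ha.mul hw)).continuous)

theorem HSol.pair_tst (h : HSol b M v f ρ) (sκ : Sl κ) (bκ : BH κ) {t : ℝ} (ht : t ∈ Ioo 0 b) :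
    HI (fun p => p.1 * (dt b v t p * tst κ 0 p + dt b f t p * tst κ 1 p)) (pair (frc (v t) (f t) (ρ t)) (tst κ)) := by
  obtain ⟨P, sP, hP⟩ := h.mom
  have hb := h.hb
  have ht' := Ioo_subset_Icc_self ht
  have pr := h.prof t ht'
  have sP' := sP.slice ht'
  have I : ∀ i, HI (fun p => p.1 * (frc (v t) (f t) (ρ t) i p * tst κ i p)) (ip (frc (v t) (f t) (ρ t) i) (tst κ i)) :=
    fun i => HI_ip ((h.s_frc i).slice ht') (s_tst sκ i) (BH_tst sκ bκ i)
  have J1 : HI (fun p => dr (v t) p * tst κ 0 p + p.1 * dr (dr (v t)) p * tst κ 0 p +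
      p.1 * dr (v t) p * tst κ 2 p) 0 := by
    refine HI.dr_zero (G := fun p => p.1 * dr (v t) p * tst κ 0 p)
      ((Sl.fst.mul pr.sv.dr).mul (s_tst sκ 0)).continuous
      (((pr.sv.dr.mul (s_tst sκ 0)).add ((Sl.fst.mul pr.sv.dr.dr).mul (s_tst sκ 0))).add
        ((Sl.fst.mul pr.sv.dr).mul (s_tst sκ 2))).continuous (fun r z _ => ?_) (BH_tst sκ bκ 0).mul_left (fun z => by simp)
    refine (((hasDerivAt_id r).mul (pr.sv.dr.hasDerivAt_r r z)).mul ((s_tst sκ 0).hasDerivAt_r r z)).congr_deriv ?_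
    simp only [id, Pi.mul_apply]
    have : dr (tst κ 0) = tst κ 2 := rfl
    rw [this]; ring
  have J2 : HI (fun p => dr (f t) p * tst κ 1 p + p.1 * dr (dr (f t)) p * tst κ 1 p +
      p.1 * dr (f t) p * tst κ 3 p) 0 := by
    refine HI.dr_zero (G := fun p => p.1 * dr (f t) p * tst κ 1 p)
      ((Sl.fst.mul pr.sf.dr).mul (s_tst sκ 1)).continuous
      (((pr.sf.dr.mul (s_tst sκ 1)).add ((Sl.fst.mul pr.sf.dr.dr).mul (s_tst sκ 1))).add
        ((Sl.fst.mul pr.sf.dr).mul (s_tst sκ 3))).continuous (fun r z _ => ?_) (BH_tst sκ bκ 1).mul_left (fun z => by simp)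
    refine (((hasDerivAt_id r).mul (pr.sf.dr.hasDerivAt_r r z)).mul ((s_tst sκ 1).hasDerivAt_r r z)).congr_deriv ?_
    simp only [id, Pi.mul_apply]
    have : dr (tst κ 1) = tst κ 3 := rfl
    rw [this]; ring
  have J3 : HI (fun p => 2 * p.1 * κ p * dz (P t) p + p.1 ^ 2 * dr κ p * dz (P t) p +
      p.1 ^ 2 * κ p * dr (dz (P t)) p) 0 := by
    refine HI.dr_zero (G := fun p => p.1 ^ 2 * κ p * dz (P t) p)
      (((Sl.fst.pow 2).mul sκ).mul sP'.dz).continuous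
      ((((contDiff_const.mul Sl.fst).mul sκ).mul sP'.dz).add (((Sl.fst.pow 2).mul sκ.dr).mul sP'.dz) |>.add
        (((Sl.fst.pow 2).mul sκ).mul sP'.dz.dr)).continuous (fun r z _ => ?_) (bκ.mul_left.mul_right) (fun z => by simp)
    refine ((((hasDerivAt_id r).pow 2).mul (sκ.hasDerivAt_r r z)).mul (sP'.dz.hasDerivAt_r r z)).congr_deriv ?_
    simp only [id, Pi.mul_apply, Pi.pow_apply]
    push_cast; ring
  have J4 : HI (fun p => p.1 ^ 2 * dz κ p * dr (P t) p + p.1 ^ 2 * κ p * dz (dr (P t)) p) 0 := by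
    refine HI.dz_zero (G := fun p => p.1 ^ 2 * κ p * dr (P t) p)
      ((((Sl.fst.pow 2).mul sκ.dz).mul sP'.dr).add (((Sl.fst.pow 2).mul sκ).mul sP'.dr.dz)).continuous
      (fun r z _ => ?_) (bκ.mul_left.mul_right)
    refine (((sκ.hasDerivAt_z r z).const_mul (r ^ 2)).mul (sP'.dr.hasDerivAt_z r z)).congr_deriv ?_
    ring
  have tot := ((((((((I 0).add (I 1)).add (I 2)).add (I 3)).add (I 4)).add J1).add J2).add J4).sub J3
  have ev : (((((((ip (frc (v t) (f t) (ρ t) 0) (tst κ 0) + ip (frc (v t) (f t) (ρ t) 1) (tst κ 1)) +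
      ip (frc (v t) (f t) (ρ t) 2) (tst κ 2)) + ip (frc (v t) (f t) (ρ t) 3) (tst κ 3)) +
      ip (frc (v t) (f t) (ρ t) 4) (tst κ 4)) + 0) + 0) + 0) - 0 = pair (frc (v t) (f t) (ρ t)) (tst κ) := by
    simp only [pair, Fin.sum_univ_five]; ring
  rw [ev] at tot
  refine tot.congr fun p hp => ?_
  have hp : 0 < p.1 := hp
  obtain ⟨m1, m2⟩ := hP t ht p hp
  have hc : dr (dz (P t)) p = dz (dr (P t)) p := sP'.dr_dz p
  have hq := pr.quot_eq hp
  have f0 : frc (v t) (f t) (ρ t) 0 p = -(v t p * dr (v t) p + f t p * dz (v t) p) := rfl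
  have f1 : frc (v t) (f t) (ρ t) 1 p = ρ t p - (v t p * dr (f t) p + f t p * dz (f t) p) := rfl
  have f2 : frc (v t) (f t) (ρ t) 2 p = -dr (v t) p := rfl
  have f3 : frc (v t) (f t) (ρ t) 3 p = -dr (f t) p := rfl
  have f4 : frc (v t) (f t) (ρ t) 4 p = -quot (v t) p := rfl
  have t0 : tst κ 0 p = -(p.1 * dz κ p) := rfl
  have t1 : tst κ 1 p = 2 * κ p + p.1 * dr κ p := rfl
  have t4 : tst κ 4 p = -dz κ p := rfl
  have hp0 : p.1 ≠ 0 := hp.ne'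
  have n1 : dt b v t p = -(v t p * dr (v t) p + f t p * dz (v t) p)
      + (dr (dr (v t)) p + dr (v t) p / p.1 - v t p / p.1 ^ 2) - dr (P t) p := by linarith
  have n2 : dt b f t p = ρ t p - (v t p * dr (f t) p + f t p * dz (f t) p)
      + (dr (dr (f t)) p + dr (f t) p / p.1) - dz (P t) p := by linarith
  rw [n1, n2, f0, f1, f2, f3, f4, hc, hq, t0, t1, t4]
  field_simp
  ring

/-- The weak formulation of the momentum equation. -/
theorem HSol.weak_momentum (h : HSol b M v f ρ) (sκ : Sl κ) (bκ : BH κ) :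
    ContinuousOn (fun τ => pair (frc (v τ) (f τ) (ρ τ)) (tst κ)) (Icc 0 b) ∧
    ∀ t₁ ∈ Icc 0 b, ∀ t₂ ∈ Icc 0 b, t₁ ≤ t₂ →
      (ip (v t₂) (tst κ 0) + ip (f t₂) (tst κ 1)) - (ip (v t₁) (tst κ 0) + ip (f t₁) (tst κ 1)) =
        ∫ τ in t₁..t₂, pair (frc (v τ) (f τ) (ρ τ)) (tst κ) := by
  have hb := h.hb
  have BT : ∀ (F : ℝ → ℝ × ℝ → ℝ) i, BHt b (fun t p => p.1 * (F t p * tst κ i p)) := fun F i => by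
    obtain ⟨L, hL⟩ := BH_tst sκ bκ i
    exact ⟨L, fun t _ p hp hh => by simp only [hL p hp hh, mul_zero]⟩
  have ST : ∀ {F : ℝ → ℝ × ℝ → ℝ} (i), Sm b F → Sm b (fun t p => p.1 * (F t p * tst κ i p)) := fun i hF =>
    Sm.fst.mul (hF.mul (Sm.of_slice (s_tst sκ i)))
  have hc : ContinuousOn (fun τ => pair (frc (v τ) (f τ) (ρ τ)) (tst κ)) (Icc 0 b) := by
    refine continuousOn_finsetSum _ fun i _ => ?_
    exact (BT _ i).continuousOn_integral (ST i (h.s_frc i)).continuousOn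
  have he : ContinuousOn (fun τ => ip (v τ) (tst κ 0) + ip (f τ) (tst κ 1)) (Icc 0 b) :=
    ((BT _ 0).continuousOn_integral (ST 0 h.sv).continuousOn).add
      ((BT _ 1).continuousOn_integral (ST 1 h.sf).continuousOn)
  refine ⟨hc, fun t₁ h1 t₂ h2 h12 => (intervalIntegral.integral_eq_sub_of_hasDerivAt_of_le h12
    (he.mono (Icc_subset_Icc h1.1 h2.2)) (fun τ hτ => ?_)
    ((hc.mono (Icc_subset_Icc h1.1 h2.2)).intervalIntegrable_of_Icc h12)).symm⟩
  have hτ : τ ∈ Ioo 0 b := ⟨h1.1.trans_lt hτ.1, hτ.2.trans_le h2.2⟩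
  have hτ' := Ioo_subset_Icc_self hτ
  have d1 := hasDerivAt_integral_of_Sm hb (ST 0 h.sv) (BT v 0) hτ
  have d2 := hasDerivAt_integral_of_Sm hb (ST 1 h.sf) (BT f 1) hτ
  have e1 : ∀ {F : ℝ → ℝ × ℝ → ℝ} (i), Sm b F → ∀ p : ℝ × ℝ,
      dt b (fun t p => p.1 * (F t p * tst κ i p)) τ p = p.1 * (dt b F τ p * tst κ i p) := fun i hF p =>
    ((ST i hF).hasDerivAt hb hτ p).unique (((hF.hasDerivAt hb hτ p).mul_const _).const_mul p.1)
  have i1 : HI (fun p => dt b (fun t p => p.1 * (v t p * tst κ 0 p)) τ p) _ :=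
    HI.of (((BT v 0).dt.slice hτ').integrableOn (((ST 0 h.sv).dt hb).slice hτ').continuous)
  have i2 : HI (fun p => dt b (fun t p => p.1 * (f t p * tst κ 1 p)) τ p) _ :=
    HI.of (((BT f 1).dt.slice hτ').integrableOn (((ST 1 h.sf).dt hb).slice hτ').continuous)
  refine (d1.add d2).congr_deriv ((i1.add i2).eq (h.pair_tst sκ bκ hτ) fun p _ => ?_)
  rw [e1 0 h.sv, e1 1 h.sf]; ring

end Weak


section PairBounds

theorem abs_pair_le {A W : Fin 5 → ℝ × ℝ → ℝ} {C D : ℝ} (hA : ∀ i, L2 (A i) C) (hW : ∀ i, L2 (W i) D) {l : ℝ}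
    (hl : 0 < l) : |pair A W| ≤ 5 * (l * C + D / l) := by
  refine (Finset.abs_sum_le_sum_abs _ _).trans ((Finset.sum_le_sum fun i _ => (hA i).abs_ip_le (hW i) hl).trans ?_)
  simp [mul_add]

theorem ip_comm (a w : ℝ × ℝ → ℝ) : ip a w = ip w a := by
  simp only [ip, mul_comm (a _)]

variable {b M : ℝ} {v f ρ : ℝ → ℝ × ℝ → ℝ} {t : ℝ}

theorem HSol.M_nonneg (h : HSol b M v f ρ) : 0 ≤ M :=
  (setIntegral_nonneg measurableSet_H fun p hp => mul_nonneg (le_of_lt hp) (by positivity)).trans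
    (h.L2 0 ⟨le_rfl, h.hb.le⟩).2

theorem HSol.L2_prf (h : HSol b M v f ρ) (ht : t ∈ Icc 0 b) (i : Fin 5) : HalfPlane.L2 (prf (v t) (f t) i) (2 * M) := by
  have pr := h.prof t ht
  obtain ⟨i1, b1⟩ := h.L2 t ht
  obtain ⟨i2, b2⟩ := h.H1 t ht
  have hM := h.M_nonneg
  have I2 := (HI.of i2).const_mul 2
  have hm := ((h.s_prf i).slice ht).continuous.aestronglyMeasurable (μ := volume.restrict H)
  have A1 : ∀ a : ℝ × ℝ → ℝ, AEStronglyMeasurable a (volume.restrict H) →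
      (∀ p, a p ^ 2 ≤ v t p ^ 2 + f t p ^ 2) → HalfPlane.L2 a (2 * M) := fun a ha hle =>
    HalfPlane.L2.of_le ha i1 (by linarith) fun p hp => mul_le_mul_of_nonneg_left (hle p) (le_of_lt hp)
  have A2 : ∀ a : ℝ × ℝ → ℝ, AEStronglyMeasurable a (volume.restrict H) →
      (∀ p ∈ H, a p ^ 2 ≤ 2 * (dr (v t) p ^ 2 + dz (v t) p ^ 2 + dr (f t) p ^ 2 + dz (f t) p ^ 2)) →
      HalfPlane.L2 a (2 * M) := fun a ha hle =>
    HalfPlane.L2.of_le ha I2.int (by rw [I2.val]; linarith) fun p hp => by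
      have := mul_le_mul_of_nonneg_left (hle p hp) (le_of_lt hp)
      linarith
  fin_cases i
  · exact A1 _ hm fun p => by show v t p ^ 2 ≤ _; nlinarith [sq_nonneg (f t p)]
  · exact A1 _ hm fun p => by show f t p ^ 2 ≤ _; nlinarith [sq_nonneg (v t p)]
  · exact A2 _ hm fun p _ => by
      show dr (v t) p ^ 2 ≤ _
      linarith [sq_nonneg (dr (v t) p), sq_nonneg (dz (v t) p), sq_nonneg (dr (f t) p), sq_nonneg (dz (f t) p)]
  · exact A2 _ hm fun p _ => by
      show dr (f t) p ^ 2 ≤ _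
      linarith [sq_nonneg (dr (v t) p), sq_nonneg (dz (v t) p), sq_nonneg (dr (f t) p), sq_nonneg (dz (f t) p)]
  · refine A2 _ hm fun p hp => ?_
    show quot (v t) p ^ 2 ≤ _
    have e : quot (v t) p = -(dr (v t) p + dz (f t) p) := by
      have := pr.div p hp
      rw [← pr.quot_eq hp] at this; linarith
    rw [e]
    nlinarith [sq_nonneg (dr (v t) p - dz (f t) p), sq_nonneg (dz (v t) p), sq_nonneg (dr (f t) p)]

theorem HSol.L2_dom (h : HSol b M v f ρ) (ht : t ∈ Icc 0 b) : HalfPlane.L2 (dom (v t) (f t)) (72 * M) := by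
  have pr := h.prof t ht
  have hL := h.L2_prf ht
  have i1 := (HI.of (h.L2 t ht).1)
  have hf : HalfPlane.L2 (f t) (2 * M) := hL 1
  have hs := pr.integral_strm_sq_le hf.int
  have I := ((((((HI.of (hL 0).int).add (HI.of hf.int)).add (HI.of hs.1)).add (HI.of (hL 2).int)).add
    (HI.of (hL 3).int)).add (HI.of (hL 4).int)).const_mul 6
  refine HalfPlane.L2.of_le (Q := _) ?_ I.int ?_ fun p hp => ?_
  · have c1 := pr.sv.continuous
    have c2 := pr.sf.continuous
    have c3 := pr.s_strm.continuous
    have c4 := pr.sv.dr.continuous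
    have c5 := pr.sf.dr.continuous
    have c6 := pr.s_quot.continuous
    exact (by unfold dom; fun_prop : Continuous (dom (v t) (f t))).aestronglyMeasurable
  · rw [I.val]
    have hM := h.M_nonneg
    linarith [(hL 0).le, hf.le, hs.2, (hL 2).le, (hL 3).le, (hL 4).le]
  · show p.1 * dom (v t) (f t) p ^ 2 ≤ 6 * (p.1 * v t p ^ 2 + p.1 * f t p ^ 2 + p.1 * strm (f t) p ^ 2 +
      p.1 * dr (v t) p ^ 2 + p.1 * dr (f t) p ^ 2 + p.1 * quot (v t) p ^ 2)
    have key : ∀ a b c d e g : ℝ, (|a| + |b| + |c| + |d| + |e| + |g|) ^ 2 ≤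
        6 * (a ^ 2 + b ^ 2 + c ^ 2 + d ^ 2 + e ^ 2 + g ^ 2) := fun a b c d e g => by
      have := sq_sum_le_card_mul_sum_sq (s := Finset.univ) (f := ![|a|, |b|, |c|, |d|, |e|, |g|])
      simpa [Fin.sum_univ_six] using this
    have := mul_le_mul_of_nonneg_left (key (v t p) (f t p) (strm (f t) p) (dr (v t) p) (dr (f t) p) (quot (v t) p))
      (le_of_lt hp : 0 ≤ p.1)
    unfold dom
    linarith

theorem HSol.L2_frc (h : HSol b M v f ρ) {A γ : ℝ} (ht : t ∈ Icc 0 b) (hA : HalfPlane.L2 (ρ t) A) (hγ : 0 ≤ γ)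
    (hv : ∀ p : ℝ × ℝ, 0 < p.1 → |v t p| ≤ γ) (hf : ∀ p : ℝ × ℝ, 0 < p.1 → |f t p| ≤ γ) (i : Fin 5) :
    HalfPlane.L2 (frc (v t) (f t) (ρ t) i) ((2 * A + 4 * M) * (γ + 1) ^ 2) := by
  have hM := h.M_nonneg
  have hA0 := hA.nonneg
  have hL := h.L2_prf ht
  obtain ⟨i2, b2⟩ := h.H1 t ht
  have hm := ((h.s_frc i).slice ht).continuous.aestronglyMeasurable (μ := volume.restrict H)
  have g1 : 1 ≤ (γ + 1) ^ 2 := one_le_pow₀ (by linarith)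
  have g2 : γ ^ 2 ≤ (γ + 1) ^ 2 := by nlinarith
  have hc : 2 * M ≤ (2 * A + 4 * M) * (γ + 1) ^ 2 := by nlinarith [mul_nonneg hA0 (sq_nonneg (γ + 1))]
  have neg : ∀ {a : ℝ × ℝ → ℝ}, HalfPlane.L2 a (2 * M) → AEStronglyMeasurable (fun p => -a p) (volume.restrict H) →
      HalfPlane.L2 (fun p => -a p) ((2 * A + 4 * M) * (γ + 1) ^ 2) := fun ha hm =>
    HalfPlane.L2.of_le hm ha.int (ha.le.trans hc) fun p _ => by rw [neg_sq]
  have conv : ∀ {p : ℝ × ℝ}, 0 < p.1 → ∀ x y : ℝ, (v t p * x + f t p * y) ^ 2 ≤ 2 * γ ^ 2 * (x ^ 2 + y ^ 2) :=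
    fun {p} hp x y => by
      have h1 : v t p ^ 2 ≤ γ ^ 2 := sq_le_sq.2 (by rw [abs_of_nonneg hγ]; exact hv p hp)
      have h2 : f t p ^ 2 ≤ γ ^ 2 := sq_le_sq.2 (by rw [abs_of_nonneg hγ]; exact hf p hp)
      nlinarith [sq_nonneg (v t p * x - f t p * y), mul_le_mul_of_nonneg_right h1 (sq_nonneg x),
        mul_le_mul_of_nonneg_right h2 (sq_nonneg y)]
  fin_cases i
  · have I := (HI.of i2).const_mul (2 * γ ^ 2)
    refine HalfPlane.L2.of_le hm I.int ?_ fun p hp => ?_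
    · rw [I.val]
      nlinarith [mul_le_mul_of_nonneg_left b2 (sq_nonneg γ), mul_le_mul_of_nonneg_right g2 hM,
        mul_nonneg hA0 (sq_nonneg (γ + 1)), mul_nonneg hM (sq_nonneg (γ + 1))]
    · show p.1 * (-(v t p * dr (v t) p + f t p * dz (v t) p)) ^ 2 ≤ _
      rw [neg_sq]
      have h1 := conv hp (dr (v t) p) (dz (v t) p)
      have hp0 : 0 ≤ p.1 := le_of_lt hp
      calc _ ≤ p.1 * (2 * γ ^ 2 * (dr (v t) p ^ 2 + dz (v t) p ^ 2)) := by gcongr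
        _ ≤ p.1 * (2 * γ ^ 2 * (dr (v t) p ^ 2 + dz (v t) p ^ 2 + dr (f t) p ^ 2 + dz (f t) p ^ 2)) := by
          exact mul_le_mul_of_nonneg_left (mul_le_mul_of_nonneg_left
            (by linarith [sq_nonneg (dr (f t) p), sq_nonneg (dz (f t) p)]) (by positivity)) hp0
        _ = _ := by ring
  · have I := ((HI.of hA.int).const_mul 2).add ((HI.of i2).const_mul (4 * γ ^ 2))
    refine HalfPlane.L2.of_le hm I.int ?_ fun p hp => ?_
    · rw [I.val]
      nlinarith [mul_le_mul_of_nonneg_left b2 (sq_nonneg γ), mul_le_mul_of_nonneg_right g2 hM, hA.le,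
        mul_le_mul_of_nonneg_left g1 hA0]
    · show p.1 * (ρ t p - (v t p * dr (f t) p + f t p * dz (f t) p)) ^ 2 ≤ _
      have h1 := conv hp (dr (f t) p) (dz (f t) p)
      have hp0 : 0 ≤ p.1 := le_of_lt hp
      have h2 : (ρ t p - (v t p * dr (f t) p + f t p * dz (f t) p)) ^ 2 ≤
          2 * ρ t p ^ 2 + 2 * (v t p * dr (f t) p + f t p * dz (f t) p) ^ 2 := by
        nlinarith [sq_nonneg (ρ t p + (v t p * dr (f t) p + f t p * dz (f t) p))]
      calc _ ≤ p.1 * (2 * ρ t p ^ 2 + 2 * (2 * γ ^ 2 * (dr (f t) p ^ 2 + dz (f t) p ^ 2))) := by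
            gcongr; linarith
        _ ≤ p.1 * (2 * ρ t p ^ 2 + 2 * (2 * γ ^ 2 * (dr (v t) p ^ 2 + dz (v t) p ^ 2 + dr (f t) p ^ 2 + dz (f t) p ^ 2))) := by
          gcongr; linarith [sq_nonneg (dr (v t) p), sq_nonneg (dz (v t) p)]
        _ = _ := by ring
  · exact neg (hL 2) hm
  · exact neg (hL 3) hm
  · exact neg (hL 4) hm

/-- The convective term does not contribute to the energy. -/
theorem Prof.integral_convection {v f : ℝ × ℝ → ℝ} (h : Prof v f) {γ C D : ℝ} (hγ : 0 ≤ γ)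
    (hv : ∀ p : ℝ × ℝ, 0 < p.1 → |v p| ≤ γ) (hf : ∀ p : ℝ × ℝ, 0 < p.1 → |f p| ≤ γ)
    (h1 : L2 v C) (h2 : L2 f C)
    (h3 : L2 (fun p => -(v p * dr v p + f p * dz v p)) D) (h4 : L2 (fun p => -(v p * dr f p + f p * dz f p)) D) :
    ip (fun p => -(v p * dr v p + f p * dz v p)) v + ip (fun p => -(v p * dr f p + f p * dz f p)) f = 0 := by
  have J := (HI.of (h3.integrable_mul h1)).add (HI.of (h4.integrable_mul h2))
  let Q : ℝ × ℝ → ℝ := fun p => p.1 * (-(v p * dr v p + f p * dz v p) * v p) + p.1 * (-(v p * dr f p + f p * dz f p) * f p)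
  have E := (HI.of h1.int).add (HI.of h2.int)
  have hn0 : ∀ n : ℕ, (0:ℝ) < ((n + 1 : ℕ) : ℝ) := fun n => by positivity
  have sη : Sl fun p => v p ^ 2 + f p ^ 2 := (h.sv.pow 2).add (h.sf.pow 2)
  have cQ : Continuous Q := ((Sl.fst.mul (((h.sv.mul h.sv.dr).add (h.sf.mul h.sv.dz)).neg.mul h.sv)).add
    (Sl.fst.mul (((h.sv.mul h.sf.dr).add (h.sf.mul h.sf.dz)).neg.mul h.sf))).continuous
  have key : ∀ n : ℕ, |∫ p in H, chi ((n + 1 : ℕ) : ℝ) p * Q p| ≤ 8 * cutK * γ * (C + C) / ((n + 1 : ℕ) : ℝ) := fun n => by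
    set R : ℝ := ((n + 1 : ℕ) : ℝ)
    have hR : 0 < R := hn0 n
    have sX := contDiff_chi R
    have bX := BH_chi hR
    have i1 : HI (fun p => chi R p * Q p) _ := HI.of (bX.mul_right.integrableOn (sX.continuous.mul cQ))
    have i2 := h.integral_transport (g := fun p => chi R p * (v p ^ 2 + f p ^ 2)) (sX.mul sη) bX.mul_right
    have e : ∀ p : ℝ × ℝ, p.1 * (v p * dr (fun p => chi R p * (v p ^ 2 + f p ^ 2)) p +
        f p * dz (fun p => chi R p * (v p ^ 2 + f p ^ 2)) p) =
        -2 * (chi R p * Q p) + p.1 * ((v p * dr (chi R) p + f p * dz (chi R) p) * (v p ^ 2 + f p ^ 2)) := fun ⟨r, z⟩ => by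
      have d1 : dr (fun p => chi R p * (v p ^ 2 + f p ^ 2)) (r, z) = dr (chi R) (r, z) * (v (r, z) ^ 2 + f (r, z) ^ 2) +
          chi R (r, z) * (2 * v (r, z) * dr v (r, z) + 2 * f (r, z) * dr f (r, z)) := by
        refine ((sX.hasDerivAt_r r z).mul (((h.sv.hasDerivAt_r r z).pow 2).add ((h.sf.hasDerivAt_r r z).pow 2))).deriv.trans ?_
        simp only [Pi.add_apply, Pi.pow_apply]; push_cast; ring
      have d2 : dz (fun p => chi R p * (v p ^ 2 + f p ^ 2)) (r, z) = dz (chi R) (r, z) * (v (r, z) ^ 2 + f (r, z) ^ 2) +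
          chi R (r, z) * (2 * v (r, z) * dz v (r, z) + 2 * f (r, z) * dz f (r, z)) := by
        refine ((sX.hasDerivAt_z r z).mul (((h.sv.hasDerivAt_z r z).pow 2).add ((h.sf.hasDerivAt_z r z).pow 2))).deriv.trans ?_
        simp only [Pi.add_apply, Pi.pow_apply]; push_cast; ring
      rw [d1, d2]; simp only [Q]; ring
    have i3 := (i2.congr fun p _ => e p).add (i1.const_mul 2)
    have i4 : HI (fun p => p.1 * ((v p * dr (chi R) p + f p * dz (chi R) p) * (v p ^ 2 + f p ^ 2))) _ :=
      i3.congr fun p _ => by ring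
    have pt : ∀ p ∈ H, |p.1 * ((v p * dr (chi R) p + f p * dz (chi R) p) * (v p ^ 2 + f p ^ 2))| ≤
        (8 * cutK * γ / R) * (p.1 * v p ^ 2 + p.1 * f p ^ 2) := fun p hp => by
      have hp : 0 < p.1 := hp
      have d1 := (abs_deriv_cutS_le hR p.1).1
      have d2 := (abs_deriv_cutS_le hR p.2).1
      have ab : ∀ s, |cutS R s| ≤ 1 := fun s => by rw [abs_of_nonneg (cutS_nonneg _ _)]; exact cutS_le_one _ _
      have x1 : |dr (chi R) p| ≤ 4 * cutK / R := by
        rw [dr_chi, abs_mul]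
        exact (mul_le_of_le_one_right (abs_nonneg _) (ab _)).trans d1
      have x2 : |dz (chi R) p| ≤ 4 * cutK / R := by
        rw [dz_chi, abs_mul]
        exact (mul_le_of_le_one_left (abs_nonneg _) (ab _)).trans d2
      have x3 : |v p * dr (chi R) p + f p * dz (chi R) p| ≤ 8 * cutK * γ / R := by
        refine (abs_add_le _ _).trans ?_
        rw [abs_mul, abs_mul]
        have := mul_le_mul (hv p hp) x1 (abs_nonneg _) hγ
        have := mul_le_mul (hf p hp) x2 (abs_nonneg _) hγ
        calc _ ≤ γ * (4 * cutK / R) + γ * (4 * cutK / R) := by linarith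
          _ = _ := by ring
      rw [abs_mul, abs_mul, abs_of_pos hp, abs_of_nonneg (by positivity : 0 ≤ v p ^ 2 + f p ^ 2)]
      calc _ ≤ p.1 * ((8 * cutK * γ / R) * (v p ^ 2 + f p ^ 2)) := by gcongr
        _ = _ := by ring
    have hle := (HI.of i4.int.abs).le (E.const_mul (8 * cutK * γ / R)) pt
    have habs : |∫ p in H, p.1 * ((v p * dr (chi R) p + f p * dz (chi R) p) * (v p ^ 2 + f p ^ 2))| ≤ _ :=
      (abs_integral_le_integral_abs).trans hle
    rw [i4.val, zero_add, abs_mul, abs_two] at habs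
    have hK := one_le_cutK
    have : (8 * cutK * γ / R) * ((∫ p in H, p.1 * v p ^ 2) + ∫ p in H, p.1 * f p ^ 2) ≤ (8 * cutK * γ / R) * (C + C) := by
      have := h1.le
      have := h2.le
      gcongr
    have e2 : (8 * cutK * γ / R) * (C + C) = 8 * cutK * γ * (C + C) / R := by ring
    have := abs_nonneg (∫ p in H, chi R p * Q p)
    linarith
  have lim : Tendsto (fun n : ℕ => ∫ p in H, chi ((n + 1 : ℕ) : ℝ) p * Q p) atTop (𝓝 (∫ p in H, Q p)) := by
    refine tendsto_integral_of_dominated_convergence (fun p => |Q p|)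
      (fun n => ((contDiff_chi _).continuous.mul cQ).aestronglyMeasurable) J.int.abs
      (fun n => Eventually.of_forall fun p => ?_) (Eventually.of_forall fun p => ?_)
    · rw [norm_mul, Real.norm_of_nonneg (chi_nonneg _ _), Real.norm_eq_abs]
      exact mul_le_of_le_one_left (abs_nonneg _) (chi_le_one _ _)
    · simpa using ((tendsto_chi p).comp (tendsto_add_atTop_nat 1)).mul_const (Q p)
  have lim0 : Tendsto (fun n : ℕ => ∫ p in H, chi ((n + 1 : ℕ) : ℝ) p * Q p) atTop (𝓝 0) := by
    refine squeeze_zero_norm key ?_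
    exact (tendsto_const_nhds.div_atTop tendsto_natCast_atTop_atTop).comp (tendsto_add_atTop_nat 1)
  have : ∫ p in H, Q p = 0 := tendsto_nhds_unique lim lim0
  rw [← this]
  exact J.val.symm

end PairBounds


section Energy

variable {b M : ℝ} {v f ρ : ℝ → ℝ × ℝ → ℝ} {t : ℝ}

theorem HSol.L2_tst (h : HSol b M v f ρ) (ht : t ∈ Icc 0 b) (n : ℕ) (i : Fin 5) :
    HalfPlane.L2 (tst (fun p => chi ((n + 1 : ℕ) : ℝ) p * strm (f t) p) i) ((144 * cutK ^ 2) ^ 2 * (72 * M)) := by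
  have pr := h.prof t ht
  have hd := h.L2_dom ht
  have I := (HI.of hd.int).const_mul ((144 * cutK ^ 2) ^ 2)
  have sκ : Sl fun p => chi ((n + 1 : ℕ) : ℝ) p * strm (f t) p := (contDiff_chi _).mul pr.s_strm
  refine L2.of_le (s_tst sκ i).continuous.aestronglyMeasurable I.int ?_ fun p hp => ?_
  · rw [I.val]; exact mul_le_mul_of_nonneg_left hd.le (sq_nonneg _)
  · have h1 : (1:ℝ) ≤ ((n + 1 : ℕ) : ℝ) := by push_cast; linarith [Nat.cast_nonneg (α := ℝ) n]
    have h2 := pr.abs_tst_le h1 i p hp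
    have h3 := pow_le_pow_left₀ (abs_nonneg _) h2 2
    rw [sq_abs] at h3
    calc _ ≤ p.1 * (144 * cutK ^ 2 * dom (v t) (f t) p) ^ 2 := mul_le_mul_of_nonneg_left h3 (le_of_lt hp)
      _ = _ := by ring

theorem HSol.tendsto_ip_tst (h : HSol b M v f ρ) (ht : t ∈ Icc 0 b) {a : ℝ × ℝ → ℝ} {C : ℝ} (ha : HalfPlane.L2 a C)
    (i : Fin 5) : Tendsto (fun n : ℕ => ip a (tst (fun p => chi ((n + 1 : ℕ) : ℝ) p * strm (f t) p) i)) atTop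
      (𝓝 (ip a (prf (v t) (f t) i))) := by
  have pr := h.prof t ht
  refine tendsto_ip (c := 144 * cutK ^ 2) ha (h.L2_dom ht) (fun n => ?_) (fun n p hp => ?_)
    (fun p hp => pr.tendsto_tst i p hp)
  · exact (s_tst ((contDiff_chi _).mul pr.s_strm) i).continuous
  · exact pr.abs_tst_le (by push_cast; linarith [Nat.cast_nonneg (α := ℝ) n]) i p hp

/-- The energy identity. -/
theorem HSol.energy_identity (h : HSol b M v f ρ) {A : ℝ} (hA : ∀ t ∈ Icc 0 b, HalfPlane.L2 (ρ t) A) {T : ℝ}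
    (hT : 0 < T) (hTb : T ≤ b) :
    IntervalIntegrable (fun τ => pair (frc (v τ) (f τ) (ρ τ)) (prf (v τ) (f τ))) volume 0 T ∧
    (ip (v T) (v T) + ip (f T) (f T)) - (ip (v 0) (v 0) + ip (f 0) (f 0)) =
      2 * (∫ τ in (0:ℝ)..T, pair (frc (v τ) (f τ) (ρ τ)) (prf (v τ) (f τ))) ∧
    ∀ᵐ τ, τ ∈ Icc 0 T → pair (frc (v τ) (f τ) (ρ τ)) (prf (v τ) (f τ)) ≤
      ip (ρ τ) (f τ) - ip (dr (f τ)) (dr (f τ)) := by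
  have hb := h.hb
  have hM := h.M_nonneg
  have hA0 : 0 ≤ A := (hA 0 ⟨le_rfl, hb.le⟩).nonneg
  have sub : Icc 0 T ⊆ Icc 0 b := Icc_subset_Icc_right hTb
  obtain ⟨g, hgm, hgi, hg⟩ := h.exists_velocity_bound
  let γ : ℝ → ℝ := fun τ => (g τ).toReal
  have hfin : ∀ᵐ τ, τ ∈ Icc 0 b → g τ < ⊤ := (ae_restrict_iff' measurableSet_Icc).1 (ae_lt_top hgm hgi.ne)
  have hγi : IntervalIntegrable γ volume 0 b :=
    (intervalIntegrable_iff_integrableOn_Icc_of_le hb.le).2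
      (integrable_toReal_of_lintegral_ne_top hgm.aemeasurable hgi.ne)
  have hγ0 : ∀ τ, 0 ≤ γ τ := fun τ => ENNReal.toReal_nonneg
  have hbv : ∀ τ ∈ Icc 0 b, g τ < ⊤ → ∀ p : ℝ × ℝ, 0 < p.1 → |v τ p| ≤ γ τ := fun τ hτ h1 p hp =>
    (ENNReal.ofReal_le_iff_le_toReal h1.ne).1 (hg τ hτ p hp).1
  have hbf : ∀ τ ∈ Icc 0 b, g τ < ⊤ → ∀ p : ℝ × ℝ, 0 < p.1 → |f τ p| ≤ γ τ := fun τ hτ h1 p hp =>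
    (ENNReal.ofReal_le_iff_le_toReal h1.ne).1 (hg τ hτ p hp).2.1
  have hfr : ∀ τ ∈ Icc 0 b, g τ < ⊤ → ∀ i, HalfPlane.L2 (frc (v τ) (f τ) (ρ τ) i) ((2 * A + 4 * M) * (γ τ + 1) ^ 2) :=
    fun τ hτ h1 => h.L2_frc hτ (hA τ hτ) (hγ0 τ) (hbv τ hτ h1) (hbf τ hτ h1)
  let Cz : ℝ := (144 * cutK ^ 2) ^ 2 * (72 * M) + 2 * M
  have hz1 : (144 * cutK ^ 2) ^ 2 * (72 * M) ≤ Cz := by simp only [Cz]; linarith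
  have hz2 : 2 * M ≤ Cz := by
    have : 0 ≤ (144 * cutK ^ 2) ^ 2 * (72 * M) := by positivity
    simp only [Cz]; linarith
  let k : ℝ → ℝ := fun τ => 5 * ((2 * A + 4 * M) + Cz) * (γ τ + 1)
  have hk : IntervalIntegrable k volume 0 b := (hγi.add intervalIntegrable_const).const_mul _
  have hpair : ∀ τ ∈ Icc 0 b, g τ < ⊤ → ∀ W, (∀ i, HalfPlane.L2 (W i) Cz) →
      |pair (frc (v τ) (f τ) (ρ τ)) W| ≤ k τ := fun τ hτ h1 W hW => by
    have hp : 0 < γ τ + 1 := by linarith [hγ0 τ]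
    refine (abs_pair_le (hfr τ hτ h1) hW (inv_pos.2 hp)).trans_eq ?_
    simp only [k]
    field_simp
  have hmono : ∀ {a : ℝ × ℝ → ℝ} {C : ℝ}, HalfPlane.L2 a C → C ≤ Cz → HalfPlane.L2 a Cz := fun ha hC =>
    ⟨ha.meas, ha.int, ha.le.trans hC⟩
  let κ : ℝ → ℕ → ℝ × ℝ → ℝ := fun s n p => chi ((n + 1 : ℕ) : ℝ) p * strm (f s) p
  have sκ : ∀ s ∈ Icc 0 b, ∀ n, Sl (κ s n) := fun s hs n => (contDiff_chi _).mul (h.prof s hs).s_strm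
  have bκ : ∀ s n, BH (κ s n) := fun s n => (BH_chi (by positivity)).mul_right
  have hlim : ∀ s ∈ Icc 0 b, ∀ τ ∈ Icc 0 b, g τ < ⊤ →
      Tendsto (fun n => pair (frc (v τ) (f τ) (ρ τ)) (tst (κ s n))) atTop
        (𝓝 (pair (frc (v τ) (f τ) (ρ τ)) (prf (v s) (f s)))) := fun s hs τ hτ h1 =>
    tendsto_finsetSum _ fun i _ => h.tendsto_ip_tst hs (hfr τ hτ h1 i) i
  have hI : ∀ t₁ ∈ Icc 0 b, ∀ t₂ ∈ Icc 0 b, t₁ ≤ t₂ → uIoc t₁ t₂ ⊆ Icc 0 b := fun t₁ h1 t₂ h2 h12 => by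
    rw [uIoc_of_le h12]; exact fun x hx => ⟨h1.1.trans hx.1.le, hx.2.trans h2.2⟩
  have hmeas : ∀ s ∈ Icc 0 b, ∀ t₁ ∈ Icc 0 b, ∀ t₂ ∈ Icc 0 b, t₁ ≤ t₂ → ∀ n,
      AEStronglyMeasurable (fun τ => pair (frc (v τ) (f τ) (ρ τ)) (tst (κ s n))) (volume.restrict (uIoc t₁ t₂)) :=
    fun s hs t₁ h1 t₂ h2 h12 n =>
      ((h.weak_momentum (sκ s hs n) (bκ s n)).1.mono (hI t₁ h1 t₂ h2 h12)).aestronglyMeasurable measurableSet_uIoc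
  have h00 : (0:ℝ) ∈ Icc 0 b := ⟨le_rfl, hb.le⟩
  have hbb : b ∈ Icc 0 b := ⟨hb.le, le_rfl⟩
  have hi : ∀ s ∈ Icc 0 b, IntervalIntegrable (fun τ => pair (frc (v τ) (f τ) (ρ τ)) (prf (v s) (f s))) volume 0 b :=
    fun s hs => by
      refine hk.mono_fun' (aestronglyMeasurable_of_tendsto_ae atTop (hmeas s hs 0 h00 b hbb hb.le) ?_) ?_
      · refine (ae_restrict_iff' measurableSet_uIoc).2 ?_
        filter_upwards [hfin] with τ h1 hτ
        have hτ' := hI 0 h00 b hbb hb.le hτ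
        exact hlim s hs τ hτ' (h1 hτ')
      · refine (ae_restrict_iff' measurableSet_uIoc).2 ?_
        filter_upwards [hfin] with τ h1 hτ
        have hτ' := hI 0 h00 b hbb hb.le hτ
        exact hpair τ hτ' (h1 hτ') _ fun i => hmono (h.L2_prf hs i) hz2
  have hφ : ∀ s ∈ Icc 0 b, ∀ t₁ ∈ Icc 0 b, ∀ t₂ ∈ Icc 0 b, t₁ ≤ t₂ →
      (ip (v t₂) (v s) + ip (f t₂) (f s)) - (ip (v t₁) (v s) + ip (f t₁) (f s)) =
        ∫ τ in t₁..t₂, pair (frc (v τ) (f τ) (ρ τ)) (prf (v s) (f s)) := fun s hs t₁ h1 t₂ h2 h12 => by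
    have L : ∀ t ∈ Icc 0 b, Tendsto (fun n => ip (v t) (tst (κ s n) 0) + ip (f t) (tst (κ s n) 1)) atTop
        (𝓝 (ip (v t) (v s) + ip (f t) (f s))) := fun t ht =>
      (h.tendsto_ip_tst hs (h.L2_prf ht 0) 0).add (h.tendsto_ip_tst hs (h.L2_prf ht 1) 1)
    have R := intervalIntegral.tendsto_integral_filter_of_dominated_convergence (μ := volume) (a := t₁) (b := t₂)
      (F := fun n τ => pair (frc (v τ) (f τ) (ρ τ)) (tst (κ s n)))
      (f := fun τ => pair (frc (v τ) (f τ) (ρ τ)) (prf (v s) (f s))) k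
      (Eventually.of_forall (hmeas s hs t₁ h1 t₂ h2 h12))
      (Eventually.of_forall fun n => by
        filter_upwards [hfin] with τ h3 hτ
        have hτ' := hI t₁ h1 t₂ h2 h12 hτ
        exact hpair τ hτ' (h3 hτ') _ fun i => hmono (h.L2_tst hs n i) hz1)
      (hk.mono_set (by rw [uIcc_of_le h12, uIcc_of_le hb.le]; exact Icc_subset_Icc h1.1 h2.2))
      (by
        filter_upwards [hfin] with τ h3 hτ
        have hτ' := hI t₁ h1 t₂ h2 h12 hτ
        exact hlim s hs τ hτ' (h3 hτ'))
    refine tendsto_nhds_unique ((L t₂ h2).sub (L t₁ h1)) (R.congr fun n => ?_)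
    exact ((h.weak_momentum (sκ s hs n) (bκ s n)).2 t₁ h1 t₂ h2 h12).symm
  have usub : uIcc 0 T ⊆ uIcc 0 b := by rw [uIcc_of_le hT.le, uIcc_of_le hb.le]; exact sub
  have dg := diagonal_sub_eq_integral hT (φ := fun s t => ip (v t) (v s) + ip (f t) (f s))
    (l := fun τ s => pair (frc (v τ) (f τ) (ρ τ)) (prf (v s) (f s))) (k := k)
    (fun s t => by simp only [ip_comm (v s), ip_comm (f s)])
    (fun s hs => (hi s (sub hs)).mono_set usub)
    (fun s hs t₁ h1 t₂ h2 => hφ s (sub hs) t₁ (sub h1) t₂ (sub h2)) (hk.mono_set usub) (by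
      filter_upwards [hfin] with τ h3 hτ
      have hτ' := sub hτ
      refine ⟨fun s hs => hpair τ hτ' (h3 hτ') _ fun i => hmono (h.L2_prf (sub hs) i) hz2, ?_⟩
      refine continuousOn_finsetSum _ fun i _ => ?_
      exact (continuousOn_ip (hfr τ hτ' (h3 hτ') i) (h.s_prf i) ((h.s_frc i).slice hτ').continuous
        (fun s hs => h.L2_prf hs i)).mono sub)
  refine ⟨dg.1, dg.2, ?_⟩
  filter_upwards [hfin] with τ h3 hτ
  have hτ' := sub hτ
  have h3 := h3 hτ'
  have pr := h.prof τ hτ'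
  have hρ := hA τ hτ'
  have L := h.L2_prf hτ'
  have F := hfr τ hτ' h3
  have Lf : HalfPlane.L2 (f τ) (2 * M) := L 1
  have s1 := (h.s_frc 1).slice hτ'
  have F1 : HalfPlane.L2 (fun p => -(v τ p * dr (f τ) p + f τ p * dz (f τ) p))
      (2 * ((2 * A + 4 * M) * (γ τ + 1) ^ 2) + 2 * A) := by
    have I := ((HI.of (F 1).int).const_mul 2).add ((HI.of hρ.int).const_mul 2)
    refine L2.of_le ((pr.sv.mul pr.sf.dr).add (pr.sf.mul pr.sf.dz)).neg.continuous.aestronglyMeasurable I.int ?_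
      fun p hp => ?_
    · rw [I.val]; linarith [(F 1).le, hρ.le]
    · show _ ≤ 2 * (p.1 * (ρ τ p - (v τ p * dr (f τ) p + f τ p * dz (f τ) p)) ^ 2) + 2 * (p.1 * ρ τ p ^ 2)
      have hp0 : 0 ≤ p.1 := le_of_lt hp
      have := mul_nonneg hp0 (sq_nonneg (ρ τ p - (v τ p * dr (f τ) p + f τ p * dz (f τ) p) + ρ τ p))
      nlinarith
  have F0 : HalfPlane.L2 (fun p => -(v τ p * dr (v τ) p + f τ p * dz (v τ) p))
      (2 * ((2 * A + 4 * M) * (γ τ + 1) ^ 2) + 2 * A) := by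
    have := F 0
    refine ⟨this.meas, this.int, this.le.trans ?_⟩
    have : 0 ≤ (2 * A + 4 * M) * (γ τ + 1) ^ 2 := by positivity
    linarith
  have conv := pr.integral_convection (hγ0 τ) (hbv τ hτ' h3) (hbf τ hτ' h3) (L 0) (L 1) F0 F1
  have e1 : ip (frc (v τ) (f τ) (ρ τ) 1) (prf (v τ) (f τ) 1) =
      ip (ρ τ) (f τ) + ip (fun p => -(v τ p * dr (f τ) p + f τ p * dz (f τ) p)) (f τ) := by
    have := (HI.of (hρ.integrable_mul Lf)).add (HI.of (F1.integrable_mul Lf))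
    refine HI.eq (HI.of ((F 1).integrable_mul (L 1))) this fun p _ => ?_
    show p.1 * ((ρ τ p - (v τ p * dr (f τ) p + f τ p * dz (f τ) p)) * f τ p) = _
    ring
  have neg : ∀ a : ℝ × ℝ → ℝ, ip (fun p => -a p) a = -ip a a := fun a => by
    simp only [ip]
    rw [← integral_neg]
    congr 1; funext p; ring
  have nn : ∀ a : ℝ × ℝ → ℝ, 0 ≤ ip a a := fun a =>
    setIntegral_nonneg measurableSet_H fun p hp => mul_nonneg (le_of_lt hp) (mul_self_nonneg _)
  have e0 : ip (frc (v τ) (f τ) (ρ τ) 0) (prf (v τ) (f τ) 0) =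
    ip (fun p => -(v τ p * dr (v τ) p + f τ p * dz (v τ) p)) (v τ) := rfl
  have e2 : ip (frc (v τ) (f τ) (ρ τ) 2) (prf (v τ) (f τ) 2) = -ip (dr (v τ)) (dr (v τ)) := neg _
  have e3 : ip (frc (v τ) (f τ) (ρ τ) 3) (prf (v τ) (f τ) 3) = -ip (dr (f τ)) (dr (f τ)) := neg _
  have e4 : ip (frc (v τ) (f τ) (ρ τ) 4) (prf (v τ) (f τ) 4) = -ip (quot (v τ)) (quot (v τ)) := neg _
  simp only [pair, Fin.sum_univ_five]
  rw [e0, e1, e2, e3, e4]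
  linarith [nn (dr (v τ)), nn (quot (v τ))]

end Energy


section EnergyEstimate

/-- A bounded function satisfying a self-improving bound. -/
theorem le_two_mul_of_improve {s : Set ℝ} {φ : ℝ → ℝ} {c₀ K : ℝ} (h0 : ∀ t ∈ s, φ t ≤ c₀)
    (hφ : ∀ t ∈ s, 0 ≤ φ t)
    (h : ∀ c, 0 ≤ c → (∀ t ∈ s, φ t ≤ c) → ∀ t ∈ s, φ t ≤ K + c / 2) {t : ℝ} (ht : t ∈ s) : φ t ≤ 2 * K := by
  have hbd : BddAbove (φ '' s) := ⟨c₀, by rintro _ ⟨x, hx, rfl⟩; exact h0 x hx⟩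
  have hle : ∀ x ∈ s, φ x ≤ sSup (φ '' s) := fun x hx => le_csSup hbd ⟨x, hx, rfl⟩
  have h1 := h _ ((hφ t ht).trans (hle t ht)) hle
  have h2 : sSup (φ '' s) ≤ K + sSup (φ '' s) / 2 :=
    csSup_le ⟨_, t, ht, rfl⟩ (by rintro _ ⟨x, hx, rfl⟩; exact h1 x hx)
  linarith [hle t ht]

variable {b M : ℝ} {v f ρ : ℝ → ℝ × ℝ → ℝ} {t : ℝ}

theorem HSol.energy_estimate (h : HSol b M v f ρ) {A e₀ : ℝ} (hA : ∀ t ∈ Icc 0 b, HalfPlane.L2 (ρ t) A)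
    (he : ∫ p in H, p.1 * (v 0 p ^ 2 + f 0 p ^ 2) ≤ e₀) (ht : t ∈ Icc 0 b) :
    ENNReal.ofReal (∫ p in H, p.1 * (v t p ^ 2 + f t p ^ 2)) +
      2 * ∫⁻ s in Icc 0 t, ∫⁻ p in H, ENNReal.ofReal (p.1 * dr (f s) p ^ 2) ≤
      ENNReal.ofReal (2 * e₀ + 16 * b ^ 2 * A) := by
  have hb := h.hb
  set e : ℝ → ℝ := fun t => ∫ p in H, p.1 * (v t p ^ 2 + f t p ^ 2) with he_def
  have ee : ∀ t ∈ Icc 0 b, ip (v t) (v t) + ip (f t) (f t) = e t := fun t ht => by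
    have L := h.L2_prf ht
    exact ((HI.of ((L 0).integrable_mul (L 0))).add (HI.of ((L 1).integrable_mul (L 1)))).eq (HI.of (h.L2 t ht).1)
      fun p _ => by show p.1 * (v t p * v t p) + p.1 * (f t p * f t p) = _; ring
  have en : ∀ t, 0 ≤ e t := fun t => setIntegral_nonneg measurableSet_H fun p hp =>
    mul_nonneg (le_of_lt hp) (by positivity)
  have h00 : (0:ℝ) ∈ Icc 0 b := ⟨le_rfl, hb.le⟩
  have hA0 : 0 ≤ A := (hA 0 h00).nonneg
  have e00 : 0 ≤ e₀ := (en 0).trans he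
  have step : ∀ S, 0 ≤ S → (∀ t ∈ Icc 0 b, e t ≤ S) → ∀ t ∈ Icc 0 b, ENNReal.ofReal (e t) +
      2 * ∫⁻ s in Icc 0 t, ∫⁻ p in H, ENNReal.ofReal (p.1 * dr (f s) p ^ 2) ≤
      ENNReal.ofReal (e₀ + 8 * b ^ 2 * A + S / 2) := fun S hS hle t ht => by
    rcases ht.1.eq_or_lt with h0 | h0
    · rw [← h0]
      have : volume (Icc (0:ℝ) 0) = 0 := by simp
      rw [setLIntegral_measure_zero _ _ this, mul_zero, add_zero]
      refine ENNReal.ofReal_le_ofReal ?_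
      have : 0 ≤ 8 * b ^ 2 * A := by positivity
      linarith
    have sub : Icc 0 t ⊆ Icc 0 b := Icc_subset_Icc_right ht.2
    obtain ⟨il, hl, hae⟩ := h.energy_identity hA h0 ht.2
    rw [ee t ht, ee 0 h00] at hl
    set l : ℝ → ℝ := fun τ => pair (frc (v τ) (f τ) (ρ τ)) (prf (v τ) (f τ))
    let κ : ℝ := 4 * b * A + S / (4 * b)
    have ik : IntervalIntegrable (fun τ => κ - l τ) volume 0 t := intervalIntegrable_const.sub il
    have eI : ∀ s ∈ Icc 0 b, ∫⁻ p in H, ENNReal.ofReal (p.1 * dr (f s) p ^ 2) = ENNReal.ofReal (ip (dr (f s)) (dr (f s))) :=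
      fun s hs => by
        have L := (h.L2_prf hs 3)
        refine (ofReal_integral_H (Q := fun p => p.1 * dr (f s) p ^ 2) L.int fun p hp =>
          mul_nonneg (le_of_lt hp) (sq_nonneg _)).trans ?_
        congr 1
        exact (HI.of L.int).eq (HI.of (L.integrable_mul L)) fun p _ => by
          show p.1 * dr (f s) p ^ 2 = p.1 * (dr (f s) p * dr (f s) p); ring
    have nn : ∀ a : ℝ × ℝ → ℝ, 0 ≤ ip a a := fun a =>
      setIntegral_nonneg measurableSet_H fun p hp => mul_nonneg (le_of_lt hp) (mul_self_nonneg _)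
    have hae' : ∀ᵐ τ, τ ∈ Icc 0 t → ip (dr (f τ)) (dr (f τ)) ≤ κ - l τ := by
      filter_upwards [hae] with τ h1 hτ
      have hτ' := sub hτ
      have h1 := h1 hτ
      have L : HalfPlane.L2 (f τ) S := by
        have L1 : HalfPlane.L2 (f τ) _ := h.L2_prf hτ' 1
        refine L2.of_le L1.meas (h.L2 τ hτ').1 (hle τ hτ') fun p hp => ?_
        exact mul_le_mul_of_nonneg_left (by linarith [sq_nonneg (v τ p)]) (le_of_lt hp)
      have h2 := (le_abs_self _).trans ((hA τ hτ').abs_ip_le L (l := 4 * b) (by positivity))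
      simp only [κ, l]
      linarith
    have h1 : ∫⁻ s in Icc 0 t, ∫⁻ p in H, ENNReal.ofReal (p.1 * dr (f s) p ^ 2) ≤
        ENNReal.ofReal (∫ s in (0:ℝ)..t, (κ - l s)) := by
      have hnn : 0 ≤ᵐ[volume.restrict (Icc 0 t)] fun s => κ - l s := by
        refine (ae_restrict_iff' measurableSet_Icc).2 ?_
        filter_upwards [hae'] with τ h1 hτ using (nn _).trans (h1 hτ)
      rw [intervalIntegral.integral_of_le ht.1, ← integral_Icc_eq_integral_Ioc,
        ofReal_integral_eq_lintegral_ofReal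
          ((intervalIntegrable_iff_integrableOn_Icc_of_le ht.1).1 ik) hnn]
      refine lintegral_mono_ae ((ae_restrict_iff' measurableSet_Icc).2 ?_)
      filter_upwards [hae'] with τ h1 hτ
      rw [eI τ (sub hτ)]
      exact ENNReal.ofReal_le_ofReal (h1 hτ)
    have hI0 : 0 ≤ ∫ s in (0:ℝ)..t, (κ - l s) := by
      refine intervalIntegral.integral_nonneg_of_ae_restrict ht.1 ?_
      refine (ae_restrict_iff' measurableSet_Icc).2 ?_
      filter_upwards [hae'] with τ h1 hτ using (nn _).trans (h1 hτ)
    have h2 : ∫ s in (0:ℝ)..t, (κ - l s) = t * κ - ∫ s in (0:ℝ)..t, l s := by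
      rw [intervalIntegral.integral_sub intervalIntegrable_const il, intervalIntegral.integral_const]
      simp
    have h3 : t * κ ≤ 4 * b ^ 2 * A + S / 4 := by
      calc t * κ ≤ b * κ := mul_le_mul_of_nonneg_right ht.2 (by positivity)
        _ = _ := by simp only [κ]; field_simp
    calc _ ≤ ENNReal.ofReal (e t) + 2 * ENNReal.ofReal (∫ s in (0:ℝ)..t, (κ - l s)) := by gcongr
      _ = ENNReal.ofReal (e t + 2 * ∫ s in (0:ℝ)..t, (κ - l s)) := by
        rw [ENNReal.ofReal_add (en t) (by positivity), ENNReal.ofReal_mul (by norm_num), ENNReal.ofReal_ofNat]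
      _ ≤ _ := ENNReal.ofReal_le_ofReal (by rw [h2]; linarith)
  have hS : ∀ t ∈ Icc 0 b, e t ≤ 2 * (e₀ + 8 * b ^ 2 * A) := fun t ht =>
    le_two_mul_of_improve (fun t ht => (h.L2 t ht).2) (fun t _ => en t) (fun S hS hle t ht => by
      have h1 := step S hS hle t ht
      refine (ENNReal.ofReal_le_ofReal_iff (by positivity)).1 (le_trans le_self_add h1)) ht
  have := step _ (by positivity) hS t ht
  refine this.trans (ENNReal.ofReal_le_ofReal (by linarith))

end EnergyEstimate


section Closing

variable {b M : ℝ} {v f ρ : ℝ → ℝ × ℝ → ℝ} {t : ℝ}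

/-- A solution together with bounds of its initial data. -/
structure BSol (b M : ℝ) (v f ρ : ℝ → ℝ × ℝ → ℝ) (e₀ G₀ A L d l : ℝ) : Prop where
  sol : HSol b M v f ρ
  he : ∫ p in H, p.1 * (v 0 p ^ 2 + f 0 p ^ 2) ≤ e₀
  gi : IntegrableOn (fun p => p.1 * gam (v 0) (f 0) p ^ 2) H
  gC : ∫ p in H, p.1 * gam (v 0) (f 0) p ^ 2 ≤ G₀
  ai : IntegrableOn (fun p => p.1 * ρ 0 p ^ 2) H
  aC : ∫ p in H, p.1 * ρ 0 p ^ 2 ≤ A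
  L0 : 0 ≤ L
  hL : ∀ p : ℝ × ℝ, 0 < p.1 → |ρ 0 p| ≤ L
  d0 : 0 < d
  d1 : d ≤ 1
  hd : ∀ p : ℝ × ℝ, 0 < p.1 → p.1 < d → ρ 0 p = 0
  l0 : 0 ≤ l
  hl : ∀ p : ℝ × ℝ, 0 < p.1 → l < |p.2| → ρ 0 p = 0

/-- Control of the velocity by a bound `y` of the norms of `Γ`. -/
noncomputable def velBound (b e₀ A y : ℝ) : ℝ :=
  (100 + b) * Real.sqrt ((1 + b) * (2 * e₀ + 16 * b ^ 2 * A + y) + 1)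

/-- The growth rate of the norms of `Γ`. -/
noncomputable def growth (b e₀ A L d l : ℝ) : ℝ :=
  A + 4 * L ^ 2 * ((100 + b) ^ 2 * ((1 + b) * (2 * e₀ + 16 * b ^ 2 * A + 1) + 1) + (l + Real.log d⁻¹ + 2) ^ 2)

variable {e₀ G₀ A L d l : ℝ}

theorem BSol.L2_rho (h : BSol b M v f ρ e₀ G₀ A L d l) (ht : t ∈ Icc 0 b) : L2 (ρ t) A := by
  have := h.sol.integral_rho_pow_le 1 (by simpa using h.ai) ht
  simp only [mul_one] at this
  exact ⟨(h.sol.sρ.slice ht).continuous.aestronglyMeasurable, this.1, this.2.trans h.aC⟩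

theorem BSol.e0_nonneg (h : BSol b M v f ρ e₀ G₀ A L d l) : 0 ≤ e₀ :=
  (setIntegral_nonneg measurableSet_H fun p hp => mul_nonneg (le_of_lt hp) (by positivity)).trans h.he

theorem BSol.G0_nonneg (h : BSol b M v f ρ e₀ G₀ A L d l) : 0 ≤ G₀ :=
  (setIntegral_nonneg measurableSet_H fun p hp => mul_nonneg (le_of_lt hp) (by positivity)).trans h.gC

theorem BSol.A_nonneg (h : BSol b M v f ρ e₀ G₀ A L d l) : 0 ≤ A :=
  (h.L2_rho ⟨le_rfl, h.sol.hb.le⟩).nonneg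

theorem aemeasurable_lintegral_H {F : ℝ → ℝ × ℝ → ℝ} (hF : Sm b F) :
    AEMeasurable (fun s => ∫⁻ p in H, ENNReal.ofReal (F s p)) (volume.restrict (Icc 0 b)) := by
  have h1 : AEMeasurable (fun q : ℝ × (ℝ × ℝ) => ENNReal.ofReal (F q.1 q.2))
      ((volume.restrict (Icc 0 b)).prod (volume.restrict H)) := by
    rw [Measure.prod_restrict]
    refine ENNReal.measurable_ofReal.comp_aemeasurable ?_
    exact (hF.continuousOn.mono (prod_mono_right (subset_univ _))).aemeasurable
      (measurableSet_Icc.prod measurableSet_H)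
  exact h1.lintegral_prod_right'

theorem HI_of_lintegral {Q : ℝ × ℝ → ℝ} (hc : Continuous Q) (h0 : ∀ p ∈ H, 0 ≤ Q p)
    (h : ∫⁻ p in H, ENNReal.ofReal (Q p) < ⊤) : HI Q (∫⁻ p in H, ENNReal.ofReal (Q p)).toReal := by
  have hi : IntegrableOn Q H := by
    refine ⟨hc.aestronglyMeasurable, ?_⟩
    rw [hasFiniteIntegral_iff_ofReal (ae_H h0)]
    exact h
  refine ⟨hi, ?_⟩
  rw [ofReal_integral_H hi h0, ENNReal.toReal_ofReal (setIntegral_nonneg measurableSet_H h0)]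

/-- Time integrated bounds of the velocity. -/
theorem BSol.exists_majorant (h : BSol b M v f ρ e₀ G₀ A L d l) {y : ℝ} (hy : 0 ≤ y) (ht : t ∈ Icc 0 b)
    (hG : ∀ s ∈ Icc 0 t, ∫⁻ p in H, ENNReal.ofReal (p.1 * gam (v s) (f s) p ^ 2) ≤ ENNReal.ofReal y)
    (hD : ∫⁻ s in Icc 0 t, ∫⁻ p in H, ENNReal.ofReal (p.1 * dr (gam (v s) (f s)) p ^ 2) ≤ ENNReal.ofReal y) :
    ∃ g : ℝ → ENNReal, (∀ s ∈ Icc 0 b, ∀ p : ℝ × ℝ, 0 < p.1 →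
        ENNReal.ofReal |quot (v s) p| ≤ g s ∧ ENNReal.ofReal |f s p| ≤ g s) ∧
      ∫⁻ s in Icc 0 t, g s ≤ ENNReal.ofReal (velBound b e₀ A y) := by
  have hb := h.sol.hb
  have hA0 := h.A_nonneg
  have he0 := h.e0_nonneg
  set S : ℝ := 2 * e₀ + 16 * b ^ 2 * A with hS
  have hS0 : 0 ≤ S := by positivity
  set w : ℝ := Real.sqrt ((1 + b) * (S + y) + 1) with hw
  have hw0 : 0 < w := Real.sqrt_pos.2 (by positivity)
  have hww : w ^ 2 = (1 + b) * (S + y) + 1 := Real.sq_sqrt (by positivity)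
  have sub : Icc 0 t ⊆ Icc 0 b := Icc_subset_Icc_right ht.2
  let e1 : ℝ → ENNReal := fun s => ENNReal.ofReal (∫ p in H, p.1 * (v s p ^ 2 + f s p ^ 2))
  let E1 : ℝ → ENNReal := fun s => ∫⁻ p in H, ENNReal.ofReal (p.1 * dr (f s) p ^ 2)
  let G1 : ℝ → ENNReal := fun s => ∫⁻ p in H, ENNReal.ofReal (p.1 * gam (v s) (f s) p ^ 2)
  let D1 : ℝ → ENNReal := fun s => ∫⁻ p in H, ENNReal.ofReal (p.1 * dr (gam (v s) (f s)) p ^ 2)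
  refine ⟨fun s => ENNReal.ofReal (100 / w) * (e1 s + E1 s + G1 s + D1 s) + ENNReal.ofReal w, ?_, ?_⟩
  · intro s hs p hp
    have pr := h.sol.prof s hs
    by_cases hfin : e1 s + E1 s + G1 s + D1 s = ⊤
    · have ht : ENNReal.ofReal (100 / w) * ⊤ = ⊤ := ENNReal.mul_top (by simpa using by positivity)
      simp only [hfin, ht, top_add, le_top, and_self]
    obtain ⟨hf1, hD1⟩ := ENNReal.add_ne_top.1 hfin
    obtain ⟨hf2, hG1⟩ := ENNReal.add_ne_top.1 hf1
    obtain ⟨_, hE1⟩ := ENNReal.add_ne_top.1 hf2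
    have hnn : ∀ a : ℝ × ℝ → ℝ, ∀ p ∈ H, 0 ≤ p.1 * a p ^ 2 := fun a p hp => mul_nonneg (le_of_lt hp) (sq_nonneg _)
    have I0 := HI.of (h.sol.L2 s hs).1
    have I1 := HI_of_lintegral (Sl.fst.mul (pr.sf.dr.pow 2)).continuous (hnn _) (lt_top_iff_ne_top.2 hE1)
    have I2 := HI_of_lintegral (Sl.fst.mul (pr.s_gam.pow 2)).continuous (hnn _) (lt_top_iff_ne_top.2 hG1)
    have I3 := HI_of_lintegral (Sl.fst.mul (pr.s_gam.dr.pow 2)).continuous (hnn _) (lt_top_iff_ne_top.2 hD1)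
    have key := pr.pointwise (h.sol.L2_prf hs 4).int I0 I1 I2 I3 p hp
    set q := (∫ p in H, p.1 * (v s p ^ 2 + f s p ^ 2)) + (E1 s).toReal + (G1 s).toReal + (D1 s).toReal with hq
    have i0 : 0 ≤ ∫ p in H, p.1 * (v s p ^ 2 + f s p ^ 2) :=
      setIntegral_nonneg measurableSet_H fun p hp => mul_nonneg (le_of_lt hp) (by positivity)
    have hqe : ENNReal.ofReal q = e1 s + E1 s + G1 s + D1 s := by
      rw [hq, ENNReal.ofReal_add (by positivity) ENNReal.toReal_nonneg,
        ENNReal.ofReal_add (by positivity) ENNReal.toReal_nonneg, ENNReal.ofReal_add i0 ENNReal.toReal_nonneg,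
        ENNReal.ofReal_toReal hE1, ENNReal.ofReal_toReal hG1, ENNReal.ofReal_toReal hD1]
    have hq0 : 0 ≤ q := by positivity
    have fin : ∀ x : ℝ, x ^ 2 ≤ 100 * q → ENNReal.ofReal |x| ≤
        ENNReal.ofReal (100 / w) * (e1 s + E1 s + G1 s + D1 s) + ENNReal.ofReal w := fun x hx => by
      rw [← hqe, ← ENNReal.ofReal_mul (by positivity), ← ENNReal.ofReal_add (by positivity) hw0.le]
      refine ENNReal.ofReal_le_ofReal ?_
      have h1 : 100 / w * q + w = (100 * q + w ^ 2) / w := by field_simp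
      rw [h1, le_div_iff₀ hw0]
      rw [← sq_abs] at hx
      nlinarith [sq_nonneg (|x| - w), abs_nonneg x]
    exact ⟨fin _ key.1, fin _ key.2⟩
  · have en := fun {t} (ht : t ∈ Icc 0 b) => h.sol.energy_estimate (fun t ht => h.L2_rho ht) h.he ht
    have hI : volume (Icc 0 t) = ENNReal.ofReal t := by simp
    have hE : ∫⁻ s in Icc 0 t, E1 s ≤ ENNReal.ofReal S := by
      refine le_trans ?_ ((le_add_self).trans (en ht))
      calc _ = 1 * ∫⁻ s in Icc 0 t, E1 s := (one_mul _).symm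
        _ ≤ 2 * ∫⁻ s in Icc 0 t, E1 s := by gcongr; norm_num
    have hmE : AEMeasurable E1 (volume.restrict (Icc 0 t)) :=
      (aemeasurable_lintegral_H (b := b) (Sm.fst.mul ((h.sol.sf.dr hb).comp_left (β := fun s => s ^ 2) (by fun_prop)))).mono_measure
        (Measure.restrict_mono sub le_rfl)
    have h1 : ∫⁻ s in Icc 0 t, (e1 s + E1 s + G1 s + D1 s) ≤ ENNReal.ofReal ((1 + b) * (S + y)) := by
      calc _ ≤ ∫⁻ s in Icc 0 t, (ENNReal.ofReal (S + y) + E1 s + D1 s) := by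
            refine setLIntegral_mono' measurableSet_Icc fun s hs => ?_
            have h1 : e1 s ≤ ENNReal.ofReal S := le_self_add.trans (en (sub hs))
            have h2 := hG s hs
            rw [ENNReal.ofReal_add hS0 hy]
            calc _ ≤ ENNReal.ofReal S + E1 s + ENNReal.ofReal y + D1 s := by gcongr
              _ = _ := by ring
        _ = ENNReal.ofReal (S + y) * ENNReal.ofReal t + (∫⁻ s in Icc 0 t, E1 s) + ∫⁻ s in Icc 0 t, D1 s := by
            rw [lintegral_add_left' (hmE.const_add _), lintegral_add_left measurable_const, lintegral_const,
              Measure.restrict_apply_univ, hI]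
        _ ≤ ENNReal.ofReal (S + y) * ENNReal.ofReal t + ENNReal.ofReal S + ENNReal.ofReal y := by gcongr
        _ = ENNReal.ofReal ((S + y) * t + S + y) := by
            have := ht.1
            rw [← ENNReal.ofReal_mul (by positivity), ← ENNReal.ofReal_add (by positivity) hS0,
              ← ENNReal.ofReal_add (by positivity) hy]
        _ ≤ _ := by
            refine ENNReal.ofReal_le_ofReal ?_
            have := mul_le_mul_of_nonneg_left ht.2 (by positivity : 0 ≤ S + y)
            linarith
    rw [lintegral_add_right _ measurable_const, lintegral_const_mul' _ _ ENNReal.ofReal_ne_top, lintegral_const,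
      Measure.restrict_apply_univ, hI]
    calc _ ≤ ENNReal.ofReal (100 / w) * ENNReal.ofReal ((1 + b) * (S + y)) + ENNReal.ofReal w * ENNReal.ofReal t := by gcongr
      _ = ENNReal.ofReal (100 / w * ((1 + b) * (S + y)) + w * t) := by
          have := ht.1
          rw [← ENNReal.ofReal_mul (by positivity), ← ENNReal.ofReal_mul hw0.le, ← ENNReal.ofReal_add (by positivity)
            (by positivity)]
      _ ≤ _ := by
          refine ENNReal.ofReal_le_ofReal ?_
          have h2 : 100 / w * ((1 + b) * (S + y)) ≤ 100 * w := by
            rw [div_mul_eq_mul_div, div_le_iff₀ hw0]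
            nlinarith
          have h3 := mul_le_mul_of_nonneg_left ht.2 hw0.le
          rw [velBound, ← hS, ← hw]
          linarith

theorem BSol.integral_rho_div_le (h : BSol b M v f ρ e₀ G₀ A L d l) {W : ℝ} (hW : 0 ≤ W) (ht : t ∈ Icc 0 b)
    {g : ℝ → ENNReal} (hg : ∀ s ∈ Icc 0 b, ∀ p : ℝ × ℝ, 0 < p.1 →
        ENNReal.ofReal |quot (v s) p| ≤ g s ∧ ENNReal.ofReal |f s p| ≤ g s)
    (hgW : ∫⁻ s in Icc 0 t, g s ≤ ENNReal.ofReal W) :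
    IntegrableOn (fun p => ρ t p ^ 2 / p.1) H ∧
      ∫ p in H, ρ t p ^ 2 / p.1 ≤ A + 4 * L ^ 2 * (W ^ 2 + (l + Real.log d⁻¹ + 2) ^ 2) := by
  have hl0 := h.l0
  have hd0 := h.d0
  have hlog : 0 ≤ Real.log d⁻¹ := Real.log_nonneg ((one_le_inv₀ hd0).2 h.d1)
  set d' : ℝ := d * Real.exp (-(W + 1)) with hd'
  have hd'0 : 0 < d' := by positivity
  have hd'1 : d' ≤ 1 := mul_le_one₀ h.d1 (Real.exp_nonneg _) (Real.exp_le_one_iff.2 (by linarith))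
  have hr := h.L2_rho ht
  have key := integral_rho_sq_div_le (h.sol.sρ.slice ht) hd'0 (by positivity : 0 ≤ l + W + 2) hr.int hr.le
    (fun p hp => h.sol.abs_rho_le h.L0 h.hL ht hp) (fun p hp hpd => by
      refine h.sol.rho_eq_zero_near hW h.hd (fun s hs p hp => (hg s hs p hp).1) ht hgW hp ?_
      have := mul_lt_mul_of_pos_right hpd (Real.exp_pos (W + 1))
      rwa [hd', mul_assoc, ← Real.exp_add, neg_add_cancel, Real.exp_zero, mul_one] at this)
    (fun p hp hpl => h.sol.rho_eq_zero_far hW h.hl (fun s hs p hp => (hg s hs p hp).2) ht hgW hp hpl) hd'1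
  refine ⟨key.1, key.2.trans ?_⟩
  have e1 : Real.log d'⁻¹ = Real.log d⁻¹ + (W + 1) := by
    rw [hd', mul_inv, Real.log_mul (by positivity) (by positivity), ← Real.exp_neg, Real.log_exp, neg_neg]
  rw [e1]
  have h2 : (l + W + 2) * (Real.log d⁻¹ + (W + 1)) ≤ 2 * (W ^ 2 + (l + Real.log d⁻¹ + 2) ^ 2) := by
    have : (l + W + 2) * (Real.log d⁻¹ + (W + 1)) ≤ (W + (l + Real.log d⁻¹ + 2)) * (W + (l + Real.log d⁻¹ + 2)) := by
      exact mul_le_mul (by linarith) (by linarith) (by positivity) (by positivity)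
    nlinarith [sq_nonneg (W - (l + Real.log d⁻¹ + 2))]
  nlinarith [mul_le_mul_of_nonneg_left h2 (sq_nonneg L)]

theorem BSol.exists_integral_rho_div_bound (h : BSol b M v f ρ e₀ G₀ A L d l) : ∃ N₀ : ℝ, ∀ t ∈ Icc 0 b,
    IntegrableOn (fun p => ρ t p ^ 2 / p.1) H ∧ ∫ p in H, ρ t p ^ 2 / p.1 ≤ N₀ := by
  obtain ⟨g, _, hgi, hg⟩ := h.sol.exists_velocity_bound
  refine ⟨_, fun t ht => h.integral_rho_div_le (W := (∫⁻ s in Icc 0 b, g s).toReal) ENNReal.toReal_nonneg ht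
    (fun s hs p hp => ⟨(hg s hs p hp).2.2, (hg s hs p hp).2.1⟩) ?_⟩
  rw [ENNReal.ofReal_toReal hgi.ne]
  exact lintegral_mono_set (Icc_subset_Icc_right ht.2)

theorem BSol.rho_axis (h : BSol b M v f ρ e₀ G₀ A L d l) (ht : t ∈ Icc 0 b) (z : ℝ) : ρ t (0, z) = 0 := by
  obtain ⟨g, _, hgi, hg⟩ := h.sol.exists_velocity_bound
  set Y := (∫⁻ s in Icc 0 b, g s).toReal
  have hc := (h.sol.sρ.slice ht).continuous
  have h1 : ∀ r, 0 < r → r < d * Real.exp (-(Y + 1)) → ρ t (r, z) = 0 := fun r hr hrd => by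
    refine h.sol.rho_eq_zero_near (Y := Y) ENNReal.toReal_nonneg h.hd (fun s hs p hp => (hg s hs p hp).2.2) ht ?_ hr ?_
    · rw [ENNReal.ofReal_toReal hgi.ne]
      exact lintegral_mono_set (Icc_subset_Icc_right ht.2)
    · have := mul_lt_mul_of_pos_right hrd (Real.exp_pos (Y + 1))
      rwa [mul_assoc, ← Real.exp_add, neg_add_cancel, Real.exp_zero, mul_one] at this
  have hlim : Tendsto (fun r : ℝ => ρ t (r, z)) (𝓝[>] 0) (𝓝 (ρ t (0, z))) :=
    ((hc.comp (by fun_prop : Continuous fun r : ℝ => (r, z))).tendsto 0).mono_left nhdsWithin_le_nhds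
  have hev : ∀ᶠ r in 𝓝[>] (0:ℝ), ρ t (r, z) = 0 := by
    have hd : 0 < d * Real.exp (-(Y + 1)) := mul_pos h.d0 (Real.exp_pos _)
    filter_upwards [Ioo_mem_nhdsGT hd] with r hr using h1 r hr.1 hr.2
  exact tendsto_nhds_unique hlim (tendsto_const_nhds.congr' (hev.mono fun r hr => hr.symm))

theorem integral_mul_exp {k c t : ℝ} (hk : 0 < k) :
    ∫ s in (0:ℝ)..t, c * Real.exp (2 * k * s) = c / (2 * k) * (Real.exp (2 * k * t) - 1) := by
  have hd : ∀ s ∈ uIcc 0 t, HasDerivAt (fun s => c / (2 * k) * Real.exp (2 * k * s)) (c * Real.exp (2 * k * s)) s := fun s _ => by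
    have := (((hasDerivAt_id s).const_mul (2 * k)).exp.const_mul (c / (2 * k)))
    refine this.congr_deriv ?_
    simp only [id]; field_simp
  rw [intervalIntegral.integral_eq_sub_of_hasDerivAt hd
    ((by fun_prop : Continuous fun s => c * Real.exp (2 * k * s)).intervalIntegrable _ _)]
  simp; ring

/-- The quantitative bounds of the velocity. -/
theorem BSol.exists_quantitative_majorant (h : BSol b M v f ρ e₀ G₀ A L d l) :
    ∃ g : ℝ → ENNReal, (∀ s ∈ Icc 0 b, ∀ p : ℝ × ℝ, 0 < p.1 →
        ENNReal.ofReal |quot (v s) p| ≤ g s) ∧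
      ∫⁻ s in Icc 0 b, g s ≤ ENNReal.ofReal
        (velBound b e₀ A ((1 + 2 * G₀) * Real.exp (2 * (growth b e₀ A L d l + 1) * b))) := by
  have hb := h.sol.hb
  have hG0 := h.G0_nonneg
  have hA0 := h.A_nonneg
  have he0 := h.e0_nonneg
  have hL0 := h.L0
  set k : ℝ := growth b e₀ A L d l + 1 with hk
  have hk0 : 0 ≤ growth b e₀ A L d l := by unfold growth; positivity
  have hk1 : 0 < k := by linarith
  obtain ⟨N₀, hN₀⟩ := h.exists_integral_rho_div_bound
  let I : ℝ → ℝ := fun t => ∫ p in H, ρ t p ^ 2 / p.1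
  have hI0 : ∀ t, 0 ≤ I t := fun t => setIntegral_nonneg measurableSet_H fun p hp =>
    div_nonneg (sq_nonneg _) (le_of_lt hp)
  have maj : ∀ c, 0 ≤ c → (∀ t ∈ Icc 0 b, I t ≤ c * Real.exp (2 * k * t)) → ∀ t ∈ Icc 0 b,
      ∃ g : ℝ → ENNReal, (∀ s ∈ Icc 0 b, ∀ p : ℝ × ℝ, 0 < p.1 →
        ENNReal.ofReal |quot (v s) p| ≤ g s ∧ ENNReal.ofReal |f s p| ≤ g s) ∧
      ∫⁻ s in Icc 0 t, g s ≤ ENNReal.ofReal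
        (velBound b e₀ A (G₀ + c / (2 * k) * (Real.exp (2 * k * t) - 1))) := fun c hc hle t ht => by
    have gam := fun {t} (ht : t ∈ Icc 0 b) => h.sol.gam_estimate (N := fun t => c * Real.exp (2 * k * t))
      (fun t ht => ⟨(h.L2_rho ht).int, (h.L2_rho ht).le⟩) (fun t ht => ⟨(hN₀ t ht).1, hle t ht⟩)
      (by fun_prop : Continuous fun t => c * Real.exp (2 * k * t)).integrableOn_Icc (fun t ht z => h.rho_axis ht z)
      h.gi h.gC ht
    simp only [integral_mul_exp hk1] at gam
    have hmono : ∀ s ∈ Icc 0 t, G₀ + c / (2 * k) * (Real.exp (2 * k * s) - 1) ≤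
        G₀ + c / (2 * k) * (Real.exp (2 * k * t) - 1) := fun s hs => by
      have := hs.2
      gcongr
    have hy : 0 ≤ G₀ + c / (2 * k) * (Real.exp (2 * k * t) - 1) := by
      have : 1 ≤ Real.exp (2 * k * t) := Real.one_le_exp (mul_nonneg (by positivity) ht.1)
      have : 0 ≤ Real.exp (2 * k * t) - 1 := by linarith
      positivity
    exact h.exists_majorant hy ht (fun s hs => (le_self_add.trans (gam ⟨hs.1, hs.2.trans ht.2⟩)).trans
      (ENNReal.ofReal_le_ofReal (hmono s hs))) (le_add_self.trans (gam ht))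
  have step : ∀ c, 0 ≤ c → (∀ t ∈ Icc 0 b, I t * Real.exp (-(2 * k * t)) ≤ c) → ∀ t ∈ Icc 0 b,
      I t * Real.exp (-(2 * k * t)) ≤ k * (1 + G₀) + c / 2 := fun c hc hle t ht => by
    have hle' : ∀ t ∈ Icc 0 b, I t ≤ c * Real.exp (2 * k * t) := fun t ht => by
      have := mul_le_mul_of_nonneg_right (hle t ht) (Real.exp_nonneg (2 * k * t))
      rwa [mul_assoc, ← Real.exp_add, neg_add_cancel, Real.exp_zero, mul_one] at this
    obtain ⟨g, hg, hgW⟩ := maj c hc hle' t ht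
    set y := G₀ + c / (2 * k) * (Real.exp (2 * k * t) - 1) with hy
    have hE : 1 ≤ Real.exp (2 * k * t) := Real.one_le_exp (mul_nonneg (by positivity) ht.1)
    have hy0 : 0 ≤ y := by
      have : 0 ≤ Real.exp (2 * k * t) - 1 := by linarith
      positivity
    have h1 := (h.integral_rho_div_le (by unfold velBound; positivity) ht hg hgW).2
    have hW2 : velBound b e₀ A y ^ 2 = (100 + b) ^ 2 * ((1 + b) * (2 * e₀ + 16 * b ^ 2 * A + y) + 1) := by
      rw [velBound, mul_pow, Real.sq_sqrt (by positivity)]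
    have h2 : I t ≤ k * (1 + y) := by
      refine h1.trans ?_
      rw [hW2]
      set P := (l + Real.log d⁻¹ + 2) ^ 2 with hP
      have hP0 : 0 ≤ P := sq_nonneg _
      have h3 : (1 + b) * (2 * e₀ + 16 * b ^ 2 * A + y) + 1 ≤
          ((1 + b) * (2 * e₀ + 16 * b ^ 2 * A + 1) + 1) * (1 + y) := by
        have : 0 ≤ y * ((1 + b) * (2 * e₀ + 16 * b ^ 2 * A)) + y + (1 + b) := by positivity
        nlinarith
      have h4 : P ≤ P * (1 + y) := by nlinarith
      have h5 : A ≤ A * (1 + y) := by nlinarith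
      have h6 : k * (1 + y) = A * (1 + y) + 4 * L ^ 2 * ((100 + b) ^ 2 * (((1 + b) * (2 * e₀ + 16 * b ^ 2 * A + 1) + 1) * (1 + y))
          + P * (1 + y)) + (1 + y) := by
        rw [hk, growth]; ring
      rw [h6]
      have h7 : 4 * L ^ 2 * ((100 + b) ^ 2 * ((1 + b) * (2 * e₀ + 16 * b ^ 2 * A + y) + 1) + P) ≤
        4 * L ^ 2 * ((100 + b) ^ 2 * (((1 + b) * (2 * e₀ + 16 * b ^ 2 * A + 1) + 1) * (1 + y)) + P * (1 + y)) := by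
        gcongr
      linarith
    have h3 : k * (1 + y) = k * (1 + G₀) + c / 2 * (Real.exp (2 * k * t) - 1) := by rw [hy]; field_simp; ring
    have h4 : I t ≤ (k * (1 + G₀) + c / 2) * Real.exp (2 * k * t) := by
      have : k * (1 + G₀) ≤ k * (1 + G₀) * Real.exp (2 * k * t) := le_mul_of_one_le_right (by positivity) hE
      rw [h3] at h2
      linarith
    have := mul_le_mul_of_nonneg_right h4 (Real.exp_nonneg (-(2 * k * t)))
    rwa [mul_assoc (k * (1 + G₀) + c / 2), ← Real.exp_add, add_neg_cancel, Real.exp_zero, mul_one] at this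
  have fin : ∀ t ∈ Icc 0 b, I t * Real.exp (-(2 * k * t)) ≤ 2 * (k * (1 + G₀)) := fun t ht =>
    le_two_mul_of_improve (c₀ := N₀) (fun t ht => by
      refine (mul_le_of_le_one_right (hI0 t) (Real.exp_le_one_iff.2 ?_)).trans (hN₀ t ht).2
      have := mul_nonneg (by positivity : 0 ≤ 2 * k) ht.1
      linarith) (fun t _ => mul_nonneg (hI0 t) (Real.exp_nonneg _)) step ht
  have hbb : b ∈ Icc 0 b := ⟨hb.le, le_rfl⟩
  obtain ⟨g, hg, hgW⟩ := maj (2 * (k * (1 + G₀))) (by positivity) (fun t ht => by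
    have := mul_le_mul_of_nonneg_right (fin t ht) (Real.exp_nonneg (2 * k * t))
    rwa [mul_assoc, ← Real.exp_add, neg_add_cancel, Real.exp_zero, mul_one] at this) b hbb
  refine ⟨g, fun s hs p hp => (hg s hs p hp).1, hgW.trans (ENNReal.ofReal_le_ofReal ?_)⟩
  have hE : 1 ≤ Real.exp (2 * k * b) := Real.one_le_exp (by positivity)
  have e1 : G₀ + 2 * (k * (1 + G₀)) / (2 * k) * (Real.exp (2 * k * b) - 1) ≤ (1 + 2 * G₀) * Real.exp (2 * k * b) := by
    have : 2 * (k * (1 + G₀)) / (2 * k) = 1 + G₀ := by field_simp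
    rw [this]
    nlinarith
  unfold velBound
  gcongr

end Closing


section Cylindrical

open HBS (E3 rad pd basisVec)

/-- The meridian half-plane `θ = 0` in `ℝ³`. -/
noncomputable def emb (p : ℝ × ℝ) : E3 := !₂[p.1, 0, p.2]

/-- The coordinates `(r, z)`. -/
noncomputable def cyl (x : E3) : ℝ × ℝ := (rad x, x 2)

theorem contDiff_emb : ContDiff ℝ ∞ emb := by
  rw [contDiff_euclidean]
  intro i
  fin_cases i
  · exact contDiff_fst
  · exact contDiff_const
  · exact contDiff_snd

theorem emb_add (p : ℝ × ℝ) (s : ℝ) : emb (p.1 + s, p.2) = emb p + s • basisVec 0 ∧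
    emb (p.1, p.2 + s) = emb p + s • basisVec 2 := by
  constructor <;> (ext i; fin_cases i <;> simp [emb, basisVec])

theorem rad_emb {p : ℝ × ℝ} (hp : 0 ≤ p.1) : rad (emb p) = p.1 := by
  simp [rad, emb, Real.sqrt_sq hp]

theorem cyl_emb {p : ℝ × ℝ} (hp : 0 ≤ p.1) : cyl (emb p) = p := by
  ext
  · exact rad_emb hp
  · simp [cyl, emb]

theorem rad_sq (x : E3) : rad x ^ 2 = x 0 ^ 2 + x 1 ^ 2 := Real.sq_sqrt (by positivity)

theorem continuous_rad : Continuous rad := by unfold HBS.rad; fun_prop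

theorem continuous_cyl : Continuous cyl := continuous_rad.prodMk (by fun_prop)

theorem rad_nonneg (x : E3) : 0 ≤ rad x := Real.sqrt_nonneg _

theorem hasDerivAt_line (x w : E3) (s : ℝ) : HasDerivAt (fun s : ℝ => x + s • w) w s := by
  simpa using ((hasDerivAt_id s).smul_const w).const_add x

theorem pd_apply {U : E3 → E3} (hU : Differentiable ℝ U) (x w : E3) (c : Fin 3) :
    (fderiv ℝ U x w) c = fderiv ℝ (fun y => U y c) x w := by
  have h := ((EuclideanSpace.proj c : E3 →L[ℝ] ℝ).hasFDerivAt).comp x (hU x).hasFDerivAt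
  have := h.fderiv
  rw [show (fun y => U y c) = (EuclideanSpace.proj c : E3 →L[ℝ] ℝ) ∘ U from rfl, this]
  rfl

theorem dr_emb {φ : E3 → ℝ} (hφ : Differentiable ℝ φ) (p : ℝ × ℝ) :
    dr (fun p => φ (emb p)) p = pd 0 φ (emb p) := by
  have h1 : (fun s => φ (emb (s, p.2))) = fun s => φ (emb (0, p.2) + s • basisVec 0) := by
    funext s; rw [← (emb_add (0, p.2) s).1]; simp
  have h2 : emb (0, p.2) + p.1 • basisVec 0 = emb p := by rw [← (emb_add (0, p.2) p.1).1]; simp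
  rw [dr, h1]
  have := (hφ (emb (0, p.2) + p.1 • basisVec 0)).hasFDerivAt.comp_hasDerivAt p.1 (hasDerivAt_line (emb (0, p.2)) (basisVec 0) p.1)
  rw [h2] at this
  exact this.deriv

theorem dz_emb {φ : E3 → ℝ} (hφ : Differentiable ℝ φ) (p : ℝ × ℝ) :
    dz (fun p => φ (emb p)) p = pd 2 φ (emb p) := by
  have h1 : (fun s => φ (emb (p.1, s))) = fun s => φ (emb (p.1, 0) + s • basisVec 2) := by
    funext s; rw [← (emb_add (p.1, 0) s).2]; simp
  have h2 : emb (p.1, 0) + p.2 • basisVec 2 = emb p := by rw [← (emb_add (p.1, 0) p.2).2]; simp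
  rw [dz, h1]
  have := (hφ (emb (p.1, 0) + p.2 • basisVec 2)).hasFDerivAt.comp_hasDerivAt p.2 (hasDerivAt_line (emb (p.1, 0)) (basisVec 2) p.2)
  rw [h2] at this
  exact this.deriv

theorem Sl.hasDerivAt_curve {g : ℝ × ℝ → ℝ} (hg : Sl g) {c : ℝ → ℝ × ℝ} {c' : ℝ × ℝ} {s : ℝ} (hc : HasDerivAt c c' s) :
    HasDerivAt (fun s => g (c s)) (c'.1 * HalfPlane.dr g (c s) + c'.2 * HalfPlane.dz g (c s)) s := by
  have hd : HasFDerivAt g (fderiv ℝ g (c s)) (c s) := (ContDiff.differentiable hg (by simp) _).hasFDerivAt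
  refine (hd.comp_hasDerivAt s hc).congr_deriv ?_
  rw [hg.dr_eq, hg.dz_eq]
  have : c' = c'.1 • ((1:ℝ), (0:ℝ)) + c'.2 • ((0:ℝ), (1:ℝ)) := by ext <;> simp
  conv_lhs => rw [this]
  rw [map_add, map_smul, map_smul]
  rfl

theorem hasDerivAt_rad {x : E3} (hx : 0 < rad x) (w : E3) :
    HasDerivAt (fun s : ℝ => rad (x + s • w)) ((x 0 * w 0 + x 1 * w 1) / rad x) 0 := by
  have h0 : ∀ i : Fin 3, HasDerivAt (fun s : ℝ => (x + s • w) i) (w i) 0 := fun i => by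
    simpa using ((hasDerivAt_id (0:ℝ)).mul_const (w i)).const_add (x i)
  have h1 := ((h0 0).pow 2).add ((h0 1).pow 2)
  have hx2 : x 0 ^ 2 + x 1 ^ 2 ≠ 0 := by rw [← rad_sq]; positivity
  have h2 := h1.sqrt (by simpa using hx2)
  refine h2.congr_deriv ?_
  simp only [zero_smul, add_zero, Pi.add_apply, Pi.pow_apply, HBS.rad]
  push_cast
  have := hx.ne'
  rw [HBS.rad] at this
  field_simp

theorem hasDerivAt_cyl {x : E3} (hx : 0 < rad x) (w : E3) :
    HasDerivAt (fun s : ℝ => cyl (x + s • w)) ((x 0 * w 0 + x 1 * w 1) / rad x, w 2) 0 :=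
  (hasDerivAt_rad hx w).prodMk (by simpa using ((hasDerivAt_id (0:ℝ)).mul_const (w 2)).const_add (x 2))

/-- The profiles of a vector field. -/
noncomputable def pr (U : E3 → E3) (p : ℝ × ℝ) : ℝ := U (emb p) 0
noncomputable def ax (U : E3 → E3) (p : ℝ × ℝ) : ℝ := U (emb p) 2

/-- A smooth divergence free axisymmetric vector field without swirl. -/
structure AxiField (U : E3 → E3) : Prop where
  smooth : ContDiff ℝ ∞ U
  axi : HBS.IsAxisymmetricNoSwirl U
  div : ∀ x, HBS.div U x = 0

variable {U : E3 → E3}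

theorem contDiff_apply (hU : ContDiff ℝ ∞ U) (c : Fin 3) : ContDiff ℝ ∞ fun x => U x c :=
  contDiff_euclidean.1 hU c

theorem AxiField.s_pr (h : AxiField U) : Sl (pr U) := (contDiff_apply h.smooth 0).comp contDiff_emb
theorem AxiField.s_ax (h : AxiField U) : Sl (ax U) := (contDiff_apply h.smooth 2).comp contDiff_emb

theorem AxiField.pr_zero (h : AxiField U) (z : ℝ) : pr U (0, z) = 0 := by
  obtain ⟨vr, vz, hU⟩ := h.axi
  simp [pr, hU, HBS.eR, emb, basisVec, HBS.rad]

theorem AxiField.apply (h : AxiField U) (x : E3) : U x 0 = x 0 * quot (pr U) (cyl x) ∧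
    U x 1 = x 1 * quot (pr U) (cyl x) ∧ U x 2 = ax U (cyl x) := by
  have hq := h.s_pr.hadamard h.pr_zero (cyl x)
  obtain ⟨vr, vz, hU⟩ := h.axi
  have e2 : rad (emb (cyl x)) = rad x := rad_emb (rad_nonneg x)
  have e3 : (emb (cyl x)) 2 = x 2 := by simp [emb, cyl]
  have hax : ax U (cyl x) = vz (rad x) (x 2) := by
    rw [ax, hU, e2, e3]; simp [HBS.eR, basisVec]
  have hpr : pr U (cyl x) = vr (rad x) (x 2) * (rad x / rad x) := by
    rw [pr, hU, e2, e3]; simp [HBS.eR, basisVec, e2]; left; simp [emb, cyl]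
  rw [show quot (pr U) = Av 0 (dr (pr U)) from rfl]
  rw [hax]
  have hz : U x 2 = vz (rad x) (x 2) := by rw [hU]; simp [HBS.eR, basisVec]
  have h0 : U x 0 = vr (rad x) (x 2) * (x 0 / rad x) := by rw [hU]; simp [HBS.eR, basisVec]
  have h1 : U x 1 = vr (rad x) (x 2) * (x 1 / rad x) := by rw [hU]; simp [HBS.eR, basisVec]
  rcases (rad_nonneg x).eq_or_lt with hr | hr
  · have hs := rad_sq x
    rw [← hr] at hs
    have x0 : x 0 = 0 := by nlinarith [sq_nonneg (x 0), sq_nonneg (x 1)]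
    have x1 : x 1 = 0 := by nlinarith [sq_nonneg (x 0), sq_nonneg (x 1)]
    refine ⟨by rw [h0, x0]; simp, by rw [h1, x1]; simp, hz⟩
  · rw [div_self hr.ne', mul_one] at hpr
    rw [hpr] at hq
    have hc : (cyl x).1 = rad x := rfl
    rw [hc] at hq
    refine ⟨by rw [h0, hq]; field_simp, by rw [h1, hq]; field_simp, hz⟩

theorem AxiField.diff (h : AxiField U) : Differentiable ℝ U := h.smooth.differentiable (by simp)

theorem AxiField.s_quot (h : AxiField U) : Sl (quot (pr U)) := h.s_pr.dr.Av 0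

/-- The derivatives away from the axis. -/
theorem AxiField.fderiv_apply (h : AxiField U) {x : E3} (hx : 0 < rad x) (w : E3) :
    (fderiv ℝ U x w) 0 = w 0 * quot (pr U) (cyl x) + x 0 * ((x 0 * w 0 + x 1 * w 1) / rad x * dr (quot (pr U)) (cyl x)
      + w 2 * dz (quot (pr U)) (cyl x)) ∧
    (fderiv ℝ U x w) 1 = w 1 * quot (pr U) (cyl x) + x 1 * ((x 0 * w 0 + x 1 * w 1) / rad x * dr (quot (pr U)) (cyl x)
      + w 2 * dz (quot (pr U)) (cyl x)) ∧
    (fderiv ℝ U x w) 2 = (x 0 * w 0 + x 1 * w 1) / rad x * dr (ax U) (cyl x) + w 2 * dz (ax U) (cyl x) := by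
  have hd : ∀ c, HasDerivAt (fun s : ℝ => U (x + s • w) c) ((fderiv ℝ U x w) c) 0 := fun c => by
    rw [pd_apply h.diff]
    have hφ : Differentiable ℝ fun y => U y c := (contDiff_apply h.smooth c).differentiable (by simp)
    have := (hφ (x + (0:ℝ) • w)).hasFDerivAt.comp_hasDerivAt (0:ℝ) (hasDerivAt_line x w 0)
    simp only [zero_smul, add_zero] at this
    exact this
  have hq := h.s_quot.hasDerivAt_curve (hasDerivAt_cyl hx w)
  have hf := h.s_ax.hasDerivAt_curve (hasDerivAt_cyl hx w)
  have hi : ∀ i : Fin 3, HasDerivAt (fun s : ℝ => (x + s • w) i) (w i) 0 := fun i => by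
    simpa using ((hasDerivAt_id (0:ℝ)).mul_const (w i)).const_add (x i)
  simp only [zero_smul, add_zero] at hq hf
  refine ⟨(hd 0).unique ?_, (hd 1).unique ?_, (hd 2).unique ?_⟩
  · have := (hi 0).mul hq
    simp only [zero_smul, add_zero] at this
    exact this.congr_of_eventuallyEq (Eventually.of_forall fun s => (h.apply _).1)
  · have := (hi 1).mul hq
    simp only [zero_smul, add_zero] at this
    exact this.congr_of_eventuallyEq (Eventually.of_forall fun s => (h.apply _).2.1)
  · exact hf.congr_of_eventuallyEq (Eventually.of_forall fun s => (h.apply _).2.2)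

theorem AxiField.prof (h : AxiField U) : Prof (pr U) (ax U) := by
  have d0 : ∀ p, dr (pr U) p = (fderiv ℝ U (emb p) (basisVec 0)) 0 := fun p => by
    rw [pd_apply h.diff]; exact dr_emb ((contDiff_apply h.smooth 0).differentiable (by simp)) p
  have d2 : ∀ p, dz (ax U) p = (fderiv ℝ U (emb p) (basisVec 2)) 2 := fun p => by
    rw [pd_apply h.diff]; exact dz_emb ((contDiff_apply h.smooth 2).differentiable (by simp)) p
  refine ⟨h.s_pr, h.s_ax, h.pr_zero, fun z => ?_, fun p hp => ?_⟩
  · have e : ∀ s, ax U (-s, z) = ax U (s, z) := fun s => by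
      have e1 := (h.apply (emb (-s, z))).2.2
      have e2 := (h.apply (emb (s, z))).2.2
      have : cyl (emb (-s, z)) = cyl (emb (s, z)) := by simp [cyl, emb, HBS.rad]
      rw [this, ← e2] at e1
      exact e1
    have h1 := (h.s_ax.hasDerivAt_r 0 z)
    have h2 : HasDerivAt (fun s => ax U (-s, z)) (-dr (ax U) (0, z)) 0 := by
      have h1' : HasDerivAt (fun s => ax U (s, z)) (dr (ax U) (0, z)) (-0) := by simpa using h1
      exact (HasDerivAt.comp (h₂ := fun s => ax U (s, z)) (0:ℝ) h1' (hasDerivAt_neg (0:ℝ))).congr_deriv (by ring)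
    simp only [e] at h2
    have := h1.unique h2
    linarith
  · have hx : 0 < rad (emb p) := by rw [rad_emb hp.le]; exact hp
    have hd := h.div (emb p)
    have e1 := (h.fderiv_apply hx (basisVec 1)).2.1
    rw [cyl_emb hp.le] at e1
    simp only [HBS.div, Fin.sum_univ_three, HBS.pd] at hd
    rw [← d0, ← d2, e1] at hd
    have hq := h.s_pr.hadamard h.pr_zero p
    have hq' : pr U p / p.1 = quot (pr U) p := by
      rw [hq]; have := hp.ne'; rw [mul_div_cancel_left₀ _ this]; rfl
    rw [hq']
    simpa [basisVec, emb] using hd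

/-- The radial and vertical derivatives. -/
theorem AxiField.sq_le (h : AxiField U) {x : E3} (hx : 0 < rad x) :
    dr (pr U) (cyl x) ^ 2 + dz (pr U) (cyl x) ^ 2 + dr (ax U) (cyl x) ^ 2 + dz (ax U) (cyl x) ^ 2 ≤
      2 * ‖fderiv ℝ U x‖ ^ 2 := by
  have hp := h.prof
  have hc : (cyl x).1 = rad x := rfl
  have hs := rad_sq x
  have nsq : ∀ y : E3, ‖y‖ ^ 2 = y 0 ^ 2 + y 1 ^ 2 + y 2 ^ 2 := fun y => by
    rw [EuclideanSpace.norm_sq_eq, Fin.sum_univ_three]; simp [sq_abs]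
  have hle : ∀ w : E3, ‖w‖ = 1 → ‖fderiv ℝ U x w‖ ^ 2 ≤ ‖fderiv ℝ U x‖ ^ 2 := fun w hw => by
    have := (fderiv ℝ U x).le_opNorm w
    rw [hw, mul_one] at this
    gcongr
  have e1 := hle (!₂[x 0 / rad x, x 1 / rad x, 0]) (by
    have : ‖(!₂[x 0 / rad x, x 1 / rad x, 0] : E3)‖ ^ 2 = 1 := by
      rw [nsq]; simp; field_simp; linarith
    nlinarith [norm_nonneg (!₂[x 0 / rad x, x 1 / rad x, 0] : E3)])
  have e2 := hle (basisVec 2) (by simp [basisVec])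
  obtain ⟨a0, a1, a2⟩ := h.fderiv_apply hx (!₂[x 0 / rad x, x 1 / rad x, 0])
  obtain ⟨b0, b1, b2⟩ := h.fderiv_apply hx (basisVec 2)
  have hu : (x 0 * (x 0 / rad x) + x 1 * (x 1 / rad x)) / rad x = 1 := by field_simp; linarith
  simp [hu] at a0 a1 a2
  simp [basisVec] at b0 b1 b2
  rw [nsq, a0, a1, a2] at e1
  rw [show (basisVec 2 : E3) = EuclideanSpace.single 2 1 from rfl, nsq, b0, b1, b2] at e2
  have v1 := hp.dr_v (cyl x)
  have v2 := hp.dz_v (cyl x)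
  rw [hc] at v1 v2
  rw [v1, v2]
  have i1 : (x 0 / rad x * quot (pr U) (cyl x) + x 0 * dr (quot (pr U)) (cyl x)) ^ 2 +
      (x 1 / rad x * quot (pr U) (cyl x) + x 1 * dr (quot (pr U)) (cyl x)) ^ 2 =
      (quot (pr U) (cyl x) + rad x * dr (quot (pr U)) (cyl x)) ^ 2 := by
    field_simp
    linear_combination (-(quot (pr U) (cyl x) + rad x * dr (quot (pr U)) (cyl x)) ^ 2) * hs
  have i2 : (x 0 * dz (quot (pr U)) (cyl x)) ^ 2 + (x 1 * dz (quot (pr U)) (cyl x)) ^ 2 =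
      (rad x * dz (quot (pr U)) (cyl x)) ^ 2 := by linear_combination (-dz (quot (pr U)) (cyl x) ^ 2) * hs
  linarith

/-- The norm of the vorticity. -/
theorem AxiField.norm_curl (h : AxiField U) {x : E3} (hx : 0 < rad x) :
    ‖HBS.curl U x‖ = |vort (pr U) (ax U) (cyl x)| := by
  have hs := rad_sq x
  have hz := h.prof.dz_v (cyl x)
  have hc : (cyl x).1 = rad x := rfl
  rw [hc] at hz
  obtain ⟨a0, a1, a2⟩ := h.fderiv_apply hx (basisVec 0)
  obtain ⟨b0, b1, b2⟩ := h.fderiv_apply hx (basisVec 1)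
  obtain ⟨c0, c1, c2⟩ := h.fderiv_apply hx (basisVec 2)
  have nsq : ‖HBS.curl U x‖ ^ 2 = |vort (pr U) (ax U) (cyl x)| ^ 2 := by
    rw [EuclideanSpace.norm_sq_eq, Fin.sum_univ_three, sq_abs]
    simp only [HBS.curl, HBS.pd, a1, a2, b0, b2, c0, c1]
    simp [basisVec]
    simp only [vort, hz]
    field_simp
    linear_combination (-(rad x * dz (quot (pr U)) (cyl x) - dr (ax U) (cyl x)) ^ 2) * hs
  exact (sq_eq_sq₀ (norm_nonneg _) (abs_nonneg _)).1 nsq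

theorem AxiField.norm_sq (h : AxiField U) (x : E3) : ‖U x‖ ^ 2 = pr U (cyl x) ^ 2 + ax U (cyl x) ^ 2 := by
  obtain ⟨e0, e1, e2⟩ := h.apply x
  have hq := h.prof.v_eq (cyl x)
  have hc : (cyl x).1 = rad x := rfl
  rw [hc] at hq
  rw [EuclideanSpace.norm_sq_eq, Fin.sum_univ_three]
  simp only [Real.norm_eq_abs, sq_abs]
  rw [e0, e1, e2, hq]
  linear_combination (-quot (pr U) (cyl x) ^ 2) * rad_sq x

/-- The second derivatives on the meridian half-plane. -/
theorem AxiField.lapH_apply (h : AxiField U) {p : ℝ × ℝ} (hp : 0 < p.1) :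
    (HBS.lapH U (emb p)) 0 = dr (dr (pr U)) p + dr (pr U) p / p.1 - pr U p / p.1 ^ 2 ∧
    (HBS.lapH U (emb p)) 2 = dr (dr (ax U)) p + dr (ax U) p / p.1 := by
  have hx : 0 < rad (emb p) := by rw [rad_emb hp.le]; exact hp
  have sp : ∀ j, ContDiff ℝ ∞ (pd j U) := fun j => (h.smooth.fderiv_right (m := ∞) (by simp)).clm_apply contDiff_const
  have dp : ∀ j, Differentiable ℝ (pd j U) := fun j => (sp j).differentiable (by simp)
  have s0 : ∀ c, ContDiff ℝ ∞ (fun y => U y c) := contDiff_apply h.smooth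
  have P0 : ∀ c, (pd 0 (pd 0 U) (emb p)) c = dr (dr fun p => U (emb p) c) p := fun c => by
    rw [HBS.pd, pd_apply (dp 0)]
    have e : (fun p => pd 0 U (emb p) c) = dr fun p => U (emb p) c := by
      funext p
      rw [dr_emb ((s0 c).differentiable (by simp))]
      exact pd_apply h.diff _ _ _
    rw [← e]
    exact (dr_emb ((contDiff_apply (sp 0) c).differentiable (by simp)) p).symm
  have P1 : ∀ (c : Fin 3) {k : ℝ → ℝ} {k' : ℝ}, (∀ s, pd 1 U (emb p + s • basisVec 1) c = s * k s) → HasDerivAt k k' 0 →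
      (pd 1 (pd 1 U) (emb p)) c = k 0 := fun c k k' hk hd => by
    rw [HBS.pd, pd_apply (dp 1)]
    have hφ := (contDiff_apply (sp 1) c).differentiable (by simp)
    have h1 := (hφ (emb p + (0:ℝ) • basisVec 1)).hasFDerivAt.comp_hasDerivAt (0:ℝ) (hasDerivAt_line (emb p) (basisVec 1) 0)
    simp only [zero_smul, add_zero] at h1
    have h2 := ((hasDerivAt_id (0:ℝ)).mul hd).congr_of_eventuallyEq (Eventually.of_forall hk)
    have := HasDerivAt.unique h1 h2
    simpa using this
  have hpos : ∀ s : ℝ, 0 < rad (emb p + s • basisVec 1) := fun s => by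
    refine Real.sqrt_pos.2 ?_
    simp [emb, basisVec]
    positivity
  have hrad := hasDerivAt_rad hx (basisVec 1)
  have hcy := hasDerivAt_cyl hx (basisVec 1)
  have hr0 : rad (emb p + (0:ℝ) • basisVec 1) ≠ 0 := (hpos 0).ne'
  have e0 := P1 0 (k := fun s => p.1 * dr (quot (pr U)) (cyl (emb p + s • basisVec 1)) / rad (emb p + s • basisVec 1))
    (fun s => by
      have := (h.fderiv_apply (hpos s) (basisVec 1)).1
      rw [HBS.pd, this]
      simp [basisVec, emb]
      ring) (((h.s_quot.dr.hasDerivAt_curve hcy).const_mul p.1).div hrad hr0)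
  have e2 := P1 2 (k := fun s => dr (ax U) (cyl (emb p + s • basisVec 1)) / rad (emb p + s • basisVec 1))
    (fun s => by
      have := (h.fderiv_apply (hpos s) (basisVec 1)).2.2
      rw [HBS.pd, this]
      simp [basisVec, emb]
      ring) ((h.s_ax.dr.hasDerivAt_curve hcy).div hrad hr0)
  simp only [zero_smul, add_zero, cyl_emb hp.le, rad_emb hp.le] at e0 e2
  have hv := h.prof.v_eq p
  have hv' := h.prof.dr_v p
  have hp0 := hp.ne'
  constructor
  · rw [HBS.lapH, PiLp.add_apply, P0, e0, hv', hv]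
    have : (fun p => U (emb p) 0) = pr U := rfl
    rw [this]
    field_simp
    ring
  · rw [HBS.lapH, PiLp.add_apply, P0, e2]
    rfl

end Cylindrical


section Polar

open HBS (E3 rad)

theorem lintegral_radial {g : ℝ → ENNReal} (hg : Measurable g) :
    ∫⁻ w : ℝ × ℝ, g (Real.sqrt (w.1 ^ 2 + w.2 ^ 2)) =
      ENNReal.ofReal (2 * Real.pi) * ∫⁻ r in Ioi (0:ℝ), ENNReal.ofReal r * g r := by
  rw [← lintegral_comp_polarCoord_symm, polarCoord_target, Measure.volume_eq_prod]
  have h1 : ∀ p ∈ Ioi (0:ℝ) ×ˢ Ioo (-Real.pi) Real.pi,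
      ENNReal.ofReal p.1 • g (Real.sqrt ((polarCoord.symm p).1 ^ 2 + (polarCoord.symm p).2 ^ 2)) =
        ENNReal.ofReal p.1 * g p.1 := fun p hp => by
    have hp : 0 < p.1 := hp.1
    rw [polarCoord_symm_apply, smul_eq_mul]
    have : (p.1 * Real.cos p.2) ^ 2 + (p.1 * Real.sin p.2) ^ 2 = p.1 ^ 2 := by
      linear_combination p.1 ^ 2 * Real.sin_sq_add_cos_sq p.2
    simp only [this, Real.sqrt_sq hp.le]
  rw [setLIntegral_congr_fun (measurableSet_Ioi.prod measurableSet_Ioo) h1,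
    setLIntegral_prod _ (by
      have : Measurable fun p : ℝ × ℝ => ENNReal.ofReal p.1 * g p.1 := by fun_prop
      exact this.aemeasurable)]
  simp only [lintegral_const, Measure.restrict_apply_univ, Real.volume_Ioo]
  rw [lintegral_mul_const _ (by fun_prop), mul_comm]
  congr 2
  ring

/-- Integration in cylindrical coordinates. -/
theorem lintegral_cyl {G : ℝ × ℝ → ENNReal} (hG : Measurable G) :
    ∫⁻ x, G (cyl x) = ENNReal.ofReal (2 * Real.pi) * ∫⁻ p in H, ENNReal.ofReal p.1 * G p := by
  have m1 : MeasurePreserving (fun x : E3 => (x : Fin 3 → ℝ)) volume volume := PiLp.volume_preserving_ofLp (Fin 3)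
  have m2 := volume_preserving_piFinSuccAbove (fun _ : Fin 3 => ℝ) 2
  have m3 : MeasurePreserving (Prod.map id MeasurableEquiv.finTwoArrow : ℝ × (Fin 2 → ℝ) → ℝ × (ℝ × ℝ)) volume volume :=
    (MeasurePreserving.id (volume : Measure ℝ)).prod (volume_preserving_finTwoArrow ℝ)
  have m := m3.comp (m2.comp m1)
  have hF : Measurable fun q : ℝ × (ℝ × ℝ) => G (Real.sqrt (q.2.1 ^ 2 + q.2.2 ^ 2), q.1) := hG.comp (by fun_prop)
  have h1 := m.lintegral_comp hF
  have e : ∀ x : E3, G (cyl x) = (fun q : ℝ × (ℝ × ℝ) => G (Real.sqrt (q.2.1 ^ 2 + q.2.2 ^ 2), q.1))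
      ((Prod.map id MeasurableEquiv.finTwoArrow ∘ (MeasurableEquiv.piFinSuccAbove (fun _ : Fin 3 => ℝ) 2) ∘
        fun x : E3 => (x : Fin 3 → ℝ)) x) := fun x => rfl
  have h2 : ∫⁻ x, G (cyl x) = ∫⁻ q : ℝ × (ℝ × ℝ), G (Real.sqrt (q.2.1 ^ 2 + q.2.2 ^ 2), q.1) :=
    (lintegral_congr e).trans h1
  rw [h2, Measure.volume_eq_prod, lintegral_prod _ hF.aemeasurable]
  have h3 : ∀ z : ℝ, ∫⁻ w : ℝ × ℝ, G (Real.sqrt (w.1 ^ 2 + w.2 ^ 2), z) =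
      ENNReal.ofReal (2 * Real.pi) * ∫⁻ r in Ioi (0:ℝ), ENNReal.ofReal r * G (r, z) := fun z =>
    lintegral_radial (g := fun r => G (r, z)) (hG.comp (by fun_prop))
  have hm : Measurable fun p : ℝ × ℝ => ENNReal.ofReal p.1 * G p := by fun_prop
  rw [lintegral_congr h3, lintegral_const_mul' _ _ ENNReal.ofReal_ne_top, H_eq, Measure.volume_eq_prod,
    setLIntegral_prod_symm _ hm.aemeasurable, Measure.restrict_univ]

theorem ae_rad_pos : ∀ᵐ x : E3, 0 < rad x := by
  have hm : MeasurableSet {p : ℝ × ℝ | p.1 ≤ 0} := measurableSet_le measurable_fst measurable_const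
  have h := lintegral_cyl (G := indicator {p : ℝ × ℝ | p.1 ≤ 0} 1) (measurable_one.indicator hm)
  have h0 : ∫⁻ p in H, ENNReal.ofReal p.1 * indicator {p : ℝ × ℝ | p.1 ≤ 0} 1 p = 0 := by
    rw [setLIntegral_congr_fun (g := fun _ => 0) measurableSet_H fun p hp => ?_, lintegral_zero]
    have hp : 0 < p.1 := hp
    have : p ∉ {p : ℝ × ℝ | p.1 ≤ 0} := by simpa using hp
    simp [indicator_of_notMem this]
  rw [h0, mul_zero] at h
  have hs : MeasurableSet (cyl ⁻¹' {p : ℝ × ℝ | p.1 ≤ 0}) := continuous_cyl.measurable hm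
  have e : ∀ x : E3, indicator {p : ℝ × ℝ | p.1 ≤ 0} (1 : ℝ × ℝ → ENNReal) (cyl x) =
      indicator (cyl ⁻¹' {p : ℝ × ℝ | p.1 ≤ 0}) 1 x := fun x => rfl
  rw [lintegral_congr e, lintegral_indicator_one hs] at h
  rw [ae_iff]
  convert h using 2
  ext x
  simp [cyl]

theorem one_le_ofReal_two_pi : 1 ≤ ENNReal.ofReal (2 * Real.pi) := by
  rw [← ENNReal.ofReal_one]
  exact ENNReal.ofReal_le_ofReal (by linarith [Real.pi_gt_three])

theorem lintegral_H_le {Q : ℝ × ℝ → ℝ} (hQ : Continuous Q) {F : E3 → ENNReal}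
    (h : ∀ x, 0 < rad x → ENNReal.ofReal (Q (cyl x)) ≤ F x) :
    ENNReal.ofReal (2 * Real.pi) * ∫⁻ p in H, ENNReal.ofReal (p.1 * Q p) ≤ ∫⁻ x, F x := by
  have h1 := lintegral_cyl (G := fun p => ENNReal.ofReal (Q p)) (by fun_prop)
  have h2 : ∫⁻ p in H, ENNReal.ofReal p.1 * ENNReal.ofReal (Q p) = ∫⁻ p in H, ENNReal.ofReal (p.1 * Q p) :=
    setLIntegral_congr_fun measurableSet_H fun p hp => (ENNReal.ofReal_mul (le_of_lt hp)).symm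
  rw [← h2, ← h1]
  exact lintegral_mono_ae (ae_rad_pos.mono h)

/-- Transfer of an integral bound to the half-plane. -/
theorem integrable_H_of_le {Q : ℝ × ℝ → ℝ} (hQ : Continuous Q) (h0 : ∀ p, 0 ≤ Q p) {F : E3 → ENNReal} {C : ℝ}
    (h : ∀ x, 0 < rad x → ENNReal.ofReal (Q (cyl x)) ≤ F x) (hC : 0 ≤ C) (hF : ∫⁻ x, F x ≤ ENNReal.ofReal C) :
    IntegrableOn (fun p => p.1 * Q p) H ∧ ∫ p in H, p.1 * Q p ≤ C := by
  have h1 : ∫⁻ p in H, ENNReal.ofReal (p.1 * Q p) ≤ ENNReal.ofReal C :=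
    ((le_mul_of_one_le_left' one_le_ofReal_two_pi).trans (lintegral_H_le hQ h)).trans hF
  have nn : ∀ p ∈ H, 0 ≤ p.1 * Q p := fun p hp => mul_nonneg (le_of_lt hp) (h0 p)
  have I := HI_of_lintegral (continuous_fst.mul hQ) nn (h1.trans_lt ENNReal.ofReal_lt_top)
  exact ⟨I.int, I.val.trans_le (ENNReal.toReal_le_of_le_ofReal hC h1)⟩

theorem lintegral_enorm_sq_le {F : Type*} [NormedAddCommGroup F] {φ : E3 → F} {M : NNReal}
    (h : eLpNorm φ 2 volume ≤ M) : ∫⁻ x, ‖φ x‖ₑ ^ 2 ≤ ENNReal.ofReal ((M : ℝ) ^ 2) := by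
  have h1 := eLpNorm_nnreal_pow_eq_lintegral (f := φ) (μ := (volume : Measure E3)) (p := 2) (by norm_num)
  have h2 : ∫⁻ x, ‖φ x‖ₑ ^ 2 = eLpNorm φ 2 volume ^ 2 := by
    simpa using h1.symm
  rw [h2, ENNReal.ofReal_pow M.coe_nonneg, ENNReal.ofReal_coe_nnreal]
  gcongr

theorem enorm_le_eLpNorm_top {F : Type*} [NormedAddCommGroup F] {φ : E3 → F} (hφ : Continuous φ) (x : E3) :
    ‖φ x‖ₑ ≤ eLpNorm φ ⊤ volume := by
  rw [eLpNorm_exponent_top]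
  have hd : Dense {y | ‖φ y‖ₑ ≤ eLpNormEssSup φ volume} := Measure.dense_of_ae ae_le_eLpNormEssSup
  have hcl : IsClosed {y | ‖φ y‖ₑ ≤ eLpNormEssSup φ volume} := isClosed_le hφ.enorm continuous_const
  have := hd.closure_eq
  rw [hcl.closure_eq] at this
  exact (this ▸ mem_univ x : x ∈ {y | ‖φ y‖ₑ ≤ eLpNormEssSup φ volume})

theorem enorm_sq_eq {F : Type*} [NormedAddCommGroup F] (y : F) (n : ℕ) : ‖y‖ₑ ^ n = ENNReal.ofReal (‖y‖ ^ n) := by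
  rw [ENNReal.ofReal_pow (norm_nonneg y), ofReal_norm]

end Polar

section FromSolutions

open HBS (E3 rad pd basisVec timeInterval IsSmoothSolution)

variable {T : ENNReal} {u₀ : E3 → E3} {ρ₀ : E3 → ℝ} {u : ℝ → E3 → E3} {ρ : ℝ → E3 → ℝ} {b : ℝ}

theorem Icc_subset_timeInterval (hb : b ∈ timeInterval T) : Icc 0 b ⊆ timeInterval T := fun _ ht =>
  ⟨ht.1, (ENNReal.ofReal_le_ofReal ht.2).trans_lt hb.2⟩

theorem contDiff_slice {F : Type*} [NormedAddCommGroup F] [NormedSpace ℝ F] {φ : ℝ → E3 → F}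
    (h : ContDiffOn ℝ ∞ (fun q : ℝ × E3 => φ q.1 q.2) (timeInterval T ×ˢ univ)) {t : ℝ} (ht : t ∈ timeInterval T) :
    ContDiff ℝ ∞ (φ t) := by
  rw [← contDiffOn_univ]
  exact h.comp (f := fun x => (t, x)) (contDiff_const.prodMk contDiff_id).contDiffOn fun x _ => ⟨ht, mem_univ _⟩

theorem Sm_of_contDiffOn {φ : ℝ → E3 → ℝ}
    (h : ContDiffOn ℝ ∞ (fun q : ℝ × E3 => φ q.1 q.2) (timeInterval T ×ˢ univ)) (hb : b ∈ timeInterval T) :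
    Sm b (fun t p => φ t (emb p)) :=
  h.comp (f := fun q : ℝ × (ℝ × ℝ) => (q.1, emb q.2))
    (contDiff_fst.prodMk (contDiff_emb.comp contDiff_snd)).contDiffOn
    fun _ hq => ⟨Icc_subset_timeInterval hb hq.1, mem_univ _⟩

theorem differentiableAt_time {F : Type*} [NormedAddCommGroup F] [NormedSpace ℝ F] {φ : ℝ → E3 → F}
    (h : ContDiffOn ℝ ∞ (fun q : ℝ × E3 => φ q.1 q.2) (timeInterval T ×ˢ univ)) (hb : b ∈ timeInterval T) {t : ℝ}
    (ht : t ∈ Ioo 0 b) (x : E3) : DifferentiableAt ℝ (fun s => φ s x) t := by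
  have hn : timeInterval T ×ˢ (univ : Set E3) ∈ 𝓝 (t, x) :=
    prod_mem_nhds (mem_of_superset (Icc_mem_nhds ht.1 ht.2) (Icc_subset_timeInterval hb)) univ_mem
  exact ((h.contDiffAt hn).differentiableAt (by simp)).comp (f := fun s : ℝ => (s, x)) t
    (differentiableAt_id.prodMk (differentiableAt_const x))

theorem gradient_apply {φ : E3 → ℝ} (x : E3) (c : Fin 3) : (gradient φ x) c = pd c φ x := by
  have : inner ℝ (gradient φ x) (basisVec c) = fderiv ℝ φ x (basisVec c) :=
    InnerProductSpace.toDual_symm_apply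
  rw [HBS.pd, ← this, HBS.basisVec, EuclideanSpace.inner_single_right]
  simp

theorem axiField_of_solution (hs : IsSmoothSolution T u₀ ρ₀ u ρ)
    (hU : ∀ t ∈ timeInterval T, HBS.IsAxisymmetricNoSwirl (u t)) {t : ℝ} (ht : t ∈ timeInterval T) : AxiField (u t) :=
  ⟨contDiff_slice hs.smooth_u ht, hU t ht, hs.div_free t ht⟩

theorem AxiField.emb_eq {U : E3 → E3} (h : AxiField U) (p : ℝ × ℝ) :
    U (emb p) = pr U p • basisVec 0 + ax U p • basisVec 2 := by
  have h1 := (h.apply (emb p)).2.1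
  have h0 : (emb p) 1 = 0 := by simp [emb]
  rw [h0, zero_mul] at h1
  ext i
  fin_cases i
  · simp [basisVec, pr]
  · simpa [basisVec] using h1
  · simp [basisVec, ax]

/-- A solution on `ℝ³` gives a solution on the half-plane. -/
theorem exists_HSol (hs : IsSmoothSolution T u₀ ρ₀ u ρ)
    (hU : ∀ t ∈ timeInterval T, HBS.IsAxisymmetricNoSwirl (u t)) (hb : b ∈ timeInterval T) (hb0 : 0 < b) :
    ∃ M, HSol b M (fun t => pr (u t)) (fun t => ax (u t)) (fun t p => ρ t (emb p)) := by
  have sub := Icc_subset_timeInterval hb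
  have AF : ∀ t ∈ Icc 0 b, AxiField (u t) := fun t ht => axiField_of_solution hs hU (sub ht)
  have su : ∀ c : Fin 3, ContDiffOn ℝ ∞ (fun q : ℝ × E3 => u q.1 q.2 c) (timeInterval T ×ˢ univ) := fun c =>
    contDiffOn_euclidean.1 hs.smooth_u c
  have sv : Sm b fun t => pr (u t) := Sm_of_contDiffOn (φ := fun t x => u t x 0) (su 0) hb
  have sf : Sm b fun t => ax (u t) := Sm_of_contDiffOn (φ := fun t x => u t x 2) (su 2) hb
  have sρ : Sm b fun t p => ρ t (emb p) := Sm_of_contDiffOn (φ := ρ) hs.smooth_ρ hb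
  obtain ⟨M, hM⟩ := hs.bounded_H1 b hb
  refine ⟨2 * (M : ℝ) ^ 2, hb0, sv, sf, sρ, fun t ht => (AF t ht).prof, ?_, ?_, fun t ht => ?_, fun t ht => ?_, ?_⟩
  · obtain ⟨P, sP, hP⟩ := hs.momentum
    have sP' : Sm b fun t p => P t (emb p) := Sm_of_contDiffOn (φ := P) sP hb
    refine ⟨fun t p => P t (emb p), sP', fun t ht p hp => ?_⟩
    have ht' := Ioo_subset_Icc_self ht
    have A := AF t ht'
    have eq := hP t (sub ht') ht.1 (emb p)
    have hdt : ∀ c : Fin 3, ∀ {G : ℝ → ℝ × ℝ → ℝ}, Sm b G → (∀ s, G s p = u s (emb p) c) →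
        (deriv (fun s => u s (emb p)) t) c = dt b G t p := fun c G sG hG => by
      have h1 := (differentiableAt_time hs.smooth_u hb ht (emb p)).hasDerivAt
      have h2 := (EuclideanSpace.proj c : E3 →L[ℝ] ℝ).hasFDerivAt.comp_hasDerivAt t h1
      have h3 := sG.hasDerivAt hb0 ht p
      simp only [hG] at h3
      exact HasDerivAt.unique h2 h3
    have e0 := congrArg (fun y : E3 => y 0) eq
    have e2 := congrArg (fun y : E3 => y 2) eq
    have dP : Differentiable ℝ (P t) := (contDiff_slice sP (sub ht')).differentiable (by simp)
    simp only [PiLp.add_apply, PiLp.sub_apply, PiLp.smul_apply, gradient_apply] at e0 e2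
    rw [hdt 0 sv fun s => rfl, (A.lapH_apply hp).1, A.emb_eq, map_add, map_smul, map_smul, PiLp.add_apply,
      PiLp.smul_apply, PiLp.smul_apply, pd_apply A.diff, pd_apply A.diff, ← dr_emb dP] at e0
    rw [hdt 2 sf fun s => rfl, (A.lapH_apply hp).2, A.emb_eq, map_add, map_smul, map_smul, PiLp.add_apply,
      PiLp.smul_apply, PiLp.smul_apply, pd_apply A.diff, pd_apply A.diff, ← dz_emb dP] at e2
    have d0 := (contDiff_apply A.smooth 0).differentiable (by simp : (∞ : WithTop ℕ∞) ≠ 0)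
    have d2 := (contDiff_apply A.smooth 2).differentiable (by simp : (∞ : WithTop ℕ∞) ≠ 0)
    have r0 : dr (pr (u t)) p = fderiv ℝ (fun y => u t y 0) (emb p) (basisVec 0) := dr_emb d0 p
    have r1 : dz (pr (u t)) p = fderiv ℝ (fun y => u t y 0) (emb p) (basisVec 2) := dz_emb d0 p
    have r2 : dr (ax (u t)) p = fderiv ℝ (fun y => u t y 2) (emb p) (basisVec 0) := dr_emb d2 p
    have r3 : dz (ax (u t)) p = fderiv ℝ (fun y => u t y 2) (emb p) (basisVec 2) := dz_emb d2 p
    rw [← r0, ← r1] at e0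
    rw [← r2, ← r3] at e2
    have k0 : (basisVec 2 : E3) 0 = 0 := by simp [basisVec]
    have k2 : (basisVec 2 : E3) 2 = 1 := by simp [basisVec]
    rw [k0] at e0
    rw [k2] at e2
    simp only [smul_eq_mul, mul_zero, mul_one] at e0 e2
    constructor
    · linear_combination e0
    · linear_combination e2
  · intro t ht p hp
    have ht' := Ioo_subset_Icc_self ht
    have A := AF t ht'
    have eq := hs.transport t (sub ht') ht.1 (emb p)
    have dρ : Differentiable ℝ (ρ t) := (contDiff_slice hs.smooth_ρ (sub ht')).differentiable (by simp)
    have h1 : deriv (fun s => ρ s (emb p)) t = dt b (fun t p => ρ t (emb p)) t p := (sρ.hasDerivAt hb0 ht p).deriv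
    rw [h1, A.emb_eq, map_add, map_smul, map_smul] at eq
    rw [dr_emb dρ, dz_emb dρ]
    simp only [smul_eq_mul] at eq
    rw [HBS.pd, HBS.pd, ← eq]
    ring
  · have A := AF t ht
    have c1 := A.s_pr.continuous
    have c2 := A.s_ax.continuous
    obtain ⟨i1, i2⟩ := integrable_H_of_le (Q := fun p => pr (u t) p ^ 2 + ax (u t) p ^ 2) (by fun_prop)
      (fun p => by positivity) (F := fun x => ‖u t x‖ₑ ^ 2)
      (fun x _ => by rw [enorm_sq_eq, A.norm_sq]) (sq_nonneg (M : ℝ)) (lintegral_enorm_sq_le (hM t ht).1)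
    exact ⟨i1, i2.trans (by linarith [sq_nonneg (M : ℝ)])⟩
  · have A := AF t ht
    have c1 := A.s_pr.dr.continuous
    have c2 := A.s_pr.dz.continuous
    have c3 := A.s_ax.dr.continuous
    have c4 := A.s_ax.dz.continuous
    refine integrable_H_of_le (Q := fun p => dr (pr (u t)) p ^ 2 + dz (pr (u t)) p ^ 2 + dr (ax (u t)) p ^ 2 +
      dz (ax (u t)) p ^ 2) (by fun_prop)
      (fun p => by positivity) (F := fun x => 2 * ‖fderiv ℝ (u t) x‖ₑ ^ 2)
      (fun x hx => ?_) (by positivity) ?_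
    · have e : (2:ENNReal) * ‖fderiv ℝ (u t) x‖ₑ ^ 2 = ENNReal.ofReal (2 * ‖fderiv ℝ (u t) x‖ ^ 2) := by
        rw [enorm_sq_eq, ENNReal.ofReal_mul (by norm_num), ENNReal.ofReal_ofNat]
      rw [e]
      exact ENNReal.ofReal_le_ofReal (A.sq_le hx)
    · rw [lintegral_const_mul' _ _ (by norm_num), ENNReal.ofReal_mul (by norm_num), ENNReal.ofReal_ofNat]
      gcongr
      exact lintegral_enorm_sq_le (hM t ht).2
  · let Q : ℝ → ℝ × ℝ → ℝ := fun t p => max (max |dr (pr (u t)) p| |dz (pr (u t)) p|) (max |dr (ax (u t)) p| |dz (ax (u t)) p|)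
    have hQc : ContinuousOn (fun q : ℝ × (ℝ × ℝ) => Q q.1 q.2) (Icc 0 b ×ˢ univ) :=
      ((sv.dr hb0).continuousOn.abs.sup (sv.dz hb0).continuousOn.abs).sup
        ((sf.dr hb0).continuousOn.abs.sup (sf.dz hb0).continuousOn.abs)
    let g : ℝ → ENNReal := fun t => ⨆ n : ℕ, ENNReal.ofReal (Q (projIcc 0 b hb0.le t) (TopologicalSpace.denseSeq (ℝ × ℝ) n))
    have hQt : ∀ t ∈ Icc 0 b, Continuous (Q t) := fun t ht => by
      have A := AF t ht
      exact (A.s_pr.dr.continuous.abs.sup A.s_pr.dz.continuous.abs).sup (A.s_ax.dr.continuous.abs.sup A.s_ax.dz.continuous.abs)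
    have hproj : ∀ t ∈ Icc 0 b, (projIcc 0 b hb0.le t : ℝ) = t := fun t ht => by rw [projIcc_of_mem hb0.le ht]
    refine ⟨g, ?_, ?_, fun t ht => ?_⟩
    · refine Measurable.iSup fun n => ENNReal.measurable_ofReal.comp (Continuous.measurable ?_)
      exact hQc.comp_continuous (f := fun t => ((projIcc 0 b hb0.le t : ℝ), TopologicalSpace.denseSeq (ℝ × ℝ) n))
        ((continuous_subtype_val.comp continuous_projIcc).prodMk continuous_const) fun t => ⟨(projIcc 0 b hb0.le t).2, mem_univ _⟩
    · refine (setLIntegral_mono' measurableSet_Icc fun t ht => ?_).trans_lt (hs.lipschitz b hb)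
      refine iSup_le fun n => ?_
      rw [hproj t ht]
      have A := AF t ht
      set p := TopologicalSpace.denseSeq (ℝ × ℝ) n
      have hc : Continuous (fderiv ℝ (u t)) := A.smooth.continuous_fderiv (by simp)
      refine le_trans ?_ (enorm_le_eLpNorm_top hc (emb p))
      rw [← ofReal_norm]
      refine ENNReal.ofReal_le_ofReal ?_
      have hle : ∀ (j c : Fin 3), |fderiv ℝ (fun y => u t y c) (emb p) (basisVec j)| ≤ ‖fderiv ℝ (u t) (emb p)‖ := fun j c => by
        rw [← pd_apply A.diff, ← Real.norm_eq_abs]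
        refine (PiLp.norm_apply_le _ c).trans ?_
        have := (fderiv ℝ (u t) (emb p)).le_opNorm (basisVec j)
        simpa [basisVec] using this
      have d0 := (contDiff_apply A.smooth 0).differentiable (by simp : (∞ : WithTop ℕ∞) ≠ 0)
      have d2 := (contDiff_apply A.smooth 2).differentiable (by simp : (∞ : WithTop ℕ∞) ≠ 0)
      refine max_le (max_le ?_ ?_) (max_le ?_ ?_)
      · exact (congrArg abs (dr_emb d0 p)).trans_le (hle 0 0)
      · exact (congrArg abs (dz_emb d0 p)).trans_le (hle 2 0)
      · exact (congrArg abs (dr_emb d2 p)).trans_le (hle 0 2)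
      · exact (congrArg abs (dz_emb d2 p)).trans_le (hle 2 2)
    · have hcl : IsClosed {p | ENNReal.ofReal (Q t p) ≤ g t} :=
        isClosed_le (ENNReal.continuous_ofReal.comp (hQt t ht)) continuous_const
      have hall : ∀ p, ENNReal.ofReal (Q t p) ≤ g t := fun p => by
        refine (TopologicalSpace.denseRange_denseSeq (ℝ × ℝ)).induction_on (p := fun p => ENNReal.ofReal (Q t p) ≤ g t) p hcl fun n => ?_
        have := le_iSup (fun n : ℕ => ENNReal.ofReal (Q (projIcc 0 b hb0.le t) (TopologicalSpace.denseSeq (ℝ × ℝ) n))) n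
        simp only [hproj t ht] at this
        simpa only [g, hproj t ht] using this
      intro p _
      exact ⟨(ENNReal.ofReal_le_ofReal ((le_max_left _ _).trans (le_max_left _ _))).trans (hall p),
        (ENNReal.ofReal_le_ofReal ((le_max_right _ _).trans (le_max_left _ _))).trans (hall p),
        (ENNReal.ofReal_le_ofReal ((le_max_left _ _).trans (le_max_right _ _))).trans (hall p),
        (ENNReal.ofReal_le_ofReal ((le_max_right _ _).trans (le_max_right _ _))).trans (hall p)⟩

end FromSolutions


section InitialData

open HBS (E3 rad timeInterval IsSmoothSolution)

theorem eq_comp_emb_cyl {φ : E3 → ℝ} (h : HBS.IsAxisymmetricScalar φ) (x : E3) : φ x = φ (emb (cyl x)) := by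
  obtain ⟨g, hg⟩ := h
  have e2 : rad (emb (cyl x)) = rad x := rad_emb (rad_nonneg x)
  have e3 : (emb (cyl x)) 2 = x 2 := by simp [emb, cyl]
  rw [hg, hg, e2, e3]

theorem exists_support_bounds {φ : E3 → ℝ} (h1 : Disjoint (tsupport φ) HBS.axis)
    (h2 : IsCompact ((fun x : E3 => x 2) '' tsupport φ)) :
    ∃ d l : ℝ, 0 < d ∧ d ≤ 1 ∧ 0 ≤ l ∧ (∀ x, rad x < d → φ x = 0) ∧ ∀ x, l < |x 2| → φ x = 0 := by
  obtain ⟨R, hR⟩ := h2.isBounded.exists_norm_le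
  have hz : ∀ x ∈ tsupport φ, |x 2| ≤ max R 0 := fun x hx =>
    (hR _ ⟨x, hx, rfl⟩).trans (le_max_left _ _)
  have hsupp : ∀ x, x ∉ tsupport φ → φ x = 0 := fun x hx => image_eq_zero_of_notMem_tsupport hx
  have hK : IsCompact (tsupport φ ∩ {x | rad x ≤ 1}) := by
    refine Metric.isCompact_of_isClosed_isBounded ((isClosed_tsupport φ).inter (isClosed_le continuous_rad continuous_const))
      (isBounded_iff_forall_norm_le.2 ⟨1 + max R 0, fun x hx => ?_⟩)
    have a1 := hz x hx.1
    have a2 : rad x ≤ 1 := hx.2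
    have a3 := le_max_right R 0
    have a4 : ‖x‖ ^ 2 = rad x ^ 2 + x 2 ^ 2 := by
      rw [EuclideanSpace.norm_sq_eq, Fin.sum_univ_three, rad_sq]; simp [sq_abs]
    refine (sq_le_sq₀ (norm_nonneg x) (by positivity)).1 ?_
    rw [a4, ← sq_abs (x 2)]
    nlinarith [rad_nonneg x, abs_nonneg (x 2)]
  have hl : ∀ x : E3, max R 0 < |x 2| → φ x = 0 := fun x hx => hsupp x fun h => (hz x h).not_gt hx
  rcases (tsupport φ ∩ {x | rad x ≤ 1}).eq_empty_or_nonempty with he | hne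
  · refine ⟨1, max R 0, one_pos, le_rfl, le_max_right _ _, fun x hx => hsupp x fun h => ?_, hl⟩
    exact (he ▸ (⟨h, hx.le⟩ : x ∈ tsupport φ ∩ {x | rad x ≤ 1}) : x ∈ (∅ : Set E3))
  · obtain ⟨y, hy, hmin⟩ := hK.exists_isMinOn hne continuous_rad.continuousOn
    have hy0 : 0 < rad y := by
      refine lt_of_le_of_ne (rad_nonneg y) fun h0 => ?_
      have hs := rad_sq y
      rw [← h0] at hs
      exact disjoint_left.1 h1 hy.1 ⟨by nlinarith [sq_nonneg (y 0), sq_nonneg (y 1)], by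
        nlinarith [sq_nonneg (y 0), sq_nonneg (y 1)]⟩
    refine ⟨rad y, max R 0, hy0, hy.2, le_max_right _ _, fun x hx => hsupp x fun h => ?_, hl⟩
    exact (isMinOn_iff.1 hmin x ⟨h, hx.le.trans hy.2⟩).not_gt hx

theorem MemLp.lintegral_sq_le {F : Type*} [NormedAddCommGroup F] {φ : E3 → F} (h : MemLp φ 2 volume) :
    ∫⁻ x, ‖φ x‖ₑ ^ 2 ≤ ENNReal.ofReal ((eLpNorm φ 2 volume).toReal ^ 2) :=
  lintegral_enorm_sq_le (M := (eLpNorm φ 2 volume).toNNReal) (ENNReal.coe_toNNReal h.2.ne).ge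

variable {u₀ : E3 → E3} {ρ₀ : E3 → ℝ}

/-- The data of the problem on the half-plane depend only on the initial data. -/
theorem exists_BSol (hρs : ContDiff ℝ ∞ ρ₀) (hu₀ : HBS.InH1 u₀)
    (hω₀r : MemLp (fun x => (HBS.rad x)⁻¹ • HBS.curl u₀ x) 2 volume)
    (hρ₀ : MemLp ρ₀ 2 volume) (hρ₀' : MemLp ρ₀ ⊤ volume) (hρa : HBS.IsAxisymmetricScalar ρ₀)
    (h1 : Disjoint (tsupport ρ₀) HBS.axis) (h2 : IsCompact ((fun x : E3 => x 2) '' tsupport ρ₀)) :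
    ∃ e₀ G₀ A L d l : ℝ, 0 ≤ e₀ ∧ 0 ≤ G₀ ∧ 0 ≤ A ∧ 0 ≤ L ∧ 0 < d ∧ d ≤ 1 ∧ 0 ≤ l ∧
      ∀ (T : ENNReal) (u : ℝ → E3 → E3) (ρ : ℝ → E3 → ℝ), IsSmoothSolution T u₀ ρ₀ u ρ →
        (∀ t ∈ timeInterval T, HBS.IsAxisymmetricNoSwirl (u t)) → ∀ b ∈ timeInterval T, 0 < b →
        ∃ M, BSol b M (fun t => pr (u t)) (fun t => ax (u t)) (fun t p => ρ t (emb p)) e₀ G₀ A L d l := by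
  obtain ⟨d, l, d0, d1, l0, hd, hl⟩ := exists_support_bounds h1 h2
  refine ⟨_, _, _, (eLpNorm ρ₀ ⊤ volume).toReal, d, l, sq_nonneg (eLpNorm u₀ 2 volume).toReal,
    sq_nonneg (eLpNorm (fun x => (HBS.rad x)⁻¹ • HBS.curl u₀ x) 2 volume).toReal,
    sq_nonneg (eLpNorm ρ₀ 2 volume).toReal, ENNReal.toReal_nonneg, d0, d1, l0, fun T u ρ hs hU b hb hb0 => ?_⟩
  obtain ⟨M, hM⟩ := exists_HSol hs hU hb hb0
  have AF : AxiField u₀ := by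
    have := axiField_of_solution hs hU (Icc_subset_timeInterval hb ⟨le_rfl, hb0.le⟩)
    rwa [hs.initial_u] at this
  have cv := AF.s_pr.continuous
  have cf := AF.s_ax.continuous
  have cg := AF.prof.s_gam.continuous
  have cρ : Continuous fun p => ρ₀ (emb p) := hρs.continuous.comp contDiff_emb.continuous
  obtain ⟨-, k1⟩ := integrable_H_of_le (Q := fun p => pr u₀ p ^ 2 + ax u₀ p ^ 2) (by fun_prop)
    (fun p => by positivity) (F := fun x => ‖u₀ x‖ₑ ^ 2)
    (fun x _ => by rw [enorm_sq_eq, AF.norm_sq]) (sq_nonneg _) (MemLp.lintegral_sq_le hu₀.1)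
  obtain ⟨g1, g2⟩ := integrable_H_of_le (Q := fun p => gam (pr u₀) (ax u₀) p ^ 2) (by fun_prop)
    (fun p => by positivity) (F := fun x => ‖(HBS.rad x)⁻¹ • HBS.curl u₀ x‖ₑ ^ 2)
    (fun x hx => by
      have hc : (cyl x).1 = rad x := rfl
      have e : (rad x)⁻¹ * (rad x * |gam (pr u₀) (ax u₀) (cyl x)|) = |gam (pr u₀) (ax u₀) (cyl x)| := by
        field_simp
      rw [enorm_sq_eq, norm_smul, AF.norm_curl hx, AF.prof.vort_eq, hc, abs_mul, norm_inv, Real.norm_eq_abs,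
        abs_of_pos hx, e, sq_abs]) (sq_nonneg _) (MemLp.lintegral_sq_le hω₀r)
  obtain ⟨a1, a2⟩ := integrable_H_of_le (Q := fun p => ρ₀ (emb p) ^ 2) (cρ.pow 2)
    (fun p => by positivity) (F := fun x => ‖ρ₀ x‖ₑ ^ 2)
    (fun x _ => by rw [enorm_sq_eq, ← eq_comp_emb_cyl hρa, Real.norm_eq_abs, sq_abs]) (sq_nonneg _) (MemLp.lintegral_sq_le hρ₀)
  refine ⟨M, hM, ?_, ?_, ?_, ?_, ?_, ENNReal.toReal_nonneg, fun p _ => ?_, d0, d1, fun p hp hpd => ?_, l0, fun p hp hpl => ?_⟩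
  · simpa only [hs.initial_u] using k1
  · simpa only [hs.initial_u] using g1
  · simpa only [hs.initial_u] using g2
  · simpa only [hs.initial_ρ] using a1
  · simpa only [hs.initial_ρ] using a2
  · have := ENNReal.toReal_mono hρ₀'.2.ne (enorm_le_eLpNorm_top hρs.continuous (emb p))
    rw [hs.initial_ρ]
    simpa using this
  · rw [hs.initial_ρ]
    exact hd _ (by rwa [rad_emb hp.le])
  · rw [hs.initial_ρ]
    exact hl _ (by simpa [emb] using hpl)

end InitialData

section Norms

open HBS (E3 rad sqrtLNorm)

theorem eLpNorm_le_sqrtLNorm (φ : E3 → E3) {p : ℝ} (hp : 2 ≤ p) :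
    eLpNorm φ (ENNReal.ofReal p) volume ≤ sqrtLNorm φ * ENNReal.ofReal (Real.sqrt p) := by
  have h1 : eLpNorm φ (ENNReal.ofReal p) volume / ENNReal.ofReal (Real.sqrt p) ≤ sqrtLNorm φ :=
    le_iSup₂ (f := fun (p : ℝ) (_ : 2 ≤ p) => eLpNorm φ (ENNReal.ofReal p) volume / ENNReal.ofReal (Real.sqrt p)) p hp
  have h0 : 0 < Real.sqrt p := Real.sqrt_pos.2 (by linarith)
  rwa [ENNReal.div_le_iff (ENNReal.ofReal_pos.2 h0).ne' ENNReal.ofReal_ne_top] at h1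

theorem lintegral_rpow_eq (φ : E3 → E3) {p : ℝ} (hp : 0 < p) :
    ∫⁻ x, ‖φ x‖ₑ ^ p = eLpNorm φ (ENNReal.ofReal p) volume ^ p := by
  have h := eLpNorm_nnreal_pow_eq_lintegral (f := φ) (μ := (volume : Measure E3)) (p := p.toNNReal)
    (by simpa using hp)
  rw [Real.coe_toNNReal p hp.le] at h
  exact h.symm

theorem lintegral_pow_le_of_sqrtLNorm {φ : E3 → E3} (h : sqrtLNorm φ < ⊤) {n : ℕ} (hn : 1 ≤ n) :
    ∫⁻ x, ‖φ x‖ₑ ^ (2 * n) ≤ ENNReal.ofReal ((2 * n) ^ n * (sqrtLNorm φ).toReal ^ (2 * n)) := by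
  have hn' : (1:ℝ) ≤ n := by exact_mod_cast hn
  have h1 := lintegral_rpow_eq φ (p := ((2 * n : ℕ) : ℝ)) (by push_cast; linarith)
  simp only [ENNReal.rpow_natCast] at h1
  rw [h1]
  have h2 := eLpNorm_le_sqrtLNorm φ (p := ((2 * n : ℕ) : ℝ)) (by push_cast; linarith)
  rw [← ENNReal.ofReal_toReal h.ne, ← ENNReal.ofReal_mul ENNReal.toReal_nonneg] at h2
  refine (pow_le_pow_left' h2 _).trans_eq ?_
  rw [← ENNReal.ofReal_pow (by positivity), mul_pow, pow_mul (Real.sqrt _), Real.sq_sqrt (by positivity)]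
  push_cast
  ring_nf

theorem rpow_le_interpolate {y c p : ℝ} (hy : 0 ≤ y) (hc : 0 < c) {n : ℕ} (h1 : (2 * n : ℕ) ≤ p)
    (h2 : p ≤ (2 * (n + 1) : ℕ)) :
    y ^ p ≤ c ^ (p - (2 * n : ℕ)) * y ^ (2 * n) + c ^ (p - (2 * (n + 1) : ℕ)) * y ^ (2 * (n + 1)) := by
  rcases hy.eq_or_lt with rfl | hy0
  · rcases n with _ | n
    · rcases (h1.eq_or_lt) with h | h
      · rw [← h]; simp
      · rw [Real.zero_rpow (by simpa using h.ne')]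
        positivity
    · rw [Real.zero_rpow (by push_cast at h1; have : (0:ℝ) ≤ n := n.cast_nonneg; linarith)]
      positivity
  · rcases le_total y c with h | h
    · have e : y ^ p = y ^ (p - (2 * n : ℕ)) * y ^ (2 * n) := by
        rw [← Real.rpow_natCast, ← Real.rpow_add hy0]; ring_nf
      have : y ^ (p - (2 * n : ℕ)) ≤ c ^ (p - (2 * n : ℕ)) := Real.rpow_le_rpow hy h (by linarith)
      rw [e]
      have h3 := mul_le_mul_of_nonneg_right this (by positivity : 0 ≤ y ^ (2 * n))
      have : 0 ≤ c ^ (p - (2 * (n + 1) : ℕ)) * y ^ (2 * (n + 1)) := by positivity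
      linarith
    · have e : y ^ p = y ^ (p - (2 * (n + 1) : ℕ)) * y ^ (2 * (n + 1)) := by
        rw [← Real.rpow_natCast, ← Real.rpow_add hy0]; ring_nf
      have : y ^ (p - (2 * (n + 1) : ℕ)) ≤ c ^ (p - (2 * (n + 1) : ℕ)) :=
        Real.rpow_le_rpow_of_nonpos hc h (by linarith)
      rw [e]
      have h3 := mul_le_mul_of_nonneg_right this (by positivity : 0 ≤ y ^ (2 * (n + 1)))
      have : 0 ≤ c ^ (p - (2 * n : ℕ)) * y ^ (2 * n) := by positivity
      linarith

/-- The norms of even exponent control all the others. -/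
theorem eLpNorm_le_of_even {φ : E3 → E3} {θ : ℝ} (hφ : Continuous φ) (hθ : 0 < θ)
    (h : ∀ n : ℕ, 1 ≤ n → ∫⁻ x, ‖φ x‖ₑ ^ (2 * n) ≤ ENNReal.ofReal ((2 * n) ^ n * θ ^ (2 * n))) {p : ℝ} (hp : 2 ≤ p) :
    eLpNorm φ (ENNReal.ofReal p) volume ≤ ENNReal.ofReal (3 * θ * Real.sqrt p) := by
  have hp0 : 0 < p := by linarith
  set n := ⌊p / 2⌋₊ with hn
  have hn1 : 1 ≤ n := Nat.le_floor (by push_cast; linarith)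
  have b1 : ((2 * n : ℕ) : ℝ) ≤ p := by
    have := Nat.floor_le (a := p / 2) (by linarith); push_cast; linarith
  have b2 : p ≤ ((2 * (n + 1) : ℕ) : ℝ) := by
    have := Nat.lt_floor_add_one (p / 2); push_cast; linarith
  set c := θ * Real.sqrt (2 * p) with hc
  have hc0 : 0 < c := by positivity
  have key : ∀ k : ℕ, (2 * k : ℝ) ≤ 2 * p → 1 ≤ k →
      ∫⁻ x, ENNReal.ofReal (c ^ (p - (2 * k : ℕ)) * ‖φ x‖ ^ (2 * k)) ≤ ENNReal.ofReal (c ^ p) := fun k hk hk1 => by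
    have e : ∀ x, ENNReal.ofReal (c ^ (p - (2 * k : ℕ)) * ‖φ x‖ ^ (2 * k)) =
        ENNReal.ofReal (c ^ (p - (2 * k : ℕ))) * ‖φ x‖ₑ ^ (2 * k) := fun x => by
      rw [enorm_sq_eq, ENNReal.ofReal_mul (by positivity)]
    rw [lintegral_congr e, lintegral_const_mul' _ _ ENNReal.ofReal_ne_top]
    refine (mul_le_mul_right (h k hk1) _).trans ?_
    rw [← ENNReal.ofReal_mul (by positivity)]
    refine ENNReal.ofReal_le_ofReal ?_
    have e1 : c ^ p = c ^ (p - (2 * k : ℕ)) * c ^ (2 * k) := by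
      rw [← Real.rpow_natCast, ← Real.rpow_add hc0]; ring_nf
    have e2 : c ^ (2 * k) = (2 * p) ^ k * θ ^ (2 * k) := by
      rw [hc, mul_pow, pow_mul (Real.sqrt _), Real.sq_sqrt (by positivity), mul_comm]
    rw [e1, e2]
    gcongr
  have h1 : ∫⁻ x, ‖φ x‖ₑ ^ p ≤ ENNReal.ofReal (c ^ p) + ENNReal.ofReal (c ^ p) := by
    have hle : ∀ x, ‖φ x‖ₑ ^ p ≤ ENNReal.ofReal (c ^ (p - (2 * n : ℕ)) * ‖φ x‖ ^ (2 * n)) +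
        ENNReal.ofReal (c ^ (p - (2 * (n + 1) : ℕ)) * ‖φ x‖ ^ (2 * (n + 1))) := fun x => by
      rw [← ofReal_norm, ENNReal.ofReal_rpow_of_nonneg (norm_nonneg _) hp0.le,
        ← ENNReal.ofReal_add (by positivity) (by positivity)]
      exact ENNReal.ofReal_le_ofReal (rpow_le_interpolate (norm_nonneg _) hc0 b1 b2)
    refine (lintegral_mono hle).trans ?_
    rw [lintegral_add_left (by fun_prop)]
    refine add_le_add (key n ?_ hn1) (key (n + 1) ?_ (by omega))
    · push_cast at b1; linarith
    · push_cast at b1 ⊢; linarith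
  rw [lintegral_rpow_eq φ hp0, ← ENNReal.ofReal_add (by positivity) (by positivity)] at h1
  have h2 : c ^ p + c ^ p ≤ (2 * c) ^ p := by
    rw [Real.mul_rpow (by norm_num) hc0.le]
    have : (2:ℝ) ≤ 2 ^ p := by
      simpa using Real.rpow_le_rpow_of_exponent_le (x := 2) (by norm_num) (by linarith : (1:ℝ) ≤ p)
    nlinarith [Real.rpow_pos_of_pos hc0 p]
  have h3 := h1.trans (ENNReal.ofReal_le_ofReal h2)
  rw [← ENNReal.ofReal_rpow_of_nonneg (by positivity) hp0.le, ENNReal.rpow_le_rpow_iff hp0] at h3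
  refine h3.trans (ENNReal.ofReal_le_ofReal ?_)
  have h4 : 2 * Real.sqrt 2 ≤ 3 := by
    nlinarith [Real.sq_sqrt (by norm_num : (0:ℝ) ≤ 2), Real.sqrt_nonneg 2]
  rw [hc, Real.sqrt_mul (by norm_num)]
  have := mul_le_mul_of_nonneg_right h4 (by positivity : 0 ≤ θ * Real.sqrt p)
  linarith

theorem inSqrtL_of_even {φ : E3 → E3} {θ : ℝ} (hφ : Continuous φ) (hθ : 0 < θ)
    (h : ∀ n : ℕ, 1 ≤ n → ∫⁻ x, ‖φ x‖ₑ ^ (2 * n) ≤ ENNReal.ofReal ((2 * n) ^ n * θ ^ (2 * n))) :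
    HBS.InSqrtL φ ∧ sqrtLNorm φ ≤ ENNReal.ofReal (3 * θ) := by
  have hle : sqrtLNorm φ ≤ ENNReal.ofReal (3 * θ) := iSup₂_le fun p hp => by
    have h0 : 0 < Real.sqrt p := Real.sqrt_pos.2 (by linarith)
    rw [ENNReal.div_le_iff (ENNReal.ofReal_pos.2 h0).ne' ENNReal.ofReal_ne_top, ← ENNReal.ofReal_mul (by positivity)]
    exact eLpNorm_le_of_even hφ hθ h hp
  exact ⟨⟨fun p hp => ⟨hφ.aestronglyMeasurable, (eLpNorm_le_of_even hφ hθ h hp).trans_lt ENNReal.ofReal_lt_top⟩,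
    hle.trans_lt ENNReal.ofReal_lt_top⟩, hle⟩

theorem AxiField.continuous_curl {U : E3 → E3} (h : AxiField U) : Continuous (HBS.curl U) := by
  have sp : ∀ j c, Continuous fun x => HBS.pd j U x c := fun j c =>
    (contDiff_apply ((h.smooth.fderiv_right (m := ∞) (by simp)).clm_apply contDiff_const) c).continuous
  have e : HBS.curl U = fun x => !₂[HBS.pd 1 U x 2 - HBS.pd 2 U x 1, HBS.pd 2 U x 0 - HBS.pd 0 U x 2,
    HBS.pd 0 U x 1 - HBS.pd 1 U x 0] := rfl
  rw [e]
  refine (PiLp.continuous_toLp 2 _).comp (continuous_pi fun i => ?_)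
  fin_cases i
  · exact (sp 1 2).sub (sp 2 1)
  · exact (sp 2 0).sub (sp 0 2)
  · exact (sp 0 1).sub (sp 1 0)

theorem AxiField.lintegral_curl_pow {U : E3 → E3} (h : AxiField U) (n : ℕ) :
    ∫⁻ x, ‖HBS.curl U x‖ₑ ^ (2 * n) =
      ENNReal.ofReal (2 * Real.pi) * ∫⁻ p in H, ENNReal.ofReal (p.1 * vort (pr U) (ax U) p ^ (2 * n)) := by
  have cω := h.prof.s_vort.continuous
  have h1 := lintegral_cyl (G := fun p => ENNReal.ofReal (vort (pr U) (ax U) p ^ (2 * n))) (by fun_prop)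
  have h2 : ∫⁻ p in H, ENNReal.ofReal p.1 * ENNReal.ofReal (vort (pr U) (ax U) p ^ (2 * n)) =
      ∫⁻ p in H, ENNReal.ofReal (p.1 * vort (pr U) (ax U) p ^ (2 * n)) :=
    setLIntegral_congr_fun measurableSet_H fun p hp => (ENNReal.ofReal_mul (le_of_lt hp)).symm
  rw [← h2, ← h1]
  refine lintegral_congr_ae (ae_rad_pos.mono fun x hx => ?_)
  beta_reduce
  rw [enorm_sq_eq, h.norm_curl hx, pow_mul, sq_abs, ← pow_mul]

end Norms


section FinalBound

open HBS (E3 rad sqrtLNorm timeInterval IsSmoothSolution)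

theorem growth_le {t e₀ A L d l : ℝ} (ht : 0 ≤ t) (he : 0 ≤ e₀) (hA : 0 ≤ A) :
    growth t e₀ A L d l ≤ (A + 4 * L ^ 2 * (10000 * (2 * e₀ + 16 * A + 2) + (l + Real.log d⁻¹ + 2) ^ 2)) * (1 + t) ^ 5 := by
  have hs : (1:ℝ) ≤ 1 + t := by linarith
  obtain ⟨s, rfl⟩ : ∃ s, t = s - 1 := ⟨t + 1, by ring⟩
  rw [show 1 + (s - 1) = s by ring] at hs ⊢
  have hs5 : (1:ℝ) ≤ s ^ 5 := one_le_pow₀ hs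
  have h1 : (100 + (s - 1)) ^ 2 ≤ 10000 * s ^ 2 := by nlinarith
  have h2 : (1 + (s - 1)) * (2 * e₀ + 16 * (s - 1) ^ 2 * A + 1) + 1 ≤ (2 * e₀ + 16 * A + 2) * s ^ 3 := by
    have q1 : s ≤ s ^ 3 := le_self_pow₀ hs (by norm_num)
    have q2 : (1:ℝ) ≤ s ^ 3 := one_le_pow₀ hs
    have q3 : (s - 1) ^ 2 ≤ s ^ 2 := by nlinarith
    have q4 := mul_le_mul_of_nonneg_left q3 (by positivity : 0 ≤ s * A)
    nlinarith [mul_le_mul_of_nonneg_left q1 he]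
  have h2' : 0 ≤ (1 + (s - 1)) * (2 * e₀ + 16 * (s - 1) ^ 2 * A + 1) + 1 := by
    have : 0 ≤ 1 + (s - 1) := by linarith
    positivity
  have h3 := mul_le_mul h1 h2 h2' (by positivity)
  have h4 : (l + Real.log d⁻¹ + 2) ^ 2 ≤ (l + Real.log d⁻¹ + 2) ^ 2 * s ^ 5 := le_mul_of_one_le_right (sq_nonneg _) hs5
  have h5 : A ≤ A * s ^ 5 := le_mul_of_one_le_right hA hs5
  have h6 := mul_le_mul_of_nonneg_left (add_le_add h3 h4) (by positivity : 0 ≤ 4 * L ^ 2)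
  unfold growth
  refine (add_le_add h5 h6).trans_eq ?_
  ring

theorem velBound_le {t e₀ A y : ℝ} (ht : 0 ≤ t) (he : 0 ≤ e₀) (hA : 0 ≤ A) (hy : 0 ≤ y) :
    velBound t e₀ A y ≤ 100 * (2 * e₀ + 16 * A + 1 + y) * (1 + t) ^ 4 := by
  have hs : (1:ℝ) ≤ 1 + t := by linarith
  obtain ⟨s, rfl⟩ : ∃ s, t = s - 1 := ⟨t + 1, by ring⟩
  rw [show 1 + (s - 1) = s by ring] at hs ⊢
  have h2 : s * (2 * e₀ + 16 * (s - 1) ^ 2 * A + y) + 1 ≤ (2 * e₀ + 16 * A + 1 + y) * s ^ 3 := by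
    have q1 : s ≤ s ^ 3 := le_self_pow₀ hs (by norm_num)
    have q2 : (1:ℝ) ≤ s ^ 3 := one_le_pow₀ hs
    have q3 : (s - 1) ^ 2 ≤ s ^ 2 := by nlinarith
    have q4 := mul_le_mul_of_nonneg_left q3 (by positivity : 0 ≤ s * A)
    nlinarith [mul_le_mul_of_nonneg_left q1 he, mul_le_mul_of_nonneg_left q1 hy]
  have h3 : 1 ≤ s * (2 * e₀ + 16 * (s - 1) ^ 2 * A + y) + 1 := by
    have : 0 ≤ s * (2 * e₀ + 16 * (s - 1) ^ 2 * A + y) := by positivity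
    linarith
  have h4 : Real.sqrt (s * (2 * e₀ + 16 * (s - 1) ^ 2 * A + y) + 1) ≤ s * (2 * e₀ + 16 * (s - 1) ^ 2 * A + y) + 1 := by
    rw [Real.sqrt_le_left (by linarith)]
    nlinarith
  unfold velBound
  rw [show 1 + (s - 1) = s by ring]
  refine (mul_le_mul (by nlinarith : 100 + (s - 1) ≤ 100 * s) (h4.trans h2) (Real.sqrt_nonneg _) (by positivity)).trans_eq ?_
  ring

theorem one_add_pow_le {t : ℝ} (ht : 0 ≤ t) : (1 + t) ^ 6 ≤ 2 ^ 16 * (1 + t ^ 17) := by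
  have h1 : (1 + t) ^ 6 ≤ (1 + t) ^ 17 := pow_le_pow_right₀ (by linarith) (by norm_num)
  have h2 := add_pow_le zero_le_one ht 17
  rw [one_pow] at h2
  exact h1.trans h2

theorem exp_add_le_exp_add_exp (a c : ℝ) : Real.exp (a + c) ≤ Real.exp (2 * a) + Real.exp (2 * c) := by
  have m : ∀ x : ℝ, Real.exp (2 * x) = Real.exp x ^ 2 := fun x => by rw [← Real.exp_nat_mul]; norm_num
  rw [Real.exp_add, m, m]
  nlinarith [sq_nonneg (Real.exp a - Real.exp c), Real.exp_pos a, Real.exp_pos c]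

/-- The double exponential growth of the final estimate. -/
theorem exists_double_exp_bound {e₀ G₀ A L : ℝ} (d l : ℝ) (he : 0 ≤ e₀) (hG : 0 ≤ G₀) (hA : 0 ≤ A) (hL : 0 ≤ L) :
    ∃ C : ℝ, 1 ≤ C ∧ ∀ t, 0 ≤ t →
      21 * Real.exp (t + (velBound t e₀ A ((1 + 2 * G₀) * Real.exp (2 * (growth t e₀ A L d l + 1) * t)) + 1)) *
        ((1 + L) * (1 + A * t)) ≤ C * Real.exp (Real.exp (C * t ^ 17)) := by
  set c₁ := A + 4 * L ^ 2 * (10000 * (2 * e₀ + 16 * A + 2) + (l + Real.log d⁻¹ + 2) ^ 2) with hc₁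
  have c₁0 : 0 ≤ c₁ := by positivity
  set c₂ := 100 * (2 * e₀ + 16 * A + 2 + 2 * G₀) with hc₂
  have c₂0 : 0 ≤ c₂ := by positivity
  set c₃ := 2 * (c₁ + 1) with hc₃
  have c₃0 : 0 ≤ c₃ := by positivity
  set c₄ := 22 + (1 + L) * (1 + A) + c₂ with hc₄
  have c₄0 : 0 ≤ c₄ := by positivity
  set c := 2 ^ 16 * (c₃ + c₄) with hc
  have c0 : 0 ≤ c := by positivity
  have E1 : 1 ≤ Real.exp (Real.exp (2 * c)) := Real.one_le_exp (Real.exp_pos _).le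
  refine ⟨2 * c + Real.exp (Real.exp (2 * c)), by linarith, fun t ht => ?_⟩
  have hs : (1:ℝ) ≤ 1 + t := by linarith
  set s := 1 + t with hs'
  have hs0 : 0 < s := by linarith
  have g1 : 2 * (growth t e₀ A L d l + 1) * t ≤ c₃ * s ^ 6 := by
    have a1 := growth_le (L := L) (d := d) (l := l) ht he hA
    rw [← hc₁, ← hs'] at a1
    have a2 : (1:ℝ) ≤ s ^ 5 := one_le_pow₀ hs
    have a3 : 2 * (growth t e₀ A L d l + 1) ≤ c₃ * s ^ 5 := by rw [hc₃]; nlinarith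
    have a4 := mul_le_mul_of_nonneg_right a3 ht
    have a5 : c₃ * s ^ 5 * t ≤ c₃ * s ^ 5 * s := mul_le_mul_of_nonneg_left (by linarith) (by positivity)
    exact (a4.trans a5).trans_eq (by ring)
  set X := Real.exp (c₃ * s ^ 6) with hX
  have X1 : 1 ≤ X := Real.one_le_exp (by positivity)
  set y := (1 + 2 * G₀) * Real.exp (2 * (growth t e₀ A L d l + 1) * t) with hy
  have y0 : 0 ≤ y := by positivity
  have yX : y ≤ (1 + 2 * G₀) * X := mul_le_mul_of_nonneg_left (Real.exp_le_exp.2 g1) (by positivity)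
  have v1 : velBound t e₀ A y ≤ c₂ * s ^ 4 * X := by
    refine (velBound_le ht he hA y0).trans ?_
    have a1 : 100 * (2 * e₀ + 16 * A + 1 + y) ≤ c₂ * X := by
      rw [hc₂]
      nlinarith [mul_le_mul_of_nonneg_left X1 he, mul_le_mul_of_nonneg_left X1 hA]
    exact (mul_le_mul_of_nonneg_right a1 (by positivity)).trans_eq (by ring)
  generalize velBound t e₀ A y = W at v1 ⊢
  have k1 : (1 + L) * (1 + A * t) ≤ Real.exp ((1 + L) * (1 + A) * s) := by
    refine le_trans ?_ (Real.add_one_le_exp _)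
    have : 1 + A * t ≤ (1 + A) * s := by nlinarith
    have := mul_le_mul_of_nonneg_left this (by positivity : 0 ≤ 1 + L)
    linarith
  have k2 : (21:ℝ) ≤ Real.exp 20 := by linarith [Real.add_one_le_exp (20:ℝ)]
  have k3 : 21 * Real.exp (t + (W + 1)) * ((1 + L) * (1 + A * t)) ≤
      Real.exp (20 + (t + (W + 1)) + (1 + L) * (1 + A) * s) := by
    rw [Real.exp_add (20 + (t + (W + 1))), Real.exp_add 20]
    exact mul_le_mul (mul_le_mul_of_nonneg_right k2 (Real.exp_pos _).le) k1 (by positivity) (by positivity)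
  have s4 : s ≤ s ^ 4 := le_self_pow₀ hs (by norm_num)
  have k4 : 20 + (t + (W + 1)) + (1 + L) * (1 + A) * s ≤ Real.exp ((c₃ + c₄) * s ^ 6) := by
    have b1 : s ≤ s ^ 4 * X := s4.trans (le_mul_of_one_le_right (by positivity) X1)
    have b2 := mul_le_mul_of_nonneg_left b1 (by positivity : 0 ≤ (1 + L) * (1 + A))
    have b3 : 20 + (t + (W + 1)) + (1 + L) * (1 + A) * s ≤ c₄ * s ^ 4 * X := by
      have b0 : 1 ≤ s ^ 4 * X := one_le_mul_of_one_le_of_one_le (one_le_pow₀ hs) X1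
      have e : c₄ * s ^ 4 * X = 22 * (s ^ 4 * X) + (1 + L) * (1 + A) * (s ^ 4 * X) + c₂ * s ^ 4 * X := by
        rw [hc₄]; ring
      rw [e]
      linarith
    have b4 : c₄ * s ^ 4 ≤ Real.exp (c₄ * s ^ 6) := by
      have : c₄ * s ^ 4 ≤ c₄ * s ^ 6 := mul_le_mul_of_nonneg_left (pow_le_pow_right₀ hs (by norm_num)) c₄0
      linarith [Real.add_one_le_exp (c₄ * s ^ 6)]
    refine b3.trans ((mul_le_mul_of_nonneg_right b4 (by positivity)).trans_eq ?_)
    rw [hX, ← Real.exp_add]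
    ring_nf
  have k5 : (c₃ + c₄) * s ^ 6 ≤ c + c * t ^ 17 := by
    have := mul_le_mul_of_nonneg_left (one_add_pow_le ht) (by positivity : 0 ≤ c₃ + c₄)
    refine this.trans_eq ?_
    rw [hc]; ring
  have k6 : Real.exp (c + c * t ^ 17) ≤ Real.exp (2 * c) + Real.exp (2 * c * t ^ 17) := by
    rw [mul_assoc 2 c]
    exact exp_add_le_exp_add_exp c (c * t ^ 17)
  have k7 : Real.exp (20 + (t + (W + 1)) + (1 + L) * (1 + A) * s) ≤
      Real.exp (Real.exp (2 * c) + Real.exp (2 * c * t ^ 17)) :=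
    Real.exp_le_exp.2 (k4.trans ((Real.exp_le_exp.2 k5).trans k6))
  refine (k3.trans k7).trans ?_
  rw [Real.exp_add]
  have t17 : 0 ≤ t ^ 17 := by positivity
  refine mul_le_mul (by linarith) (Real.exp_le_exp.2 (Real.exp_le_exp.2 ?_)) (Real.exp_pos _).le (by positivity)
  exact mul_le_mul_of_nonneg_right (by linarith) t17

variable {b M e₀ G₀ A L d l : ℝ} {v f ρ : ℝ → ℝ × ℝ → ℝ}

theorem BSol.integral_rho_pow_le (h : BSol b M v f ρ e₀ G₀ A L d l) (m : ℕ) {t : ℝ} (ht : t ∈ Icc 0 b) :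
    IntegrableOn (fun p => p.1 * ρ t p ^ (2 * (m + 1))) H ∧ ∫ p in H, p.1 * ρ t p ^ (2 * (m + 1)) ≤ L ^ (2 * m) * A := by
  have hle : ∀ p ∈ H, p.1 * ρ 0 p ^ (2 * (m + 1)) ≤ L ^ (2 * m) * (p.1 * ρ 0 p ^ 2) := fun p hp => by
    have hp0 : 0 < p.1 := hp
    have h1 : ρ 0 p ^ (2 * m) ≤ L ^ (2 * m) := by
      rw [pow_mul, pow_mul, ← sq_abs]
      have := h.hL p hp
      gcongr
    have h2 := mul_le_mul_of_nonneg_right h1 (by positivity : 0 ≤ p.1 * ρ 0 p ^ 2)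
    refine le_trans (le_of_eq ?_) h2
    ring
  have i0 : IntegrableOn (fun p => L ^ (2 * m) * (p.1 * ρ 0 p ^ 2)) H := h.ai.const_mul _
  have cρ := (h.sol.sρ.slice ⟨le_rfl, h.sol.hb.le⟩).continuous
  have i1 : IntegrableOn (fun p => p.1 * ρ 0 p ^ (2 * (m + 1))) H := by
    refine i0.mono' (by fun_prop) (ae_H fun p hp => ?_)
    rw [Real.norm_eq_abs, abs_of_nonneg (mul_nonneg (le_of_lt hp) (by rw [pow_mul]; positivity))]
    exact hle p hp
  obtain ⟨j1, j2⟩ := h.sol.integral_rho_pow_le (m + 1) i1 ht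
  refine ⟨j1, j2.trans ((setIntegral_mono_on i1 i0 measurableSet_H hle).trans ?_)⟩
  rw [integral_const_mul]
  exact mul_le_mul_of_nonneg_left h.aC (pow_nonneg h.L0 _)

/-- Absorption of the constants in the estimate for the powers of the vorticity. -/
theorem vorticity_power_bound {E N t A L : ℝ} (hN : 0 ≤ N) (ht : 0 ≤ t) (hA : 0 ≤ A) (hL : 0 ≤ L) (m : ℕ) :
    2 * Real.pi * (Real.exp (2 * (m + 1) * E) * ((2 * (m + 1)) ^ (m + 1) * N ^ (2 * (m + 1)) +
      2 * ((m + 1) ^ (m + 1) * (L ^ (2 * m) * A)) * t)) ≤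
      (2 * (m + 1)) ^ (m + 1) * (7 * Real.exp E * (N + (1 + L) * (1 + A * t))) ^ (2 * (m + 1)) := by
  have hm : (1:ℝ) ≤ m + 1 := by have : (0:ℝ) ≤ m := m.cast_nonneg; linarith
  have n0 : 2 * (m + 1) ≠ 0 := by omega
  have hpi : 2 * Real.pi ≤ 7 ^ (2 * (m + 1)) :=
    (by linarith [Real.pi_lt_d2] : 2 * Real.pi ≤ 7).trans (le_self_pow₀ (by norm_num) n0)
  have hexp : Real.exp (2 * (m + 1) * E) = Real.exp E ^ (2 * (m + 1)) := by
    rw [← Real.exp_nat_mul]; push_cast; ring_nf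
  have hL1 : L ^ (2 * m) ≤ (1 + L) ^ (2 * (m + 1)) :=
    (pow_le_pow_left₀ hL (by linarith) _).trans (pow_le_pow_right₀ (by linarith) (by omega))
  have hA1 : A * t ≤ (1 + A * t) ^ (2 * (m + 1)) := by
    have : 0 ≤ A * t := by positivity
    exact (by linarith : A * t ≤ 1 + A * t).trans (le_self_pow₀ (by linarith) n0)
  have h2 : (2:ℝ) ≤ 2 ^ (m + 1) := le_self_pow₀ (by norm_num) (by omega)
  have hK : 2 * ((m + 1) ^ (m + 1) * (L ^ (2 * m) * A)) * t ≤
      (2 * (m + 1)) ^ (m + 1) * ((1 + L) * (1 + A * t)) ^ (2 * (m + 1)) := by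
    rw [mul_pow (2:ℝ), mul_pow (1 + L)]
    have q := mul_le_mul (mul_le_mul_of_nonneg_right h2 (by positivity : (0:ℝ) ≤ (m + 1) ^ (m + 1)))
      (mul_le_mul hL1 hA1 (by positivity) (by positivity)) (by positivity) (by positivity)
    refine le_trans (le_of_eq ?_) q
    ring
  have hsum : (2 * (m + 1)) ^ (m + 1) * N ^ (2 * (m + 1)) + 2 * ((m + 1) ^ (m + 1) * (L ^ (2 * m) * A)) * t ≤
      (2 * (m + 1)) ^ (m + 1) * (N + (1 + L) * (1 + A * t)) ^ (2 * (m + 1)) := by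
    have q := pow_add_pow_le hN (by positivity : 0 ≤ (1 + L) * (1 + A * t)) n0
    have q' := mul_le_mul_of_nonneg_left q (by positivity : (0:ℝ) ≤ (2 * (m + 1)) ^ (m + 1))
    linarith
  rw [hexp, mul_pow (7 * Real.exp E), mul_pow 7]
  have q := mul_le_mul hpi (mul_le_mul_of_nonneg_left hsum (by positivity : 0 ≤ Real.exp E ^ (2 * (m + 1))))
    (by positivity) (by positivity)
  refine q.trans_eq ?_
  ring

/-- The bound of the vorticity at a positive time. -/
theorem BSol.inSqrtL_curl {U : ℝ → E3 → E3}
    (h : BSol b M (fun t => pr (U t)) (fun t => ax (U t)) ρ e₀ G₀ A L d l)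
    (hU : ∀ t ∈ Icc 0 b, AxiField (U t)) (h0 : sqrtLNorm (HBS.curl (U 0)) < ⊤) :
    HBS.InSqrtL (HBS.curl (U b)) ∧ sqrtLNorm (HBS.curl (U b)) ≤ ENNReal.ofReal
      (21 * Real.exp (b + (velBound b e₀ A ((1 + 2 * G₀) * Real.exp (2 * (growth b e₀ A L d l + 1) * b)) + 1)) *
        ((sqrtLNorm (HBS.curl (U 0))).toReal + (1 + L) * (1 + A * b))) := by
  obtain ⟨g, hg, hgY⟩ := h.exists_quantitative_majorant
  have hb := h.sol.hb
  have hA := h.A_nonneg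
  have hL := h.L0
  have z0 : (0:ℝ) ∈ Icc 0 b := ⟨le_rfl, hb.le⟩
  have zb : b ∈ Icc 0 b := ⟨hb.le, le_rfl⟩
  set Y := velBound b e₀ A ((1 + 2 * G₀) * Real.exp (2 * (growth b e₀ A L d l + 1) * b)) with hY
  have hY0 : 0 ≤ Y := by rw [hY]; unfold velBound; positivity
  set N := (sqrtLNorm (HBS.curl (U 0))).toReal with hN
  have hN0 : 0 ≤ N := ENNReal.toReal_nonneg
  have hK0 : 0 < (1 + L) * (1 + A * b) := by positivity
  have key := inSqrtL_of_even (φ := HBS.curl (U b)) (θ := 7 * Real.exp (b + (Y + 1)) * (N + (1 + L) * (1 + A * b)))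
    (hU b zb).continuous_curl (by positivity) fun n hn => by
      obtain ⟨m, rfl⟩ : ∃ m, n = m + 1 := ⟨n - 1, by omega⟩
      have cω := (hU 0 z0).prof.s_vort.continuous
      obtain ⟨i1, i2⟩ := integrable_H_of_le (Q := fun p => vort (pr (U 0)) (ax (U 0)) p ^ (2 * (m + 1))) (by fun_prop)
        (fun p => by rw [pow_mul]; positivity) (F := fun x => ‖HBS.curl (U 0) x‖ₑ ^ (2 * (m + 1)))
        (fun x hx => by rw [enorm_sq_eq, (hU 0 z0).norm_curl hx, pow_mul |_|, sq_abs, ← pow_mul]) (by positivity)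
        (lintegral_pow_le_of_sqrtLNorm h0 hn)
      have hv := h.sol.vort_estimate m (fun t ht => ⟨(h.L2_rho ht).int, (h.L2_rho ht).le⟩)
        (fun t ht => h.integral_rho_pow_le m ht) i1 i2 hY0 hg zb hgY
      rw [(hU b zb).lintegral_curl_pow]
      refine (mul_le_mul_right hv _).trans ?_
      rw [← ENNReal.ofReal_mul (by positivity)]
      refine ENNReal.ofReal_le_ofReal ?_
      have := vorticity_power_bound (E := b + (Y + 1)) hN0 hb.le hA hL m
      push_cast
      exact this
  refine ⟨key.1, key.2.trans_eq ?_⟩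
  congr 1
  ring

end FinalBound

end HalfPlane

theorem mainTheorem6
    (u₀ : HBS.E3 → HBS.E3) (ρ₀ : HBS.E3 → ℝ)
    (hu₀_smooth : ContDiff ℝ ∞ u₀) (hρ₀_smooth : ContDiff ℝ ∞ ρ₀)
    (hu₀ : HBS.InH1 u₀)
    (hω₀r : MemLp (fun x => (HBS.rad x)⁻¹ • HBS.curl u₀ x) 2 volume)
    (hω₀ : HBS.InSqrtL (HBS.curl u₀))
    (hρ₀_L2 : MemLp ρ₀ 2 volume) (hρ₀_Linf : MemLp ρ₀ ⊤ volume)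
    (hρ₀_axi : HBS.IsAxisymmetricScalar ρ₀)
    (hρ₀_axis : Disjoint (tsupport ρ₀) HBS.axis)
    (hρ₀_proj : IsCompact ((fun x : HBS.E3 => x 2) '' tsupport ρ₀)) :
    ∃ C : ℝ, 0 < C ∧
      ∀ (T : ENNReal) (u : ℝ → HBS.E3 → HBS.E3) (ρ : ℝ → HBS.E3 → ℝ),
        HBS.IsSmoothSolution T u₀ ρ₀ u ρ →
        (∀ t ∈ HBS.timeInterval T, HBS.IsAxisymmetricNoSwirl (u t)) →
        (∀ t ∈ HBS.timeInterval T, HBS.IsAxisymmetricScalar (ρ t)) →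
        ∀ t ∈ HBS.timeInterval T,
          HBS.InSqrtL (HBS.curl (u t)) ∧
          HBS.sqrtLNorm (HBS.curl (u t)) ≤
            ENNReal.ofReal (C * Real.exp (Real.exp (C * t ^ 17))) *
              (HBS.sqrtLNorm (HBS.curl u₀) + 1) := by
  obtain ⟨e₀, G₀, A, L, d, l, he, hG, hA, hL, -, -, -, hB⟩ := HalfPlane.exists_BSol hρ₀_smooth hu₀ hω₀r hρ₀_L2
    hρ₀_Linf hρ₀_axi hρ₀_axis hρ₀_proj
  obtain ⟨C, hC, hbound⟩ := HalfPlane.exists_double_exp_bound d l he hG hA hL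
  refine ⟨C, by linarith, fun T u ρ hs hU _ t ht => ?_⟩
  rcases ht.1.eq_or_lt with rfl | ht0
  · rw [hs.initial_u]
    refine ⟨hω₀, le_trans ?_ (le_mul_of_one_le_left' (ENNReal.one_le_ofReal.2 ?_))⟩
    · exact le_self_add
    · exact one_le_mul_of_one_le_of_one_le hC (Real.one_le_exp (Real.exp_pos _).le)
  · obtain ⟨M, hM⟩ := hB T u ρ hs hU t ht ht0
    have h0 : HBS.sqrtLNorm (HBS.curl (u 0)) < ⊤ := by rw [hs.initial_u]; exact hω₀.2
    obtain ⟨h1, h2⟩ := hM.inSqrtL_curl (U := u)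
      (fun s hs' => HalfPlane.axiField_of_solution hs hU (HalfPlane.Icc_subset_timeInterval ht hs')) h0
    refine ⟨h1, h2.trans ?_⟩
    rw [hs.initial_u]
    have hN : 0 ≤ (HBS.sqrtLNorm (HBS.curl u₀)).toReal := ENNReal.toReal_nonneg
    conv_rhs => rw [← ENNReal.ofReal_toReal hω₀.2.ne, ← ENNReal.ofReal_one, ← ENNReal.ofReal_add hN zero_le_one]
    rw [← ENNReal.ofReal_mul (by positivity)]
    refine ENNReal.ofReal_le_ofReal (le_trans ?_ (mul_le_mul_of_nonneg_right (hbound t ht.1) (by linarith)))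
    have hK : 1 ≤ (1 + L) * (1 + A * t) :=
      one_le_mul_of_one_le_of_one_le (by linarith) (by nlinarith)
    rw [mul_assoc (21 * _)]
    refine mul_le_mul_of_nonneg_left ?_ (by positivity)
    nlinarith
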